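/- Let $g\ge 1$ and let $f=\sum_{i=0}^d f_ix^i\in\mathbb{Z}[x]$ be squarefree over $\mathbb{Q}$ with $f_d\ne 0$ and $d\in\{2g+1,2g+2\}$, so that $y^2=f(x)$ defines a smooth projective hyperelliptic curve of genus $g$ over $\mathbb{Q}$. Write $\|f\|=\max_i|f_i|$. Call a prime $p$ *admissible* if $p$ is odd, the equation has good reduction at $p$ (that is, $f\bmod p$ is squarefree of degree $2g+1$ or $2g+2$), $p\nmid f_d$, and, in case $f_0\neq 0$, also $p\nmid f_0$. For such $p$ the Hasse–Witt matrix $W_p$ is the $g\times g$ matrix over $\mathbb{Z}/p\mathbb{Z}$ whose $(i,j)$ entry ($1\le i,j\le g$) is the coefficient of $x^{pi-j}$ in $f^{(p-1)/2}$, reduced modulo $p$ (zero if $pi-j<0$). Complexity is measured on a random access machine that operates on integers of arbitrary size, with variables and arrays. Its instructions are: loading a constant, addition, subtraction, multiplication, shifts by $z$ bits, bit length, reading and writing an array entry, and branching and looping on the sign of a variable. The multiplication of two integers of at most $n$ bits takes time $1+\mathsf{M}(n)$, and every other instruction takes time linear in the number of bits (of operands, addresses and, for left shifts, the shift amount) that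 it handles. Space is the largest number of bits in use at any moment, where every nonzero memory cell accounts for its address and its contents; input and output are included. The function $\mathsf{M}$ is any function with $\mathsf{M}(n)\ge n$, with $\mathsf{M}(n)/n$ nondecreasing, and with $\mathsf{M}(kn)=O(k\,\mathsf{M}(n))$ for $k=O(1+\log n)$; for example $\mathsf{M}(n)=n\log n\log\log n$ (logarithms bounded below by $1$). Then there is an algorithm (a single program for this machine, independent of $\mathsf{M}$, $g$, $f$ and $N$) such that, for every such $\mathsf{M}$ and every constant $C$, there is a constant $K$, depending only on $\mathsf{M}$ and $C$, with the following property. For all $g$, all $f$ as above and all $N$ with $g\le C\log N$, the program, given $f$ and $N$, computes the list of all admissible primes $p\le N$ together with their Hasse–Witt matrices $W_p$. It runs in time at most $$K\,g^5\,\mathsf{M}\bigl(\lceil N\log(\|f\|N)\rceil\bigr)\log N$$ and uses space at most $$K\,g^2N\left(1+\frac{\log\|f\|}{\log N}\right).$$ -/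

import Mathlib

open Polynomial

/-! ### Hyperelliptic equations, admissible primes, Hasse–Witt matrices -/

/-- Over a field `K` of characteristic different from `2`: the equation `y ^ 2 = f x` defines a
smooth projective hyperelliptic curve of genus `g` (genus `1` included). -/
def IsHyperelliptic {K : Type*} [CommRing K] (g : ℕ) (f : K[X]) : Prop :=
  Squarefree f ∧ (f.natDegree = 2 * g + 1 ∨ f.natDegree = 2 * g + 2)

/-- The reduction of `f` modulo `p`. -/
noncomputable def reduceMod (p : ℕ) (f : ℤ[X]) : (ZMod p)[X] := f.map (Int.castRingHom (ZMod p))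

/-- Good reduction at an odd prime `p` of the curve `y ^ 2 = f x` of genus `g`: the reduced equation
again defines a smooth curve of genus `g`. -/
def HasGoodReductionAt (g : ℕ) (f : ℤ[X]) (p : ℕ) : Prop := IsHyperelliptic g (reduceMod p f)

/-- `p` is an odd prime of good reduction that does not divide the leading coefficient of `f`, and
does not divide the constant coefficient either, unless that coefficient is zero. -/
structure IsAdmissible (g : ℕ) (f : ℤ[X]) (p : ℕ) : Prop where
  prime : p.Prime
  odd : Odd p
  good : HasGoodReductionAt g f p
  leading : ¬ (p : ℤ) ∣ f.leadingCoeff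
  constant : f.coeff 0 ≠ 0 → ¬ (p : ℤ) ∣ f.coeff 0

/-- The coefficient of `x ^ k` for an integer `k`; it is `0` for negative `k`. -/
def zcoeff (f : ℤ[X]) (k : ℤ) : ℤ := if 0 ≤ k then f.coeff k.toNat else 0

/-- The Hasse–Witt matrix: for `1 ≤ i, j ≤ g` its entry is the coefficient of `x ^ (p i - j)` in
`f ^ ((p - 1) / 2)`, modulo `p`. The indices of type `Fin g` start from `0`, whence the shifts. -/
noncomputable def hasseWitt (g : ℕ) (f : ℤ[X]) (p : ℕ) : Matrix (Fin g) (Fin g) (ZMod p) :=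
  Matrix.of fun i j =>
    ((zcoeff (f ^ ((p - 1) / 2)) ((p : ℤ) * ((i : ℤ) + 1) - ((j : ℤ) + 1)) : ℤ) : ZMod p)

/-- The maximum of the absolute values of the coefficients of `f`. -/
def coeffNorm (f : ℤ[X]) : ℕ := f.support.sup fun k => (f.coeff k).natAbs

/-! ### A random access machine with bit costs

The programs are `while` programs over integers of arbitrary size. The memory consists of variables
and of arrays, both named by natural numbers. -/

/-- The contents of the memory: `var x` is the variable `x`, and `arr (a, i)` is the entry with
index `i` of the array `a`. Only finitely many cells are nonzero. -/
structure Store where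
  var : ℕ →₀ ℤ
  arr : ℕ × ℕ →₀ ℤ

/-- The number of binary digits of `|z|`. -/
def bits (z : ℤ) : ℕ := z.natAbs.size

/-- The number of bits in use: every nonzero cell accounts for its address, its sign and the binary
digits of its contents. -/
def Store.space (σ : Store) : ℕ :=
  (σ.var.sum fun x z => x.size + 1 + bits z) +
    σ.arr.sum fun c z => c.1.size + c.2.size + 1 + bits z

/-- The elementary instructions. -/
inductive Instr where
  /-- `x := k` -/
  | const (x : ℕ) (k : ℤ)
  /-- `x := y + z` -/
  | add (x y z : ℕ)
  /-- `x := y - z` -/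
  | sub (x y z : ℕ)
  /-- `x := y * z` -/
  | mul (x y z : ℕ)
  /-- `x := y * 2 ^ z` -/
  | shl (x y z : ℕ)
  /-- `x := ⌊y / 2 ^ z⌋` -/
  | shr (x y z : ℕ)
  /-- `x :=` the number of binary digits of `y` -/
  | len (x y : ℕ)
  /-- `x := a[y]` -/
  | load (x a y : ℕ)
  /-- `a[y] := x` -/
  | store (a y x : ℕ)

/-- `x := k`. -/
noncomputable def Store.setVar (σ : Store) (x : ℕ) (k : ℤ) : Store :=
  { σ with var := σ.var.update x k }

/-- The effect of an instruction on the memory. -/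
noncomputable def Instr.run : Instr → Store → Store
  | const x k, σ => σ.setVar x k
  | add x y z, σ => σ.setVar x (σ.var y + σ.var z)
  | sub x y z, σ => σ.setVar x (σ.var y - σ.var z)
  | mul x y z, σ => σ.setVar x (σ.var y * σ.var z)
  | shl x y z, σ => σ.setVar x (σ.var y * 2 ^ (σ.var z).toNat)
  | shr x y z, σ => σ.setVar x (σ.var y / 2 ^ (σ.var z).toNat)
  | len x y, σ => σ.setVar x (bits (σ.var y))
  | load x a y, σ => σ.setVar x (σ.arr (a, (σ.var y).toNat))
  | store a y x, σ => { σ with arr := σ.arr.update (a, (σ.var y).toNat) (σ.var x) }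

/-- The time taken by an instruction. Multiplying two integers of at most `n` bits takes time
`1 + M n`; every other instruction takes time linear in the number of bits that it handles,
addresses included. -/
noncomputable def Instr.time (M : ℕ → ℝ) : Instr → Store → ℝ
  | const _ k, _ => 1 + bits k
  | add _ y z, σ => 1 + max (bits (σ.var y)) (bits (σ.var z))
  | sub _ y z, σ => 1 + max (bits (σ.var y)) (bits (σ.var z))
  | mul _ y z, σ => 1 + M (max (bits (σ.var y)) (bits (σ.var z)))
  | shl _ y z, σ => 1 + bits (σ.var y) + bits (σ.var z) + (σ.var z).toNat
  | shr _ y z, σ => 1 + bits (σ.var y) + bits (σ.var z)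
  | len _ y, σ => 1 + bits (σ.var y)
  | load _ a y, σ => 1 + bits (σ.var y) + bits (σ.arr (a, (σ.var y).toNat))
  | store _ y x, σ => 1 + bits (σ.var y) + bits (σ.var x)

/-- Programs. -/
inductive Program where
  /-- a single instruction -/
  | instr (i : Instr)
  /-- `P; Q` -/
  | seq (P Q : Program)
  /-- `if x > 0 then P else Q` -/
  | ite (x : ℕ) (P Q : Program)
  /-- `while x > 0 do P` -/
  | while (x : ℕ) (P : Program)

/-- `Exec M P σ τ t s`: started on the memory `σ`, the program `P` halts with the memory `τ` after
time `t`, and `s` is the maximal number of bits in use at any moment on the way. -/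
inductive Exec (M : ℕ → ℝ) : Program → Store → Store → ℝ → ℕ → Prop
  | instr (i : Instr) (σ : Store) :
      Exec M (.instr i) σ (i.run σ) (i.time M σ) (max σ.space (i.run σ).space)
  | seq {P Q : Program} {σ τ υ : Store} {t t' : ℝ} {s s' : ℕ} :
      Exec M P σ τ t s → Exec M Q τ υ t' s' →
      Exec M (.seq P Q) σ υ (t + t') (max s s')
  | ite_pos {x : ℕ} {P Q : Program} {σ τ : Store} {t : ℝ} {s : ℕ} :
      0 < σ.var x → Exec M P σ τ t s →
      Exec M (.ite x P Q) σ τ (1 + bits (σ.var x) + t) s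
  | ite_nonpos {x : ℕ} {P Q : Program} {σ τ : Store} {t : ℝ} {s : ℕ} :
      σ.var x ≤ 0 → Exec M Q σ τ t s →
      Exec M (.ite x P Q) σ τ (1 + bits (σ.var x) + t) s
  | while_pos {x : ℕ} {P : Program} {σ τ υ : Store} {t t' : ℝ} {s s' : ℕ} :
      0 < σ.var x → Exec M P σ τ t s → Exec M (.while x P) τ υ t' s' →
      Exec M (.while x P) σ υ (1 + bits (σ.var x) + t + t') (max s s')
  | while_nonpos {x : ℕ} {P : Program} {σ : Store} :
      σ.var x ≤ 0 → Exec M (.while x P) σ σ (1 + bits (σ.var x)) σ.space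

/-- The usual conventions on the time `M n` to multiply two `n`-bit integers: it is at least `n`,
`M n / n` is nondecreasing, and `M (k n) = O (k M n)` for `k = O (1 + log n)`. They hold for
`n log n log log n` (with the logarithms bounded below by `1`). -/
structure IsMulTime (M : ℕ → ℝ) : Prop where
  le_apply : ∀ n : ℕ, (n : ℝ) ≤ M n
  div_mono : ∀ m n : ℕ, 1 ≤ m → m ≤ n → M m / m ≤ M n / n
  mul_le : ∀ C : ℝ, ∃ K : ℝ, ∀ k n : ℕ, 1 ≤ k → 1 ≤ n → (k : ℝ) ≤ C * (1 + Real.log n) →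
    M (k * n) ≤ K * (k * M n)

/-! ### Input and output -/

/-- The memory at the start: variable `0` holds `N`, variable `1` holds the degree of `f`, array `0`
holds the coefficients of `f`, and everything else is zero. -/
noncomputable def inputStore (f : ℤ[X]) (N : ℕ) : Store where
  var := Finsupp.single 0 (N : ℤ) + Finsupp.single 1 (f.natDegree : ℤ)
  arr := Finsupp.onFinset (f.support.image fun k => (0, k))
    (fun c => if c.1 = 0 then f.coeff c.2 else 0) (by
      rintro ⟨a, k⟩ h
      by_cases ha : a = 0
      · subst ha
        simpa using h
      · simp [ha] at h)

/-- The memory holds the Hasse–Witt matrices of `y ^ 2 = f x` at all admissible primes up to `N`: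
variable `0` holds the number of these primes, array `0` lists them in increasing order, and array
`1` lists the entries of their matrices, row by row, as integers in `[0, p)`. -/
def HoldsHasseWitt (g : ℕ) (f : ℤ[X]) (N : ℕ) (σ : Store) : Prop :=
  σ.var 0 = ({p | p ≤ N ∧ IsAdmissible g f p}.ncard : ℤ) ∧
  ∀ p ≤ N, IsAdmissible g f p → ∀ k, k = {q | q < p ∧ IsAdmissible g f q}.ncard →
    σ.arr (0, k) = p ∧
    ∀ i j : Fin g, σ.arr (1, (k * g + i) * g + j) = ((hasseWitt g f p i j).val : ℤ)

/-!
The program combines average polynomial time with accumulating remainder trees.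

Mathematics. Let `p = 2 n + 1` be prime, and `H` a squarefree polynomial of degree `D` over `ℤ/p`
with `H 0 ≠ 0`. Since `2 n = -1`, the power `H ^ n` satisfies `2 H y' + H' y = 0`, so that the
coefficients of `y` obey a linear recurrence of length `D`, except at the indices that are divisible
by `p`. Let `S` be the power series with `S 0 = 1` and no other terms at multiples of `p` that obeys
it (`isHalfSol_solCoeff`). Every other solution arises from `S` by a factor `φ (x ^ p)`
(`IsHalfSol.ext`), so that the coefficients of `H ^ n` that make up the Hasse–Witt matrix, which lie
just below multiples of `p`, are combinations of those of `S` with the coefficients of `φ`, the ones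
of `H ^ n` at multiples of `p` (`coeff_pow_eq`). Both ingredients are cheap:

* The coefficients of `S` below `p i` lead to those below `p (i + 1)` by the product of the `p - 1`
  matrices of the recurrence, the same one for all `i` (`window_period`). These matrices are
  reductions of integer matrices that do not depend on `p`, and their products modulo all primes are
  computed at once, in a product tree whose partial products are pushed down from the root, modulo
  the product of the primes below each node (`Par.map_prefTree`).
* As `H ^ n` is a polynomial, its coefficients vanish for `D` indices in a row. These are linear
  equations for `φ`, and since `H` is squarefree, they determine `φ` up to a factor
  (`exists_smul_of_kernel`). The factor follows from `H 0 ^ n`.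

Good reduction is tested by linear algebra as well, since `H` is squarefree if and only if
`a H + b H' = 0` has no nonzero solution in low degree (`squarefree_iff_kernel`). The recurrence
needs `H 0 ≠ 0`; if `f = x F`, the program uses `F (x ^ 2)` in place of `f`, whose powers have the
same coefficients in other places (`Par.IsFor.hasseWitt_eq`).

Complexity. One tree over all `k ≤ N` would need too much space. So the range is cut into blocks of
`B` numbers, where `B` is a power of `2` of order `N / (log N) ^ 2`, and the product of the matrices
of all former blocks is carried on modulo the product of all odd primes up to `N`, which is found in
a first pass. A level of the trees of all blocks then costs as much as `D ^ 3` multiplications of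
numbers with `O (N * W)` bits, where `W` is of order `log ‖f‖ + log N`; there are `O (log N)` levels.
The work for one prime is `O (D ^ 3 + log N)` operations with short numbers, and Chebyshev's bounds for the
product and the number of the primes control the rest (`Par.IsFor.totalCost_le`,
`Par.IsFor.space_le`). The reduction of one number modulo another is done by Newton iteration within
a constant number of multiplications (`does_mod`), because the cost of multiplication is at least
linear.

The machine. Programs are written with expressions over variables and arrays, which are compiled to
instructions (`Ex.compile_step`). Properties of the memory are given by plain functions, and the
Hoare triples `Does` come with a time credit, from which every command takes its share. The space is
bounded once and for all by capacities for all variables and array entries, the `Ctx`, which every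
triple respects.
-/

open Polynomial Finset

/-! ### Binary lengths -/

lemma bits_le_iff {z : ℤ} {n : ℕ} : bits z ≤ n ↔ |z| < 2 ^ n := by
  unfold bits
  rw [Nat.size_le, Int.abs_eq_natAbs]
  norm_cast

@[simp] lemma bits_zero : bits 0 = 0 := by simp [bits]

@[simp] lemma bits_one_le : bits 1 ≤ 8 := by simp [bits]

@[simp] lemma bits_ofNat_le {n : ℕ} [n.AtLeastTwo] (h : n < 256) : bits (ofNat(n) : ℤ) ≤ 8 := by
  rw [bits_le_iff]
  change |(n : ℤ)| < 2 ^ 8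
  rw [abs_of_nonneg (by positivity)]
  exact_mod_cast h

lemma bits_eq {z : ℤ} {n : ℕ} (h1 : 2 ^ n ≤ z) (h2 : z < 2 ^ (n + 1)) : bits z = n + 1 := by
  have h0 : (0 : ℤ) < 2 ^ n := by positivity
  refine le_antisymm (bits_le_iff.2 (by rwa [abs_of_nonneg (by linarith)])) ?_
  by_contra h
  have := bits_le_iff.1 (show bits z ≤ n by omega)
  rw [abs_of_nonneg (by linarith)] at this
  linarith

lemma abs_lt_two_pow_bits (z : ℤ) : |z| < 2 ^ bits z := bits_le_iff.1 le_rfl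

lemma bits_add_le (a b : ℤ) : bits (a + b) ≤ max (bits a) (bits b) + 1 := by
  rw [bits_le_iff, pow_succ]
  have ha : |a| < 2 ^ max (bits a) (bits b) := bits_le_iff.1 (le_max_left _ _)
  have hb : |b| < 2 ^ max (bits a) (bits b) := bits_le_iff.1 (le_max_right _ _)
  have := abs_add_le a b
  linarith

lemma bits_neg (a : ℤ) : bits (-a) = bits a := by simp [bits]

lemma bits_sub_le (a b : ℤ) : bits (a - b) ≤ max (bits a) (bits b) + 1 := by
  rw [sub_eq_add_neg, ← bits_neg b]
  exact bits_add_le _ _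

lemma bits_mul_le (a b : ℤ) : bits (a * b) ≤ bits a + bits b := by
  rw [bits_le_iff, abs_mul, pow_add]
  exact mul_lt_mul'' (abs_lt_two_pow_bits a) (abs_lt_two_pow_bits b) (abs_nonneg _) (abs_nonneg _)

lemma bits_ediv_le (a : ℤ) (k : ℕ) : bits (a / 2 ^ k) ≤ bits a := by
  rw [bits_le_iff]
  refine lt_of_le_of_lt ?_ (abs_lt_two_pow_bits a)
  have h2 : (1 : ℤ) ≤ 2 ^ k := one_le_pow₀ (by norm_num)
  rcases le_or_gt 0 a with h | h
  · rw [abs_of_nonneg h, abs_of_nonneg (Int.ediv_nonneg h (by positivity))]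
    exact Int.ediv_le_self _ h
  · rw [abs_of_neg h, abs_of_neg (Int.ediv_neg_of_neg_of_pos h (by positivity))]
    have : a ≤ a / 2 ^ k := (Int.le_ediv_iff_mul_le (by positivity)).2 (by nlinarith)
    linarith

lemma bits_natCast {n L : ℕ} (h : n ≤ L) : bits (n : ℤ) ≤ L := by
  rw [bits_le_iff, abs_of_nonneg (by positivity)]
  exact_mod_cast h.trans_lt Nat.lt_two_pow_self

lemma bits_mono {a b : ℤ} (h : |a| ≤ |b|) : bits a ≤ bits b :=
  bits_le_iff.2 (h.trans_lt (abs_lt_two_pow_bits b))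

lemma bits_le_of_lt {z : ℤ} {n : ℕ} (h0 : 0 ≤ z) (h : z < 2 ^ n) : bits z ≤ n := by
  rw [bits_le_iff, abs_of_nonneg h0]; exact h

/-! ### Expressions and abstract memory -/

/-- The abstract contents of the memory, as plain functions. Only the variables below `60` are
visible to programs written with expressions; the variables from `60` to `129` serve for the
evaluation of expressions. -/
structure St where
  v : ℕ → ℤ
  a : ℕ → ℕ → ℤ

/-- `x := k`. -/
def St.set (s : St) (x : ℕ) (k : ℤ) : St := ⟨Function.update s.v x k, s.a⟩

/-- `b[i] := k`. -/
def St.put (s : St) (b i : ℕ) (k : ℤ) : St :=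
  ⟨s.v, Function.update s.a b (Function.update (s.a b) i k)⟩

@[simp] lemma St.set_v (s : St) (x y : ℕ) (k : ℤ) :
    (s.set x k).v y = if y = x then k else s.v y := by
  simp [St.set, Function.update_apply]

@[simp high] lemma St.set_v_of_lt (s : St) {x y : ℕ} (k : ℤ) (hx : x < 40) (hy : 40 ≤ y) :
    (s.set y k).v x = s.v x := by rw [set_v, if_neg (by omega)]

@[simp] lemma St.set_a (s : St) (x : ℕ) (k : ℤ) : (s.set x k).a = s.a := rfl

@[simp] lemma St.put_v (s : St) (b i : ℕ) (k : ℤ) : (s.put b i k).v = s.v := rfl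

@[simp] lemma St.put_a (s : St) (b i : ℕ) (k : ℤ) (b' i' : ℕ) :
    (s.put b i k).a b' i' = if b' = b ∧ i' = i then k else s.a b' i' := by
  by_cases h : b' = b
  · subst h; simp [St.put, Function.update_apply]
  · simp [St.put, h]

/-- The binary operations: sum, difference, product, and `⌊a / 2 ^ b⌋`. -/
inductive Op where
  | add | sub | mul | shr

namespace Op

/-- The value of an operation. -/
def app : Op → ℤ → ℤ → ℤ
  | add, a, b => a + b
  | sub, a, b => a - b
  | mul, a, b => a * b
  | shr, a, b => a / 2 ^ b.toNat

/-- The instruction that performs an operation. -/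
def instr : Op → ℕ → ℕ → ℕ → Instr
  | add => .add
  | sub => .sub
  | mul => .mul
  | shr => .shr

lemma run_instr (o : Op) (σ : Store) (x y z : ℕ) :
    (o.instr x y z).run σ = σ.setVar x (o.app (σ.var y) (σ.var z)) := by cases o <;> rfl

lemma bits_app_le (o : Op) (a b : ℤ) : bits (o.app a b) ≤ bits a + bits b + 1 := by
  have h1 := bits_add_le a b
  have h2 := bits_sub_le a b
  have h3 := bits_mul_le a b
  have h4 := bits_ediv_le a b.toNat
  cases o <;> simp only [app] <;> omega

end Op

/-- Integer expressions over variables and array entries. -/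
inductive Ex where
  | lit (k : ℤ)
  | var (x : ℕ)
  | bin (o : Op) (a b : Ex)
  /-- the binary length -/
  | len (a : Ex)
  /-- the entry with index `i` of the array `b` -/
  | get (b : ℕ) (i : Ex)
  /-- `if c > 0 then a else b` -/
  | ite (c a b : Ex)

namespace Ex

instance : Add Ex := ⟨bin .add⟩
instance : Sub Ex := ⟨bin .sub⟩
instance : Mul Ex := ⟨bin .mul⟩
instance (n : ℕ) : OfNat Ex n := ⟨lit n⟩

/-- `⌊a / 2 ^ b⌋` -/
abbrev shr : Ex → Ex → Ex := bin .shr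

/-- The value of an expression. -/
def eval (s : St) : Ex → ℤ
  | lit k => k
  | var x => s.v x
  | bin o a b => o.app (a.eval s) (b.eval s)
  | len a => bits (a.eval s)
  | get b i => s.a b (i.eval s).toNat
  | ite c a b => if 0 < c.eval s then a.eval s else b.eval s

/-- The size of an expression. -/
def sz : Ex → ℕ
  | lit _ => 2
  | var _ => 2
  | bin _ a b => a.sz + b.sz + 1
  | len a => a.sz + 1
  | get _ i => i.sz + 1
  | ite c a b => c.sz + a.sz + b.sz + 1

/-- All numbers that the evaluation reads have at most `L` bits. -/
def Leaf (L : ℕ) (s : St) : Ex → Prop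
  | lit k => bits k ≤ 8
  | var x => x < 60 ∧ bits (s.v x) ≤ L
  | bin _ a b => a.Leaf L s ∧ b.Leaf L s
  | len a => a.Leaf L s
  | get b i => i.Leaf L s ∧ bits (s.a b (i.eval s).toNat) ≤ L
  | ite c a b => c.Leaf L s ∧ (0 < c.eval s → a.Leaf L s) ∧ (c.eval s ≤ 0 → b.Leaf L s)

/-- The expression reads only variables and arrays that are reserved for short numbers. -/
def ok : Ex → Bool
  | lit k => bits k ≤ 8
  | var x => x < 40
  | bin _ a b => a.ok && b.ok
  | len a => a.ok
  | get b i => i.ok && (b == 1 || 8 ≤ b)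
  | ite c a b => c.ok && a.ok && b.ok

section
variable (s : St) (L : ℕ) (a b c : Ex)

@[simp] lemma eval_ofNat (n : ℕ) : (ofNat(n) : Ex).eval s = (OfNat.ofNat n : ℤ) := rfl
@[simp] lemma eval_var (x : ℕ) : (var x).eval s = s.v x := rfl
@[simp] lemma eval_add : (a + b).eval s = a.eval s + b.eval s := rfl
@[simp] lemma eval_sub : (a - b).eval s = a.eval s - b.eval s := rfl
@[simp] lemma eval_mul : (a * b).eval s = a.eval s * b.eval s := rfl
@[simp] lemma eval_shr : (shr a b).eval s = a.eval s / 2 ^ (b.eval s).toNat := rfl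
@[simp] lemma eval_len : (len a).eval s = bits (a.eval s) := rfl
@[simp] lemma eval_get (x : ℕ) : (get x a).eval s = s.a x (a.eval s).toNat := rfl
@[simp] lemma eval_ite : (ite c a b).eval s = if 0 < c.eval s then a.eval s else b.eval s := rfl

lemma evals (s : St) : (∀ n : ℕ, (ofNat(n) : Ex).eval s = (OfNat.ofNat n : ℤ)) ∧
    (∀ x, (var x).eval s = s.v x) ∧ (∀ a b : Ex, (a + b).eval s = a.eval s + b.eval s) ∧
    (∀ a b : Ex, (a - b).eval s = a.eval s - b.eval s) ∧ (∀ a b : Ex, (a * b).eval s = a.eval s * b.eval s) ∧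
    (∀ a b, (shr a b).eval s = a.eval s / 2 ^ (b.eval s).toNat) ∧ (∀ a, (len a).eval s = bits (a.eval s)) ∧
    (∀ x a, (get x a).eval s = s.a x (a.eval s).toNat) ∧
    ∀ c a b, (ite c a b).eval s = if 0 < c.eval s then a.eval s else b.eval s := by
  simp

@[simp] lemma leaf_ofNat (n : ℕ) :
    (ofNat(n) : Ex).Leaf L s ↔ bits (OfNat.ofNat n : ℤ) ≤ 8 := Iff.rfl
@[simp] lemma leaf_var (x : ℕ) : (var x).Leaf L s ↔ x < 60 ∧ bits (s.v x) ≤ L := Iff.rfl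
@[simp] lemma leaf_add : (a + b).Leaf L s ↔ a.Leaf L s ∧ b.Leaf L s := Iff.rfl
@[simp] lemma leaf_sub : (a - b).Leaf L s ↔ a.Leaf L s ∧ b.Leaf L s := Iff.rfl
@[simp] lemma leaf_mul : (a * b).Leaf L s ↔ a.Leaf L s ∧ b.Leaf L s := Iff.rfl
@[simp] lemma leaf_shr : (shr a b).Leaf L s ↔ a.Leaf L s ∧ b.Leaf L s := Iff.rfl
@[simp] lemma leaf_len : (len a).Leaf L s ↔ a.Leaf L s := Iff.rfl
@[simp] lemma leaf_get (x : ℕ) :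
    (get x a).Leaf L s ↔ a.Leaf L s ∧ bits (s.a x (a.eval s).toNat) ≤ L := Iff.rfl
@[simp] lemma leaf_ite : (ite c a b).Leaf L s ↔
    c.Leaf L s ∧ (0 < c.eval s → a.Leaf L s) ∧ (c.eval s ≤ 0 → b.Leaf L s) := Iff.rfl
end

lemma Leaf.mono {L L' : ℕ} (h : L ≤ L') {s : St} : ∀ {e : Ex}, e.Leaf L s → e.Leaf L' s
  | lit _, he => he
  | var _, he => ⟨he.1, he.2.trans h⟩
  | bin _ _ _, he => ⟨he.1.mono h, he.2.mono h⟩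
  | len a, he => Leaf.mono h (e := a) he
  | get _ _, he => ⟨he.1.mono h, he.2.trans h⟩
  | ite _ _ _, he => ⟨he.1.mono h, fun x => (he.2.1 x).mono h, fun x => (he.2.2 x).mono h⟩

lemma two_le_sz : ∀ e : Ex, 2 ≤ e.sz
  | lit _ => le_rfl
  | var _ => le_rfl
  | bin _ a b => by have := two_le_sz a; simp only [sz]; omega
  | len a => by have := two_le_sz a; simp only [sz]; omega
  | get _ i => by have := two_le_sz i; simp only [sz]; omega
  | ite c a b => by have := two_le_sz a; simp only [sz]; omega

/-- The bits of the value are bounded by the size of the expression times the bits read. -/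
lemma bits_eval_le {L : ℕ} (hL : 8 ≤ L) {s : St} :
    ∀ {e : Ex}, e.Leaf L s → bits (e.eval s) ≤ e.sz * (L + 1)
  | lit k, he => by
      have : bits k ≤ 8 := he
      simp only [eval, sz]; omega
  | var _, he => by
      have := he.2
      simp only [eval, sz]; omega
  | bin o a b, he => by
      have h1 := bits_eval_le hL he.1
      have h2 := bits_eval_le hL he.2
      have := o.bits_app_le (a.eval s) (b.eval s)
      simp only [eval, sz, add_mul]; omega
  | len a, he => by
      have h1 := bits_eval_le hL (e := a) he
      have := bits_natCast (le_refl (bits (a.eval s)))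
      simp only [eval, sz, add_mul]; omega
  | get x i, he => by
      have := he.2
      simp only [eval, sz, add_mul]; omega
  | ite c a b, he => by
      simp only [eval, sz, add_mul]
      split_ifs with h
      · have := bits_eval_le hL (he.2.1 h); omega
      · have := bits_eval_le hL (he.2.2 (not_lt.1 h)); omega

/-- The program that stores the value of an expression in the variable `t`, using only variables
from `t` on. -/
def compile : Ex → ℕ → Program
  | lit k, t => .instr (.const t k)
  | var x, t => .seq (.instr (.const t 0)) (.instr (.add t x t))
  | bin o a b, t => .seq (a.compile t) (.seq (b.compile (t + 1)) (.instr (o.instr t t (t + 1))))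
  | len a, t => .seq (a.compile t) (.instr (.len t t))
  | get b i, t => .seq (i.compile t) (.instr (.load t b t))
  | ite c a b, t => .seq (c.compile t) (.ite t (a.compile t) (b.compile t))

end Ex

/-! ### Multiplication times -/

lemma IsMulTime.nonneg {M : ℕ → ℝ} (hM : IsMulTime M) (n : ℕ) : 0 ≤ M n :=
  (Nat.cast_nonneg n).trans (hM.le_apply n)

lemma IsMulTime.mul_apply_le {M : ℕ → ℝ} (hM : IsMulTime M) {m n : ℕ} (h1 : 1 ≤ m) (h : m ≤ n) :
    n * M m ≤ m * M n := by
  have := hM.div_mono m n h1 h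
  have hm : (0 : ℝ) < m := mod_cast h1
  have hn : (0 : ℝ) < n := mod_cast h1.trans h
  rw [div_le_div_iff₀ hm hn] at this
  linarith

lemma IsMulTime.mono {M : ℕ → ℝ} (hM : IsMulTime M) {m n : ℕ} (h1 : 1 ≤ m) (h : m ≤ n) :
    M m ≤ M n := by
  have h2 := hM.mul_apply_le h1 h
  have hm : (0 : ℝ) < m := mod_cast h1
  have : (m : ℝ) ≤ n := mod_cast h
  nlinarith [hM.nonneg m, hM.nonneg n]

/-! ### Contexts -/

/-- The bounds that a program respects throughout its run: `lam` bits for the variables below `40`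
and for the array `1` and the arrays from `8` on, `bet` bits for all variables, and for every array
`x < 16` a length and a number of bits for each entry. The array `3` is the stack of the reduction
of one number modulo another; its entries are halved in length at each level. -/
structure Ctx where
  M : ℕ → ℝ
  hM : IsMulTime M
  lam : ℕ
  bet : ℕ
  len : ℕ → ℕ
  cap : ℕ → ℕ → ℕ
  lam_ge : 8 ≤ lam
  bet_ge : 1000000 * (lam + 1) ≤ bet
  len_stack : bet < 2 ^ len 3
  cap_stack : ∀ i, bet / 2 ^ i + 3 ≤ cap 3 i
  cap_small : ∀ x i, (x = 1 ∨ 8 ≤ x) → cap x i ≤ lam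

namespace Ctx

/-- The space that is never exceeded. -/
def S (c : Ctx) : ℕ := 130 * (9 + c.bet) +
    ∑ x ∈ range 16, ∑ i ∈ range (c.len x), (x.size + i.size + 1 + c.cap x i)

/-- The time unit: every instruction on numbers of at most `n` bits takes at most `c.u n`. -/
noncomputable def u (c : Ctx) (n : ℕ) : ℝ := (3 + c.M 0) * c.M (n + 1)

variable (c : Ctx)

lemma u_mono {m n : ℕ} (h : m ≤ n) : c.u m ≤ c.u n :=
  mul_le_mul_of_nonneg_left (c.hM.mono (by omega) (by omega)) (by have := c.hM.nonneg 0; linarith)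

lemma M_le_u (n : ℕ) : 3 * c.M (n + 1) ≤ c.u n := by
  unfold u
  nlinarith [c.hM.nonneg 0, c.hM.nonneg (n + 1)]

lemma three_mul_le_u (n : ℕ) : 3 * ((n : ℝ) + 1) ≤ c.u n := by
  have h1 := c.hM.le_apply (n + 1)
  have h2 := c.M_le_u n
  push_cast at h1
  linarith

lemma u_pos (n : ℕ) : 0 < c.u n := by
  have := c.three_mul_le_u n
  have : (0 : ℝ) ≤ n := by positivity
  linarith

lemma one_add_M_le_u {k n : ℕ} (h : k ≤ n) : 1 + c.M k ≤ c.u n := by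
  have h1 : (1 : ℝ) ≤ c.M (n + 1) := by
    refine le_trans ?_ (c.hM.le_apply (n + 1)); push_cast; linarith [(Nat.cast_nonneg n : (0:ℝ) ≤ n)]
  have h0 := c.hM.nonneg 0
  unfold u
  rcases Nat.eq_zero_or_pos k with rfl | hk
  · nlinarith
  · have := c.hM.mono hk (show k ≤ n + 1 by omega)
    nlinarith

/-- `u` grows at least linearly. -/
lemma u_le_div {m n : ℕ} (h : m ≤ n) : c.u m ≤ ((m : ℝ) + 1) / (n + 1) * c.u n := by
  have := c.hM.mul_apply_le (m := m + 1) (n := n + 1) (by omega) (by omega)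
  have h0 := c.hM.nonneg 0
  unfold u
  rw [div_mul_eq_mul_div, le_div_iff₀ (by positivity)]
  push_cast at this
  nlinarith

end Ctx

/-- The abstract memory respects the bounds of the context. -/
structure Fit (c : Ctx) (s : St) : Prop where
  small : ∀ x < 40, bits (s.v x) ≤ c.lam
  var : ∀ x < 60, bits (s.v x) ≤ c.bet
  arr : ∀ x i, s.a x i ≠ 0 → x < 16 ∧ i < c.len x ∧ bits (s.a x i) ≤ c.cap x i

/-- The abstract memory `s` describes the memory `σ`, and both respect the bounds. -/
structure Describes (c : Ctx) (σ : Store) (s : St) : Prop where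
  fit : Fit c s
  var : ∀ x < 60, σ.var x = s.v x
  bet : ∀ x < 130, bits (σ.var x) ≤ c.bet
  zero : ∀ x, 130 ≤ x → σ.var x = 0
  arr : ∀ x i, σ.arr (x, i) = s.a x i

lemma Fit.arr_le {c : Ctx} {s : St} (h : Fit c s) (x i : ℕ) : bits (s.a x i) ≤ c.cap x i := by
  by_cases h0 : s.a x i = 0
  · simp [h0, bits_zero]
  · exact (h.arr x i h0).2.2

lemma Fit.leaf {c : Ctx} {s : St} (h : Fit c s) : ∀ {e : Ex}, e.ok = true → e.Leaf c.lam s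
  | .lit k, he => of_decide_eq_true (p := bits k ≤ 8) he
  | .var x, he => by
      have hx : x < 40 := of_decide_eq_true he
      exact ⟨by omega, h.small x hx⟩
  | .bin _ _ _, he => by have := (Bool.and_eq_true _ _).mp he; exact ⟨h.leaf this.1, h.leaf this.2⟩
  | .len a, he => h.leaf (e := a) he
  | .get x i, he => by
      have h1 := (Bool.and_eq_true _ _).mp he
      refine ⟨h.leaf h1.1, (h.arr_le _ _).trans (c.cap_small _ _ ?_)⟩
      simpa using h1.2
  | .ite _ _ _, he => by
      have h1 := (Bool.and_eq_true _ _).mp he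
      have h2 := (Bool.and_eq_true _ _).mp h1.1
      exact ⟨h.leaf h2.1, fun _ => h.leaf h2.2, fun _ => h.leaf h1.2⟩

lemma Describes.space_le {c : Ctx} {σ : Store} {s : St} (h : Describes c σ s) : σ.space ≤ c.S := by
  unfold Store.space Ctx.S
  refine add_le_add ?_ ?_
  · rw [Finsupp.sum]
    have hs : σ.var.support ⊆ range 130 := fun x hx => by
      rw [mem_range]
      by_contra hx'
      exact (Finsupp.mem_support_iff.1 hx) (h.zero x (by omega))
    refine (sum_le_sum_of_subset hs).trans ?_
    refine (sum_le_card_nsmul _ _ (9 + c.bet) fun x hx => ?_).trans (by simp)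
    have hx := mem_range.1 hx
    have h1 := h.bet x hx
    have h2 : x.size ≤ 8 := Nat.size_le.2 (by omega)
    omega
  · rw [Finsupp.sum, sum_sigma']
    rw [← sum_image (s := (range 16).sigma fun x => range (c.len x))
      (f := fun q : ℕ × ℕ => q.1.size + q.2.size + 1 + c.cap q.1 q.2)
      (g := fun q : (_ : ℕ) × ℕ => (q.1, q.2))]
    · refine (sum_le_sum fun q hq => ?_).trans (sum_le_sum_of_subset ?_)
      · rw [h.arr]
        have := h.fit.arr_le q.1 q.2
        omega
      · intro q hq
        have hq := Finsupp.mem_support_iff.1 hq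
        rw [h.arr] at hq
        have := h.fit.arr _ _ hq
        simp only [mem_image, mem_sigma, mem_range]
        exact ⟨⟨q.1, q.2⟩, ⟨this.1, this.2.1⟩, rfl⟩
    · rintro ⟨a, b⟩ _ ⟨a', b'⟩ _ hh
      simp only [Prod.mk.injEq] at hh
      obtain ⟨rfl, rfl⟩ := hh
      rfl

lemma Store.setVar_var (σ : Store) (x y : ℕ) (k : ℤ) :
    (σ.setVar x k).var y = if y = x then k else σ.var y := by
  simp [Store.setVar, Finsupp.update_apply]

lemma Describes.setTemp {c : Ctx} {σ : Store} {s : St} (h : Describes c σ s) {t : ℕ} (h1 : 60 ≤ t)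
    (h2 : t < 130) {k : ℤ} (hk : bits k ≤ c.bet) : Describes c (σ.setVar t k) s where
  fit := h.fit
  var x hx := by rw [Store.setVar_var, if_neg (by omega), h.var x hx]
  bet x hx := by
    rw [Store.setVar_var]; split_ifs
    · exact hk
    · exact h.bet x hx
  zero x hx := by rw [Store.setVar_var, if_neg (by omega), h.zero x hx]
  arr := h.arr

lemma Describes.setVar {c : Ctx} {σ : Store} {s : St} (h : Describes c σ s) {x : ℕ} (hx : x < 60) {k : ℤ}
    (hk : bits k ≤ c.bet) (hk' : x < 40 → bits k ≤ c.lam) : Describes c (σ.setVar x k) (s.set x k) where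
  fit := by
    refine ⟨fun y hy => ?_, fun y hy => ?_, h.fit.arr⟩
    · rw [St.set_v]; split_ifs with hh
      · exact hk' (hh ▸ hy)
      · exact h.fit.small y hy
    · rw [St.set_v]; split_ifs
      · exact hk
      · exact h.fit.var y hy
  var y hy := by rw [Store.setVar_var, St.set_v, h.var y hy]
  bet y hy := by
    rw [Store.setVar_var]; split_ifs
    · exact hk
    · exact h.bet y hy
  zero y hy := by rw [Store.setVar_var, if_neg (by omega), h.zero y hy]
  arr := h.arr

/-- `P` leads from `σ` to `τ` in time `T` and within the space of the context. -/
def Step (c : Ctx) (P : Program) (σ τ : Store) (T : ℝ) : Prop :=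
  ∃ t sp, Exec c.M P σ τ t sp ∧ t ≤ T ∧ sp ≤ c.S

lemma Step.mono {c : Ctx} {P : Program} {σ τ : Store} {T T' : ℝ} (h : Step c P σ τ T)
    (hT : T ≤ T') : Step c P σ τ T' := by
  obtain ⟨t, sp, h1, h2, h3⟩ := h
  exact ⟨t, sp, h1, h2.trans hT, h3⟩

lemma Step.seq {c : Ctx} {P P' : Program} {σ τ υ : Store} {T T' : ℝ} (h : Step c P σ τ T)
    (h' : Step c P' τ υ T') : Step c (.seq P P') σ υ (T + T') := by
  obtain ⟨t, sp, h1, h2, h3⟩ := h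
  obtain ⟨t', sp', h1', h2', h3'⟩ := h'
  exact ⟨_, _, .seq h1 h1', add_le_add h2 h2', max_le h3 h3'⟩

lemma Step.instr {c : Ctx} {i : Instr} {σ : Store} {s s' : St} {T : ℝ} (h : Describes c σ s)
    (h' : Describes c (i.run σ) s') (hT : i.time c.M σ ≤ T) : Step c (.instr i) σ (i.run σ) T :=
  ⟨_, _, .instr i σ, hT, max_le h.space_le h'.space_le⟩

lemma Step.ite_pos {c : Ctx} {x : ℕ} {P P' : Program} {σ τ : Store} {T T' : ℝ}
    (hx : 0 < σ.var x) (h : Step c P σ τ T) (hT : 1 + bits (σ.var x) ≤ T') :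
    Step c (.ite x P P') σ τ (T' + T) := by
  obtain ⟨t, sp, h1, h2, h3⟩ := h
  exact ⟨_, _, .ite_pos hx h1, by linarith, h3⟩

lemma Step.ite_nonpos {c : Ctx} {x : ℕ} {P P' : Program} {σ τ : Store} {T T' : ℝ}
    (hx : σ.var x ≤ 0) (h : Step c P' σ τ T) (hT : 1 + bits (σ.var x) ≤ T') :
    Step c (.ite x P P') σ τ (T' + T) := by
  obtain ⟨t, sp, h1, h2, h3⟩ := h
  exact ⟨_, _, .ite_nonpos hx h1, by linarith, h3⟩

lemma Ctx.le_u {c : Ctx} {n a b : ℕ} (ha : a ≤ n) (hb : b ≤ n) : (1 : ℝ) + a + b ≤ c.u n := by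
  have h := c.three_mul_le_u n
  have h1 : (a : ℝ) ≤ n := mod_cast ha
  have h2 : (b : ℝ) ≤ n := mod_cast hb
  have h3 : (0 : ℝ) ≤ n := by positivity
  linarith

lemma Ctx.max_le_u {c : Ctx} {n a b : ℕ} (ha : a ≤ n) (hb : b ≤ n) :
    (1 : ℝ) + (max a b : ℕ) ≤ c.u n := by
  have h := c.three_mul_le_u n
  have h1 : ((max a b : ℕ) : ℝ) ≤ n := mod_cast max_le ha hb
  have h3 : (0 : ℝ) ≤ n := by positivity
  linarith

lemma Ctx.le_u' {c : Ctx} {n a : ℕ} (ha : a ≤ n) : (1 : ℝ) + a ≤ c.u n := by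
  simpa using Ctx.le_u (c := c) ha (Nat.zero_le n)

lemma Op.time_instr_le (o : Op) {c : Ctx} {n x y z : ℕ} {σ : Store} (hy : bits (σ.var y) ≤ n)
    (hz : bits (σ.var z) ≤ n) : (o.instr x y z).time c.M σ ≤ c.u n := by
  cases o
  · exact Ctx.max_le_u hy hz
  · exact Ctx.max_le_u hy hz
  · exact c.one_add_M_le_u (max_le hy hz)
  · exact Ctx.le_u hy hz

/-- The compiled expression computes the value and leaves everything below `t` as it was. -/
lemma Ex.compile_step {c : Ctx} {L n : ℕ} {s : St} (hL : 8 ≤ L) (hn : n ≤ c.bet) (e : Ex) (t : ℕ)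
    (σ : Store) (he : e.Leaf L s) (hs : e.sz * (L + 1) ≤ n) (h1 : 60 ≤ t) (h2 : t + e.sz ≤ 130)
    (hσ : Describes c σ s) : ∃ τ, Step c (e.compile t) σ τ (e.sz * c.u n) ∧ Describes c τ s ∧
      τ.var t = e.eval s ∧ ∀ x < t, τ.var x = σ.var x := by
  have hb : ∀ {e : Ex}, e.Leaf L s → e.sz * (L + 1) ≤ n → bits (e.eval s) ≤ n :=
    fun h h' => (bits_eval_le hL h).trans h'
  have hb1 := hb he hs
  have hu := c.u_pos n
  induction e generalizing t σ with
  | lit k =>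
    simp only [sz] at hs h2
    have r := hσ.setTemp (t := t) h1 (by omega) (hb1.trans hn)
    refine ⟨_, (Step.instr (i := .const t k) (T := c.u n) hσ r (Ctx.le_u' hb1)).mono ?_, r, ?_, ?_⟩
    · simp only [sz]; push_cast; linarith
    · rw [Instr.run, Store.setVar_var, if_pos rfl]; rfl
    · intro x hx; rw [Instr.run, Store.setVar_var, if_neg (by omega)]
  | var x =>
    simp only [sz] at hs h2
    have hx := he.1
    have r0 := hσ.setTemp (t := t) (k := 0) h1 (by omega) (by simp)
    have hv : (σ.setVar t 0).var x + (σ.setVar t 0).var t = s.v x := by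
      rw [Store.setVar_var, Store.setVar_var, if_neg (by omega), if_pos rfl, hσ.var x hx, add_zero]
    have r1 := r0.setTemp h1 (t := t) (k := _ + _) (by omega) (by rw [hv]; exact hb1.trans hn)
    refine ⟨_, ((Step.instr (i := .const t 0) (T := c.u n) hσ r0 (Ctx.le_u' (by simp))).seq
      (Step.instr (i := .add t x t) (T := c.u n) r0 r1 (Ctx.max_le_u ?_ ?_))).mono ?_, r1, ?_, ?_⟩
    · rw [Instr.run, Store.setVar_var, if_neg (by omega), hσ.var x hx]; exact hb1
    · simp [Instr.run, Store.setVar_var]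
    · simp only [sz]; push_cast; linarith
    · rw [Instr.run, Instr.run, Store.setVar_var, if_pos rfl]; exact hv
    · intro y hy
      simp only [Instr.run, Store.setVar_var]
      rw [if_neg (by omega), if_neg (by omega)]
  | bin o a b iha ihb =>
    simp only [sz, add_mul] at hs h2
    have := two_le_sz a
    have := two_le_sz b
    obtain ⟨τ, s1, r1, v1, f1⟩ := iha t σ he.1 (by omega) h1 (by omega) hσ (hb he.1 (by omega))
    obtain ⟨υ, s2, r2, v2, f2⟩ := ihb (t + 1) τ he.2 (by omega) (by omega) (by omega) r1
      (hb he.2 (by omega))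
    have hv : υ.var t = a.eval s := by rw [f2 t (by omega), v1]
    have e3 : (o.instr t t (t + 1)).run υ = υ.setVar t ((bin o a b).eval s) := by
      rw [o.run_instr, hv, v2]; rfl
    have r3 := e3 ▸ r2.setTemp (t := t) h1 (by omega) (hb1.trans hn)
    refine ⟨_, (s1.seq (s2.seq (Step.instr (T := c.u n) r2 r3 (o.time_instr_le (by rw [hv]; exact hb he.1 (by omega))
        (by rw [v2]; exact hb he.2 (by omega)))))).mono ?_, r3, ?_, ?_⟩
    · simp only [sz]; push_cast; linarith
    · rw [e3, Store.setVar_var, if_pos rfl]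
    · intro x hx
      rw [e3, Store.setVar_var, if_neg (by omega), f2 x (by omega), f1 x hx]
  | len a iha =>
    simp only [sz, add_mul] at hs h2
    obtain ⟨τ, s1, r1, v1, f1⟩ := iha t σ he (by omega) h1 (by omega) hσ (hb he (by omega))
    have r2 := r1.setTemp (t := t) (k := bits (τ.var t)) h1 (by omega)
      (by rw [v1]; exact hb1.trans hn)
    refine ⟨_, (s1.seq (Step.instr (i := .len t t) (T := c.u n) r1 r2 ?_)).mono ?_, r2, ?_, ?_⟩
    · refine Ctx.le_u' ?_
      rw [v1]; exact hb he (by omega)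
    · simp only [sz]; push_cast; linarith
    · simp only [Instr.run, Store.setVar_var, v1]; rfl
    · intro x hx; simp only [Instr.run]; rw [Store.setVar_var, if_neg (by omega), f1 x hx]
  | get b i ihi =>
    simp only [sz, add_mul] at hs h2
    obtain ⟨τ, s1, r1, v1, f1⟩ := ihi t σ he.1 (by omega) h1 (by omega) hσ (hb he.1 (by omega))
    have hval : τ.arr (b, (τ.var t).toNat) = (Ex.get b i).eval s := by rw [r1.arr, v1]; rfl
    have r2 := r1.setTemp (t := t) (k := τ.arr (b, (τ.var t).toNat)) h1 (by omega)
      (by rw [hval]; exact hb1.trans hn)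
    refine ⟨_, (s1.seq (Step.instr (i := .load t b t) (T := c.u n) r1 r2 ?_)).mono ?_, r2, ?_, ?_⟩
    · refine Ctx.le_u ?_ ?_
      · rw [v1]; exact hb he.1 (by omega)
      · rw [hval]; exact hb1
    · simp only [sz]; push_cast; linarith
    · simp [Instr.run, Store.setVar_var, hval]
    · intro x hx; simp only [Instr.run]; rw [Store.setVar_var, if_neg (by omega), f1 x hx]
  | ite k a b ihk iha ihb =>
    simp only [sz, add_mul] at hs h2
    obtain ⟨τ, s1, r1, v1, f1⟩ := ihk t σ he.1 (by omega) h1 (by omega) hσ (hb he.1 (by omega))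
    have hk : (1 : ℝ) + bits (τ.var t) ≤ c.u n := Ctx.le_u' (by rw [v1]; exact hb he.1 (by omega))
    by_cases hc : 0 < k.eval s
    · obtain ⟨υ, s2, r2, v2, f2⟩ := iha t τ (he.2.1 hc) (by omega) h1 (by omega) r1
        (hb (he.2.1 hc) (by omega))
      refine ⟨υ, (s1.seq (Step.ite_pos (by rw [v1]; exact hc) s2 hk)).mono ?_, r2, ?_, ?_⟩
      · simp only [sz]; push_cast
        have : (0 : ℝ) ≤ b.sz * c.u n := by positivity
        linarith
      · rw [v2]; simp [eval, hc]
      · intro x hx; rw [f2 x hx, f1 x hx]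
    · obtain ⟨υ, s2, r2, v2, f2⟩ := ihb t τ (he.2.2 (not_lt.1 hc)) (by omega) h1 (by omega) r1
        (hb (he.2.2 (not_lt.1 hc)) (by omega))
      refine ⟨υ, (s1.seq (Step.ite_nonpos (by rw [v1]; exact not_lt.1 hc) s2 hk)).mono ?_,
        r2, ?_, ?_⟩
      · simp only [sz]; push_cast
        have : (0 : ℝ) ≤ a.sz * c.u n := by positivity
        linarith
      · rw [v2]; simp [eval, hc]
      · intro x hx; rw [f2 x hx, f1 x hx]

/-! ### Programs built from expressions, and their Hoare rules -/

/-- `x := e` -/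
def asg (x : ℕ) (e : Ex) : Program :=
  .seq (e.compile 60) (.seq (.instr (.const 61 0)) (.instr (.add x 60 61)))

/-- `b[i] := e` -/
def put (b : ℕ) (i e : Ex) : Program :=
  .seq (i.compile 60) (.seq (e.compile 61) (.instr (.store b 60 61)))

/-- `if e > 0 then P else P'` -/
def branch (e : Ex) (P P' : Program) : Program := .seq (e.compile 60) (.ite 60 P P')

/-- `while e > 0 do P` -/
def loop (e : Ex) (P : Program) : Program := .seq (e.compile 60) (.while 60 (.seq P (e.compile 60)))

/-- The programs of a list, one after the other. -/
def blk : List Program → Program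
  | [] => .instr (.const 60 0)
  | P :: Ps => .seq P (blk Ps)

/-- `for x = 0, …, e - 1 do P` -/
def forLoop (x : ℕ) (e : Ex) (P : Program) : Program :=
  blk [asg x 0, loop (e - .var x) (blk [P, asg x (.var x + 1)])]

/-- A Hoare triple with resource bounds: started on a memory described by `s`, the program `P` halts
within time `T` and within the space of the context, on a memory with the property `Q`. -/
def Does (c : Ctx) (P : Program) (s : St) (T : ℝ) (Q : St → Prop) : Prop :=
  ∀ σ, Describes c σ s → ∃ τ s', Step c P σ τ T ∧ Describes c τ s' ∧ Q s'

/-- The time for a simple command that reads numbers of at most `L` bits. -/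
noncomputable def bc (c : Ctx) (L : ℕ) : ℝ := 200 * c.u (64 * (L + 1))

lemma bc_pos (c : Ctx) (L : ℕ) : 0 < bc c L := by
  have := c.u_pos (64 * (L + 1)); unfold bc; linarith

lemma bc_mono (c : Ctx) {L L' : ℕ} (h : L ≤ L') : bc c L ≤ bc c L' := by
  have := c.u_mono (show 64 * (L + 1) ≤ 64 * (L' + 1) by omega); unfold bc; linarith

lemma u_le_bc (c : Ctx) (L : ℕ) : c.u L ≤ bc c L := by
  have := c.u_mono (show L ≤ 64 * (L + 1) by omega)
  have := c.u_pos L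
  unfold bc; linarith

section Rules
variable {c : Ctx} {s : St} {P P' : Program} {Ps : List Program} {T T' : ℝ} {Q R : St → Prop}
  {L : ℕ}

lemma Does.mono (h : Does c P s T Q) (hT : T ≤ T') (hQ : ∀ s', Q s' → R s') :
    Does c P s T' R := fun σ hσ => by
  obtain ⟨τ, s', h1, h2, h3⟩ := h σ hσ
  exact ⟨τ, s', h1.mono hT, h2, hQ _ h3⟩

lemma Does.time_le (h : Does c P s T Q) (hT : T ≤ T') : Does c P s T' Q := h.mono hT fun _ => id

/-- The time is treated as a credit `T`, from which every command takes its share. -/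
lemma Does.cons (h : Does c P s T' fun s' => Does c (blk Ps) s' (T - T') Q) :
    Does c (blk (P :: Ps)) s T Q := fun σ hσ => by
  obtain ⟨τ, s', h1, h2, h3⟩ := h σ hσ
  obtain ⟨υ, s'', h4, h5, h6⟩ := h3 τ h2
  exact ⟨υ, s'', (h1.seq h4).mono (by linarith), h5, h6⟩

lemma Does.nil (hT : bc c 8 ≤ T) (h : Q s) : Does c (blk []) s T Q := fun σ hσ => by
  refine ⟨σ.setVar 60 0, s, ?_, hσ.setTemp le_rfl (by norm_num) (by simp [bits_zero]), h⟩
  refine Step.instr (i := .const 60 0) hσ (hσ.setTemp le_rfl (by norm_num) (by simp [bits_zero])) ?_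
  have := c.u_pos (64 * (8 + 1))
  have h2 := c.three_mul_le_u (64 * (8 + 1))
  simp only [Instr.time, bits_zero]
  simp only [bc] at hT
  push_cast at h2 ⊢
  linarith

lemma Does.asg {x : ℕ} {e : Ex} (v : ℤ) (hL : 8 ≤ L) (hb : 64 * (L + 1) ≤ c.bet) (hl : Fit c s → e.Leaf L s) (hv : e.eval s = v)
    (h : Q (s.set x v)) (hx : x < 60 := by norm_num) (hsz : e.sz ≤ 60 := by decide)
    (hs : x < 40 → bits v ≤ c.lam := by norm_num) :
    Does c (asg x e) s (bc c L) Q := fun σ hσ => by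
  subst hv
  have hl := hl hσ.fit
  have hsz' : e.sz * (L + 1) ≤ 64 * (L + 1) := Nat.mul_le_mul_right _ (by omega)
  obtain ⟨τ, s1, r1, v1, f1⟩ := e.compile_step hL hb 60 σ hl hsz' le_rfl (by omega) hσ
  have hv := (Ex.bits_eval_le hL hl).trans hsz'
  have r2 := r1.setTemp (t := 61) (k := 0) (by norm_num) (by norm_num) (by simp [bits_zero])
  have e2 : (τ.setVar 61 0).var 60 + (τ.setVar 61 0).var 61 = e.eval s := by
    simp [Store.setVar_var, v1]
  have r3 : Describes c ((Instr.add x 60 61).run (τ.setVar 61 0)) (s.set x (e.eval s)) := by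
    rw [Instr.run, e2]; exact r2.setVar hx (hv.trans hb) hs
  have hu := c.u_pos (64 * (L + 1))
  refine ⟨_, _, (s1.seq ((Step.instr (T := c.u (64 * (L + 1))) (i := .const 61 0) r1 r2 ?_).seq
    (Step.instr (T := c.u (64 * (L + 1))) r2 r3 ?_))).mono ?_, r3, h⟩
  · exact Ctx.le_u' (by simp [bits_zero])
  · refine Ctx.max_le_u ?_ ?_
    · simp only [Instr.run, Store.setVar_var]; simpa [v1] using hv
    · simp [Instr.run, Store.setVar_var, bits_zero]
  · have : (e.sz : ℝ) ≤ 60 := mod_cast hsz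
    unfold bc; nlinarith

/-- Assignment of an expression that reads only short numbers. -/
lemma Does.asg_ok {x : ℕ} {e : Ex} (v : ℤ) (hv : e.eval s = v)
    (hs : x < 40 → bits v ≤ c.lam) (h : Q (s.set x v)) (hx : x < 60 := by norm_num)
    (hsz : e.sz ≤ 60 := by decide) (hok : e.ok = true := by decide) :
    Does c (_root_.asg x e) s (bc c c.lam) Q :=
  Does.asg v c.lam_ge (by have := c.bet_ge; omega) (fun hf => hf.leaf hok) hv h hx hsz hs

lemma Does.put {b : ℕ} {i e : Ex} (j : ℕ) (v : ℤ) (hL : 8 ≤ L) (hb : 64 * (L + 1) ≤ c.bet) (hli : Fit c s → i.Leaf L s) (hl : Fit c s → e.Leaf L s)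
    (hj : i.eval s = j) (hv : e.eval s = v)
    (hs : v ≠ 0 → b < 16 ∧ j < c.len b ∧ bits v ≤ c.cap b j) (h : Q (s.put b j v))
    (hsz : i.sz + e.sz ≤ 60 := by decide) : Does c (_root_.put b i e) s (bc c L) Q := fun σ hσ => by
  subst hv
  obtain rfl : (i.eval s).toNat = j := by rw [hj, Int.toNat_natCast]
  have hl := hl hσ.fit
  have hli := hli hσ.fit
  have hsz1 : i.sz * (L + 1) ≤ 64 * (L + 1) := Nat.mul_le_mul_right _ (by omega)
  have hsz2 : e.sz * (L + 1) ≤ 64 * (L + 1) := Nat.mul_le_mul_right _ (by omega)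
  obtain ⟨τ, s1, r1, v1, f1⟩ := i.compile_step hL hb 60 σ hli hsz1 le_rfl (by omega) hσ
  obtain ⟨υ, s2, r2, v2, f2⟩ := e.compile_step hL hb 61 τ hl hsz2 (by omega) (by omega) r1
  have v1' : υ.var 60 = i.eval s := by rw [f2 60 (by omega), v1]
  have hv1 := (Ex.bits_eval_le hL hli).trans hsz1
  have hv2 := (Ex.bits_eval_le hL hl).trans hsz2
  have r3 : Describes c ((Instr.store b 60 61).run υ) (s.put b (i.eval s).toNat (e.eval s)) := by
    refine ⟨⟨r2.fit.small, r2.fit.var, fun x j hx => ?_⟩, r2.var, r2.bet, r2.zero, fun x j => ?_⟩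
    · rw [St.put_a] at hx ⊢
      split_ifs at hx ⊢ with hh
      · rw [hh.1, hh.2]; exact hs hx
      · exact r2.fit.arr x j hx
    · simp only [Instr.run, Finsupp.update_apply, St.put_a, v1', v2, Prod.mk.injEq, r2.arr]
  refine ⟨_, _, (s1.seq (s2.seq (Step.instr (T := c.u (64 * (L + 1))) r2 r3 ?_))).mono ?_, r3, h⟩
  · refine Ctx.le_u ?_ ?_
    · rw [v1']; exact hv1
    · rw [v2]; exact hv2
  · have h1 : ((i.sz + e.sz : ℕ) : ℝ) ≤ 60 := mod_cast hsz
    have hu := c.u_pos (64 * (L + 1))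
    unfold bc; push_cast at h1; nlinarith

lemma Does.put_ok {b : ℕ} {i e : Ex} (j : ℕ) (v : ℤ) (hj : i.eval s = j) (hv : e.eval s = v)
    (hs : v ≠ 0 → b < 16 ∧ j < c.len b ∧ bits v ≤ c.cap b j) (h : Q (s.put b j v))
    (hsz : i.sz + e.sz ≤ 60 := by decide) (hi : i.ok = true := by decide)
    (he : e.ok = true := by decide) : Does c (_root_.put b i e) s (bc c c.lam) Q :=
  Does.put j v c.lam_ge (by have := c.bet_ge; omega) (fun hf => hf.leaf hi)
    (fun hf => hf.leaf he) hj hv hs h hsz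

lemma Does.branch {e : Ex} (hL : 8 ≤ L) (hb : 64 * (L + 1) ≤ c.bet) (hl : Fit c s → e.Leaf L s)
    (h1 : 0 < e.eval s → Does c P s (T - bc c L) Q)
    (h2 : e.eval s ≤ 0 → Does c P' s (T - bc c L) Q) (hsz : e.sz ≤ 60 := by decide) :
    Does c (_root_.branch e P P') s T Q := fun σ hσ => by
  have hl := hl hσ.fit
  have hsz' : e.sz * (L + 1) ≤ 64 * (L + 1) := Nat.mul_le_mul_right _ (by omega)
  obtain ⟨τ, s1, r1, v1, f1⟩ := e.compile_step hL hb 60 σ hl hsz' le_rfl (by omega) hσ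
  have hv : (1 : ℝ) + bits (τ.var 60) ≤ c.u (64 * (L + 1)) :=
    Ctx.le_u' (by rw [v1]; exact (Ex.bits_eval_le hL hl).trans hsz')
  have hu := c.u_pos (64 * (L + 1))
  have : (e.sz : ℝ) ≤ 60 := mod_cast hsz
  by_cases hc : 0 < e.eval s
  · obtain ⟨υ, s', s2, r2, q⟩ := h1 hc τ r1
    refine ⟨υ, s', (s1.seq (Step.ite_pos (by rw [v1]; exact hc) s2 hv)).mono ?_, r2, q⟩
    have e3 := mul_le_mul_of_nonneg_right this hu.le
    unfold bc; linarith
  · obtain ⟨υ, s', s2, r2, q⟩ := h2 (not_lt.1 hc) τ r1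
    refine ⟨υ, s', (s1.seq (Step.ite_nonpos (by rw [v1]; exact not_lt.1 hc) s2 hv)).mono ?_, r2, q⟩
    have e3 := mul_le_mul_of_nonneg_right this hu.le
    unfold bc; linarith

lemma Does.branch_ok {e : Ex} (h1 : 0 < e.eval s → Does c P s (T - bc c c.lam) Q)
    (h2 : e.eval s ≤ 0 → Does c P' s (T - bc c c.lam) Q)
    (hsz : e.sz ≤ 60 := by decide) (hok : e.ok = true := by decide) :
    Does c (_root_.branch e P P') s T Q :=
  Does.branch c.lam_ge (by have := c.bet_ge; omega) (fun hf => hf.leaf hok) h1 h2 hsz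

/-- A `while` loop that is executed exactly `n` times, with the invariants `I k`. -/
lemma Does.loop {e : Ex} (hsz : e.sz ≤ 60) (n : ℕ) (I : ℕ → St → Prop) (T : ℕ → ℝ) (L : ℕ → ℕ)
    (hL : ∀ k ≤ n, 8 ≤ L k ∧ 64 * (L k + 1) ≤ c.bet) (h0 : I 0 s)
    (hl : ∀ k ≤ n, ∀ s, I k s → Fit c s → e.Leaf (L k) s)
    (hpos : ∀ k < n, ∀ s, I k s → 0 < e.eval s)
    (hbody : ∀ k < n, ∀ s, I k s → Fit c s → Does c P s (T k) (I (k + 1)))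
    (hexit : ∀ s, I n s → e.eval s ≤ 0 ∧ Q s) : Does c (_root_.loop e P) s
      (∑ k ∈ range (n + 1), bc c (L k) + ∑ k ∈ range n, T k) Q := by
  have hcomp : ∀ k ≤ n, ∀ s σ, I k s → Describes c σ s → ∃ τ,
      Step c (e.compile 60) σ τ (e.sz * c.u (64 * (L k + 1))) ∧ Describes c τ s ∧
        τ.var 60 = e.eval s ∧ (1 : ℝ) + bits (τ.var 60) ≤ c.u (64 * (L k + 1)) := by
    intro k hk s σ hI hσ
    have hsz' : e.sz * (L k + 1) ≤ 64 * (L k + 1) := Nat.mul_le_mul_right _ (by omega)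
    obtain ⟨τ, s1, r1, v1, f1⟩ := e.compile_step (hL k hk).1 (hL k hk).2 60 σ (hl k hk s hI hσ.fit)
      hsz' le_rfl (by omega) hσ
    refine ⟨τ, s1, r1, v1, Ctx.le_u' ?_⟩
    rw [v1]; exact (Ex.bits_eval_le (hL k hk).1 (hl k hk s hI hσ.fit)).trans hsz'
  have hszr : (e.sz : ℝ) ≤ 60 := mod_cast hsz
  -- the part of the run after the evaluation of the condition for the `k`-th time
  have key : ∀ m k, k + m = n → ∀ s σ, I k s → Describes c σ s → σ.var 60 = e.eval s →
      (1 : ℝ) + bits (σ.var 60) ≤ c.u (64 * (L k + 1)) →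
      ∃ τ s', Step c (.while 60 (.seq P (e.compile 60))) σ τ
        (c.u (64 * (L k + 1)) + ∑ j ∈ range m, (bc c (L (k + 1 + j)) + T (k + j))) ∧
        Describes c τ s' ∧ Q s' := by
    intro m
    induction m with
    | zero =>
      intro k hk s σ hI hσ hv hb
      obtain rfl : k = n := by omega
      refine ⟨σ, s, ⟨_, _, .while_nonpos (by rw [hv]; exact (hexit s hI).1), ?_, hσ.space_le⟩, hσ,
        (hexit s hI).2⟩
      simpa using hb
    | succ m ih =>
      intro k hk s σ hI hσ hv hb
      obtain ⟨τ, s', ⟨t1, sp1, x1, y1, z1⟩, r1, i1⟩ := hbody k (by omega) s hI hσ.fit σ hσ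
      obtain ⟨υ, ⟨t2, sp2, x2, y2, z2⟩, r2, v2, b2⟩ := hcomp (k + 1) (by omega) s' τ i1 r1
      obtain ⟨ω, s'', ⟨t3, sp3, x3, y3, z3⟩, r3, q3⟩ := ih (k + 1) (by omega) s' υ i1 r2 v2 b2
      refine ⟨ω, s'', ⟨_, _, .while_pos (by rw [hv]; exact hpos k (by omega) s hI) (.seq x1 x2) x3,
        ?_, max_le (max_le z1 z2) z3⟩, r3, q3⟩
      rw [sum_range_succ']
      have hu := c.u_pos (64 * (L (k + 1) + 1))
      have e1 : ∀ j, bc c (L (k + 1 + (j + 1))) + T (k + (j + 1)) =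
          bc c (L (k + 1 + 1 + j)) + T (k + 1 + j) := by
        intro j; rw [show k + 1 + (j + 1) = k + 1 + 1 + j by ring,
          show k + (j + 1) = k + 1 + j by ring]
      simp only [e1, add_zero]
      have e2 : bc c (L (k + 1)) = 200 * c.u (64 * (L (k + 1) + 1)) := rfl
      have e3 := mul_le_mul_of_nonneg_right hszr hu.le
      linarith
  intro σ hσ
  obtain ⟨τ, s1, r1, v1, b1⟩ := hcomp 0 (Nat.zero_le _) s σ h0 hσ
  obtain ⟨υ, s', s2, r2, q2⟩ := key n 0 (by omega) s τ h0 r1 v1 b1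
  refine ⟨υ, s', (s1.seq s2).mono ?_, r2, q2⟩
  rw [sum_range_succ', sum_add_distrib]
  have hu := c.u_pos (64 * (L 0 + 1))
  have : bc c (L 0) = 200 * c.u (64 * (L 0 + 1)) := rfl
  have e1 : ∀ j, 0 + 1 + j = j + 1 := fun j => by ring
  simp only [e1, zero_add]
  have e3 := mul_le_mul_of_nonneg_right hszr hu.le
  linarith

/-- A counting loop, whose bound is an expression that reads only short numbers. -/
lemma Does.forLoop {x : ℕ} {e : Ex} (n : ℕ) (hn : bits (n : ℤ) ≤ c.lam) (I : ℕ → St → Prop) (T : ℕ → ℝ)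
    (h0 : I 0 (s.set x 0)) (hv : ∀ k ≤ n, ∀ s, I k s → s.v x = k ∧ e.eval s = n)
    (hbody : ∀ k < n, ∀ s, I k s → Fit c s →
      Does c P s (T k) fun s' => s'.v x = k ∧ I (k + 1) (s'.set x ((k : ℤ) + 1)))
    (hQ : ∀ s, I n s → Q s) (hx : x < 40 := by norm_num) (hok : e.ok = true := by decide)
    (hsz : e.sz ≤ 57 := by decide) :
    Does c (_root_.forLoop x e P) s (∑ k ∈ range n, T k + (3 * n + 3) * bc c c.lam) Q := by
  have hb : 64 * (c.lam + 1) ≤ c.bet := by have := c.bet_ge; omega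
  have h8 := bc_mono c c.lam_ge
  have hpos := bc_pos c c.lam
  have hn0 : (0 : ℝ) ≤ n * bc c c.lam := by positivity
  unfold _root_.forLoop
  refine .cons (.asg_ok 0 (by simp) (fun _ => by simp) (hx := by omega) (.cons (.loop (I := I)
      (T := fun k => T k + (bc c c.lam + bc c 8)) (L := fun _ => c.lam) ?_ n
      (fun k hk => ⟨c.lam_ge, hb⟩) ?_ ?_ ?_ ?_ ?_)))
  · change e.sz + 2 + 1 ≤ 60; omega
  · exact h0
  · intro k hk s hI hf
    exact ⟨hf.leaf hok, by omega, hf.small x hx⟩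
  · intro k hk s hI
    have := hv k hk.le s hI
    simp only [Ex.evals, this.1, this.2]
    omega
  · intro k hk s hI hf
    refine .cons ((hbody k hk s hI hf).mono le_rfl fun s' hs' => ?_)
    refine .cons (.asg_ok ((k : ℤ) + 1) (by simp [hs'.1]) (fun _ => ?_)
      (.nil ?_ hs'.2) (by omega) (show (5 : ℕ) ≤ 60 by norm_num) ?_)
    · refine le_trans (bits_mono ?_) hn
      rw [abs_of_nonneg (by positivity), abs_of_nonneg (by positivity)]
      omega
    · linarith
    · change (decide (x < 40) && decide (bits 1 ≤ 8)) = true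
      simp [hx, bits]
  · intro s hI
    have := hv n le_rfl s hI
    refine ⟨?_, .nil ?_ (hQ s hI)⟩
    · simp [this.1, this.2]
    · rw [sum_add_distrib]
      simp only [sum_const, card_range, nsmul_eq_mul]
      push_cast
      have : (n : ℝ) * bc c 8 ≤ n * bc c c.lam := by gcongr
      linarith

/-- `x := y · 2 ^ z` -/
lemma Does.shl {x y z n : ℕ} (v : ℤ) (k : ℕ) (hv : s.v y = v) (hk : s.v z = k)
    (h1 : bits v ≤ n) (h3 : k ≤ n) (hn : 2 * n ≤ c.bet) (h : Q (s.set x (v * 2 ^ k)))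
    (hx : 40 ≤ x := by norm_num) (hx' : x < 60 := by norm_num) (hy : y < 60 := by norm_num)
    (hz : z < 60 := by norm_num) :
    Does c (.instr (.shl x y z)) s (c.u n) Q := fun σ hσ => by
  obtain rfl : (s.v z).toNat = k := by rw [hk, Int.toNat_natCast]
  have h2 : bits (s.v z) ≤ n := by rw [hk]; exact bits_natCast h3
  subst hv
  have hb : bits (s.v y * 2 ^ (s.v z).toNat) ≤ c.bet := by
    have h4 : bits (s.v y * 2 ^ (s.v z).toNat) ≤ bits (s.v y) + (s.v z).toNat := by
      rw [bits_le_iff, abs_mul, pow_add, abs_pow, abs_two]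
      exact mul_lt_mul_of_pos_right (abs_lt_two_pow_bits _) (by positivity)
    omega
  have r : Describes c ((Instr.shl x y z).run σ) (s.set x (s.v y * 2 ^ (s.v z).toNat)) := by
    change Describes c (σ.setVar x (σ.var y * 2 ^ (σ.var z).toNat)) _
    rw [hσ.var y hy, hσ.var z hz]
    exact hσ.setVar hx' hb (by omega)
  refine ⟨_, _, Step.instr hσ r ?_, r, h⟩
  simp only [Instr.time, hσ.var y hy, hσ.var z hz]
  have e1 : (bits (s.v y) : ℝ) ≤ n := mod_cast h1
  have e2 : (bits (s.v z) : ℝ) ≤ n := mod_cast h2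
  have e3 : ((s.v z).toNat : ℝ) ≤ n := mod_cast h3
  have := c.three_mul_le_u n
  linarith

end Rules

/-! ### Division with remainder by Newton iteration -/

/-- One step of Newton's iteration for the inverse of `y'`, which roughly doubles the precision `u`
of an approximation `z` to the inverse of the leading `u + 2` bits of `y'`. -/
lemma newton_step {u u' : ℕ} (h : u ≤ u') (h2 : u' ≤ 2 * u) {z y' : ℤ}
    (hy1 : 2 ^ (u' + 1) ≤ y') (hy2 : y' < 2 ^ (u' + 2)) (hz : 0 ≤ z)
    (hz' : z ≤ 2 ^ (u + 3))
    (hE : 0 ≤ 2 ^ (2 * u + 4) - z * (y' / 2 ^ (u' - u)))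
    (hE' : 2 ^ (2 * u + 4) - z * (y' / 2 ^ (u' - u)) ≤ 2 ^ (u + 3)) {z1 e z2 : ℤ}
    (h1 : z1 = z * 2 ^ (u' - u)) (he : e = 2 ^ (2 * u' + 4) - z1 * y')
    (hz2 : z2 = z1 + z1 * e / 2 ^ (2 * u' + 4)) :
    0 ≤ z2 ∧ z2 ≤ 2 ^ (u' + 3) ∧ 0 ≤ 2 ^ (2 * u' + 4) - z2 * y' ∧
      2 ^ (2 * u' + 4) - z2 * y' ≤ 2 ^ (u' + 3) := by
  obtain ⟨δ, rfl⟩ := Nat.exists_eq_add_of_le h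
  rw [Nat.add_sub_cancel_left] at *
  set d : ℤ := 2 ^ δ with hd
  have hd0 : 0 < d := by positivity
  set y := y' / d with hy
  have hr := Int.emod_add_mul_ediv y' d
  have hr0 := Int.emod_nonneg y' hd0.ne'
  have hr1 := Int.emod_lt_of_pos y' hd0
  set r := y' % d
  set A : ℤ := 2 ^ (u + 3) with hA
  have hA0 : 0 < A := by positivity
  have hB : (2 : ℤ) ^ (2 * u + 4) * 4 = A ^ 2 := by rw [hA]; ring
  have hX : (2 : ℤ) ^ (2 * (u + δ) + 4) * 4 = d ^ 2 * A ^ 2 := by rw [hA, hd]; ring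
  set B : ℤ := 2 ^ (2 * u + 4)
  set X : ℤ := 2 ^ (2 * (u + δ) + 4) with hXX
  have hX0 : 0 < X := by positivity
  have hXB : X = d ^ 2 * B := by linarith [show X * 4 = d ^ 2 * B * 4 by rw [hX, mul_assoc, hB]]
  -- the two contributions to the error have opposite signs
  have he1 : e = d ^ 2 * (B - z * y) - z * (d * r) := by
    rw [he, h1, hXB, ← hr]; simp only [← hy]; ring
  have hub : e ≤ d ^ 2 * A := by
    have : 0 ≤ z * (d * r) := by positivity
    have : d ^ 2 * (B - z * y) ≤ d ^ 2 * A := mul_le_mul_of_nonneg_left hE' (by positivity)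
    linarith
  have hlb : -(d ^ 2 * A) ≤ e := by
    have h5 : z * (d * r) ≤ A * (d * d) := by
      refine mul_le_mul hz' ?_ (by positivity) hA0.le
      exact mul_le_mul_of_nonneg_left hr1.le hd0.le
    have : 0 ≤ d ^ 2 * (B - z * y) := by positivity
    nlinarith
  have hsq : e ^ 2 ≤ X * (4 * d ^ 2) := by
    have : e ^ 2 ≤ (d ^ 2 * A) ^ 2 := sq_le_sq' hlb hub
    calc e ^ 2 ≤ (d ^ 2 * A) ^ 2 := this
      _ = (X * 4) * d ^ 2 := by rw [hX]; ring
      _ = _ := by ring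
  have hd4 : 4 * d ^ 2 ≤ 2 ^ (u + δ + 2) := by
    have : 4 * d ^ 2 = 2 ^ (2 * δ + 2) := by rw [hd]; ring
    rw [this]
    exact pow_le_pow_right₀ (by norm_num) (by omega)
  have hq := Int.emod_add_mul_ediv (z1 * e) X
  have hq0 := Int.emod_nonneg (z1 * e) hX0.ne'
  have hq1 := Int.emod_lt_of_pos (z1 * e) hX0
  set q := z1 * e / X
  have hy0 : 0 < y' := lt_of_lt_of_le (by positivity) hy1
  have hid : X * (X - z2 * y') = e ^ 2 + y' * (z1 * e % X) := by
    have : z1 * y' = X - e := by linarith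
    have h6 : z1 * e % X = z1 * e - X * q := by linarith
    rw [hz2, h6]
    linear_combination (-e - X) * this
  have hnn : 0 ≤ X - z2 * y' := by
    have : 0 ≤ X * (X - z2 * y') := by rw [hid]; positivity
    exact nonneg_of_mul_nonneg_right this hX0
  have hle : X - z2 * y' ≤ 2 ^ (u + δ + 3) := by
    have : X * (X - z2 * y') ≤ X * 2 ^ (u + δ + 3) := by
      rw [hid]
      have h7 : y' * (z1 * e % X) ≤ 2 ^ (u + δ + 2) * X :=
        mul_le_mul hy2.le hq1.le hq0 (by positivity)
      have h8 : X * (4 * d ^ 2) ≤ X * 2 ^ (u + δ + 2) := mul_le_mul_of_nonneg_left hd4 hX0.le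
      have h9 : (2 : ℤ) ^ (u + δ + 3) = 2 * 2 ^ (u + δ + 2) := by ring
      rw [h9]; linarith
    exact le_of_mul_le_mul_left this hX0
  have hX2 : X = 2 ^ (u + δ + 3) * 2 ^ (u + δ + 1) := by rw [hXX, ← pow_add]; congr 1; ring
  have hz0 : 0 ≤ z2 := by
    by_contra hneg
    have : z2 * y' ≤ (-1) * y' := mul_le_mul_of_nonneg_right (by omega) hy0.le
    have h3 : (2 : ℤ) ^ (u + δ + 3) ≤ X := by
      rw [hX2]; exact le_mul_of_one_le_right (by positivity) (one_le_pow₀ (by norm_num))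
    linarith
  refine ⟨hz0, ?_, hnn, hle⟩
  by_contra hbig
  push Not at hbig
  have : 2 ^ (u + δ + 3) * 2 ^ (u + δ + 1) < z2 * y' :=
    mul_lt_mul hbig hy1 (by positivity) hz0
  rw [← hX2] at this
  linarith

/-- The remainder computed with an approximate inverse is off by at most one modulus. -/
lemma approx_rem {n l : ℕ} (hln : l ≤ n) {a m z : ℤ} (ha : |a| < 2 ^ n)
    (hm : 2 ^ (l - 1) ≤ m)
    (hE : 0 ≤ 2 ^ (2 * n + 4) - z * (m * 2 ^ (n + 2 - l)))
    (hE' : 2 ^ (2 * n + 4) - z * (m * 2 ^ (n + 2 - l)) ≤ 2 ^ (n + 3)) :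
    -m < a - m * (a * z / 2 ^ (n + 2 + l)) ∧ a - m * (a * z / 2 ^ (n + 2 + l)) < 2 * m := by
  set W : ℤ := 2 ^ (n + 2 + l) with hW
  have hW0 : 0 < W := by positivity
  set K : ℤ := 2 ^ (n + 2 - l) with hK
  have hK0 : 0 < K := by positivity
  have h1 : (2 : ℤ) ^ (2 * n + 4) = K * W := by
    rw [hK, hW, ← pow_add]; congr 1; omega
  have h2 : (2 : ℤ) ^ (n + 3) = K * 2 ^ (l + 1) := by rw [hK, ← pow_add]; congr 1; omega
  have h3 : 0 ≤ W - z * m := by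
    refine nonneg_of_mul_nonneg_right (a := K) ?_ hK0
    rw [h1] at hE; linarith
  have h4 : W - z * m ≤ 2 ^ (l + 1) := by
    refine le_of_mul_le_mul_left (a := K) ?_ hK0
    rw [h1, h2] at hE'; linarith
  have hq := Int.emod_add_mul_ediv (a * z) W
  have hq0 := Int.emod_nonneg (a * z) hW0.ne'
  have hq1 := Int.emod_lt_of_pos (a * z) hW0
  set q := a * z / W
  have hm0 : 0 < m := lt_of_lt_of_le (by positivity) hm
  have hmW : 2 ^ n * 2 ^ (l + 1) ≤ m * W := by
    have : (2 : ℤ) ^ n * 2 ^ (l + 1) ≤ 2 ^ (l - 1) * W := by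
      rw [hW, ← pow_add, ← pow_add]; exact pow_le_pow_right₀ (by norm_num) (by omega)
    exact this.trans (mul_le_mul_of_nonneg_right hm hW0.le)
  have hab : |a * (W - z * m)| < m * W := by
    rw [abs_mul, abs_of_nonneg h3]
    refine lt_of_lt_of_le ?_ hmW
    exact (mul_le_mul_of_nonneg_left h4 (abs_nonneg a)).trans_lt
      (mul_lt_mul_of_pos_right ha (by positivity))
  have hid : W * (a - m * q) = a * (W - z * m) + m * (a * z % W) := by
    have : a * z % W = a * z - W * q := by linarith
    rw [this]; ring
  have h5 := abs_lt.1 hab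
  have h6 : 0 ≤ m * (a * z % W) := by positivity
  have h7 : m * (a * z % W) ≤ m * W := mul_le_mul_of_nonneg_left hq1.le hm0.le
  constructor
  · refine lt_of_mul_lt_mul_left (a := W) ?_ hW0.le
    rw [hid]; linarith
  · refine lt_of_mul_lt_mul_left (a := W) ?_ hW0.le
    rw [hid]; linarith

/-- The precisions used in the computation of an inverse to the precision `n`: each is half of the
preceding one, rounded up. -/
def prec : ℕ → ℕ → ℕ
  | n, 0 => n
  | n, j + 1 => prec ((n + 1) / 2) j

lemma prec_succ (n j : ℕ) : prec n (j + 1) = (prec n j + 1) / 2 := by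
  induction j generalizing n with
  | zero => rfl
  | succ j ih => rw [prec, ih, prec]

lemma prec_succ_le (n j : ℕ) (h : 1 ≤ prec n j) :
    prec n (j + 1) ≤ prec n j ∧ 1 ≤ prec n (j + 1) ∧ prec n j ≤ 2 * prec n (j + 1) := by
  rw [prec_succ]; omega

lemma prec_pos {n : ℕ} (h : 1 ≤ n) : ∀ j, 1 ≤ prec n j
  | 0 => h
  | j + 1 => (prec_succ_le n j (prec_pos h j)).2.1

lemma prec_le {n : ℕ} (h : 1 ≤ n) : ∀ j, prec n j ≤ n
  | 0 => le_rfl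
  | j + 1 => (prec_succ_le n j (prec_pos h j)).1.trans (prec_le h j)

lemma prec_bound (n j : ℕ) (h : 1 ≤ n) : prec n j * 2 ^ j + 1 ≤ n + 2 ^ j := by
  induction j generalizing n with
  | zero => simp [prec]
  | succ j ih =>
    have := ih ((n + 1) / 2) (by omega)
    rw [prec, pow_succ, ← mul_assoc]
    omega

/-- The number of halvings until the precision `1` is reached. -/
lemma exists_prec (n : ℕ) (h : 1 ≤ n) : ∃ J, prec n J = 1 ∧ (∀ j < J, 1 < prec n j) ∧ J + 1 ≤ n ∧
    ∑ j ∈ range (J + 1), (prec n j + j) ≤ 9 * n := by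
  induction n using Nat.strong_induction_on with
  | _ n ih =>
    rcases Nat.lt_or_ge n 2 with h2 | h2
    · obtain rfl : n = 1 := by omega
      exact ⟨0, rfl, by simp, by simp, by simp [prec]⟩
    · obtain ⟨J, h3, h4, h5, h6⟩ := ih ((n + 1) / 2) (by omega) (by omega)
      refine ⟨J + 1, h3, ?_, by omega, ?_⟩
      · rintro (_ | j) hj
        · exact h2
        · exact h4 j (by omega)
      · rw [sum_range_succ']
        simp only [prec]
        have : ∑ k ∈ range (J + 1), (prec ((n + 1) / 2) k + (k + 1)) =
          ∑ k ∈ range (J + 1), (prec ((n + 1) / 2) k + k) + (J + 1) := by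
          simp only [← add_assoc, sum_add_distrib]; simp [add_assoc]
        rw [this]
        omega

lemma bc_le_div (c : Ctx) {L L' : ℕ} (h : L ≤ L') :
    bc c L ≤ ((64 * (L + 1) + 1 : ℕ) : ℝ) / (64 * (L' + 1) + 1 : ℕ) * bc c L' := by
  have := c.u_le_div (show 64 * (L + 1) ≤ 64 * (L' + 1) by omega)
  unfold bc
  push_cast at this ⊢
  linarith

lemma sum_bc_le (c : Ctx) {n J : ℕ} (h : 1 ≤ n) (hJ : J + 1 ≤ n)
    (hsum : ∑ j ∈ range (J + 1), (prec n j + j) ≤ 9 * n) :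
    ∑ j ∈ range (J + 1), bc c (20 * (prec n j + j + 2)) ≤ 4 * bc c (80 * n) := by
  have h1 : ∀ j ∈ range (J + 1), bc c (20 * (prec n j + j + 2)) ≤
      ((64 * (20 * (prec n j + j + 2) + 1) + 1 : ℕ) : ℝ) / (64 * (80 * n + 1) + 1 : ℕ)
        * bc c (80 * n) := by
    intro j hj
    have := prec_le h j
    have := mem_range.1 hj
    exact bc_le_div c (by omega)
  refine (sum_le_sum h1).trans ?_
  rw [← sum_mul, ← sum_div]
  refine mul_le_mul_of_nonneg_right ?_ (bc_pos _ _).le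
  rw [div_le_iff₀ (by positivity), ← Nat.cast_sum]
  have : ∑ j ∈ range (J + 1), (64 * (20 * (prec n j + j + 2) + 1) + 1) ≤
      4 * (64 * (80 * n + 1) + 1) := by
    calc _ = 1280 * ∑ j ∈ range (J + 1), (prec n j + j) + 2625 * (J + 1) := by
          rw [mul_sum]
          have : ∀ j, 64 * (20 * (prec n j + j + 2) + 1) + 1 = 1280 * (prec n j + j) + 2625 :=
            fun j => by ring
          simp only [this, sum_add_distrib]; simp; ring
      _ ≤ _ := by omega
  exact_mod_cast this

/-- `40 mod 41 → 42`. The variables `43` and `44` hold the binary lengths `l` of the modulus and `n`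
of the operands together, `45` the leading `u + 2` bits of the modulus, `46` the height of the stack
of truncated moduli, `47` the precision `u`, and `50` the approximate inverse. -/
def modProg : Program :=
  blk [asg 43 (.len (.var 41)), asg 44 (.len (.var 40) + .var 43),
    asg 45 (.var 44 + 2 - .var 43), .instr (.shl 45 41 45),
    asg 46 0, asg 47 (.var 44),
    loop (.var 47 - 1) (blk [put 3 (.var 46) (.var 45), asg 48 (.shr (.var 47 + 1) 1),
      asg 45 (.shr (.var 45) (.var 47 - .var 48)), asg 47 (.var 48), asg 46 (.var 46 + 1)]),
    asg 50 (21 - 2 * .var 45),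
    loop (.var 46) (blk [asg 46 (.var 46 - 1), asg 45 (.get 3 (.var 46)), put 3 (.var 46) 0,
      asg 48 (.len (.var 45) - 2), asg 49 (.var 48 - .var 47), .instr (.shl 50 50 49),
      asg 52 (2 * .var 48 + 4), asg 53 1, .instr (.shl 53 53 52),
      asg 51 (.var 53 - .var 50 * .var 45),
      asg 50 (.var 50 + .shr (.var 50 * .var 51) (.var 52)), asg 47 (.var 48)]),
    asg 42 (.var 40 - .var 41 * .shr (.var 40 * .var 50) (.var 44 + 2 + .var 43)),
    branch (0 - .var 42) (asg 42 (.var 42 + .var 41)) (blk []),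
    branch (.var 42 - .var 41 + 1) (asg 42 (.var 42 - .var 41)) (blk [])]

/-- The time for the reduction of a number of at most `L` bits modulo another one. -/
noncomputable def modCost (c : Ctx) (L : ℕ) : ℝ := 400 * bc c (160 * L)

section
variable {c : Ctx} {s : St} {a m : ℤ} {n l : ℕ}

/-- The leading `u + 2` bits of a modulus `m` with `l` bits. -/
def trunc (m : ℤ) (n l u : ℕ) : ℤ := m * 2 ^ (n + 2 - l) / 2 ^ (n - u)

/-- The state of the division with the precision `prec n j`: the truncated moduli of the precisions
`prec n 0`, …, `prec n (j - 1)` are on the stack. -/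
structure DivState (s : St) (a m : ℤ) (n l j : ℕ) (s' : St) : Prop where
  v40 : s'.v 40 = a
  v41 : s'.v 41 = m
  v43 : s'.v 43 = l
  v44 : s'.v 44 = n
  v46 : s'.v 46 = j
  v47 : s'.v 47 = prec n j
  frame : ∀ x < 40, s'.v x = s.v x
  arr : ∀ b i, s'.a b i = if b = 3 ∧ i < j then trunc m n l (prec n i) else s.a b i

/-- The state of the division after `j` truncations of the modulus. -/
structure DivDown (s : St) (a m : ℤ) (n l j : ℕ) (s' : St) : Prop extends
    DivState s a m n l j s' where
  v45 : s'.v 45 = trunc m n l (prec n j)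

/-- The state of the division when an approximate inverse to the precision `prec n j` is known. -/
structure DivUp (s : St) (a m : ℤ) (n l j : ℕ) (s' : St) : Prop extends
    DivState s a m n l j s' where
  z0 : 0 ≤ s'.v 50
  z1 : s'.v 50 ≤ 2 ^ (prec n j + 3)
  e0 : 0 ≤ 2 ^ (2 * prec n j + 4) - s'.v 50 * trunc m n l (prec n j)
  e1 : 2 ^ (2 * prec n j + 4) - s'.v 50 * trunc m n l (prec n j) ≤ 2 ^ (prec n j + 3)

/-- The truncated modulus of precision `u` has exactly `u + 2` bits. -/
lemma trunc_bounds {u : ℕ} (hl1 : 2 ^ (l - 1) ≤ m) (hl2 : m < 2 ^ l) (hl : 1 ≤ l) (hln : l ≤ n)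
    (hu : u ≤ n) : 2 ^ (u + 1) ≤ trunc m n l u ∧ trunc m n l u < 2 ^ (u + 2) := by
  unfold trunc
  rw [Int.le_ediv_iff_mul_le (by positivity), ← pow_add, Int.ediv_lt_iff_lt_mul (by positivity),
    ← pow_add, show u + 1 + (n - u) = l - 1 + (n + 2 - l) by omega,
    show u + 2 + (n - u) = l + (n + 2 - l) by omega, pow_add, pow_add]
  exact ⟨mul_le_mul_of_nonneg_right hl1 (by positivity),
    mul_lt_mul_of_pos_right hl2 (by positivity)⟩

lemma trunc_trunc {u u' : ℕ} (h : u ≤ u') (h' : u' ≤ n) :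
    trunc m n l u' / 2 ^ (u' - u) = trunc m n l u := by
  unfold trunc
  rw [Int.ediv_ediv_of_nonneg (by positivity), ← pow_add]
  congr 2; omega

lemma divDown_step (hl1 : 2 ^ (l - 1) ≤ m) (hl2 : m < 2 ^ l) (hl : 1 ≤ l) (hln : l ≤ n)
    (hn : 20000 * n ≤ c.bet) {j J : ℕ} (hJ : J + 1 ≤ n) (hj : j < J) (hp : 1 < prec n j)
    {s' : St} (h : DivDown s a m n l j s') :
    Does c (blk [put 3 (.var 46) (.var 45), asg 48 (.shr (.var 47 + 1) 1),
      asg 45 (.shr (.var 45) (.var 47 - .var 48)), asg 47 (.var 48), asg 46 (.var 46 + 1)])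
      s' (6 * bc c (20 * (prec n j + j + 2))) (DivDown s a m n l (j + 1)) := by
  obtain ⟨⟨h40, h41, h43, h44, h46, h47, hfr, harr⟩, h45⟩ := h
  have hpn := prec_le (show 1 ≤ n by omega) j
  have hb := prec_bound n j (by omega)
  obtain ⟨hs1, hs2, hs3⟩ := prec_succ_le n j (by omega)
  obtain ⟨t1, t2⟩ := trunc_bounds hl1 hl2 hl hln hpn
  have tt := trunc_trunc (m := m) (l := l) hs1 hpn
  have b45 := bits_le_of_lt (le_trans (by positivity) t1) t2
  set y := trunc m n l (prec n j) with hy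
  set U := prec n j with hU
  set u := prec n (j + 1) with hu
  set L := 20 * (U + j + 2) with hL
  have hL8 : 8 ≤ L := by omega
  have hLb : 64 * (L + 1) ≤ c.bet := by omega
  have b45' : bits y ≤ L := by omega
  have b46 : bits (j : ℤ) ≤ L := bits_natCast (by omega)
  have b47 : bits (U : ℤ) ≤ L := bits_natCast (by omega)
  have b48 : bits (u : ℤ) ≤ L := bits_natCast (by omega)
  have hbc8 := bc_mono c hL8
  have e48 : ((U : ℤ) + 1) / 2 = u := by rw [hu, prec_succ]; push_cast; rfl
  refine .cons (.put j y hL8 hLb (fun _ => by simp [h46, b46]) (fun _ => by simp [h45, b45'])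
    (by simp [h46]) h45 (fun _ => ⟨by norm_num, ?_, b45.trans (le_trans ?_ (c.cap_stack j))⟩)
    (.cons (.asg u hL8 hLb (fun _ => by simp [h47, b47]) (by simp [h47, e48])
    (.cons (.asg (y / 2 ^ (U - u)) hL8 hLb (fun _ => by simp [h45, h47, b45', b47, b48])
      (by simp [h45, h47])
    (.cons (.asg u hL8 hLb (fun _ => by simp [b48]) (by simp)
    (.cons (.asg (j + 1) hL8 hLb (fun _ => by simp [h46, b46]) (by simp [h46])
    (.nil (by linarith) ⟨⟨by simp [h40], by simp [h41], by simp [h43], by simp [h44], by simp,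
      by simp [hu], fun x hx => by simp [hx, hfr x hx], fun b i => ?_⟩, by simp [tt]; rfl⟩))))))))))
  · have : 2 * 2 ^ j ≤ U * 2 ^ j := Nat.mul_le_mul_right _ hp
    exact (Nat.pow_lt_pow_iff_right (by norm_num)).1
      ((show 2 ^ j ≤ c.bet by omega).trans_lt c.len_stack)
  · have h5 : U - 1 ≤ c.bet / 2 ^ j := by
      rw [Nat.le_div_iff_mul_le (by positivity), Nat.sub_mul]; omega
    omega
  · simp only [St.set_a, St.put_a, harr]
    rcases lt_trichotomy i j with hi | rfl | hi
    · simp [hi, hi.ne, show i < j + 1 by omega]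
    · by_cases hb3 : b = 3 <;> simp [hb3, hy, hU]
    · simp [hi.ne', show ¬ i < j by omega, show ¬ i < j + 1 by omega]

lemma divUp_step (hl1 : 2 ^ (l - 1) ≤ m) (hl2 : m < 2 ^ l) (hl : 1 ≤ l) (hln : l ≤ n)
    (hn : 20000 * n ≤ c.bet) {j J : ℕ} (hJ : J + 1 ≤ n) (hj : j < J) (hp : 1 < prec n j)
    (hY : ∀ i, s.a 3 i = 0) {s' : St} (h : DivUp s a m n l (j + 1) s') :
    Does c (blk [asg 46 (.var 46 - 1), asg 45 (.get 3 (.var 46)), put 3 (.var 46) 0,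
      asg 48 (.len (.var 45) - 2), asg 49 (.var 48 - .var 47), .instr (.shl 50 50 49),
      asg 52 (2 * .var 48 + 4), asg 53 1, .instr (.shl 53 53 52),
      asg 51 (.var 53 - .var 50 * .var 45),
      asg 50 (.var 50 + .shr (.var 50 * .var 51) (.var 52)), asg 47 (.var 48)])
      s' (13 * bc c (20 * (prec n j + j + 2))) (DivUp s a m n l j) := by
  obtain ⟨⟨h40, h41, h43, h44, h46, h47, hfr, harr⟩, hz0, hz1, he0, he1⟩ := h
  have hpn := prec_le (show 1 ≤ n by omega) j
  obtain ⟨hs1, hs2, hs3⟩ := prec_succ_le n j (by omega)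
  obtain ⟨t1, t2⟩ := trunc_bounds hl1 hl2 hl hln hpn
  rw [← trunc_trunc hs1 hpn] at he0 he1
  set y := trunc m n l (prec n j) with hy
  set U := prec n j with hU
  set u := prec n (j + 1) with hu
  set z := s'.v 50 with hz
  obtain ⟨r1, r2, r3, r4⟩ := newton_step hs1 hs3 t1 t2 hz0 hz1 he0 he1 rfl rfl rfl
  set z1 := z * 2 ^ (U - u) with hz1d
  set e := 2 ^ (2 * U + 4) - z1 * y with hed
  set z2 := z1 + z1 * e / 2 ^ (2 * U + 4) with hz2d
  set L := 20 * (U + j + 2) with hL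
  have hL8 : 8 ≤ L := by omega
  have hb : 64 * (L + 1) ≤ c.bet := by omega
  have by' : bits y = U + 2 := bits_eq t1 t2
  have bj : bits (j : ℤ) ≤ L := bits_natCast (by omega)
  have bj1 : bits ((j : ℤ) + 1) ≤ L := bits_natCast (n := j + 1) (by omega)
  have bU : bits (U : ℤ) ≤ L := bits_natCast (by omega)
  have bu : bits (u : ℤ) ≤ L := bits_natCast (by omega)
  have b52 : bits (2 * (U : ℤ) + 4) ≤ L := by
    exact_mod_cast bits_natCast (n := 2 * U + 4) (by omega)
  have hpw : ∀ {i k}, i < k → (2 : ℤ) ^ i < 2 ^ k := fun h => pow_lt_pow_right₀ (by norm_num) h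
  have bz : bits z ≤ u + 4 := bits_le_of_lt hz0 (hz1.trans_lt (hpw (by omega)))
  have bz1 : bits z1 ≤ U + 4 := by
    refine bits_le_of_lt (by positivity) (lt_of_le_of_lt
      (mul_le_mul_of_nonneg_right hz1 (by positivity)) ?_)
    rw [← pow_add]; exact hpw (by omega)
  have bX : bits ((2 : ℤ) ^ (2 * U + 4)) ≤ 2 * U + 5 := bits_le_of_lt (by positivity) (hpw (by omega))
  have be : bits e ≤ L := by
    have h1 := bits_mul_le z1 y
    exact (bits_sub_le _ _).trans (by omega)
  have bz1' : bits z1 ≤ L := by omega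
  have bX' : bits ((2 : ℤ) ^ (2 * U + 4)) ≤ L := by omega
  have hbc8 := bc_mono c hL8
  have huL := u_le_bc c L
  have hget : s'.a 3 j = y := by rw [harr, if_pos ⟨rfl, by omega⟩]
  refine .cons (.asg j hL8 hb (fun _ => by simp [h46, bj1]) (by simp [h46])
    (.cons (.asg y hL8 hb (fun _ => by simp [bj, hget, by']; omega) (by simp [hget])
    (.cons (.put j 0 hL8 hb (fun _ => by simp [bj]) (fun _ => by simp) (by simp) (by simp)
      (fun hne => (hne rfl).elim)
    (.cons (.asg U hL8 hb (fun _ => by simp [by']; omega) (by simp [by'])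
    (.cons (.asg (U - u : ℕ) hL8 hb (fun _ => by simp [h47, bU, bu]) (by simp [h47]; omega)
    (.cons (.shl (n := L) z (U - u) (by simp [hz]) (by simp) (by omega) (by omega) (by omega)
    (.cons (.asg (2 * U + 4 : ℕ) hL8 hb (fun _ => by simp [bU]) (by simp)
    (.cons (.asg 1 hL8 hb (fun _ => by simp) (by simp)
    (.cons (.shl (n := L) 1 (2 * U + 4) (by simp) (by simp) (bits_one_le.trans hL8) (by omega) (by omega)
    (.cons (.asg e hL8 hb (fun _ => by simp [bX', ← hz1d, bz1']; omega) (by simp [← hz1d, hed])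
    (.cons (.asg z2 hL8 hb (fun _ => by simp [← hz1d, bz1', be, b52]) ?_
    (.cons (.asg U hL8 hb (fun _ => by simp [bU]) (by simp)
    (.nil (by linarith) ⟨⟨by simp [h40], by simp [h41], by simp [h43], by simp [h44], by simp,
      by simp [hU], fun x hx => by simp [hx, hfr x hx], fun b i => ?_⟩, by simpa using r1, by simpa using r2,
      by simpa using r3, by simpa using r4⟩))))))))))))))))))))))))
  · simp only [Ex.evals, St.set_v]
    norm_num
    rw [← hz1d, hz2d]; norm_cast
  · simp only [St.set_a, St.put_a, harr]
    rcases lt_trichotomy i j with hi | rfl | hi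
    · simp [hi, hi.ne, show i < j + 1 by omega]
    · by_cases hb3 : b = 3 <;> simp [hb3, hY]
    · simp [hi.ne', show ¬ i < j by omega, show ¬ i < j + 1 by omega]

lemma does_mod {L : ℕ} (hL : 8 ≤ L) (hb : 50000 * L ≤ c.bet) (ha : bits (s.v 40) ≤ L)
    (hm : bits (s.v 41) ≤ L) (hm0 : 0 < s.v 41) (hY : ∀ i, s.a 3 i = 0) {Q : St → Prop}
    (hQ : ∀ s', s'.v 42 = s.v 40 % s.v 41 → s'.v 41 = s.v 41 → s'.a = s.a →
      (∀ x < 40, s'.v x = s.v x) → Q s') :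
    Does c modProg s (modCost c L) Q := by
  obtain ⟨m, hmd⟩ : ∃ m, m = s.v 41 := ⟨_, rfl⟩
  obtain ⟨a, had⟩ : ∃ a, a = s.v 40 := ⟨_, rfl⟩
  rw [← hmd] at hm hm0
  rw [← had] at ha
  obtain ⟨l, hld⟩ : ∃ l, l = bits m := ⟨_, rfl⟩
  obtain ⟨n, hnd⟩ : ∃ n, n = bits a + l := ⟨_, rfl⟩
  have hl : 1 ≤ l := by
    by_contra hc
    have := bits_le_iff.1 (show bits m ≤ 0 by omega)
    rw [abs_of_pos hm0] at this
    simp at this; omega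
  have hl2 : m < 2 ^ l := by
    have := abs_lt_two_pow_bits m
    rwa [abs_of_pos hm0, ← hld] at this
  have hl1 : 2 ^ (l - 1) ≤ m := by
    by_contra hc
    have := bits_le_of_lt hm0.le (not_le.1 hc)
    omega
  have hln : l ≤ n := by omega
  have hn1 : 1 ≤ n := by omega
  have hn : 20000 * n ≤ c.bet := by omega
  obtain ⟨J, hJ1, hJ2, hJ3, hJ4⟩ := exists_prec n hn1
  have hsum := sum_bc_le c hn1 hJ3 hJ4
  have hrev : ∑ j ∈ range (J + 1), bc c (20 * (prec n (J - j) + (J - j) + 2)) =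
      ∑ j ∈ range (J + 1), bc c (20 * (prec n j + j + 2)) :=
    sum_range_reflect (fun j => bc c (20 * (prec n j + j + 2))) (J + 1)
  have hrev' : ∑ k ∈ range J, bc c (20 * (prec n (J - (k + 1)) + (J - (k + 1)) + 2)) =
      ∑ j ∈ range J, bc c (20 * (prec n j + j + 2)) := by
    rw [← sum_range_reflect]
    refine sum_congr rfl fun j hj => ?_
    have := mem_range.1 hj
    rw [show J - (J - 1 - j + 1) = j by omega]
  have hsum' : ∑ j ∈ range J, bc c (20 * (prec n j + j + 2)) ≤ 4 * bc c (80 * n) := by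
    rw [sum_range_succ] at hsum
    linarith [bc_pos c (20 * (prec n J + J + 2))]
  have hcost := bc_mono c (show 80 * n ≤ 160 * L by omega)
  set K := 10 * L with hK
  have hK8 : 8 ≤ K := by omega
  have hKb : 64 * (K + 1) ≤ c.bet := by omega
  have hbcK := bc_mono c (show K ≤ 160 * L by omega)
  have hbc8 := bc_mono c hK8
  have hbc0 := bc_pos c K
  have huK := u_le_bc c K
  have bl : bits (l : ℤ) ≤ K := bits_natCast (by omega)
  have bn : bits (n : ℤ) ≤ K := bits_natCast (by omega)
  have en : (bits a : ℤ) + l = n := by rw [hnd]; push_cast; rfl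
  have hlen : ∀ j ≤ J, 8 ≤ 20 * (prec n j + j + 2) ∧
      64 * (20 * (prec n j + j + 2) + 1) ≤ c.bet := by
    intro j hj
    have := prec_le hn1 j
    omega
  unfold modProg modCost
  refine .cons (.asg l hK8 hKb (fun _ => by simp [← hmd]; omega) (by simp [← hmd, ← hld])
    (.cons (.asg n hK8 hKb (fun _ => by simp [← had, bl]; omega) (by simp [← had, en])
    (.cons (.asg (n + 2 - l : ℕ) hK8 hKb (fun _ => by simp [bl, bn]) (by simp; omega)
    (.cons (.shl (n := K) m (n + 2 - l) (by simp [hmd]) (by simp) (by omega) (by omega) (by omega)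
    (.cons (.asg 0 hK8 hKb (fun _ => by simp) (by simp)
    (.cons (.asg n hK8 hKb (fun _ => by simp [bn]) (by simp)
    (.cons (.loop (by decide) J (DivDown s a m n l) (fun j => 6 * bc c (20 * (prec n j + j + 2)))
      (fun j => 20 * (prec n j + j + 2)) hlen ?_ ?_ ?_ ?_ fun s' h => ?_)))))))))))))
  · exact ⟨⟨by simp [had], by simp [hmd], by simp, by simp, by simp, by simp [prec],
      fun x hx => by simp [hx], by simp⟩, by simp [trunc, prec]⟩
  · intro j hj s' h _
    simp only [Ex.leaf_sub, Ex.leaf_var, Ex.leaf_ofNat, h.v47]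
    exact ⟨⟨by norm_num, bits_natCast (by omega)⟩, by simp⟩
  · intro j hj s' h
    have := hJ2 j hj
    simp [h.v47]; omega
  · exact fun j hj s' h _ => divDown_step hl1 hl2 hl hln hn hJ3 hj (hJ2 j hj) h
  refine ⟨by simp [h.v47, hJ1], ?_⟩
  obtain ⟨t1, t2⟩ := trunc_bounds (u := 1) hl1 hl2 hl hln hn1
  have h45 := h.v45
  rw [hJ1] at h45
  set y := trunc m n l 1 with hy
  have b45 : bits y ≤ K := (bits_le_of_lt (le_trans (by positivity) t1) t2).trans (by omega)
  refine .cons (.asg (21 - 2 * y) hK8 hKb (fun _ => by simp [h45, b45]) (by simp [h45])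
    (.cons (.loop (by decide) J (fun k => DivUp s a m n l (J - k))
    (fun k => 13 * bc c (20 * (prec n (J - (k + 1)) + (J - (k + 1)) + 2)))
    (fun k => 20 * (prec n (J - k) + (J - k) + 2)) (fun k _ => hlen _ (by omega)) ?_ ?_ ?_ ?_
    fun s' h => ?_)))
  · -- the initial approximation `21 - 2 y` to `64 / y` is good for the possible values `4`, …, `7`
    norm_num at t1 t2
    have : y = 4 ∨ y = 5 ∨ y = 6 ∨ y = 7 := by omega
    rw [Nat.sub_zero]
    refine ⟨⟨by simp [h.v40], by simp [h.v41], by simp [h.v43], by simp [h.v44], by simp [h.v46],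
      by simp [h.v47], fun x hx => by simp [hx, h.frame x hx], fun b i => by simp [h.arr]⟩,
      ?_, ?_, ?_, ?_⟩ <;> rw [St.set_v, if_pos rfl] <;> try rw [hJ1]
    all_goals try rw [← hy]
    all_goals rcases this with h | h | h | h <;> rw [h] <;> norm_num
  · intro k hk s' h _
    simp only [Ex.leaf_var, h.v46]
    exact ⟨by norm_num, bits_natCast (by omega)⟩
  · intro k hk s' h
    simp [h.v46]; omega
  · intro k hk s' h _
    rw [show J - k = J - (k + 1) + 1 by omega] at h
    exact divUp_step hl1 hl2 hl hln hn hJ3 (by omega) (hJ2 _ (by omega)) hY h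
  rw [Nat.sub_self] at h
  refine ⟨by simp [h.v46], ?_⟩
  have hE := h.e0
  have hE' := h.e1
  have hz1 := h.z1
  simp only [trunc, prec, Nat.sub_self, pow_zero, Int.ediv_one] at hE hE' hz1
  have bz : bits (s'.v 50) ≤ K := (bits_le_of_lt h.z0 (hz1.trans_lt
    (pow_lt_pow_right₀ (by norm_num) (show n + 3 < n + 4 by omega)))).trans (by omega)
  obtain ⟨q1, q2⟩ := approx_rem hln ((abs_lt_two_pow_bits a).trans_le
    (pow_le_pow_right₀ (by norm_num) (by omega))) hl1 hE hE'
  have eS : ((n : ℤ) + 2 + l).toNat = n + 2 + l := by omega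
  set q := a * s'.v 50 / 2 ^ (n + 2 + l) with hq
  have hbr : ∀ z, -m < z → z < 2 * m → bits z ≤ K := by
    intro z h1 h2
    refine (bits_le_iff (n := l + 1)).2 ?_ |>.trans (by omega)
    rw [abs_lt, pow_succ]; constructor <;> linarith
  have br := hbr _ q1 q2
  have hmod : (a - m * q) % m = a % m := by simp [Int.sub_mul_emod_self_left]
  have harr : s'.a = s.a := by
    funext b i; rw [h.arr]; simp
  have bm : bits m ≤ K := by omega
  -- after the first correction the remainder lies in `[0, 2m)`
  have hrest : ∀ s1 : St, 0 ≤ s1.v 42 → s1.v 42 < 2 * m → s1.v 42 % m = a % m → s1.v 41 = m →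
      s1.a = s.a → (∀ x < 40, s1.v x = s.v x) → ∀ T, 4 * bc c K ≤ T → Does c
      (blk [branch (.var 42 - .var 41 + 1) (asg 42 (.var 42 - .var 41)) (blk [])]) s1 T Q := by
    intro s1 g0 g1 g2 g3 g4 g5 T hT
    have b42 := hbr _ (by linarith) g1
    refine .cons (T' := 2 * bc c K) (.branch hK8 hKb (fun _ => by simp [g3, bm, b42])
      (fun hc => ?_) (fun hc => ?_)) <;> simp [g3] at hc
    · refine .time_le (.asg (s1.v 42 - m) hK8 hKb (fun _ => by simp [g3, bm, b42]) (by simp [g3])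
        (.nil (by linarith) (hQ _ ?_ (by simp [g3, hmd]) (by simp [g4])
          fun x hx => by simp [hx, g5 x hx]))) (by linarith)
      rw [St.set_v, if_pos rfl, ← had, ← hmd, ← g2, ← Int.sub_emod_right,
        Int.emod_eq_of_lt (by linarith) (by linarith)]
    · refine .nil (by linarith) (.nil (by linarith) (hQ _ ?_ (by rw [g3, hmd]) g4 g5))
      rw [← had, ← hmd, ← g2, Int.emod_eq_of_lt g0 (by linarith)]
  refine .cons (.asg (a - m * q) hK8 hKb (fun _ => by simp [h.v40, h.v41, h.v43, h.v44, bz, bn, bl]; omega)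
    (by simp [h.v40, h.v41, h.v44, h.v43, eS, ← hq]) (.cons (T' := 2 * bc c K)
    (.branch hK8 hKb (fun _ => by simp [br]) (fun hc => ?_) (fun hc => ?_)))) <;> simp at hc
  · refine .time_le (.asg (a - m * q + m) hK8 hKb (fun _ => by simp [h.v41, br, bm])
      (by simp [h.v41]) (hrest _ (by simp; linarith) (by simp; linarith) (by simp [hmod])
        (by simp [h.v41]) (by simp [harr]) (fun x hx => by simp [hx, h.frame x hx]) _ ?_)) (by linarith)
    rw [← mul_sum, ← mul_sum, hrev', hrev]; linarith
  · refine .nil (by linarith) (hrest _ (by simp; linarith) (by simp; linarith) (by simp [hmod])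
      (by simp [h.v41]) (by simp [harr]) (fun x hx => by simp [hx, h.frame x hx]) _ ?_)
    rw [← mul_sum, ← mul_sum, hrev', hrev]; linarith

end

/-! ### Tables of sums of products -/

/-- The arrays `A`, with the first `n` entries from `base` on in the array `a` replaced. -/
def fill (A : ℕ → ℕ → ℤ) (a base n : ℕ) (w : ℕ → ℤ) : ℕ → ℕ → ℤ := fun a' j =>
  if a' = a ∧ base ≤ j ∧ j < base + n then w (j - base) else A a' j

lemma fill_zero (A : ℕ → ℕ → ℤ) (a base : ℕ) (w : ℕ → ℤ) : fill A a base 0 w = A := by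
  funext a' j
  simp only [fill]
  rw [if_neg (by omega)]

lemma fill_ne {A : ℕ → ℕ → ℤ} {a base n : ℕ} {w : ℕ → ℤ} {a' : ℕ} (h : a' ≠ a) (j : ℕ) :
    fill A a base n w a' j = A a' j := by simp [fill, h]

lemma fill_of_lt {A : ℕ → ℕ → ℤ} {a base n : ℕ} {w : ℕ → ℤ} {a' j : ℕ} (h : j < base) :
    fill A a base n w a' j = A a' j := by
  simp only [fill]
  rw [if_neg (by omega)]

lemma fill_of_le {A : ℕ → ℕ → ℤ} {a base n : ℕ} {w : ℕ → ℤ} {a' j : ℕ} (h : base + n ≤ j) :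
    fill A a base n w a' j = A a' j := by
  simp only [fill]
  rw [if_neg (by omega)]

lemma fill_eq {A : ℕ → ℕ → ℤ} {a base n : ℕ} {w : ℕ → ℤ} {j : ℕ} (h : j < n) :
    fill A a base n w a (base + j) = w j := by
  simp only [fill]
  rw [if_pos ⟨trivial, by omega, by omega⟩]
  simp

/-- Entries of a table with rows of length `n2`. -/
lemma fill_table {A : ℕ → ℕ → ℤ} {a base n1 n2 r k : ℕ} {w : ℕ → ℕ → ℤ} (hr : r < n1) (hk : k < n2) :
    fill A a base (n1 * n2) (fun t => w (t / n2) (t % n2)) a (base + r * n2 + k) = w r k := by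
  have h : r * n2 + k < n1 * n2 := by
    have := Nat.mul_le_mul_right n2 hr
    rw [Nat.succ_mul] at this
    omega
  rw [add_assoc, fill_eq h]
  have h0 : 0 < n2 := by omega
  rw [mul_comm r n2, Nat.mul_add_div h0, Nat.div_eq_of_lt hk, Nat.mul_add_mod, Nat.mod_eq_of_lt hk,
    add_zero]

lemma St.put_fill {s : St} {A : ℕ → ℕ → ℤ} {a base n : ℕ} {w : ℕ → ℤ}
    (h : s.a = fill A a base n w) : (s.put a (base + n) (w n)).a = fill A a base (n + 1) w := by
  funext a' j
  rw [St.put_a, h]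
  simp only [fill]
  by_cases h1 : a' = a ∧ j = base + n
  · obtain ⟨rfl, rfl⟩ := h1
    simp
  · rw [if_neg h1]
    by_cases h2 : a' = a ∧ base ≤ j ∧ j < base + n
    · rw [if_pos h2, if_pos (by omega)]
    · rw [if_neg h2, if_neg (by omega)]

/-- `s'` agrees with `s` on all variables but the scratch variables. -/
structure Same (s s' : St) : Prop where
  v : ∀ x, (hx : x < 36 := by norm_num) → s'.v x = s.v x

/-- `s'` arises from `s` by changes of scratch variables and of the given part of one array only. -/
structure Near (a base n : ℕ) (s s' : St) : Prop extends Same s s' where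
  arr : ∀ a' j, (h : ¬ (a' = a ∧ base ≤ j ∧ j < base + n) := by norm_num) → s'.a a' j = s.a a' j

lemma Near.of_fill {a base n m : ℕ} {s s' : St} {w : ℕ → ℤ} (hv : Same s s')
    (h : s'.a = fill s.a a base m w) (hm : m ≤ n) : Near a base n s s' :=
  ⟨hv, fun a' j hj => by rw [h]; simp only [fill]; rw [if_neg (by omega)]⟩

/-- Fills the table with `n1` rows of length `n2`, whose entries are computed by `P` in the
variable `42`, while the variables `36` and `37` hold the indices. -/
def tab (a : ℕ) (base n1 n2 : Ex) (P : Program) : Program :=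
  forLoop 36 n1 (forLoop 37 n2 (blk [P, put a (base + .var 36 * n2 + .var 37) (.var 42)]))

section
variable {c : Ctx} {s : St} {Q : St → Prop} {L : ℕ}

lemma does_tab {a : ℕ} {base n1 n2 : Ex} {P : Program} (B N1 N2 : ℕ) (w : ℕ → ℕ → ℤ) {T : ℝ}
    (hL : c.lam ≤ L) (hLb : 64 * (L + 1) ≤ c.bet)
    (hok : base.ok = true ∧ n1.ok = true ∧ n2.ok = true)
    (hsz : base.sz ≤ 15 ∧ n1.sz ≤ 57 ∧ n2.sz ≤ 15)
    (hbits : bits (N1 : ℤ) ≤ c.lam ∧ bits (N2 : ℤ) ≤ c.lam)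
    (hev : ∀ s', Near a B (N1 * N2) s s' →
      base.eval s' = B ∧ n1.eval s' = N1 ∧ n2.eval s' = N2)
    (hP : ∀ r < N1, ∀ k < N2, ∀ s', Near a B (N1 * N2) s s' → s'.v 36 = r → s'.v 37 = k →
      Does c P s' T fun t => t.v 42 = w r k ∧ t.a = s'.a ∧ ∀ x < 38, t.v x = s'.v x)
    (hw : ∀ r < N1, ∀ k < N2, bits (w r k) ≤ L ∧ (w r k ≠ 0 → a < 16 ∧ B + r * N2 + k < c.len a ∧
      bits (w r k) ≤ c.cap a (B + r * N2 + k)))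
    (hT : 0 ≤ T)
    (hQ : ∀ s', s'.a = fill s.a a B (N1 * N2) (fun t => w (t / N2) (t % N2)) →
      Same s s' → Q s') :
    Does c (tab a base n1 n2 P) s ((N1 + 1) * (N2 + 1) * (T + 9 * bc c L)) Q := by
  have h8 : bc c 8 ≤ bc c L := bc_mono c (c.lam_ge.trans hL)
  have hl := bc_mono c hL
  have hp := bc_pos c L
  set W : ℕ → ℤ := fun t => w (t / N2) (t % N2) with hW
  have e1 : ∀ k r, k < N2 → W (r * N2 + k) = w r k := by
    intro k r hk
    have h0 : 0 < N2 := by omega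
    simp only [hW]
    rw [mul_comm r N2, Nat.mul_add_div h0, Nat.div_eq_of_lt hk, Nat.mul_add_mod, Nat.mod_eq_of_lt hk,
      add_zero]
  have e2 : ∀ r < N1, ∀ k ≤ N2, r * N2 + k ≤ N1 * N2 := fun r hr k hk => by
    have := Nat.mul_le_mul_right N2 hr
    rw [Nat.succ_mul] at this
    omega
  refine .time_le (.forLoop (hok := hok.2.1) (hsz := hsz.2.1) N1 hbits.1
    (I := fun r s' => s'.v 36 = r ∧ Same s s' ∧ s'.a = fill s.a a B (r * N2) W)
    (T := fun _ => N2 * (T + 2 * bc c L) + (3 * N2 + 3) * bc c c.lam) ?_ ?_ ?_ ?_) ?_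
  · refine ⟨by simp, ⟨fun x hx => by simp [show x ≠ 36 by omega]⟩, by simp [fill_zero]⟩
  · intro r hr s' h
    exact ⟨h.1, (hev s' (Near.of_fill h.2.1 h.2.2 (Nat.mul_le_mul_right _ hr))).2.1⟩
  · intro r hr s' h _
    refine .time_le (.forLoop (hok := hok.2.2) (hsz := by omega) N2 hbits.2
      (I := fun k t => t.v 37 = k ∧ t.v 36 = r ∧ Same s t ∧
        t.a = fill s.a a B (r * N2 + k) W) (T := fun _ => T + 2 * bc c L) ?_ ?_ ?_ ?_)
      (by rw [sum_const, card_range, nsmul_eq_mul])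
    · refine ⟨by simp, by simp [h.1], ⟨fun x hx => by simp [show x ≠ 37 by omega, h.2.1.v x hx]⟩,
        by simp [h.2.2]⟩
    · intro k hk t ht
      exact ⟨ht.1, (hev t (Near.of_fill ht.2.2.1 ht.2.2.2 (e2 r hr k hk))).2.2⟩
    · intro k hk t ht _
      have hn := Near.of_fill ht.2.2.1 ht.2.2.2 (e2 r hr k hk.le)
      refine .cons ((hP r hr k hk t hn ht.2.1 ht.1).mono le_rfl fun u hu => ?_)
      have hnu : Near a B (N1 * N2) s u := by
        refine ⟨⟨fun x hx => ?_⟩, fun a' j hj => ?_⟩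
        · rw [hu.2.2 x (by omega), hn.v x hx]
        · rw [hu.2.1, hn.arr a' j hj]
      have hv := hev u hnu
      have h36 : u.v 36 = r := by rw [hu.2.2 36 (by norm_num), ht.2.1]
      have h37 : u.v 37 = k := by rw [hu.2.2 37 (by norm_num), ht.1]
      refine .cons (.put (L := L) (B + (r * N2 + k)) (w r k) (c.lam_ge.trans hL) hLb
        (fun hf => ?_) (fun _ => ?_) ?_ ?_ ?_ (.nil (by linarith) ?_)
        (show base.sz + (2 + n2.sz + 1) + 1 + 2 + 1 + 2 ≤ 60 by omega))
      · have b1 := (hf.leaf hok.1).mono hL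
        have b2 := (hf.leaf hok.2.2).mono hL
        simp only [Ex.leaf_add, Ex.leaf_mul, Ex.leaf_var]
        exact ⟨⟨b1, ⟨by norm_num, (hf.small 36 (by norm_num)).trans hL⟩, b2⟩, by norm_num,
          (hf.small 37 (by norm_num)).trans hL⟩
      · simp only [Ex.leaf_var, hu.1]
        exact ⟨by norm_num, (hw r hr k hk).1⟩
      · simp only [Ex.evals, hv.1, hv.2.2, h36, h37]
        push_cast; ring
      · simp [hu.1]
      · intro h0
        rw [← add_assoc]
        exact (hw r hr k hk).2 h0
      · refine ⟨by simp [h37], by simp, by simp [h36], ⟨fun x hx => ?_⟩, ?_⟩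
        · simp [show x ≠ 37 by omega, hnu.v x hx]
        · rw [St.set_a, ← e1 k r hk, St.put_fill (by rw [hu.2.1, ht.2.2.2])]
          congr 1
    · intro t ht
      refine ⟨ht.2.1, by simp, ⟨fun x hx => ?_⟩, ?_⟩
      · simp [show x ≠ 36 by omega, ht.2.2.1.v x hx]
      · rw [St.set_a, ht.2.2.2]; congr 1; ring
  · intro s' h
    exact hQ s' h.2.2 h.2.1
  · simp only [sum_const, card_range, nsmul_eq_mul]
    have := mul_le_mul_of_nonneg_left hl (show (0 : ℝ) ≤ 3 * N1 * N2 + 6 * N1 + 3 by positivity)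
    have : 0 ≤ ((N1 : ℝ) + N2 + 1) * T + (4 * N1 * N2 + 3 * N1 + 9 * N2 + 6) * bc c L := by positivity
    linarith

/-- The sum of the values of `e` for `38 = 0, …, n - 1`, in the variable `x`. -/
def dot (x : ℕ) (n e : Ex) : Program := blk [asg x 0, forLoop 38 n (asg x (.var x + e))]

lemma does_dot {x : ℕ} {n e : Ex} (N : ℕ) (f : ℕ → ℤ) (hx : 40 ≤ x) (hx' : x < 60)
    (hL : c.lam ≤ L) (hLb : 64 * (L + 1) ≤ c.bet) (hok : n.ok = true) (hsz : n.sz ≤ 57)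
    (hesz : e.sz ≤ 57) (hN : bits (N : ℤ) ≤ c.lam)
    (hev : ∀ s', (∀ y < 38, s'.v y = s.v y) → s'.a = s.a → n.eval s' = N ∧ ∀ k < N, s'.v 38 = k →
      e.eval s' = f k ∧ (Fit c s' → e.Leaf L s'))
    (hf : ∀ k ≤ N, bits (∑ j ∈ range k, f j) ≤ L)
    (hQ : ∀ s', s'.v x = ∑ j ∈ range N, f j → s'.a = s.a → (∀ y < 38, s'.v y = s.v y) → Q s') :
    Does c (dot x n e) s ((N + 1) * (6 * bc c L)) Q := by
  have h8 : bc c 8 ≤ bc c L := bc_mono c (c.lam_ge.trans hL)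
  have hl := bc_mono c hL
  have hp := bc_pos c L
  have hp' := bc_pos c c.lam
  have hn : (0 : ℝ) ≤ N * bc c L := by positivity
  have a3 : (3 * (N : ℝ) + 3) * bc c c.lam ≤ (3 * N + 3) * bc c L := by gcongr
  refine .cons (.asg_ok 0 (by simp) (fun _ => by simp) (hx := hx') (.cons (.mono (.forLoop (hok := hok) (hsz := hsz) N hN
    (I := fun k s' => s'.v 38 = k ∧ s'.v x = ∑ j ∈ range k, f j ∧ s'.a = s.a ∧
      ∀ y < 38, s'.v y = s.v y) (T := fun _ => bc c L) ?_ ?_ ?_ fun s' h => h) le_rfl ?_)))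
  · refine ⟨by simp, by simp [show x ≠ 38 by omega], by simp, fun y hy => ?_⟩
    simp [show y ≠ 38 by omega, show y ≠ x by omega]
  · intro k hk s' h
    exact ⟨h.1, (hev s' h.2.2.2 h.2.2.1).1⟩
  · intro k hk s' h _
    have he := (hev s' h.2.2.2 h.2.2.1).2 k hk h.1
    refine .asg (∑ j ∈ range (k + 1), f j) (c.lam_ge.trans hL) hLb
      (fun hf' => ?_) ?_ ?_ hx' (show 2 + e.sz + 1 ≤ 60 by omega) (by omega)
    · rw [Ex.leaf_add, Ex.leaf_var, h.2.1]
      exact ⟨⟨hx', hf k hk.le⟩, he.2 hf'⟩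
    · simp [h.2.1, he.1, sum_range_succ]
    · refine ⟨by simp [h.1, show 38 ≠ x by omega], by simp, by simp [show x ≠ 38 by omega], by simp [h.2.2.1], fun y hy => ?_⟩
      simp [show y ≠ 38 by omega, show y ≠ x by omega, h.2.2.2 y hy]
  · intro s' h
    refine .nil ?_ (hQ s' h.2.1 h.2.2.1 h.2.2.2)
    simp only [sum_const, card_range, nsmul_eq_mul]
    linarith

/-- A table of sums. -/
def tabDot (a : ℕ) (base n1 n2 n3 e : Ex) : Program := tab a base n1 n2 (dot 42 n3 e)

/-- A table of sums modulo `m`. -/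
def tabMod (a : ℕ) (base n1 n2 n3 e m : Ex) : Program :=
  tab a base n1 n2 (blk [dot 40 n3 e, asg 41 m, modProg])

/-- The time for each term of a table, if the numbers have at most `L` bits. -/
noncomputable def cellCost (c : Ctx) (L : ℕ) : ℝ := 2 * modCost c L

lemma bc_le_modCost (c : Ctx) (L : ℕ) : 400 * bc c L ≤ modCost c L := by
  have := bc_mono c (show L ≤ 160 * L by omega)
  unfold modCost; linarith

lemma cellCost_pos (c : Ctx) (L : ℕ) : 0 < cellCost c L := by
  have := bc_le_modCost c L
  have := bc_pos c L
  unfold cellCost; linarith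

lemma cellCost_mono (c : Ctx) {L L' : ℕ} (h : L ≤ L') : cellCost c L ≤ cellCost c L' := by
  have := bc_mono c (show 160 * L ≤ 160 * L' by omega)
  unfold cellCost modCost; linarith

lemma bc_le_cellCost (c : Ctx) (L : ℕ) : 800 * bc c L ≤ cellCost c L := by
  have := bc_le_modCost c L
  unfold cellCost; linarith

/-- The hypotheses under which a table of sums is computed: `B`, `N1`, `N2`, `N3` are the values of
the expressions for its position and size, and `f r k j` is the value of the `j`-th term of the
entry with indices `r` and `k`. -/
structure TabSpec (c : Ctx) (s : St) (L : ℕ) (a : ℕ) (base n1 n2 n3 e : Ex) (B N1 N2 N3 : ℕ)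
    (f : ℕ → ℕ → ℕ → ℤ) : Prop where
  lam : c.lam ≤ L
  bet : 50000 * L ≤ c.bet
  short : bits (N1 : ℤ) ≤ c.lam ∧ bits (N2 : ℤ) ≤ c.lam ∧ bits (N3 : ℤ) ≤ c.lam
  eval : ∀ s', Near a B (N1 * N2) s s' →
    base.eval s' = B ∧ n1.eval s' = N1 ∧ n2.eval s' = N2 ∧ n3.eval s' = N3
  term : ∀ r < N1, ∀ k < N2, ∀ j < N3, ∀ s', Near a B (N1 * N2) s s' → s'.v 36 = r → s'.v 37 = k →
    s'.v 38 = j → e.eval s' = f r k j ∧ (Fit c s' → e.Leaf L s')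
  sum : ∀ r < N1, ∀ k < N2, ∀ n ≤ N3, bits (∑ j ∈ range n, f r k j) ≤ L
  ok : base.ok = true ∧ n1.ok = true ∧ n2.ok = true ∧ n3.ok = true
  sz : base.sz ≤ 15 ∧ n1.sz ≤ 57 ∧ n2.sz ≤ 15 ∧ n3.sz ≤ 57 ∧ e.sz ≤ 57

variable {a : ℕ} {base n1 n2 n3 e m : Ex} {B N1 N2 N3 : ℕ} {f : ℕ → ℕ → ℕ → ℤ}

lemma Near.of_eq {n : ℕ} {s s' s'' : St} (h : Near a B n s s') (hv : Same s' s'')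
    (ha : s''.a = s'.a) : Near a B n s s'' :=
  ⟨⟨fun x hx => by rw [hv.v x hx, h.v x hx]⟩, fun a' j hj => by rw [ha, h.arr a' j hj]⟩

lemma TabSpec.does_dot (h : TabSpec c s L a base n1 n2 n3 e B N1 N2 N3 f) {x r k : ℕ} (hx : 40 ≤ x)
    (hx' : x < 60) (hr : r < N1) (hk : k < N2) {s' : St} (hs' : Near a B (N1 * N2) s s')
    (h36 : s'.v 36 = r) (h37 : s'.v 37 = k)
    (hQ : ∀ t, t.v x = ∑ j ∈ range N3, f r k j → t.a = s'.a → (∀ y < 38, t.v y = s'.v y) → Q t) :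
    Does c (dot x n3 e) s' ((N3 + 1) * (6 * bc c L)) Q := by
  refine _root_.does_dot N3 (f r k) hx hx' h.lam (by have := h.bet; have := h.lam; have := c.lam_ge; omega)
    h.ok.2.2.2 h.sz.2.2.2.1 h.sz.2.2.2.2 h.short.2.2 (fun t ht ha => ?_) (h.sum r hr k hk) hQ
  have hn := hs'.of_eq ⟨fun x hx => ht x (by omega)⟩ ha
  exact ⟨(h.eval t hn).2.2.2, fun j hj h38 => h.term r hr k hk j hj t hn
    (by rw [ht 36 (by norm_num), h36]) (by rw [ht 37 (by norm_num), h37]) h38⟩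

lemma does_tabDot (h : TabSpec c s L a base n1 n2 n3 e B N1 N2 N3 f)
    (hw : ∀ r < N1, ∀ k < N2, ∑ j ∈ range N3, f r k j ≠ 0 → a < 16 ∧
      B + r * N2 + k < c.len a ∧ bits (∑ j ∈ range N3, f r k j) ≤ c.cap a (B + r * N2 + k))
    (hQ : ∀ s', s'.a = fill s.a a B (N1 * N2)
      (fun t => ∑ j ∈ range N3, f (t / N2) (t % N2) j) → Same s s' → Q s') :
    Does c (tabDot a base n1 n2 n3 e) s ((N1 + 1) * (N2 + 1) * (N3 + 1) * cellCost c L) Q := by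
  have hp := bc_pos c L
  have hLb : 64 * (L + 1) ≤ c.bet := by have := h.bet; have := h.lam; have := c.lam_ge; omega
  have h3 : (0 : ℝ) ≤ N3 * bc c L := by positivity
  refine .time_le (does_tab B N1 N2 (fun r k => ∑ j ∈ range N3, f r k j)
    (T := (N3 + 1) * (6 * bc c L)) h.lam hLb ⟨h.ok.1, h.ok.2.1, h.ok.2.2.1⟩
    ⟨h.sz.1, h.sz.2.1, h.sz.2.2.1⟩ ⟨h.short.1, h.short.2.1⟩
    (fun s' hs' => ⟨(h.eval s' hs').1, (h.eval s' hs').2.1, (h.eval s' hs').2.2.1⟩) ?_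
    (fun r hr k hk => ⟨h.sum r hr k hk N3 le_rfl, hw r hr k hk⟩) (by positivity) hQ) ?_
  · exact fun r hr k hk s' hs' h36 h37 => h.does_dot (by norm_num) (by norm_num) hr hk hs' h36 h37
      fun t h1 h2 h3 => ⟨h1, h2, h3⟩
  · have := bc_le_cellCost c L
    have : ((N3 : ℝ) + 1) * (800 * bc c L) ≤ (N3 + 1) * cellCost c L := by gcongr
    exact (mul_le_mul_of_nonneg_left (by linarith) (by positivity)).trans_eq (mul_assoc ..).symm

lemma does_tabMod (h : TabSpec c s L a base n1 n2 n3 e B N1 N2 N3 f) {M : ℤ} (hM0 : 0 < M)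
    (hMb : bits M ≤ L) (hmsz : m.sz ≤ 60)
    (hm : ∀ s', Near a B (N1 * N2) s s' → m.eval s' = M ∧ (Fit c s' → m.Leaf L s'))
    (hw : ∀ r < N1, ∀ k < N2, a < 16 ∧ B + r * N2 + k < c.len a ∧
      bits M ≤ c.cap a (B + r * N2 + k))
    (hY : ∀ i, s.a 3 i = 0) (ha3 : a ≠ 3)
    (hQ : ∀ s', s'.a = fill s.a a B (N1 * N2)
      (fun t => (∑ j ∈ range N3, f (t / N2) (t % N2) j) % M) →
        Same s s' → Q s') :
    Does c (tabMod a base n1 n2 n3 e m) s ((N1 + 1) * (N2 + 1) * (N3 + 1) * cellCost c L) Q := by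
  have hp := bc_pos c L
  have hL8 := c.lam_ge.trans h.lam
  have hLb : 64 * (L + 1) ≤ c.bet := by have := h.bet; omega
  have h3 : (0 : ℝ) ≤ N3 * bc c L := by positivity
  have hmc := bc_le_modCost c L
  have h8 : bc c 8 ≤ bc c L := bc_mono c hL8
  have hb : ∀ z : ℤ, bits (z % M) ≤ bits M := fun z => bits_mono (by
    rw [abs_of_nonneg (Int.emod_nonneg _ hM0.ne'), abs_of_pos hM0]
    exact (Int.emod_lt_of_pos _ hM0).le)
  refine .time_le (does_tab B N1 N2 (fun r k => (∑ j ∈ range N3, f r k j) % M)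
    (T := (N3 + 1) * (6 * bc c L) + 2 * bc c L + modCost c L) h.lam hLb
    ⟨h.ok.1, h.ok.2.1, h.ok.2.2.1⟩
    ⟨h.sz.1, h.sz.2.1, h.sz.2.2.1⟩ ⟨h.short.1, h.short.2.1⟩
    (fun s' hs' => ⟨(h.eval s' hs').1, (h.eval s' hs').2.1, (h.eval s' hs').2.2.1⟩) ?_
    (fun r hr k hk => ⟨(hb _).trans hMb, fun _ => ⟨(hw r hr k hk).1, (hw r hr k hk).2.1,
      (hb _).trans (hw r hr k hk).2.2⟩⟩) (by linarith) hQ) ?_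
  · intro r hr k hk s' hs' h36 h37
    refine .cons (h.does_dot (by norm_num) (by norm_num) hr hk hs' h36 h37 fun t h1 h2 h3 => ?_)
    have hn := hs'.of_eq ⟨fun x hx => h3 x (by omega)⟩ h2
    refine .cons (.asg M (hsz := hmsz) hL8 hLb (hm t hn).2 (hm t hn).1
      (.cons ((does_mod (L := L) hL8 h.bet ?_ ?_ ?_ (fun i => ?_) fun u u1 u2 u3 u4 =>
        Does.nil ?_ ⟨?_, ?_, fun x hx => ?_⟩))))
    · simp [h1]; exact h.sum r hr k hk N3 le_rfl
    · simp [hMb]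
    · simp [hM0]
    · rw [St.set_a, hn.arr 3 i (fun hh => ha3 hh.1.symm), hY]
    · linarith
    · rw [u1]; simp [h1]
    · rw [u3, St.set_a, h2]
    · rw [u4 x (by omega), ← h3 x hx]
      simp [show x ≠ 41 by omega]
  · have : ((N3 : ℝ) + 1) * (400 * bc c L) ≤ (N3 + 1) * modCost c L := by gcongr
    have : 0 ≤ (N3 : ℝ) * modCost c L := mul_nonneg (by positivity) (by linarith)
    refine (mul_le_mul_of_nonneg_left ?_ (by positivity)).trans_eq (mul_assoc ..).symm
    unfold cellCost
    linarith

lemma bits_sum_one {n : ℕ} {f : ℕ → ℤ} (hn : n ≤ 1) (h : bits (f 0) ≤ L) :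
    bits (∑ j ∈ range n, f j) ≤ L := by
  interval_cases n <;> simp [h]

end

/-! ### Parameters and memory layout of the main program -/

/-- The number of leaves below the node `v` of a heap with `2 ^ b` leaves. -/
def leaves (b v : ℕ) : ℕ := 2 ^ (b + 1 - v.size)

/-- The parameters of a run of the main program. `h` lists the coefficients of a polynomial of degree
`D`, whose powers contain the entries of the Hasse–Witt matrices; `sh` is the factor by which the
indices of the entries are stretched. The block length is `2 ^ b`; `lam` bounds the lengths of all
auxiliary numbers, and `lf` those of the coefficients. -/
structure Par where
  M : ℕ → ℝ
  hM : IsMulTime M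
  N : ℕ
  D : ℕ
  g : ℕ
  sh : ℕ
  b : ℕ
  lf : ℕ
  lam : ℕ
  h : ℕ → ℤ
  lam_ge : 4 * N.size + 4 * D.size + 60 ≤ lam
  hb : 2 ^ b ≤ N
  hD : 2 ≤ D
  hg : 1 ≤ g
  hsh : sh = 1 ∨ sh = 2
  hgD : sh * g ≤ D + (sh - 1)
  hh : ∀ j, bits (h j) ≤ lf

namespace Par
variable (P : Par)

/-- The block length. -/
def B : ℕ := 2 ^ P.b

/-- Every composite number up to `N` has a divisor between `2` and `Q`. -/
def Q : ℕ := 2 ^ ((P.N.size + 1) / 2)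

/-- The length of the entries of the matrices at the leaves, with some leeway. -/
def W : ℕ := P.lf + 2 * P.lam + 1

/-- The length of the longest numbers that are multiplied. -/
def top : ℕ := 2 * P.N + P.B * P.W + P.lam

/-- The odd primes up to `N`. -/
def primes : Finset ℕ := (range (P.N + 1)).filter fun k => k.Prime ∧ k ≠ 2

/-- The number of bits that every variable may hold. -/
def bet : ℕ := 1000000 * (P.top + 1)

/-- The arrays: `0` holds the input, and later the list of primes, `1` the matrices, `2` the
polynomial `h`, `3` the stack of the division, `4` the tree of moduli, `5` the tree of matrices and
`6` the tree of partial products, `8` the sieve, and the other ones the data for one prime. In the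
trees, the nodes `0` and `2 * B` stand for the data that are carried from block to block. -/
def len (x : ℕ) : ℕ :=
  if x = 0 then max (P.D + 1) P.primes.card
  else if x = 1 then P.primes.card * P.g * P.g
  else if x = 2 then P.D + 1
  else if x = 3 then P.bet.size
  else if x = 4 then 2 * P.B + 1
  else if x = 5 then 2 * P.B * (P.D * P.D)
  else if x = 6 then (2 * P.B + 1) * (P.D * P.D)
  else if x = 7 then 0
  else if x = 8 then P.B
  else 4 * ((P.D + 2) * (P.D + 2))

/-- The capacity of a node of the tree of moduli. -/
def nodeCap (v : ℕ) : ℕ := if v = 0 ∨ v = 2 * P.B then 2 * P.N + 1 else leaves P.b v * P.lam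

/-- The number of bits for each entry of an array. -/
def cap (x i : ℕ) : ℕ :=
  if x = 0 then (if i ≤ P.D then P.lf + P.lam else P.lam)
  else if x = 2 then P.lf
  else if x = 3 then P.bet / 2 ^ i + 3
  else if x = 4 then P.nodeCap i
  else if x = 5 then leaves P.b (i / (P.D * P.D)) * P.W
  else if x = 6 then P.nodeCap (i / (P.D * P.D))
  else P.lam

lemma cap_small (x i : ℕ) (hx : x = 1 ∨ 8 ≤ x) : P.cap x i = P.lam := by
  unfold cap
  split_ifs <;> omega

lemma len_three : P.len 3 = P.bet.size := by simp [len]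

lemma cap_three (i : ℕ) : P.cap 3 i = P.bet / 2 ^ i + 3 := by simp [cap]

lemma bet_ge : 1000000 * (P.lam + 1) ≤ P.bet := by unfold bet top; omega

lemma eight_le_lam : 8 ≤ P.lam := by have := P.lam_ge; omega

lemma bet_lt : P.bet < 2 ^ P.len 3 := by rw [len_three]; exact Nat.lt_size_self _

attribute [irreducible] bet len cap

/-- The bounds for the memory. -/
def ctx : Ctx where
  M := P.M
  hM := P.hM
  lam := P.lam
  bet := P.bet
  len := P.len
  cap := P.cap
  lam_ge := P.eight_le_lam
  bet_ge := P.bet_ge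
  len_stack := P.bet_lt
  cap_stack := fun i => (P.cap_three i).ge
  cap_small := fun x i hx => (P.cap_small x i hx).le

@[simp] lemma ctx_lam : P.ctx.lam = P.lam := rfl
@[simp] lemma ctx_bet : P.ctx.bet = P.bet := rfl

lemma bc_eight_le : bc P.ctx 8 ≤ bc P.ctx P.lam := bc_mono _ P.eight_le_lam

lemma one_le_B : 1 ≤ P.B := Nat.one_le_two_pow

lemma B_le : P.B ≤ P.N := P.hb

lemma one_le_N : 1 ≤ P.N := P.one_le_B.trans P.B_le

lemma two_pow_size_le : 2 ^ P.N.size ≤ 2 * P.N := by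
  have h1 : 1 ≤ P.N.size := Nat.size_pos.2 P.one_le_N
  have h2 : 2 ^ (P.N.size - 1) ≤ P.N := Nat.lt_size.1 (by omega)
  rw [show P.N.size = P.N.size - 1 + 1 by omega, pow_succ]
  omega

lemma two_le_Q : 2 ≤ P.Q := by
  have h1 : 1 ≤ P.N.size := Nat.size_pos.2 P.one_le_N
  exact Nat.le_self_pow (by omega) 2

lemma Q_le : P.Q ≤ 2 * P.N := by
  have h1 : 1 ≤ P.N.size := Nat.size_pos.2 P.one_le_N
  exact (Nat.pow_le_pow_right (by norm_num) (by omega)).trans P.two_pow_size_le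

lemma lam_le_top : P.lam ≤ P.top := by unfold top; omega

/-- Numbers of polynomial size are short. -/
lemma short {z : ℤ} (hz : |z| ≤ 2 ^ 20 * ((P.N : ℤ) + 1) ^ 4 * ((P.D : ℤ) + 2) ^ 4) :
    bits z ≤ P.lam := by
  refine (bits_le_iff.2 ?_).trans P.lam_ge
  have h1 : ((P.N : ℤ) + 1) ≤ 2 ^ P.N.size := mod_cast Nat.lt_size_self P.N
  have h2 : ((P.D : ℤ) + 2) ≤ 2 ^ (P.D.size + 1) := by
    have h3 : ((P.D : ℤ) + 1) ≤ 2 ^ P.D.size := mod_cast Nat.lt_size_self P.D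
    have h4 : (1 : ℤ) ≤ 2 ^ P.D.size := one_le_pow₀ (by norm_num)
    rw [pow_succ]; linarith
  calc |z| ≤ _ := hz
    _ ≤ 2 ^ 20 * (2 ^ P.N.size) ^ 4 * (2 ^ (P.D.size + 1)) ^ 4 := by gcongr
    _ = 2 ^ (4 * P.N.size + 4 * P.D.size + 24) := by
      rw [← pow_mul, ← pow_mul, ← pow_add, ← pow_add]; congr 1; ring
    _ < _ := pow_lt_pow_right₀ (by norm_num) (by omega)

lemma short_nat {n : ℕ} (i j : ℕ) (hi : i ≤ 4) (hj : j ≤ 4)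
    (hn : n ≤ 2 ^ 20 * ((P.N + 1) ^ i * (P.D + 2) ^ j)) : bits (n : ℤ) ≤ P.lam := by
  refine P.short ?_
  rw [abs_of_nonneg (by positivity)]
  have : n ≤ 2 ^ 20 * (P.N + 1) ^ 4 * (P.D + 2) ^ 4 := by
    refine hn.trans ?_
    rw [mul_assoc]
    refine Nat.mul_le_mul_left _ (Nat.mul_le_mul ?_ ?_)
    · exact Nat.pow_le_pow_right (by omega) hi
    · exact Nat.pow_le_pow_right (by omega) hj
  exact_mod_cast this

lemma short_N {n : ℕ} (hn : n ≤ 2 ^ 20 * (P.N + 1) := by omega) : bits (n : ℤ) ≤ P.lam :=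
  P.short_nat 1 0 (by norm_num) (by norm_num) (by simpa using hn)

lemma short_D {n : ℕ} (hn : n ≤ 2 ^ 20 * (P.D + 2)) : bits (n : ℤ) ≤ P.lam :=
  P.short_nat 0 1 (by norm_num) (by norm_num) (by simpa using hn)

end Par

/-- `s'` agrees with `s` on the variables below `36` except those in `V` and on the arrays except
those in `A`. -/
structure Frame (V A : List ℕ) (s s' : St) : Prop where
  v : ∀ x, (hx : x < 36 := by norm_num) → (hV : x ∉ V := by simp) → s'.v x = s.v x
  a : ∀ x, (hA : x ∉ A := by simp) → s'.a x = s.a x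

lemma Frame.refl (V A : List ℕ) (s : St) : Frame V A s s := ⟨fun _ _ _ => rfl, fun _ _ => rfl⟩

lemma Frame.trans {V A V' A' V'' A'' : List ℕ} {s s' s'' : St} (h : Frame V A s s')
    (h' : Frame V' A' s' s'') (hV : V ⊆ V'' := by simp) (hA : A ⊆ A'' := by simp)
    (hV' : V' ⊆ V'' := by simp) (hA' : A' ⊆ A'' := by simp) : Frame V'' A'' s s'' :=
  ⟨fun x hx hxV => by rw [h'.v x hx fun h => hxV (hV' h), h.v x hx fun h => hxV (hV h)],
    fun x hx => by rw [h'.a x fun h => hx (hA' h), h.a x fun h => hx (hA h)]⟩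

lemma Frame.mono {V A V' A' : List ℕ} {s s' : St} (h : Frame V A s s') (hV : V ⊆ V' := by simp)
    (hA : A ⊆ A' := by simp) : Frame V' A' s s' :=
  ⟨fun x hx hxV => h.v x hx fun h => hxV (hV h), fun x hx => h.a x fun h => hx (hA h)⟩

lemma Frame.set {V A : List ℕ} {s s' : St} (h : Frame V A s s') {x : ℕ} {k : ℤ}
    (hx : x ∈ V ∨ 36 ≤ x := by simp) : Frame V A s (s'.set x k) := by
  refine ⟨fun y hy hyV => ?_, fun y hy => h.a y hy⟩
  rw [St.set_v, if_neg, h.v y hy hyV]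
  rintro rfl
  rcases hx with hx | hx
  · exact hyV hx
  · omega

lemma Frame.put {V A : List ℕ} {s s' : St} (h : Frame V A s s') {x i : ℕ} {k : ℤ}
    (hx : x ∈ A := by simp) : Frame V A s (s'.put x i k) := by
  refine ⟨fun y hy hyV => h.v y hy hyV, fun y hy => ?_⟩
  rw [← h.a y hy]
  funext j
  rw [St.put_a, if_neg]
  rintro ⟨rfl, _⟩
  exact hy hx

lemma Frame.of_fill {V A : List ℕ} {s s' s'' : St} (h : Frame V A s s') {a base n : ℕ}
    {w : ℕ → ℤ} (hv : Same s' s'') (ha : s''.a = fill s'.a a base n w) (hx : a ∈ A := by simp) :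
    Frame V A s s'' := by
  refine ⟨fun x hx' hxV => by rw [hv.v x hx', h.v x hx' hxV], fun y hy => ?_⟩
  rw [← h.a y hy, ha]
  funext j
  exact fill_ne (by rintro rfl; exact hy hx) j

/-- The memory holds the parameters, and the division stack is empty. -/
structure Holds (P : Par) (s : St) : Prop where
  v0 : s.v 0 = P.N
  v2 : s.v 2 = P.D
  v3 : s.v 3 = P.sh
  v5 : s.v 5 = P.B
  v8 : s.v 8 = P.g
  v33 : s.v 33 = P.D * P.D
  v35 : s.v 35 = P.Q
  h : ∀ j, s.a 2 j = P.h j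
  stack : ∀ i, s.a 3 i = 0

lemma Holds.frame {P : Par} {s s' : St} {V A : List ℕ} (h : Holds P s) (hf : Frame V A s s')
    (hV : ∀ x ∈ [0, 2, 3, 5, 8, 33, 35], x ∉ V := by decide) (hA : ∀ x ∈ [2, 3], x ∉ A := by decide) :
    Holds P s' where
  v0 := by rw [hf.v 0 (by norm_num) (hV 0 (by simp)), h.v0]
  v2 := by rw [hf.v 2 (by norm_num) (hV 2 (by simp)), h.v2]
  v3 := by rw [hf.v 3 (by norm_num) (hV 3 (by simp)), h.v3]
  v5 := by rw [hf.v 5 (by norm_num) (hV 5 (by simp)), h.v5]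
  v8 := by rw [hf.v 8 (by norm_num) (hV 8 (by simp)), h.v8]
  v33 := by rw [hf.v 33 (by norm_num) (hV 33 (by simp)), h.v33]
  v35 := by rw [hf.v 35 (by norm_num) (hV 35 (by simp)), h.v35]
  h := fun j => by rw [hf.a 2 (hA 2 (by simp)), h.h]
  stack := fun j => by rw [hf.a 3 (hA 3 (by simp)), h.stack]

namespace Par
variable {P : Par} {s : St}

lemma bits_one : bits ((1 : ℕ) : ℤ) ≤ P.lam := bits_one_le.trans P.eight_le_lam

lemma bits_D : bits (P.D : ℤ) ≤ P.lam := P.short_D (by omega)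

lemma bits_B : bits (P.B : ℤ) ≤ P.lam := P.short_N (by have := P.B_le; omega)

lemma fit_small (h : Fit P.ctx s) {x : ℕ} (hx : x < 40) : bits (s.v x) ≤ P.lam := h.small x hx

lemma lam_le_W : 2 * P.lam ≤ P.W := by unfold W; omega

lemma bet_of_le_top {L : ℕ} (h : L ≤ P.top) : 50000 * L ≤ P.bet ∧ 64 * (L + 1) ≤ P.bet := by
  unfold bet
  omega

end Par

/-! ### Trees -/

lemma size_two_mul {v : ℕ} (h : 1 ≤ v) : (2 * v).size = v.size + 1 := by
  have := Nat.size_shiftLeft (m := v) (by omega) 1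
  rwa [Nat.shiftLeft_eq, pow_one, mul_comm] at this

lemma size_two_mul_add_one {v : ℕ} : (2 * v + 1).size = v.size + 1 := by
  have := Nat.size_bit (b := true) (n := v) (by simp)
  simpa [Nat.bit] using this

lemma leaves_children {b v : ℕ} (h : 1 ≤ v) (hv : v < 2 ^ b) :
    2 * leaves b (2 * v) = leaves b v ∧ 2 * leaves b (2 * v + 1) = leaves b v := by
  unfold leaves
  rw [size_two_mul h, size_two_mul_add_one]
  have : v.size ≤ b := Nat.size_le.2 hv
  rw [show b + 1 - v.size = b + 1 - (v.size + 1) + 1 by omega, pow_succ]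
  omega

lemma one_le_leaves (b v : ℕ) : 1 ≤ leaves b v := Nat.one_le_two_pow

lemma leaves_le {b v : ℕ} (h : 1 ≤ v) : leaves b v ≤ 2 ^ b := by
  have : 1 ≤ v.size := Nat.size_pos.2 h
  exact Nat.pow_le_pow_right (by norm_num) (by omega)

namespace Par
lemma leaves_mul_le {P : Par} {v X : ℕ} (hv : 1 ≤ v) (hX : X ≤ P.W) : leaves P.b v * X + P.lam ≤ P.top := by
  have := Nat.mul_le_mul (leaves_le (b := P.b) hv) hX
  unfold top B
  omega

end Par

lemma leaves_one (b : ℕ) : leaves b 1 = 2 ^ b := by simp [leaves]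

lemma size_pow_add {b i : ℕ} (h : i < 2 ^ b) : (2 ^ b + i).size = b + 1 := by
  refine le_antisymm (Nat.size_le.2 (by rw [pow_succ]; omega)) ?_
  rw [Nat.succ_le_iff, Nat.lt_size]; omega

lemma leaves_leaf {b i : ℕ} (h : i < 2 ^ b) : leaves b (2 ^ b + i) = 1 := by
  simp [leaves, size_pow_add h]

lemma sum_leaves (b : ℕ) : ∑ v ∈ range (2 * 2 ^ b - 1), leaves b (v + 1) = (b + 1) * 2 ^ b := by
  have hsplit : ∀ b, 2 * 2 ^ b - 1 = (2 ^ b - 1) + 2 ^ b := fun b => by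
    have := Nat.one_le_two_pow (n := b); omega
  induction b with
  | zero => simp [leaves]
  | succ b ih =>
    rw [hsplit, sum_range_add]
    have h1 : ∀ i ∈ range (2 ^ (b + 1)), leaves (b + 1) (2 ^ (b + 1) - 1 + i + 1) = 1 := by
      intro i hi
      have := Nat.one_le_two_pow (n := b + 1)
      rw [show 2 ^ (b + 1) - 1 + i + 1 = 2 ^ (b + 1) + i by omega]
      exact leaves_leaf (mem_range.1 hi)
    rw [sum_congr rfl h1, show 2 ^ (b + 1) - 1 = 2 * 2 ^ b - 1 by rw [pow_succ']]
    have h2 : ∀ v ∈ range (2 * 2 ^ b - 1), leaves (b + 1) (v + 1) = 2 * leaves b (v + 1) := by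
      intro v hv
      have : (v + 1).size ≤ b + 1 := Nat.size_le.2 (by rw [pow_succ]; have := mem_range.1 hv; omega)
      unfold leaves
      rw [show b + 1 + 1 - (v + 1).size = b + 1 - (v + 1).size + 1 by omega, pow_succ']
    rw [sum_congr rfl h2, ← mul_sum, ih]
    simp
    ring

/-- The time for all nodes of a tree, each proportional to the number of leaves below, is that for
the root, times the number of levels. -/
lemma sum_bc_leaves (c : Ctx) (b : ℕ) {Y : ℕ} (hY : 2 ≤ Y) :
    ∑ v ∈ range (2 * 2 ^ b - 1), bc c (leaves b (v + 1) * Y) ≤ 2 * (b + 1) * bc c (2 ^ b * Y) := by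
  have h1 : ∀ v ∈ range (2 * 2 ^ b - 1), bc c (leaves b (v + 1) * Y) ≤
      (leaves b (v + 1) : ℝ) * (2 / 2 ^ b * bc c (2 ^ b * Y)) := by
    intro v hv
    have hl := leaves_le (b := b) (show 1 ≤ v + 1 by omega)
    refine (bc_le_div c (Nat.mul_le_mul_right Y hl)).trans ?_
    rw [← mul_assoc]
    refine mul_le_mul_of_nonneg_right ?_ (bc_pos _ _).le
    rw [mul_div_assoc', div_le_div_iff₀ (by positivity) (by positivity)]
    have h2 : (64 * (leaves b (v + 1) * Y + 1) + 1) * 2 ^ b ≤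
        leaves b (v + 1) * 2 * (64 * (2 ^ b * Y + 1) + 1) := by
      have h3 := one_le_leaves b (v + 1)
      have : 2 * 2 ^ b ≤ leaves b (v + 1) * Y * 2 ^ b :=
        Nat.mul_le_mul_right _ (by nlinarith)
      nlinarith
    exact_mod_cast h2
  refine (sum_le_sum h1).trans ?_
  rw [← sum_mul, ← Nat.cast_sum, sum_leaves]
  push_cast
  field_simp
  exact le_rfl

lemma sum_bc_nodes (c : Ctx) (b : ℕ) {Y : ℕ} (hY : 2 ≤ Y) :
    ∑ k ∈ range (2 ^ b - 1), bc c (leaves b (2 ^ b - 1 - k) * Y) ≤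
      2 * (b + 1) * bc c (2 ^ b * Y) ∧
    ∑ k ∈ range (2 ^ b - 1), bc c (leaves b (k + 1) * Y) ≤ 2 * (b + 1) * bc c (2 ^ b * Y) := by
  have h : ∑ k ∈ range (2 ^ b - 1), bc c (leaves b (k + 1) * Y) ≤
      2 * (b + 1) * bc c (2 ^ b * Y) := by
    refine le_trans (sum_le_sum_of_subset_of_nonneg ?_ fun _ _ _ => (bc_pos _ _).le)
      (sum_bc_leaves c b hY)
    exact range_subset_range.2 (by omega)
  refine ⟨?_, h⟩
  rw [← sum_range_reflect (fun k => bc c (leaves b (k + 1) * Y))] at h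
  refine le_trans (le_of_eq (sum_congr rfl fun k hk => ?_)) h
  have := mem_range.1 hk
  rw [show 2 ^ b - 1 - 1 - k + 1 = 2 ^ b - 1 - k by omega]

/-- The product tree over the given leaves, as a heap: the node `v` has the children `2 v` and
`2 v + 1`, and the leaves are the nodes from `B` on. -/
def heap {α : Type*} [Mul α] (B : ℕ) (leaf : ℕ → α) (v : ℕ) : α :=
  if v = 0 ∨ B ≤ v then leaf (v - B) else heap B leaf (2 * v) * heap B leaf (2 * v + 1)
termination_by 2 * B - v
decreasing_by all_goals omega

lemma heap_leaf {α : Type*} [Mul α] (B : ℕ) (leaf : ℕ → α) (i : ℕ) :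
    heap B leaf (B + i) = leaf i := by
  rw [heap, if_pos (by omega)]; simp

lemma heap_node {α : Type*} [Mul α] {B : ℕ} (leaf : ℕ → α) {v : ℕ} (h : 1 ≤ v) (hv : v < B) :
    heap B leaf v = heap B leaf (2 * v) * heap B leaf (2 * v + 1) := by
  conv_lhs => rw [heap]
  rw [if_neg (by omega)]

/-- Induction from the leaves of a heap to its root. -/
lemma heap_induction {B : ℕ} {p : ℕ → Prop} (leaf : ∀ i < B, p (B + i))
    (node : ∀ v, 1 ≤ v → v < B → p (2 * v) → p (2 * v + 1) → p v) (v : ℕ) (h : 1 ≤ v)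
    (hv : v < 2 * B) : p v := by
  induction hn : 2 * B - v using Nat.strong_induction_on generalizing v with
  | _ n ih =>
    rcases Nat.lt_or_ge v B with h1 | h1
    · exact node v h h1 (ih _ (by omega) _ (by omega) (by omega) rfl)
        (ih _ (by omega) _ (by omega) (by omega) rfl)
    · obtain ⟨i, rfl⟩ := Nat.exists_eq_add_of_le h1
      exact leaf i (by omega)

/-! ### The sieve -/

/-- `z` is `1` or `0`, according to whether `p` holds. -/
def Indicates (z : ℤ) (p : Prop) : Prop := (p → z = 1) ∧ (¬ p → z = 0)

lemma Indicates.congr {z : ℤ} {p q : Prop} (h : Indicates z p) (hpq : p ↔ q) : Indicates z q := by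
  rwa [← hpq]

/-- The program that marks in the array `8` the composite numbers among those from the variable `34`
on. -/
def sieveProg : Program := blk [
  tabDot 8 0 1 (.var 5) 1 0,
  forLoop 11 (.var 35 - 2) (blk [
    asg 40 (0 - .var 34), asg 41 (.var 11 + 2), modProg, asg 10 (.var 42),
    loop (.var 5 - .var 10) (blk [
      put 8 (.var 10) (.ite (.var 34 + .var 10 - .var 11 - 2) 1 (.get 8 (.var 10))),
      asg 10 (.var 10 + .var 11 + 2)])])]

/-- The numbers that are marked by the sieve. -/
def Marked (Q k : ℕ) : Prop := ∃ q, 2 ≤ q ∧ q < Q ∧ q ∣ k ∧ q < k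

lemma marked_succ {q k : ℕ} (hq : 2 ≤ q) : Marked (q + 1) k ↔ Marked q k ∨ (q ∣ k ∧ q < k) := by
  constructor
  · rintro ⟨r, h1, h2, h3, h4⟩
    rcases Nat.lt_or_ge r q with h | h
    · exact .inl ⟨r, h1, h, h3, h4⟩
    · obtain rfl : r = q := by omega
      exact .inr ⟨h3, h4⟩
  · rintro (⟨r, h1, h2, h3, h4⟩ | ⟨h3, h4⟩)
    · exact ⟨r, h1, by omega, h3, h4⟩
    · exact ⟨q, hq, by omega, h3, h4⟩

lemma sum_div_le (B j : ℕ) : ∑ q ∈ range (2 ^ j - 1), B / (q + 1) ≤ B * j := by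
  induction j with
  | zero => simp
  | succ j ih =>
    have h1 := Nat.one_le_two_pow (n := j)
    rw [show 2 ^ (j + 1) - 1 = (2 ^ j - 1) + 2 ^ j by rw [pow_succ]; omega, sum_range_add,
      mul_add, mul_one]
    refine add_le_add ih ?_
    refine (sum_le_card_nsmul _ _ (B / 2 ^ j) fun q _ => ?_).trans ?_
    · exact Nat.div_le_div_left (by omega) (by omega)
    · rw [card_range, smul_eq_mul]; exact Nat.mul_div_le _ _

lemma add_le_of_dvd {q x y : ℕ} (hx : q ∣ x) (hy : q ∣ y) (h : x < y) : x + q ≤ y := by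
  have := Nat.le_of_dvd (by omega) (Nat.dvd_sub hy hx)
  omega

namespace Par
variable {P : Par} {s : St} {R : St → Prop}

lemma len_eight : P.len 8 = P.B := by simp [len]

lemma cap_eight (i : ℕ) : P.cap 8 i = P.lam := P.cap_small 8 i (by norm_num)

lemma bet_lam : 64 * (P.lam + 1) ≤ P.bet := by have := P.bet_ge; omega

/-- The time for the sieve. -/
noncomputable def sieveCost (P : Par) : ℝ :=
  (4 * P.Q + 4 * P.B * (P.N.size + 2)) * cellCost P.ctx P.lam

lemma does_mark {q lo i0 : ℕ} {p : ℕ → Prop} (hs : Holds P s) (hq : 2 ≤ q) (hqQ : q < P.Q)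
    (h34 : s.v 34 = lo) (h11 : s.v 11 = (q : ℤ) - 2) (h10 : s.v 10 = i0) (hi0 : i0 < q)
    (hdvd : q ∣ lo + i0) (hp : ∀ i < P.B, Indicates (s.a 8 i) (p i))
    (hR : ∀ s', Frame [10] [8] s s' →
      (∀ i < P.B, Indicates (s'.a 8 i) (p i ∨ (q ∣ lo + i ∧ q < lo + i))) → R s') :
    Does P.ctx (loop (.var 5 - .var 10) (blk [
      put 8 (.var 10) (.ite (.var 34 + .var 10 - .var 11 - 2) 1 (.get 8 (.var 10))),
      asg 10 (.var 10 + .var 11 + 2)])) s ((4 * (P.B / q : ℕ) + 8) * bc P.ctx P.lam) R := by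
  have hpos := bc_pos P.ctx P.lam
  have h8 := P.bc_eight_le
  have hB := P.B_le
  have hQ := P.Q_le
  have hN := P.one_le_N
  set n := (P.B - i0 + q - 1) / q with hn
  have hn1 : ∀ k < n, i0 + k * q < P.B := fun k hk => by
    have := (Nat.le_div_iff_mul_le (by omega)).1 (Nat.succ_le_of_lt hk)
    rw [Nat.succ_mul] at this
    omega
  have hn2 : P.B ≤ i0 + n * q := by
    have := Nat.lt_div_mul_add (a := P.B - i0 + q - 1) (b := q) (by omega)
    rw [← hn] at this
    omega
  have hn3 : n ≤ P.B / q + 1 := by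
    rw [← Nat.add_div_right _ (by omega)]
    exact Nat.div_le_div_right (by omega)
  refine .time_le (.loop (by decide) n (L := fun _ => P.lam)
    (I := fun k s' => s'.v 10 = (i0 + k * q : ℕ) ∧ Frame [10] [8] s s' ∧
      ∀ i < P.B, Indicates (s'.a 8 i) (p i ∨ (i < i0 + k * q ∧ q ∣ lo + i ∧ q < lo + i)))
    (T := fun _ => 3 * bc P.ctx P.lam) (fun k hk => ⟨P.eight_le_lam, bet_lam⟩) ?_
    (fun k _ s' _ hf => hf.leaf (by decide)) (fun k hk s' h => ?_) (fun k hk s' h _ => ?_)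
    fun s' h => ?_) ?_
  · refine ⟨by simp [h10], .refl _ _ _, fun i hi => (hp i hi).congr ⟨.inl, Or.rec id fun h => ?_⟩⟩
    have := add_le_of_dvd h.2.1 hdvd (by omega)
    omega
  · have := hn1 k hk
    simp only [Ex.evals, h.1, h.2.1.v 5, hs.v5]
    omega
  · have hk1 := hn1 k hk
    rw [add_mul, one_mul, ← add_assoc]
    have hdiv : q ∣ lo + (i0 + k * q) := by
      rw [← add_assoc]; exact dvd_add hdvd (dvd_mul_left _ _)
    set i := i0 + k * q with hi
    have e34 : s'.v 34 = lo := by rw [h.2.1.v 34, h34]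
    have e11 : s'.v 11 = (q : ℤ) - 2 := by rw [h.2.1.v 11, h11]
    set w : ℤ := if (q : ℤ) < lo + i then 1 else s'.a 8 i with hw
    have hflag : Indicates w (p i ∨ (i < i + q ∧ q ∣ lo + i ∧ q < lo + i)) := by
      rw [hw]
      split_ifs with hc
      · exact ⟨fun _ => rfl, fun hno => absurd (.inr ⟨by omega, hdiv, mod_cast hc⟩) hno⟩
      · exact (h.2.2 i hk1).congr (or_congr Iff.rfl (by omega))
    have hwb : bits w ≤ P.lam := by
      by_cases hp' : p i ∨ (i < i + q ∧ q ∣ lo + i ∧ q < lo + i)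
      · rw [hflag.1 hp']; exact bits_one
      · rw [hflag.2 hp']; simp
    refine .cons (.put_ok i w (by simp [h.1]) ?_ (fun _ => ⟨by norm_num, ?_, ?_⟩)
      (.cons (.asg_ok ((i + q : ℕ) : ℤ) ?_ (fun _ => P.short_N)
        (.nil ?_ ⟨by simp, h.2.1.put.set, fun i' hi' => ?_⟩))))
    · simp only [Ex.evals, e34, e11, h.1, Int.toNat_natCast, hw]
      congr 1
      exact propext ⟨fun _ => by linarith, fun _ => by linarith⟩
    · change i < P.len 8
      rwa [len_eight]
    · change _ ≤ P.cap 8 i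
      rwa [cap_eight]
    · simp [h.1, e11]; ring
    · change bc P.ctx 8 ≤ 3 * bc P.ctx P.lam - bc P.ctx P.lam - bc P.ctx P.lam
      linarith
    · rw [St.set_a, St.put_a]
      split_ifs with hc
      · rwa [hc.2]
      · have hc : i' ≠ i := fun h => hc ⟨rfl, h⟩
        refine (h.2.2 i' hi').congr (or_congr Iff.rfl (and_congr_left fun h1 => ⟨by omega, fun h2 => ?_⟩))
        by_contra h3
        have := add_le_of_dvd hdiv h1.1 (by omega)
        omega
  · refine ⟨?_, hR s' h.2.1 fun i hi => (h.2.2 i hi).congr (or_congr Iff.rfl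
      (and_iff_right (by omega)))⟩
    simp only [Ex.evals, h.1, h.2.1.v 5, hs.v5]
    omega
  · simp only [sum_const, card_range, nsmul_eq_mul]
    have : (n : ℝ) ≤ (P.B / q : ℕ) + 1 := mod_cast hn3
    have := mul_le_mul_of_nonneg_right this hpos.le
    push_cast at *
    linarith

lemma does_sieve {lo : ℕ} (hs : Holds P s) (h34 : s.v 34 = lo) (hlo : lo ≤ 3 * P.N + 1)
    (hR : ∀ s', Frame [10, 11] [8] s s' →
      (∀ i < P.B, Indicates (s'.a 8 i) (Marked P.Q (lo + i))) → R s') :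
    Does P.ctx sieveProg s P.sieveCost R := by
  have hpos := bc_pos P.ctx P.lam
  have h8 := P.bc_eight_le
  have hB := P.B_le
  have hQ := P.Q_le
  have hQ2 := P.two_le_Q
  have hN := P.one_le_N
  have hlb : 50000 * P.lam ≤ P.bet := by have := P.bet_ge; omega
  refine .cons (does_tabDot (L := P.lam) (B := 0) (N1 := 1) (N2 := P.B) (N3 := 1)
    (f := fun _ _ _ => 0) ?_ (by simp) fun s1 ha1 hv1 => ?_)
  · exact ⟨le_rfl, hlb, ⟨bits_one, bits_B, bits_one⟩, fun s' h => by simp [@h.v, hs.v5],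
      fun r _ k hk j _ s' h _ _ _ => ⟨by simp, fun hf => by simp⟩, by simp, by decide, by decide⟩
  have hf1 : Frame [10, 11] [8] s s1 := (Frame.refl _ _ s).of_fill hv1 ha1
  refine .cons (.forLoop (P.Q - 2) P.short_N
    (I := fun k s' => s'.v 11 = k ∧ Frame [10, 11] [8] s s' ∧
      ∀ i < P.B, Indicates (s'.a 8 i) (Marked (k + 2) (lo + i)))
    (T := fun k => modCost P.ctx P.lam + (4 * (P.B / (k + 2) : ℕ) + 12) * bc P.ctx P.lam)
    ⟨by simp, hf1.set, fun i hi => ?_⟩ (fun k hk s' h => ⟨h.1, ?_⟩) (fun k hk s' h _ => ?_)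
    fun s' h => ?_)
  · have h0 := fill_eq (A := s.a) (a := 8) (base := 0) (j := i)
      (w := fun t => ∑ j ∈ range 1, (fun _ _ _ => (0 : ℤ)) (t / P.B) (t % P.B) j)
      (show i < 1 * P.B by omega)
    rw [← ha1, zero_add] at h0
    refine ⟨?_, fun _ => by rw [St.set_a, h0]; simp⟩
    rintro ⟨q, h1, h2, -⟩; omega
  · simp only [Ex.evals, h.2.1.v 35, hs.v35]
    omega
  · have hs' := hs.frame h.2.1
    have e34 : s'.v 34 = lo := by rw [h.2.1.v 34, h34]
    have hk2 : (0 : ℤ) < (k : ℤ) + 2 := by omega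
    have hb : bits ((k + 2 : ℕ) : ℤ) ≤ P.lam := P.short_N
    obtain ⟨i0, hi0⟩ := Int.eq_ofNat_of_zero_le (Int.emod_nonneg (-(lo : ℤ)) hk2.ne')
    have hi1 := Int.emod_lt_of_pos (-(lo : ℤ)) hk2
    have hdm := Int.emod_add_mul_ediv (-(lo : ℤ)) ((k : ℤ) + 2)
    rw [hi0] at hi1 hdm
    have hb0 : bits (i0 : ℤ) ≤ P.lam := P.short_N
    refine .cons (.asg_ok (-(lo : ℤ)) (by simp [e34]) (by norm_num) (.cons (.asg_ok ((k + 2 : ℕ) : ℤ)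
      (by simp [h.1]) (by norm_num) (.cons (does_mod (L := P.lam) P.eight_le_lam hlb
        (by simpa [bits_neg] using P.short_N) (by simpa using hb) (by simp; omega)
        (fun i => by simp [hs'.stack]) fun s2 u1 u2 u3 u4 => ?_)))))
    have e42 : s2.v 42 = i0 := by rw [u1, ← hi0]; simp
    refine .cons (.asg i0 P.eight_le_lam bet_lam (fun _ => ?_) (by simp [e42]) (hs := fun _ => hb0) ?_)
    · rw [Ex.leaf_var, e42]; exact ⟨by norm_num, hb0⟩
    have ha2 : (s2.set 10 i0).a = s'.a := by rw [St.set_a, u3]; simp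
    have hf2 : Frame [10] [8] s' (s2.set 10 i0) := by
      refine ⟨fun x hx hxV => ?_, fun x _ => by rw [ha2]⟩
      rw [St.set_v, if_neg (by simpa using hxV), u4 x (by omega)]
      simp [show x ≠ 40 by omega, show x ≠ 41 by omega]
    refine .cons (does_mark (q := k + 2) (lo := lo) (i0 := i0)
      (p := fun i => Marked (k + 2) (lo + i)) (hs'.frame hf2) (by omega) (by omega)
      (by rw [hf2.v 34, e34]) (by rw [hf2.v 11, h.1]; push_cast; ring) (by simp) (by omega) ?_
      (fun i hi => ?_) fun s3 hf3 hfl => .nil ?_ ⟨by rw [hf3.v 11, hf2.v 11, h.1], by simp,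
        ((h.2.1.trans (V'' := [10, 11]) (A'' := [8]) hf2).trans hf3).set, fun i hi => ?_⟩)
    · have : ((k + 2 : ℕ) : ℤ) ∣ (lo + i0 : ℕ) := ⟨-(-(lo : ℤ) / (k + 2)), by push_cast; linarith⟩
      exact_mod_cast this
    · rw [ha2]; exact h.2.2 i hi
    · simp only [ctx_lam]
      linarith
    · exact (hfl i hi).congr (marked_succ (q := k + 2) (by omega)).symm
  · refine .nil ?_ (hR s' h.2.1 fun i hi => (h.2.2 i hi).congr (by rw [Nat.sub_add_cancel hQ2]))
    simp only [sum_add_distrib, sum_const, card_range, nsmul_eq_mul, sieveCost,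
      ← sum_mul, ← mul_sum, ctx_lam]
    have h1 : ∑ k ∈ range (P.Q - 2), (P.B / (k + 2) : ℕ) ≤ P.B * P.N.size := by
      have h2 := sum_div_le P.B ((P.N.size + 1) / 2)
      change ∑ q ∈ range (P.Q - 1), _ ≤ _ at h2
      rw [show P.Q - 1 = P.Q - 2 + 1 by omega, sum_range_succ'] at h2
      have h3 : 1 ≤ P.N.size := Nat.size_pos.2 hN
      exact (Nat.le_add_right _ _).trans (h2.trans (Nat.mul_le_mul_left _ (by omega)))
    have h1' : ∑ k ∈ range (P.Q - 2), ((P.B / (k + 2) : ℕ) : ℝ) ≤ P.B * P.N.size := mod_cast h1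
    have h5 : ((P.Q - 2 : ℕ) : ℝ) ≤ P.Q := mod_cast Nat.sub_le _ _
    have h7 := bc_le_cellCost P.ctx P.lam
    have h9 : modCost P.ctx P.lam = cellCost P.ctx P.lam / 2 := by unfold cellCost; ring
    have hB1 : (1 : ℝ) ≤ P.B := mod_cast P.one_le_B
    have hQ2' : (2 : ℝ) ≤ P.Q := mod_cast hQ2
    rw [h9]
    set X := cellCost P.ctx P.lam
    set y := bc P.ctx P.lam
    have hX : 0 < X := by linarith
    have g1 := mul_le_mul_of_nonneg_right h5 hX.le
    have g2 := mul_le_mul_of_nonneg_right h5 hpos.le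
    have g3 := mul_le_mul_of_nonneg_right h1' hpos.le
    have g4 := mul_le_mul_of_nonneg_left h7 (show 0 ≤ (P.B : ℝ) * P.N.size by positivity)
    have g5 := mul_le_mul_of_nonneg_right hB1 hX.le
    have g6 := mul_le_mul_of_nonneg_right hQ2' hX.le
    have g7 := mul_le_mul_of_nonneg_left h7 (show 0 ≤ (P.Q : ℝ) by positivity)
    have g8 : 0 ≤ (P.B * P.N.size : ℝ) * X := by positivity
    push_cast
    linarith

/-! ### The tree of moduli -/

lemma cap_four (v : ℕ) : P.cap 4 v = P.nodeCap v := by simp [cap]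

lemma nodeCap_node {v : ℕ} (h : 1 ≤ v) (hv : v < 2 * P.B) : P.nodeCap v = leaves P.b v * P.lam := by
  unfold nodeCap
  rw [if_neg (by omega)]

/-- The modulus at the leaf that belongs to `k`. -/
def modulus (P : Par) (k : ℕ) : ℕ := if k ∈ P.primes then k else 1

lemma mem_primes {k : ℕ} : k ∈ P.primes ↔ k ≤ P.N ∧ k.Prime ∧ k ≠ 2 := by
  simp [primes]

lemma not_marked {k : ℕ} (hk : k ≤ P.N) (h2 : 2 < k) : ¬ Marked P.Q k ↔ k.Prime := by
  constructor
  · intro h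
    by_contra hp
    have h1 := Nat.minFac_sq_le_self (by omega) hp
    refine h ⟨k.minFac, (Nat.minFac_prime (by omega)).two_le, ?_, Nat.minFac_dvd k, ?_⟩
    · by_contra hq
      have h3 : P.Q ^ 2 ≤ k := (Nat.pow_le_pow_left (not_lt.1 hq) 2).trans h1
      have h4 : 2 ^ P.N.size ≤ P.Q ^ 2 := by
        unfold Q
        rw [← pow_mul]
        exact Nat.pow_le_pow_right (by norm_num) (by omega)
      have := Nat.lt_size_self P.N
      omega
    · have := (Nat.minFac_prime (show k ≠ 1 by omega)).two_le
      nlinarith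
  · rintro hp ⟨q, h1, -, h3, h4⟩
    rcases (Nat.dvd_prime hp).1 h3 with h | h <;> omega

lemma one_le_modulus (k : ℕ) : 1 ≤ P.modulus k := by
  unfold modulus
  split_ifs with h
  exacts [(mem_primes.1 h).2.1.one_le, le_rfl]

lemma modulus_lt (k : ℕ) : P.modulus k < 2 ^ P.lam := by
  have h1 := Nat.lt_size_self P.N
  have h2 : 2 ^ P.N.size ≤ 2 ^ P.lam :=
    Nat.pow_le_pow_right (by norm_num) (by have := P.lam_ge; omega)
  have := P.one_le_N
  unfold modulus
  split_ifs with h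
  · have := (mem_primes.1 h).1; omega
  · omega

lemma modulus_of_marked {k : ℕ} {z : ℤ} (h : Indicates z (Marked P.Q k)) :
    (if 0 < z then (1 : ℤ) else if 0 < (P.N : ℤ) + 1 - k then if 0 < (k : ℤ) - 2 then (k : ℤ) else 1 else 1)
      = P.modulus k := by
  unfold modulus
  by_cases hm : Marked P.Q k
  · rw [h.1 hm, if_pos (by norm_num), if_neg]
    · simp
    · intro hk
      have := mem_primes.1 hk
      rcases Nat.lt_or_ge 2 k with h2 | h2
      · exact (not_marked this.1 h2).2 this.2.1 hm
      · have := this.2.1.two_le; omega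
  · rw [h.2 hm, if_neg (by norm_num)]
    by_cases hN : k ≤ P.N
    · rw [if_pos (by omega)]
      by_cases h2 : 2 < k
      · rw [if_pos (by omega), if_pos (mem_primes.2 ⟨hN, (not_marked hN h2).1 hm, by omega⟩)]
      · rw [if_neg (by omega), if_neg]
        · simp
        · intro hk
          have := mem_primes.1 hk
          have := this.2.1.two_le
          omega
    · rw [if_neg (by omega), if_neg (fun hk => hN (mem_primes.1 hk).1)]
      simp

/-- The tree of moduli for the block from `lo` on. -/
def modTree (P : Par) (lo v : ℕ) : ℤ := heap P.B (fun i => (P.modulus (lo + i) : ℤ)) v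

lemma modTree_bounds (lo : ℕ) {v : ℕ} (h : 1 ≤ v) (hv : v < 2 * P.B) :
    0 < P.modTree lo v ∧ P.modTree lo v < 2 ^ (leaves P.b v * P.lam) := by
  refine heap_induction (B := P.B) (p := fun v => 0 < P.modTree lo v ∧
    P.modTree lo v < 2 ^ (leaves P.b v * P.lam)) (fun i hi => ?_) (fun v h1 h2 h3 h4 => ?_) v h hv
  · rw [modTree, heap_leaf, B, leaves_leaf hi, one_mul]
    exact ⟨mod_cast P.one_le_modulus _, mod_cast P.modulus_lt _⟩
  · have h5 := leaves_children h1 h2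
    rw [modTree, heap_node _ h1 h2]
    refine ⟨mul_pos h3.1 h4.1, ?_⟩
    have : leaves P.b v * P.lam = leaves P.b (2 * v) * P.lam + leaves P.b (2 * v + 1) * P.lam := by
      rw [← add_mul]; congr 1; omega
    rw [this, pow_add]
    exact mul_lt_mul'' h3.2 h4.2 h3.1.le h4.1.le

lemma bits_modTree (lo : ℕ) {v : ℕ} (h : 1 ≤ v) (hv : v < 2 * P.B) :
    bits (P.modTree lo v) ≤ leaves P.b v * P.lam :=
  bits_le_of_lt (modTree_bounds lo h hv).1.le (modTree_bounds lo h hv).2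

/-- The program that computes the tree of moduli for the block from the variable `34` on. -/
def modTreeProg : Program := blk [sieveProg,
  tabDot 4 (.var 5) 1 (.var 5) 1 (.ite (.get 8 (.var 37)) 1 (.ite (.var 0 + 1 - (.var 34 + .var 37))
    (.ite (.var 34 + .var 37 - 2) (.var 34 + .var 37) 1) 1)),
  forLoop 10 (.var 5 - 1) (put 4 (.var 5 - 1 - .var 10)
    (.get 4 (2 * (.var 5 - 1 - .var 10)) * .get 4 (2 * (.var 5 - 1 - .var 10) + 1)))]

/-- The time for a tree of moduli. -/
noncomputable def modTreeCost (P : Par) : ℝ := P.sieveCost + 16 * P.B * cellCost P.ctx P.lam +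
  2 * (P.b + 1) * bc P.ctx (P.B * P.lam)

lemma does_modTree {lo : ℕ} (hs : Holds P s) (h34 : s.v 34 = lo) (hlo : lo ≤ 3 * P.N + 1)
    (hR : ∀ s', Frame [10, 11] [4, 8] s s' →
      (∀ v, 1 ≤ v → v < 2 * P.B → s'.a 4 v = P.modTree lo v) →
      s'.a 4 0 = s.a 4 0 → s'.a 4 (2 * P.B) = s.a 4 (2 * P.B) → R s') :
    Does P.ctx modTreeProg s P.modTreeCost R := by
  have hpos := bc_pos P.ctx P.lam
  have hbm := bc_le_cellCost P.ctx P.lam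
  have h8 := P.bc_eight_le
  have hB := P.B_le
  have hN := P.one_le_N
  have hB1 := P.one_le_B
  refine .cons (does_sieve hs h34 hlo fun s1 hf1 hm1 => ?_)
  have hs1 := hs.frame hf1
  have e34 : s1.v 34 = lo := by rw [hf1.v 34, h34]
  refine .cons (does_tabDot (L := P.lam) (B := P.B) (N1 := 1) (N2 := P.B) (N3 := 1)
    (f := fun _ k _ => (P.modulus (lo + k) : ℤ)) ?_ (fun r hr k hk _ => ⟨by norm_num, ?_, ?_⟩)
    fun s2 ha2 hv2 => ?_)
  · refine ⟨le_rfl, (bet_of_le_top P.lam_le_top).1, ⟨bits_one, bits_B, bits_one⟩, fun s' h => ?_, fun r _ k hk j _ s' h _ h37 _ => ⟨?_, fun hf => ?_⟩,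
      fun r _ k hk n hn => ?_, by decide, by decide⟩
    · simp [@h.v, hs1.v5]
    · rw [← modulus_of_marked (hm1 k hk)]
      simp only [Ex.evals, h37,
        h.v 34, h.v 0, hs1.v0, e34, Int.toNat_natCast,
        h.arr 8 k (by omega)]
      push_cast
      rfl
    · exact hf.leaf (by decide)
    · exact bits_sum_one hn (bits_le_of_lt (by positivity) (mod_cast P.modulus_lt _))
  · obtain rfl : r = 0 := by omega
    change _ < P.len 4
    simp [len]; omega
  · obtain rfl : r = 0 := by omega
    change _ ≤ P.cap 4 _
    rw [cap_four, nodeCap_node (by omega) (by omega), sum_range_one]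
    rw [zero_mul, add_zero, show leaves P.b (P.B + k) = 1 from leaves_leaf hk, one_mul]
    exact bits_le_of_lt (by positivity) (mod_cast P.modulus_lt _)
  have hf2 : Frame [10, 11] [4, 8] s s2 := (hf1.mono (A' := [4, 8])).of_fill hv2 ha2
  have hs2 := hs.frame hf2
  have hleaf : ∀ i < P.B, s2.a 4 (P.B + i) = P.modTree lo (P.B + i) := by
    intro i hi
    rw [ha2, fill_eq (by omega), modTree, heap_leaf]
    simp [Nat.mod_eq_of_lt hi]
  have hout : ∀ v, v < P.B ∨ 2 * P.B ≤ v → s2.a 4 v = s.a 4 v := by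
    rintro v (hv | hv)
    · rw [ha2, fill_of_lt hv, hf1.a 4]
    · rw [ha2, fill_of_le (by omega), hf1.a 4]
  refine .cons (.forLoop (P.B - 1)
    P.short_N (I := fun k s' => s'.v 10 = k ∧ Frame [10, 11] [4, 8] s s' ∧
      (∀ v, P.B - k ≤ v → v < 2 * P.B → s'.a 4 v = P.modTree lo v) ∧
      ∀ v, v = 0 ∨ 2 * P.B ≤ v → s'.a 4 v = s.a 4 v)
    (T := fun k => bc P.ctx (leaves P.b (P.B - 1 - k) * P.lam)) ?_ ?_ ?_ ?_)
  · refine ⟨by simp, hf2.set, fun v h1 h2 => ?_, fun v hv => ?_⟩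
    · obtain ⟨i, rfl⟩ := Nat.exists_eq_add_of_le h1
      rw [St.set_a]
      exact hleaf i (by omega)
    · rw [St.set_a]
      exact hout v (by omega)
  · exact fun k hk s' h => ⟨h.1, by simp only [Ex.evals, (hs.frame h.2.1).v5]; omega⟩
  · intro k hk s' h _
    set v := P.B - 1 - k with hv
    have hs' := hs.frame h.2.1
    have hv1 : 1 ≤ v := by omega
    have hvB : v < P.B := by omega
    have hlv := one_le_leaves P.b v
    have hlam : P.lam ≤ leaves P.b v * P.lam := Nat.le_mul_of_pos_left _ hlv
    have hch := leaves_children hv1 hvB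
    have ev : (Ex.var 5 - 1 - Ex.var 10).eval s' = v := by
      simp only [Ex.evals, hs'.v5, h.1]; omega
    have t1 : ((2 : ℤ) * v).toNat = 2 * v := by omega
    have t2 : ((2 : ℤ) * v + 1).toNat = 2 * v + 1 := by omega
    have m1 := h.2.2.1 (2 * v) (by omega) (by omega)
    have m2 := h.2.2.1 (2 * v + 1) (by omega) (by omega)
    have htop := leaves_mul_le (P := P) (X := P.lam) hv1 (by unfold W; omega)
    have hle : ∀ u, leaves P.b u ≤ leaves P.b v → leaves P.b u * P.lam ≤ leaves P.b v * P.lam :=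
      fun u hu => Nat.mul_le_mul_right _ hu
    have hnode : P.modTree lo v = P.modTree lo (2 * v) * P.modTree lo (2 * v + 1) :=
      heap_node _ hv1 hvB
    refine .put (L := leaves P.b v * P.lam) v (P.modTree lo v)
      (P.eight_le_lam.trans hlam) (bet_of_le_top (by omega)).2 (fun hf => ?_) (fun hf => ?_) ev ?_
      (fun _ => ⟨by norm_num, ?_, ?_⟩) ⟨by simpa using h.1, by simp, ?_, ?_, ?_⟩
    · exact (hf.leaf (by decide)).mono hlam
    · refine (Ex.leaf_mul ..).2 ⟨(Ex.leaf_get ..).2 ⟨(hf.leaf (by decide)).mono hlam, ?_⟩,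
        (Ex.leaf_get ..).2 ⟨(hf.leaf (by decide)).mono hlam, ?_⟩⟩
      · rw [Ex.eval_mul, ev, Ex.eval_ofNat, t1, m1]
        exact (bits_modTree lo (by omega) (by omega)).trans (hle _ (by omega))
      · rw [Ex.eval_add, Ex.eval_mul, ev, Ex.eval_ofNat, Ex.eval_ofNat, t2, m2]
        exact (bits_modTree lo (by omega) (by omega)).trans (hle _ (by omega))
    · rw [Ex.eval_mul, Ex.eval_get, Ex.eval_get, Ex.eval_add, Ex.eval_mul, ev, Ex.eval_ofNat,
        Ex.eval_ofNat, t1, t2, m1, m2, hnode]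
    · change _ < P.len 4
      simp [len]; omega
    · change _ ≤ P.cap 4 _
      rw [cap_four, nodeCap_node hv1 (by omega)]
      exact bits_modTree lo hv1 (by omega)
    · exact h.2.1.put.set
    · intro u hu1 hu2
      rw [St.set_a, St.put_a]
      split_ifs with hc
      · rw [hc.2]
      · exact h.2.2.1 u (by omega) hu2
    · intro u hu
      rw [St.set_a, St.put_a, if_neg (by omega)]
      exact h.2.2.2 u hu
  · intro s' h
    refine .nil ?_ (hR s' h.2.1 (fun v h1 h2 => h.2.2.1 v (by omega) h2) (h.2.2.2 0 (by simp))
      (h.2.2.2 _ (by simp)))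
    have h1 : ∑ k ∈ range (P.B - 1), bc P.ctx (leaves P.b (P.B - 1 - k) * P.lam) ≤
        2 * (P.b + 1) * bc P.ctx (P.B * P.lam) :=
      (sum_bc_nodes P.ctx P.b (by have := P.eight_le_lam; omega)).1
    have h2 : ((P.B - 1 : ℕ) : ℝ) ≤ P.B := mod_cast Nat.sub_le _ _
    have h3 : (1 : ℝ) ≤ P.B := mod_cast hB1
    have h4 : (P.B : ℝ) * (800 * bc P.ctx P.lam) ≤ P.B * cellCost P.ctx P.lam := by gcongr
    have h5 : ((P.B - 1 : ℕ) : ℝ) * bc P.ctx P.lam ≤ P.B * bc P.ctx P.lam := by gcongr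
    have h6 : 1 * cellCost P.ctx P.lam ≤ P.B * cellCost P.ctx P.lam :=
      mul_le_mul_of_nonneg_right h3 (cellCost_pos _ _).le
    simp only [ctx_lam, modTreeCost] at *
    push_cast
    linarith

end Par

/-! ### The tree of matrices -/

lemma mul_abs_sum_le {D n : ℕ} {x y : ℕ → ℤ} {a b : ℤ} (hD : 0 < D) (hn : n ≤ D)
    (hx : ∀ j < D, D * |x j| ≤ a) (hy : ∀ j < D, D * |y j| ≤ b) :
    D * |∑ j ∈ range n, x j * y j| ≤ a * b := by
  have hD' : (0 : ℤ) < D := mod_cast hD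
  have ha : 0 ≤ a := (mul_nonneg hD'.le (abs_nonneg (x 0))).trans (hx 0 hD)
  have hb : 0 ≤ b := (mul_nonneg hD'.le (abs_nonneg (y 0))).trans (hy 0 hD)
  refine le_of_mul_le_mul_left ?_ hD'
  calc (D : ℤ) * (D * |∑ j ∈ range n, x j * y j|)
      ≤ D * (D * ∑ j ∈ range n, |x j * y j|) := by
        gcongr; exact abs_sum_le_sum_abs _ _
    _ = ∑ j ∈ range n, (D * |x j|) * (D * |y j|) := by
        rw [mul_sum, mul_sum]
        exact sum_congr rfl fun j _ => by rw [abs_mul]; ring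
    _ ≤ ∑ _j ∈ range n, a * b := by
        refine sum_le_sum fun j hj => ?_
        have hj : j < D := (mem_range.1 hj).trans_le hn
        exact mul_le_mul (hx j hj) (hy j hj) (by positivity) ha
    _ = n * (a * b) := by simp
    _ ≤ D * (a * b) := by gcongr

lemma bits_le_of_mul_abs {D L : ℕ} {z : ℤ} (hD : 2 ≤ D) (h : D * |z| ≤ 2 ^ L) : bits z ≤ L := by
  rw [bits_le_iff]
  have hD' : (2 : ℤ) ≤ D := mod_cast hD
  have h0 := abs_nonneg z
  have h1 : (0 : ℤ) < 2 ^ L := by positivity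
  nlinarith

/-- Square matrices. -/
abbrev Mat (D : ℕ) (R : Type) := Matrix (Fin D) (Fin D) R

/-- The array `a` holds the matrix `X` as its block number `v`. -/
def MatAt (s : St) (a v : ℕ) {D : ℕ} (X : Mat D ℤ) : Prop :=
  ∀ r k : Fin D, s.a a (v * (D * D) + r * D + k) = X r k

lemma index_lt {D r k : ℕ} (hr : r < D) (hk : k < D) : r * D + k < D * D := by
  calc r * D + k < r * D + D := by omega
    _ = (r + 1) * D := by ring
    _ ≤ D * D := Nat.mul_le_mul_right _ hr

lemma index_div {D u r k : ℕ} (hr : r < D) (hk : k < D) : (u * (D * D) + r * D + k) / (D * D) = u := by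
  have h := index_lt hr hk
  rw [add_assoc, mul_comm u, Nat.mul_add_div (by omega), Nat.div_eq_of_lt h, add_zero]

lemma index_ne {D u v r k : ℕ} (hr : r < D) (hk : k < D) (h : u ≠ v) :
    ¬ (v * (D * D) ≤ u * (D * D) + r * D + k ∧ u * (D * D) + r * D + k < v * (D * D) + D * D) := by
  have h1 := index_lt hr hk
  rintro ⟨h2, h3⟩
  rcases Nat.lt_or_ge u v with h4 | h4
  · have := Nat.mul_le_mul_right (D * D) (show u + 1 ≤ v by omega)
    rw [add_mul] at this; omega
  · have := Nat.mul_le_mul_right (D * D) (show v + 1 ≤ u by omega)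
    rw [add_mul] at this; omega

lemma MatAt.of_fill {s s' : St} {a v D : ℕ} {X : Mat D ℤ} {w : ℕ → ℕ → ℤ}
    (ha : s'.a = fill s.a a (v * (D * D)) (D * D) (fun t => w (t / D) (t % D)))
    (hw : ∀ r k : Fin D, w r k = X r k) : MatAt s' a v X := fun r k => by
  rw [ha, fill_table r.2 k.2, hw]

lemma MatAt.of_fill_ne {s s' : St} {a a' u v D : ℕ} {X : Mat D ℤ} {w : ℕ → ℤ}
    (h : MatAt s a u X) (ha : s'.a = fill s.a a' (v * (D * D)) (D * D) w) (huv : a ≠ a' ∨ u ≠ v) :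
    MatAt s' a u X := fun r k => by
  rw [ha]
  unfold fill
  rw [if_neg, h r k]
  rintro ⟨h1, h2⟩
  rcases huv with h3 | h3
  · exact h3 h1
  · exact index_ne r.2 k.2 h3 h2

lemma MatAt.congr {s s' : St} {a v D : ℕ} {X : Mat D ℤ} (h : MatAt s a v X)
    (ha : s'.a a = s.a a) : MatAt s' a v X := fun r k => by rw [ha, h r k]

/-- The entry with the indices in the variables `r` and `k` of the matrix in the array `a` from `i`
on. -/
def entry (a : ℕ) (i : Ex) (r k : ℕ) : Ex := .get a (i + .var r * .var 2 + .var k)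

namespace Par
variable {P : Par} {s : St} {R : St → Prop}

lemma entry_spec {a r k u j l L : ℕ} {i : Ex} {z : ℤ} (hi : i.ok = true) (h2 : s.v 2 = P.D)
    (he : i.eval s = (u * (P.D * P.D) : ℕ)) (hr : s.v r = j) (hk : s.v k = l)
    (hz : s.a a (u * (P.D * P.D) + j * P.D + l) = z) (hL : P.lam ≤ L) (hb : bits z ≤ L)
    (hrk : r < 40 ∧ k < 40 := by norm_num) :
    (entry a i r k).eval s = z ∧ (Fit P.ctx s → (entry a i r k).Leaf L s) := by
  have e : (i + .var r * .var 2 + .var k).eval s = (u * (P.D * P.D) + j * P.D + l : ℕ) := by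
    simp [he, h2, hr, hk]
  have hok : (i + .var r * .var 2 + .var k).ok = true := by
    change (i.ok && (decide (r < 40) && true) && decide (k < 40)) = true
    simp [hi, hrk]
  unfold entry
  rw [Ex.eval_get, Ex.leaf_get, e, Int.toNat_natCast, hz]
  exact ⟨rfl, fun hf => ⟨(hf.leaf hok).mono hL, hb⟩⟩

/-- The time for the nodes of a tree of matrices. -/
lemma sum_cellCost : ∑ k ∈ range (P.B - 1), cellCost P.ctx (leaves P.b (P.B - 1 - k) * P.W) ≤
      1600 * (P.b + 1) * bc P.ctx (P.B * (160 * P.W)) ∧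
    ∑ k ∈ range (P.B - 1), cellCost P.ctx (leaves P.b (k + 1) * P.W) ≤
      1600 * (P.b + 1) * bc P.ctx (P.B * (160 * P.W)) := by
  have e : ∀ u, cellCost P.ctx (u * P.W) = 800 * bc P.ctx (u * (160 * P.W)) := fun u => by
    unfold cellCost modCost
    rw [mul_left_comm]; ring_nf
  have h := sum_bc_nodes P.ctx P.b (Y := 160 * P.W)
    (by have := P.lam_le_W; have := P.eight_le_lam; omega)
  simp only [e, ← mul_sum, B]
  exact ⟨by linarith [h.1], by linarith [h.2]⟩

lemma cube_bounds : 3 * (((P.D : ℝ) + 1) * (P.D + 1)) ≤ (P.D + 1) ^ 3 ∧ 27 ≤ ((P.D : ℝ) + 1) ^ 3 := by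
  have h : (2 : ℝ) ≤ P.D := mod_cast P.hD
  constructor <;> nlinarith [mul_nonneg (sub_nonneg.2 h) (sub_nonneg.2 h)]

/-- The entry of the transition matrix number `k` of the recurrence for the coefficients of powers
of `h`. -/
def stepEntry (P : Par) (k r j : ℕ) : ℤ :=
  if 0 < j then if j = r + 1 then 2 * k * P.h 0 else 0 else (r + 1 - 2 * k) * P.h (r + 1)

/-- The transition matrix number `k`. -/
def step (P : Par) (k : ℕ) : Mat P.D ℤ := Matrix.of fun r j => P.stepEntry k r j

/-- The tree of products of transition matrices for the block from `lo` on. -/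
def matTree (P : Par) (lo v : ℕ) : Mat P.D ℤ :=
  heap P.B (fun i => P.step (lo + i)) v

lemma stepEntry_bound {k r : ℕ} (j : ℕ) (hk : k ≤ 4 * P.N + 1) (hr : r < P.D) :
    P.D * |P.stepEntry k r j| ≤ 2 ^ P.W := by
  have key : ∀ z : ℤ, |z| ≤ P.D + 8 * P.N + 4 → ∀ i, P.D * |z * P.h i| ≤ 2 ^ P.W := by
    intro z hz i
    have h1 : bits (P.D * z) ≤ P.lam := by
      refine P.short ?_
      rw [abs_mul, Nat.abs_cast]
      calc (P.D : ℤ) * |z| ≤ (P.D + 2) * (8 * (P.N + 1) * (P.D + 2)) := by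
            refine mul_le_mul (by omega) (hz.trans ?_) (abs_nonneg _) (by positivity)
            linarith [show (0 : ℤ) ≤ P.N * P.D by positivity]
        _ = 8 * (P.N + 1) ^ 1 * (P.D + 2) ^ 2 := by ring
        _ ≤ _ := by gcongr <;> omega
    have h2 := bits_le_iff.1 h1
    have h3 := bits_le_iff.1 (P.hh i)
    rw [abs_mul, ← mul_assoc, ← Nat.abs_cast, ← abs_mul]
    calc |(P.D : ℤ) * z| * |P.h i| ≤ 2 ^ P.lam * 2 ^ P.lf := by gcongr
      _ = 2 ^ (P.lam + P.lf) := by rw [pow_add]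
      _ ≤ 2 ^ P.W := pow_le_pow_right₀ (by norm_num) (by unfold W; omega)
  unfold stepEntry
  split_ifs
  · exact key _ (by rw [abs_of_nonneg (by positivity)]; omega) _
  · rw [abs_zero, mul_zero]; positivity
  · exact key _ (by rw [abs_le]; omega) _

lemma matTree_bound {lo : ℕ} (hlo : lo ≤ 3 * P.N + 1) {v : ℕ} (h : 1 ≤ v) (hv : v < 2 * P.B)
    (r j : Fin P.D) : P.D * |P.matTree lo v r j| ≤ 2 ^ (leaves P.b v * P.W) := by
  have hD : 0 < P.D := by have := P.hD; omega
  have hB := P.B_le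
  revert r j
  refine heap_induction (B := P.B) (p := fun v => ∀ r j : Fin P.D,
    P.D * |P.matTree lo v r j| ≤ 2 ^ (leaves P.b v * P.W)) (fun i hi r j => ?_)
    (fun v h1 h2 h3 h4 r j => ?_) v h hv
  · rw [matTree, heap_leaf, B, leaves_leaf hi, one_mul]
    exact stepEntry_bound _ (by omega) r.2
  · have h5 := leaves_children h1 h2
    have e : leaves P.b v * P.W = leaves P.b (2 * v) * P.W + leaves P.b (2 * v + 1) * P.W := by
      rw [← add_mul]; congr 1; omega
    have hnode : P.matTree lo v = P.matTree lo (2 * v) * P.matTree lo (2 * v + 1) := heap_node _ h1 h2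
    rw [hnode, Matrix.mul_apply, e, pow_add]
    have := mul_abs_sum_le (n := P.D) (x := fun i => if hi : i < P.D then P.matTree lo (2 * v) r ⟨i, hi⟩ else 0)
      (y := fun i => if hi : i < P.D then P.matTree lo (2 * v + 1) ⟨i, hi⟩ j else 0) hD le_rfl
      (fun i hi => by simpa [hi] using h3 r ⟨i, hi⟩) (fun i hi => by simpa [hi] using h4 ⟨i, hi⟩ j)
    rw [sum_range] at this
    simpa using this

lemma bits_matTree {lo : ℕ} (hlo : lo ≤ 3 * P.N + 1) {v : ℕ} (h : 1 ≤ v) (hv : v < 2 * P.B)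
    (r j : Fin P.D) : bits (P.matTree lo v r j) ≤ leaves P.b v * P.W :=
  bits_le_of_mul_abs P.hD (matTree_bound hlo h hv r j)

lemma cap_five {u r k : ℕ} (hr : r < P.D) (hk : k < P.D) :
    P.cap 5 (u * (P.D * P.D) + r * P.D + k) = leaves P.b u * P.W := by
  simp [cap, index_div hr hk]

lemma lt_len_five {u r k : ℕ} (hu : u < 2 * P.B) (hr : r < P.D) (hk : k < P.D) :
    u * (P.D * P.D) + r * P.D + k < P.len 5 := by
  have := Nat.mul_le_mul_right (P.D * P.D) (show u + 1 ≤ 2 * P.B from hu)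
  have h1 := index_lt hr hk
  rw [add_mul] at this
  simp only [len]
  norm_num
  omega

/-- The program that computes the tree of matrices for the block from the variable `34` on. -/
def matTreeProg : Program := blk [
  forLoop 10 (.var 5) (tabDot 5 ((.var 5 + .var 10) * .var 33) (.var 2) (.var 2) 1
    (.ite (.var 37) (.ite (.var 37 - .var 36) (.ite (.var 36 + 2 - .var 37)
      (2 * (.var 34 + .var 10) * .get 2 0) 0) 0)
      ((.var 36 + 1 - 2 * (.var 34 + .var 10)) * .get 2 (.var 36 + 1)))),
  forLoop 10 (.var 5 - 1) (blk [asg 11 (.var 5 - 1 - .var 10),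
    tabDot 5 (.var 11 * .var 33) (.var 2) (.var 2) (.var 2)
      (entry 5 (2 * .var 11 * .var 33) 36 38 *
        entry 5 ((2 * .var 11 + 1) * .var 33) 38 37)])]

/-- The time for a tree of matrices. -/
noncomputable def matTreeCost (P : Par) : ℝ :=
  ((P.D : ℝ) + 1) ^ 3 * (8 * P.B * cellCost P.ctx P.W + 1600 * (P.b + 1) * bc P.ctx (P.B * (160 * P.W)))

lemma does_matLeaf {lo i : ℕ} (hs : Holds P s) (h34 : s.v 34 = lo) (hlo : lo ≤ 3 * P.N + 1)
    (h10 : s.v 10 = i) (hi : i < P.B)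
    (hR : ∀ s', s'.a = fill s.a 5 ((P.B + i) * (P.D * P.D)) (P.D * P.D)
      (fun t => P.stepEntry (lo + i) (t / P.D) (t % P.D)) → Same s s' → R s') :
    Does P.ctx (tabDot 5 ((.var 5 + .var 10) * .var 33) (.var 2) (.var 2) 1
      (.ite (.var 37) (.ite (.var 37 - .var 36) (.ite (.var 36 + 2 - .var 37)
        (2 * (.var 34 + .var 10) * .get 2 0) 0) 0)
        ((.var 36 + 1 - 2 * (.var 34 + .var 10)) * .get 2 (.var 36 + 1)))) s
      ((P.D + 1) * (P.D + 1) * ((1 : ℕ) + 1) * cellCost P.ctx P.W) R := by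
  have hW := P.lam_le_W
  have hB := P.B_le
  have hl : leaves P.b (P.B + i) = 1 := leaves_leaf hi
  have htop : P.W ≤ P.top := by
    have := leaves_mul_le (P := P) (v := P.B + i) (X := P.W) (by have := P.one_le_B; omega) le_rfl
    rw [hl] at this; omega
  have hb : ∀ r < P.D, ∀ k, bits (P.stepEntry (lo + i) r k) ≤ P.W := fun r hr k =>
    bits_le_of_mul_abs P.hD (stepEntry_bound k (by omega) hr)
  refine does_tabDot (L := P.W) (B := (P.B + i) * (P.D * P.D)) (N1 := P.D) (N2 := P.D) (N3 := 1)
    (f := fun r k _ => P.stepEntry (lo + i) r k) ?_ (fun r hr k hk _ => ⟨by norm_num, ?_, ?_⟩)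
    fun s' ha hv => ?_
  · refine ⟨by simp only [ctx_lam]; omega, (bet_of_le_top htop).1, ⟨bits_D, bits_D, bits_one⟩, fun s' h => ?_, fun r hr k hk j _ s' h h36 h37 _ => ⟨?_, fun hf => ?_⟩,
      fun r hr k hk n hn => bits_sum_one hn (hb r hr k), by decide, by decide⟩
    · simp [@h.v, hs.v5, hs.v2, h10, hs.v33]
    · have t1 : ((r : ℤ) + 1).toNat = r + 1 := by omega
      have h2 : ∀ j, s'.a 2 j = P.h j := fun j => by rw [h.arr 2 j (by omega), hs.h]
      simp only [Ex.evals, h36, h37, h.v 34, h34, h.v 10, h10, h2, t1,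
        stepEntry, Int.toNat_zero]
      by_cases hk0 : 0 < k
      · rw [if_pos (by omega), if_pos hk0]
        by_cases hkr : k = r + 1
        · rw [if_pos (by omega), if_pos (by omega), if_pos hkr]; push_cast; rfl
        · rw [if_neg hkr]
          split_ifs <;> first | rfl | omega
      · rw [if_neg (by omega), if_neg hk0]; push_cast; ring
    · have h2 : ∀ x < 40, bits (s'.v x) ≤ P.W := fun x hx => (fit_small hf hx).trans (by omega)
      have h3 : ∀ j, bits (s'.a 2 j) ≤ P.W := fun j => by
        rw [h.arr 2 _ (by omega), hs.h]; exact (P.hh j).trans (by unfold W; omega)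
      simp [h2, h3]
  · exact lt_len_five (by omega) hr hk
  · change _ ≤ P.cap 5 _
    rw [cap_five hr hk, hl, one_mul, sum_range_one]
    exact hb r hr k
  · exact hR s' (by rw [ha]; congr 1; funext t; simp) hv

lemma does_matNode {lo v : ℕ} (hs : Holds P s) (hlo : lo ≤ 3 * P.N + 1) (h11 : s.v 11 = v)
    (hv : 1 ≤ v) (hvB : v < P.B) (hl : MatAt s 5 (2 * v) (P.matTree lo (2 * v)))
    (hr : MatAt s 5 (2 * v + 1) (P.matTree lo (2 * v + 1)))
    (hR : ∀ s', MatAt s' 5 v (P.matTree lo v) →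
      (∀ u, u ≠ v → ∀ X : Mat P.D ℤ, MatAt s 5 u X → MatAt s' 5 u X) →
      Frame [] [5] s s' → R s') :
    Does P.ctx (tabDot 5 (.var 11 * .var 33) (.var 2) (.var 2) (.var 2)
      (entry 5 (2 * .var 11 * .var 33) 36 38 *
        entry 5 ((2 * .var 11 + 1) * .var 33) 38 37)) s
      ((P.D + 1) * (P.D + 1) * (P.D + 1) * cellCost P.ctx (leaves P.b v * P.W)) R := by
  have hW := P.lam_le_W
  have hlv := one_le_leaves P.b v
  have hWv : P.W ≤ leaves P.b v * P.W := Nat.le_mul_of_pos_left _ hlv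
  have hch := leaves_children hv hvB
  have hD : 0 < P.D := by have := P.hD; omega
  have hle : ∀ u, leaves P.b u ≤ leaves P.b v → leaves P.b u * P.W ≤ leaves P.b v * P.W :=
    fun u hu => Nat.mul_le_mul_right _ hu
  have e : leaves P.b v * P.W = leaves P.b (2 * v) * P.W + leaves P.b (2 * v + 1) * P.W := by
    rw [← add_mul]; congr 1; omega
  have hsum : ∀ r < P.D, ∀ k < P.D, ∀ n ≤ P.D, bits (∑ j ∈ range n,
      s.a 5 (2 * v * (P.D * P.D) + r * P.D + j) * s.a 5 ((2 * v + 1) * (P.D * P.D) + j * P.D + k)) ≤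
      leaves P.b v * P.W := by
    intro r hr' k hk n hn
    refine bits_le_of_mul_abs P.hD ?_
    rw [e, pow_add]
    refine mul_abs_sum_le hD hn (fun j hj => ?_) (fun j hj => ?_)
    · rw [hl ⟨r, hr'⟩ ⟨j, hj⟩]; exact matTree_bound hlo (by omega) (by omega) _ _
    · rw [hr ⟨j, hj⟩ ⟨k, hk⟩]; exact matTree_bound hlo (by omega) (by omega) _ _
  refine does_tabDot (L := leaves P.b v * P.W) (B := v * (P.D * P.D)) (N1 := P.D) (N2 := P.D) (N3 := P.D)
    (f := fun r k j => s.a 5 (2 * v * (P.D * P.D) + r * P.D + j) *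
      s.a 5 ((2 * v + 1) * (P.D * P.D) + j * P.D + k)) ?_ (fun r hr k hk _ => ⟨by norm_num, ?_, ?_⟩)
    fun s' ha hv' => ?_
  · refine ⟨by simp only [ctx_lam]; omega,
      (bet_of_le_top (by have := leaves_mul_le (P := P) hv le_rfl; omega)).1, ⟨bits_D, bits_D, bits_D⟩, fun s' h => ?_,
      fun r hr' k hk j hj s' h h36 h37 h38 => ?_, hsum, by decide, by decide⟩
    · simp [@h.v, hs.v2, h11, hs.v33]
    · have n1 := h.arr 5 (2 * v * (P.D * P.D) + r * P.D + j)
        fun hh => index_ne hr' hj (show 2 * v ≠ v by omega) hh.2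
      have n2 := h.arr 5 ((2 * v + 1) * (P.D * P.D) + j * P.D + k)
        fun hh => index_ne hj hk (show 2 * v + 1 ≠ v by omega) hh.2
      have b1 := entry_spec (L := leaves P.b v * P.W) (i := 2 * .var 11 * .var 33) (by decide)
        (by simp [@h.v, hs.v2]) (by simp [@h.v, h11, hs.v33]) h36 h38 n1 (by omega) (by
          rw [hl ⟨r, hr'⟩ ⟨j, hj⟩]
          exact (bits_matTree hlo (by omega) (by omega) _ _).trans (hle _ (by omega)))
      have b2 := entry_spec (L := leaves P.b v * P.W) (i := (2 * .var 11 + 1) * .var 33) (by decide)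
        (by simp [@h.v, hs.v2]) (by simp [@h.v, h11, hs.v33]) h38 h37 n2 (by omega) (by
          rw [hr ⟨j, hj⟩ ⟨k, hk⟩]
          exact (bits_matTree hlo (by omega) (by omega) _ _).trans (hle _ (by omega)))
      exact ⟨by rw [Ex.eval_mul, b1.1, b2.1], fun hf => (Ex.leaf_mul ..).2 ⟨b1.2 hf, b2.2 hf⟩⟩
  · exact lt_len_five (by omega) hr hk
  · change _ ≤ P.cap 5 _
    rw [cap_five hr hk]
    exact hsum _ hr _ hk _ le_rfl
  · refine hR s' (MatAt.of_fill (w := fun r k => ∑ j ∈ range P.D,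
      s.a 5 (2 * v * (P.D * P.D) + r * P.D + j) * s.a 5 ((2 * v + 1) * (P.D * P.D) + j * P.D + k)) ha
        fun r k => ?_) (fun u hu X hX => hX.of_fill_ne ha (.inr hu))
      ((Frame.refl _ _ s).of_fill hv' ha)
    rw [matTree, heap_node _ hv hvB, Matrix.mul_apply, sum_range]
    exact sum_congr rfl fun j _ => by rw [hl r j, hr j k]; rfl

lemma does_matTree {lo : ℕ} (hs : Holds P s) (h34 : s.v 34 = lo) (hlo : lo ≤ 3 * P.N + 1)
    (hR : ∀ s', Frame [10, 11] [5] s s' →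
      (∀ v, 1 ≤ v → v < 2 * P.B → MatAt s' 5 v (P.matTree lo v)) → R s') :
    Does P.ctx matTreeProg s P.matTreeCost R := by
  have hpos := bc_pos P.ctx P.lam
  have hbm := bc_le_cellCost P.ctx P.lam
  have h8 := P.bc_eight_le
  have hB := P.B_le
  have hN := P.one_le_N
  have hB1 := P.one_le_B
  refine .cons (.forLoop P.B bits_B
    (I := fun k s' => s'.v 10 = k ∧ Frame [10, 11] [5] s s' ∧
      ∀ i < k, MatAt s' 5 (P.B + i) (P.matTree lo (P.B + i)))
    (T := fun k => (P.D + 1) * (P.D + 1) * ((1 : ℕ) + 1) * cellCost P.ctx P.W) ?_ ?_ ?_ fun s1 h1 => ?_)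
  · exact ⟨by simp, (Frame.refl _ _ s).set, by simp⟩
  · exact fun k hk s' h => ⟨h.1, by simp [(hs.frame h.2.1).v5]⟩
  · intro k hk s' h _
    have hs' := hs.frame h.2.1
    refine does_matLeaf hs' (by rw [h.2.1.v 34, h34]) hlo h.1 hk
      fun s2 ha hv => ⟨by rw [hv.v 10, h.1], by simp, (h.2.1.of_fill hv ha).set,
        fun i hi => ?_⟩
    refine MatAt.congr (s := s2) ?_ (by simp)
    rcases Nat.lt_or_ge i k with hik | hik
    · exact (h.2.2 i hik).of_fill_ne ha (.inr (by omega))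
    · obtain rfl : i = k := by omega
      exact MatAt.of_fill (w := fun r j => P.stepEntry (lo + i) r j) ha fun r j => by
        rw [matTree, heap_leaf]; rfl
  have hs1 := hs.frame h1.2.1
  refine .cons (.forLoop (P.B - 1)
    P.short_N (I := fun k s' => s'.v 10 = k ∧ Frame [10, 11] [5] s s' ∧
      ∀ v, P.B - k ≤ v → v < 2 * P.B → MatAt s' 5 v (P.matTree lo v))
    (T := fun k => 2 * bc P.ctx P.lam + (P.D + 1) * (P.D + 1) * (P.D + 1) *
      cellCost P.ctx (leaves P.b (P.B - 1 - k) * P.W)) ?_ ?_ ?_ ?_)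
  · refine ⟨by simp, h1.2.1.set, fun v hv1 hv2 => ?_⟩
    obtain ⟨i, rfl⟩ := Nat.exists_eq_add_of_le hv1
    exact (h1.2.2 i (by omega)).congr (by simp)
  · exact fun k hk s' h => ⟨h.1, by simp only [Ex.evals, (hs.frame h.2.1).v5]; omega⟩
  · intro k hk s' h _
    set v := P.B - 1 - k with hv
    have hs' := hs.frame h.2.1
    refine .cons (.asg_ok (v : ℤ) ?_
      (fun _ => P.short_N) ?_)
    · simp only [Ex.evals, hs'.v5, h.1]; omega
    have hf : Frame [10, 11] [5] s (s'.set 11 v) := h.2.1.set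
    refine .cons (does_matNode (lo := lo) (v := v) (hs.frame hf) hlo (by simp) (by omega) (by omega) ?_ ?_
      fun s2 hm hne hf2 => .nil ?_ ⟨?_, by simp, (hf.trans hf2).set, ?_⟩)
    · exact (h.2.2 _ (by omega) (by omega)).congr (by simp)
    · exact (h.2.2 _ (by omega) (by omega)).congr (by simp)
    · simp only [ctx_lam]; linarith
    · rw [hf2.v 10]; simp [h.1]
    · intro u hu1 hu2
      refine MatAt.congr (s := s2) ?_ (by simp)
      by_cases huv : u = v
      · rw [huv]; exact hm
      · exact hne u huv _ ((h.2.2 u (by omega) hu2).congr (by simp))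
  · intro s' h
    refine .nil ?_ (hR s' h.2.1 fun v h1 h2 => h.2.2 v (by omega) h2)
    have h1 : ((P.B - 1 : ℕ) : ℝ) * bc P.ctx P.lam ≤ P.B * bc P.ctx P.lam := by
      gcongr; exact Nat.sub_le _ _
    have h2 : 1 * bc P.ctx P.lam ≤ P.B * bc P.ctx P.lam := by gcongr; exact_mod_cast hB1
    have hcW : cellCost P.ctx P.lam ≤ cellCost P.ctx P.W := cellCost_mono _ (by have := P.lam_le_W; omega)
    have h4 : (P.B : ℝ) * (800 * bc P.ctx P.lam) ≤ P.B * cellCost P.ctx P.W := by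
      gcongr; linarith
    have hC : 0 ≤ (P.B : ℝ) * cellCost P.ctx P.W := mul_nonneg (by positivity) (cellCost_pos _ _).le
    have g1 := mul_le_mul_of_nonneg_left P.sum_cellCost.1 (show 0 ≤ ((P.D : ℝ) + 1) ^ 3 by positivity)
    have g2 := mul_le_mul_of_nonneg_right P.cube_bounds.1 hC
    have g3 := mul_le_mul_of_nonneg_right P.cube_bounds.2 hC
    simp only [sum_add_distrib, sum_const, card_range, nsmul_eq_mul, ← mul_sum, ctx_lam, matTreeCost]
    push_cast
    linarith

/-! ### The tree of partial products -/

/-- The tree of the products of all matrices that come before a node, each modulo the modulus of the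
node. The product `V` of all matrices before the block enters at the root. -/
def prefTree (P : Par) (lo : ℕ) (V : Mat P.D ℤ) (v : ℕ) :
    Mat P.D ℤ :=
  if v ≤ 1 then V.map (· % P.modTree lo 1)
  else if v % 2 = 0 then (prefTree P lo V (v / 2)).map (· % P.modTree lo v)
  else (prefTree P lo V (v / 2) * P.matTree lo (v - 1)).map (· % P.modTree lo v)
termination_by v
decreasing_by all_goals omega

lemma prefTree_one (lo : ℕ) (V) : P.prefTree lo V 1 = V.map (· % P.modTree lo 1) := by
  rw [prefTree, if_pos le_rfl]

lemma prefTree_two_mul (lo : ℕ) (V) {v : ℕ} (h : 1 ≤ v) :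
    P.prefTree lo V (2 * v) = (P.prefTree lo V v).map (· % P.modTree lo (2 * v)) := by
  rw [prefTree, if_neg (by omega), if_pos (by omega), Nat.mul_div_cancel_left v (by norm_num)]

lemma prefTree_two_mul_add_one (lo : ℕ) (V) {v : ℕ} (h : 1 ≤ v) :
    P.prefTree lo V (2 * v + 1) =
      (P.prefTree lo V v * P.matTree lo (2 * v)).map (· % P.modTree lo (2 * v + 1)) := by
  rw [prefTree, if_neg (by omega), if_neg (by omega), show (2 * v + 1) / 2 = v by omega,
    Nat.add_sub_cancel]

lemma prefTree_bounds (lo : ℕ) (V) {v : ℕ} (h : 1 ≤ v) (hv : v < 2 * P.B) (r k : Fin P.D) :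
    0 ≤ P.prefTree lo V v r k ∧ P.prefTree lo V v r k < P.modTree lo v := by
  have hm := (modTree_bounds lo h hv).1
  rw [prefTree]
  split_ifs with h1 h2
  · obtain rfl : v = 1 := by omega
    exact ⟨Int.emod_nonneg _ hm.ne', Int.emod_lt_of_pos _ hm⟩
  · exact ⟨Int.emod_nonneg _ hm.ne', Int.emod_lt_of_pos _ hm⟩
  · exact ⟨Int.emod_nonneg _ hm.ne', Int.emod_lt_of_pos _ hm⟩

lemma abs_prefTree_le (lo : ℕ) (V) {v : ℕ} (h : 1 ≤ v) (hv : v < 2 * P.B) (r k : Fin P.D) :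
    |P.prefTree lo V v r k| < 2 ^ (leaves P.b v * P.lam) := by
  have h1 := prefTree_bounds lo V h hv r k
  rw [abs_of_nonneg h1.1]
  exact h1.2.trans (modTree_bounds lo h hv).2

lemma cap_six {u r k : ℕ} (hr : r < P.D) (hk : k < P.D) :
    P.cap 6 (u * (P.D * P.D) + r * P.D + k) = P.nodeCap u := by
  simp [cap, index_div hr hk]

lemma lt_len_six {u r k : ℕ} (hu : u ≤ 2 * P.B) (hr : r < P.D) (hk : k < P.D) :
    u * (P.D * P.D) + r * P.D + k < P.len 6 := by
  have := Nat.mul_le_mul_right (P.D * P.D) (show u + 1 ≤ 2 * P.B + 1 by omega)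
  have h1 := index_lt hr hk
  rw [add_mul] at this
  simp only [len]
  norm_num
  omega

section Node
variable {base i1 i2 mi : Ex} {u w v n L : ℕ} {X Y : Mat P.D ℤ} {m : ℤ}

lemma does_mulNode
    (hok : base.ok = true ∧ i1.ok = true ∧ i2.ok = true ∧ mi.ok = true)
    (hsz : base.sz ≤ 15 ∧ i1.sz ≤ 15 ∧ i2.sz ≤ 15 ∧ mi.sz ≤ 15)
    (hev : ∀ s', Same s s' → base.eval s' = (v * (P.D * P.D) : ℕ) ∧
      i1.eval s' = (u * (P.D * P.D) : ℕ) ∧ i2.eval s' = (w * (P.D * P.D) : ℕ) ∧ mi.eval s' = n)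
    (hs : Holds P s) (huv : u ≠ v) (hv : v ≤ 2 * P.B) (hX : MatAt s 6 u X) (hY : MatAt s 5 w Y)
    (hm : s.a 4 n = m) (hm0 : 0 < m) (hmb : bits m ≤ P.nodeCap v) (hmL : bits m ≤ L)
    (hL : P.lam ≤ L) (hLt : L ≤ P.top) (hXL : ∀ r k, bits (X r k) ≤ L) (hYL : ∀ r k, bits (Y r k) ≤ L)
    {a : ℤ} {l : ℕ} (hXa : ∀ r k, |X r k| ≤ a) (hYa : ∀ r k, P.D * |Y r k| ≤ 2 ^ l)
    (hal : a * 2 ^ l < 2 ^ L)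
    (hR : ∀ s', MatAt s' 6 v ((X * Y).map (· % m)) →
      (∀ u, u ≠ v → ∀ Z : Mat P.D ℤ, MatAt s 6 u Z → MatAt s' 6 u Z) →
      Frame [] [6] s s' → R s') :
    Does P.ctx (tabMod 6 base (.var 2) (.var 2) (.var 2)
      (entry 6 (i1) 36 38 * entry 5 (i2) 38 37)
      (.get 4 mi)) s ((P.D + 1) * (P.D + 1) * (P.D + 1) * cellCost P.ctx L) R := by
  have hD : 0 < P.D := by have := P.hD; omega
  have hsum : ∀ r < P.D, ∀ k < P.D, ∀ n ≤ P.D, bits (∑ j ∈ range n,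
      s.a 6 (u * (P.D * P.D) + r * P.D + j) * s.a 5 (w * (P.D * P.D) + j * P.D + k)) ≤ L := by
    intro r hr' k hk n hn
    rw [bits_le_iff]
    refine lt_of_le_of_lt ?_ hal
    refine le_of_mul_le_mul_left ?_ (show (0 : ℤ) < P.D from mod_cast hD)
    rw [show (P.D : ℤ) * (a * 2 ^ l) = P.D * a * 2 ^ l by ring]
    refine mul_abs_sum_le hD hn (fun j hj => ?_) (fun j hj => ?_)
    · rw [hX ⟨r, hr'⟩ ⟨j, hj⟩]; exact mul_le_mul_of_nonneg_left (hXa _ _) (by positivity)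
    · rw [hY ⟨j, hj⟩ ⟨k, hk⟩]; exact hYa _ _
  refine does_tabMod (L := L) (B := v * (P.D * P.D)) (N1 := P.D) (N2 := P.D) (N3 := P.D) (M := m)
    (f := fun r k j => s.a 6 (u * (P.D * P.D) + r * P.D + j) * s.a 5 (w * (P.D * P.D) + j * P.D + k))
    ?_ hm0 hmL ?_ (fun s' h => ⟨?_, fun hf => ?_⟩) (fun r hr k hk => ⟨by norm_num, ?_, ?_⟩)
    hs.stack (by norm_num) fun s' ha hv' => ?_
  · refine ⟨hL, (bet_of_le_top hLt).1, ⟨bits_D, bits_D, bits_D⟩, fun s' h => ?_,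
      fun r hr' k hk j hj s' h h36 h37 h38 => ?_, hsum,
      ⟨hok.1, by decide, by decide, by decide⟩, ⟨hsz.1, by decide, by decide, by decide,
      show (i1.sz + 5 + 1 + 2 + 1 + 1) + (i2.sz + 5 + 1 + 2 + 1 + 1) + 1 ≤ 57 by omega⟩⟩
    · exact ⟨(hev s' h.toSame).1, by simp [@h.v, hs.v2], by simp [@h.v, hs.v2], by simp [@h.v, hs.v2]⟩
    · have b1 := entry_spec (L := L) hok.2.1 (by simp [@h.v, hs.v2]) (hev s' h.toSame).2.1 h36 h38
        (h.arr 6 (u * (P.D * P.D) + r * P.D + j) fun hh => index_ne hr' hj huv hh.2) hL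
        (by rw [hX ⟨r, hr'⟩ ⟨j, hj⟩]; exact hXL _ _)
      have b2 := entry_spec (L := L) hok.2.2.1 (by simp [@h.v, hs.v2]) (hev s' h.toSame).2.2.1 h38 h37
        (h.arr 5 (w * (P.D * P.D) + j * P.D + k) (by omega)) hL
        (by rw [hY ⟨j, hj⟩ ⟨k, hk⟩]; exact hYL _ _)
      exact ⟨by rw [Ex.eval_mul, b1.1, b2.1], fun hf => (Ex.leaf_mul ..).2 ⟨b1.2 hf, b2.2 hf⟩⟩
  · change mi.sz + 1 ≤ 60; omega
  · rw [Ex.eval_get, (hev s' h.toSame).2.2.2, Int.toNat_natCast, h.arr 4 n (by omega), hm]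
  · rw [Ex.leaf_get, (hev s' h.toSame).2.2.2, Int.toNat_natCast, h.arr 4 n (by omega), hm]
    exact ⟨(hf.leaf hok.2.2.2).mono hL, hmL⟩
  · exact lt_len_six hv hr hk
  · change _ ≤ P.cap 6 _
    rw [cap_six hr hk]; exact hmb
  · refine hR s' (MatAt.of_fill (w := fun r k => (∑ j ∈ range P.D,
      s.a 6 (u * (P.D * P.D) + r * P.D + j) * s.a 5 (w * (P.D * P.D) + j * P.D + k)) % m) ha
        fun r k => ?_) (fun u hu X hX => hX.of_fill_ne ha (.inr hu))
      ((Frame.refl _ _ s).of_fill hv' ha)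
    rw [Matrix.map_apply, Matrix.mul_apply, sum_range]
    congr 1
    exact sum_congr rfl fun j _ => by rw [hX r j, hY j k]

lemma does_copyNode (hok : base.ok = true ∧ i1.ok = true ∧ mi.ok = true)
    (hsz : base.sz ≤ 15 ∧ i1.sz ≤ 15 ∧ mi.sz ≤ 15)
    (hev : ∀ s', Same s s' → base.eval s' = (v * (P.D * P.D) : ℕ) ∧
      i1.eval s' = (u * (P.D * P.D) : ℕ) ∧ mi.eval s' = n)
    (hs : Holds P s) (huv : u ≠ v) (hv : v ≤ 2 * P.B) (hX : MatAt s 6 u X)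
    (hm : s.a 4 n = m) (hm0 : 0 < m) (hmb : bits m ≤ P.nodeCap v) (hmL : bits m ≤ L)
    (hL : P.lam ≤ L) (hLt : L ≤ P.top) (hXL : ∀ r k, bits (X r k) ≤ L)
    (hR : ∀ s', MatAt s' 6 v (X.map (· % m)) →
      (∀ u, u ≠ v → ∀ Z : Mat P.D ℤ, MatAt s 6 u Z → MatAt s' 6 u Z) →
      Frame [] [6] s s' → R s') :
    Does P.ctx (tabMod 6 base (.var 2) (.var 2) 1 (entry 6 (i1) 36 37)
      (.get 4 mi)) s ((P.D + 1) * (P.D + 1) * ((1 : ℕ) + 1) * cellCost P.ctx L) R := by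
  refine does_tabMod (L := L) (B := v * (P.D * P.D)) (N1 := P.D) (N2 := P.D) (N3 := 1) (M := m)
    (f := fun r k _ => s.a 6 (u * (P.D * P.D) + r * P.D + k))
    ?_ hm0 hmL ?_ (fun s' h => ⟨?_, fun hf => ?_⟩) (fun r hr k hk => ⟨by norm_num, ?_, ?_⟩)
    hs.stack (by norm_num) fun s' ha hv' => ?_
  · refine ⟨hL, (bet_of_le_top hLt).1, ⟨bits_D, bits_D, bits_one⟩, fun s' h => ?_,
      fun r hr' k hk j hj s' h h36 h37 h38 => ?_, fun r hr' k hk n hn => bits_sum_one hn ?_,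
      ⟨hok.1, by decide, by decide, by decide⟩, ⟨hsz.1, by decide, by decide, by decide,
      show (i1.sz + 5 + 1 + 2 + 1 + 1) ≤ 57 by omega⟩⟩
    · exact ⟨(hev s' h.toSame).1, by simp [@h.v, hs.v2], by simp [@h.v, hs.v2], by simp⟩
    · exact entry_spec hok.2.1 (by simp [@h.v, hs.v2]) (hev s' h.toSame).2.1 h36 h37
        (h.arr 6 (u * (P.D * P.D) + r * P.D + k) fun hh => index_ne hr' hk huv hh.2) hL
        (by rw [hX ⟨r, hr'⟩ ⟨k, hk⟩]; exact hXL _ _)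
    · rw [hX ⟨r, hr'⟩ ⟨k, hk⟩]; exact hXL _ _
  · change mi.sz + 1 ≤ 60; omega
  · rw [Ex.eval_get, (hev s' h.toSame).2.2, Int.toNat_natCast, h.arr 4 n (by omega), hm]
  · rw [Ex.leaf_get, (hev s' h.toSame).2.2, Int.toNat_natCast, h.arr 4 n (by omega), hm]
    exact ⟨(hf.leaf hok.2.2).mono hL, hmL⟩
  · exact lt_len_six hv hr hk
  · change _ ≤ P.cap 6 _
    rw [cap_six hr hk]; exact hmb
  · refine hR s' (MatAt.of_fill (w := fun r k => (∑ j ∈ range 1,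
      s.a 6 (u * (P.D * P.D) + r * P.D + k)) % m) ha
        fun r k => ?_) (fun u hu X hX => hX.of_fill_ne ha (.inr hu))
      ((Frame.refl _ _ s).of_fill hv' ha)
    rw [Matrix.map_apply, sum_range_one, hX r k]

end Node

/-- The program that computes the tree of partial products for a block, and the product that is
carried to the next block, modulo the product of all primes. -/
def prefTreeProg : Program := blk [
  tabMod 6 (.var 33) (.var 2) (.var 2) 1 (entry 6 (0) 36 37) (.get 4 1),
  forLoop 10 (.var 5 - 1) (blk [asg 11 (.var 10 + 1),
    tabMod 6 (2 * .var 11 * .var 33) (.var 2) (.var 2) 1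
      (entry 6 (.var 11 * .var 33) 36 37) (.get 4 (2 * .var 11)),
    tabMod 6 ((2 * .var 11 + 1) * .var 33) (.var 2) (.var 2) (.var 2)
      (entry 6 (.var 11 * .var 33) 36 38 *
        entry 5 (2 * .var 11 * .var 33) 38 37) (.get 4 (2 * .var 11 + 1))]),
  tabMod 6 (2 * .var 5 * .var 33) (.var 2) (.var 2) (.var 2)
    (entry 6 (0) 36 38 * entry 5 (.var 33) 38 37)
    (.get 4 (2 * .var 5)),
  tabMod 6 0 (.var 2) (.var 2) 1
    (entry 6 (2 * .var 5 * .var 33) 36 37) (.get 4 (2 * .var 5))]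

/-- The time for a tree of partial products. -/
noncomputable def prefTreeCost (P : Par) : ℝ :=
  ((P.D : ℝ) + 1) ^ 3 * (4 * cellCost P.ctx P.top + P.B * cellCost P.ctx P.W +
    3200 * (P.b + 1) * bc P.ctx (P.B * (160 * P.W)))

lemma bits_le_top_of_abs {z : ℤ} (h : |z| ≤ 4 ^ P.N) : bits z ≤ P.top ∧ bits z ≤ 2 * P.N + 1 := by
  have h1 : bits z ≤ 2 * P.N + 1 := by
    refine bits_le_iff.2 (h.trans_lt ?_)
    rw [pow_succ, pow_mul]; norm_num
  have := P.eight_le_lam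
  exact ⟨h1.trans (by unfold top; omega), h1⟩

lemma does_prefTree {lo : ℕ} (hs : Holds P s) (hlo : lo ≤ 3 * P.N + 1)
    (hm : ∀ v, 1 ≤ v → v < 2 * P.B → s.a 4 v = P.modTree lo v)
    {rad : ℤ} (hrad : s.a 4 (2 * P.B) = rad) (hr0 : 0 < rad) (hr1 : rad ≤ 4 ^ P.N)
    (ht : ∀ v, 1 ≤ v → v < 2 * P.B → MatAt s 5 v (P.matTree lo v))
    {V : Mat P.D ℤ} (hV : MatAt s 6 0 V) (hVb : ∀ r k, |V r k| ≤ 4 ^ P.N)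
    (hR : ∀ s', Frame [10, 11] [6] s s' →
      (∀ v, 1 ≤ v → v < 2 * P.B → MatAt s' 6 v (P.prefTree lo V v)) →
      MatAt s' 6 0 (((V * P.matTree lo 1).map (· % rad)).map (· % rad)) → R s') :
    Does P.ctx prefTreeProg s P.prefTreeCost R := by
  have hpos := bc_pos P.ctx P.lam
  have hbm := bc_le_cellCost P.ctx P.lam
  have h8 := P.bc_eight_le
  have hB := P.B_le
  have hN := P.one_le_N
  have hB1 := P.one_le_B
  have h1B : 1 < 2 * P.B := by omega
  have hlt := P.lam_le_top
  have hW := P.lam_le_W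
  have hl1 : leaves P.b 1 = P.B := leaves_one _
  have hrb := bits_le_top_of_abs (P := P) (z := rad) (by rwa [abs_of_pos hr0])
  have hncR : P.nodeCap (2 * P.B) = 2 * P.N + 1 := by simp [nodeCap]
  have hnc0 : P.nodeCap 0 = 2 * P.N + 1 := by simp [nodeCap]
  have hBW : P.B * P.W ≤ P.top := by unfold top; omega
  have hmb : ∀ v, 1 ≤ v → v < 2 * P.B → bits (P.modTree lo v) ≤ P.nodeCap v := fun v h1 h2 => by
    rw [nodeCap_node h1 h2]; exact bits_modTree lo h1 h2
  have hBl : P.B * P.lam ≤ P.B * P.W := Nat.mul_le_mul_left _ (by omega)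
  refine .cons (does_copyNode (u := 0) (v := 1) (n := 1) (L := P.top) (X := V) (i1 := 0)
    (by decide) (by decide) (fun s' h => by simp [@h.v, hs.v33]) hs
    (by norm_num) (by omega) hV (hm 1 le_rfl h1B) (modTree_bounds lo le_rfl h1B).1
    (hmb 1 le_rfl h1B) ?_ hlt le_rfl (fun r k => (bits_le_top_of_abs (hVb r k)).1)
    fun s1 hm1 hk1 hf1 => ?_)
  · refine (bits_modTree lo le_rfl h1B).trans ?_
    rw [hl1]; omega
  have hs1 := hs.frame hf1
  rw [← prefTree_one] at hm1
  refine .cons (.forLoop (P.B - 1)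
    P.short_N (I := fun k s' => s'.v 10 = k ∧ Frame [10, 11] [6] s s' ∧
      MatAt s' 6 0 V ∧ ∀ v, 1 ≤ v → v < 2 * (k + 1) → MatAt s' 6 v (P.prefTree lo V v))
    (T := fun k => 2 * bc P.ctx P.lam + 2 * (P.D + 1) ^ 3 * cellCost P.ctx (leaves P.b (k + 1) * P.W))
    ?_ ?_ ?_ fun s2 h2 => ?_)
  · refine ⟨by simp, (hf1.mono (V' := [10, 11])).set, (hk1 0 (by norm_num) _ hV).congr (by simp),
      fun v hv1 hv2 => ?_⟩
    obtain rfl : v = 1 := by omega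
    exact hm1.congr (by simp)
  · exact fun k hk s' h => ⟨h.1, by simp only [Ex.evals, (hs.frame h.2.1).v5]; omega⟩
  · intro k hk s' h _
    have hs' := hs.frame h.2.1
    set v := k + 1 with hv
    have hv1 : 1 ≤ v := by omega
    have hvB : v < P.B := by omega
    have hch := leaves_children hv1 hvB
    have hL := leaves_mul_le (P := P) hv1 (le_refl P.W)
    have hWv : P.W ≤ leaves P.b v * P.W := Nat.le_mul_of_pos_left _ (one_le_leaves _ _)
    have hle : ∀ u, leaves P.b u ≤ leaves P.b v → leaves P.b u * P.lam ≤ leaves P.b v * P.W :=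
      fun u hu => Nat.mul_le_mul hu (by omega)
    have hmL : ∀ u, 1 ≤ u → u < 2 * P.B → leaves P.b u ≤ leaves P.b v →
        bits (P.modTree lo u) ≤ leaves P.b v * P.W :=
      fun u h1 h2 h3 => (bits_modTree lo h1 h2).trans (hle u h3)
    have hXL : ∀ r j, bits (P.prefTree lo V v r j) ≤ leaves P.b v * P.W := fun r j =>
      (bits_le_iff.2 (abs_prefTree_le lo V hv1 (by omega) r j)).trans (hle v le_rfl)
    refine .cons (.asg_ok (v : ℤ) ?_
      (fun _ => P.short_N) ?_)
    · simp only [Ex.evals, h.1]; omega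
    have hf : Frame [10, 11] [6] s (s'.set 11 v) := h.2.1.set
    set t := s'.set 11 v with ht'
    have ht11 : t.v 11 = v := by simp [ht']
    have ha : t.a = s'.a := rfl
    have hst := hs.frame hf
    have hm4 : ∀ u, 1 ≤ u → u < 2 * P.B → t.a 4 u = P.modTree lo u := fun u h1 h2 => by
      rw [hf.a 4, hm u h1 h2]
    refine .cons (does_copyNode (u := v) (v := 2 * v) (n := 2 * v) (L := leaves P.b v * P.W)
      (i1 := .var 11 * .var 33) (by decide) (by decide)
      (fun s' h => by simp [@h.v, ht11, hst.v33]) hst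
      (by omega) (by omega) ((h.2.2.2 v hv1 (by omega)).congr (by rw [ha]))
      (hm4 (2 * v) (by omega) (by omega)) (modTree_bounds lo (by omega) (by omega)).1
      (hmb _ (by omega) (by omega)) (hmL _ (by omega) (by omega) (by omega)) (by omega) (by omega) hXL
      fun s2 hm2 hk2 hf2 => ?_)
    rw [← prefTree_two_mul lo V hv1] at hm2
    have hs2 := hst.frame hf2
    have hff := hf.trans (V'' := [10, 11]) (A'' := [6]) hf2
    have h211 : s2.v 11 = v := by rw [hf2.v 11, ht11]
    have hpv := hk2 v (by omega) _ ((h.2.2.2 v hv1 (by omega)).congr (s' := t) (by rw [ha]))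
    refine .cons (does_mulNode (u := v) (v := 2 * v + 1) (w := 2 * v) (n := 2 * v + 1)
      (L := leaves P.b v * P.W) (i1 := .var 11 * .var 33) (i2 := 2 * .var 11 * .var 33)
      (a := 2 ^ (leaves P.b v * P.lam)) (l := leaves P.b (2 * v) * P.W)
      (by decide) (by decide) (fun s' h => by simp [@h.v, h211, hs2.v33]) hs2
      (by omega) (by omega) hpv
      ((ht (2 * v) (by omega) (by omega)).congr (by rw [hff.a 5]))
      (by rw [hff.a 4, hm _ (by omega) (by omega)]) (modTree_bounds lo (by omega) (by omega)).1
      (hmb _ (by omega) (by omega)) (hmL _ (by omega) (by omega) (by omega)) (by omega) (by omega) hXL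
      (fun r j => (bits_matTree hlo (by omega) (by omega) r j).trans (Nat.mul_le_mul_right _ (by omega)))
      (fun r j => (abs_prefTree_le lo V hv1 (by omega) r j).le)
      (fun r j => matTree_bound hlo (by omega) (by omega) r j) ?_
      fun s3 hm3 hk3 hf3 => .nil ?_ ⟨?_, by simp [hv], (hff.trans hf3).set, ?_, ?_⟩)
    · rw [← pow_add]
      refine pow_lt_pow_right₀ (by norm_num) ?_
      have h1 := one_le_leaves P.b (2 * v)
      have h3 : leaves P.b v * P.W = leaves P.b (2 * v) * P.W + leaves P.b (2 * v) * P.W := by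
        rw [← add_mul]; congr 1; omega
      have h4 : leaves P.b v * P.lam = leaves P.b (2 * v) * (2 * P.lam) := by
        rw [← hch.1]; ring
      have h5 := Nat.mul_lt_mul_of_pos_left (show 2 * P.lam < P.W by unfold W; omega) h1
      omega
    · have hc := cellCost_pos P.ctx (leaves P.b v * P.W)
      have hd : (2 : ℝ) ≤ P.D := mod_cast P.hD
      set X := cellCost P.ctx (leaves P.b v * P.W)
      have : ((P.D : ℝ) + 1) * (P.D + 1) * 2 * X ≤ (P.D + 1) * (P.D + 1) * (P.D + 1) * X := by
        gcongr; linarith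
      simp only [ctx_lam]
      push_cast
      linarith
    · rw [hf3.v 10, hf2.v 10]; simp [ht', h.1]
    · exact (hk3 0 (by omega) _ (hk2 0 (by omega) _ (h.2.2.1.congr (s' := t) (by rw [ha])))).congr (by simp)
    · intro u hu1 hu2
      refine MatAt.congr (s := s3) ?_ (by simp)
      by_cases hu3 : u = 2 * v + 1
      · rw [hu3, prefTree_two_mul_add_one lo V hv1]; exact hm3
      · refine hk3 u hu3 _ ?_
        by_cases hu4 : u = 2 * v
        · rw [hu4]; exact hm2
        · exact hk2 u hu4 _ ((h.2.2.2 u hu1 (by omega)).congr (by rw [ha]))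
  have hs2 := hs.frame h2.2.1
  have hrad2 : s2.a 4 (2 * P.B) = rad := by rw [h2.2.1.a 4 (by simp), hrad]
  refine .cons (does_mulNode (u := 0) (v := 2 * P.B) (w := 1) (n := 2 * P.B) (L := P.top)
    (i1 := 0) (i2 := .var 33) (a := 4 ^ P.N) (l := P.B * P.W) (by decide) (by decide)
    (fun s' h => by simp [@h.v, hs2.v33, hs2.v5]) hs2 (by omega) le_rfl h2.2.2.1
    ((ht 1 le_rfl h1B).congr (by rw [h2.2.1.a 5 (by simp)])) hrad2 hr0 (by rw [hncR]; exact hrb.2)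
    hrb.1 hlt le_rfl (fun r k => (bits_le_top_of_abs (hVb r k)).1)
    (fun r k => (bits_matTree hlo le_rfl h1B r k).trans (by rw [hl1]; exact hBW)) hVb
    (fun r k => by have := matTree_bound hlo le_rfl h1B r k; rwa [hl1] at this) ?_
    fun s3 hm3 hk3 hf3 => ?_)
  · rw [show (4 : ℤ) = 2 ^ 2 by norm_num, ← pow_mul, ← pow_add]
    refine pow_lt_pow_right₀ (by norm_num) ?_
    have := P.eight_le_lam
    unfold top; omega
  have hs3 := hs2.frame hf3
  refine .cons (does_copyNode (u := 2 * P.B) (v := 0) (n := 2 * P.B) (L := P.top)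
    (i1 := 2 * .var 5 * .var 33) (by decide) (by decide)
    (fun s' h => by simp [@h.v, hs3.v5, hs3.v33]) hs3 (by omega)
    (by omega) hm3 (by rw [hf3.a 4, hrad2]) hr0 (by rw [hnc0]; exact hrb.2) hrb.1 hlt le_rfl
    (fun r k => ?_) fun s4 hm4 hk4 hf4 => .nil ?_ (hR s4 ?_ (fun v hv1 hv2 => ?_) hm4))
  · refine (bits_mono ?_).trans hrb.1
    rw [Matrix.map_apply, abs_of_nonneg (Int.emod_nonneg _ hr0.ne'), abs_of_pos hr0]
    exact (Int.emod_lt_of_pos _ hr0).le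
  · have h1 : ((P.B - 1 : ℕ) : ℝ) * bc P.ctx P.lam ≤ P.B * bc P.ctx P.lam := by
      gcongr; exact Nat.sub_le _ _
    have h3 : (1 : ℝ) ≤ P.B := mod_cast hB1
    have hcW : cellCost P.ctx P.lam ≤ cellCost P.ctx P.W := cellCost_mono _ (by omega)
    have hct : cellCost P.ctx P.lam ≤ cellCost P.ctx P.top := cellCost_mono _ hlt
    have h4 : (P.B : ℝ) * (800 * bc P.ctx P.lam) ≤ P.B * cellCost P.ctx P.W := by
      gcongr; linarith
    have hC : 0 ≤ (P.B : ℝ) * cellCost P.ctx P.W := mul_nonneg (by positivity) (cellCost_pos _ _).le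
    have hX := cellCost_pos P.ctx P.top
    have g1 := mul_le_mul_of_nonneg_left P.sum_cellCost.2 (show 0 ≤ ((P.D : ℝ) + 1) ^ 3 by positivity)
    have g2 := mul_le_mul_of_nonneg_right P.cube_bounds.1 hX.le
    have g3 := mul_le_mul_of_nonneg_right P.cube_bounds.2 hC
    have g4 := mul_le_mul_of_nonneg_right P.cube_bounds.2 hX.le
    simp only [sum_add_distrib, sum_const, card_range, nsmul_eq_mul, ← mul_sum, ctx_lam, prefTreeCost]
    push_cast
    linarith
  · exact (h2.2.1.trans hf3 (V'' := [10, 11]) (A'' := [6])).trans hf4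
  · refine hk4 v (by omega) _ (hk3 v (by omega) _ (h2.2.2.2 v hv1 ?_))
    omega

end Par

/-! ### Linear algebra modulo a prime -/

lemma Ex.get_eval {s : St} {x n : ℕ} {e : Ex} (h : e.eval s = n) : (Ex.get x e).eval s = s.a x n := by
  rw [Ex.eval_get, h, Int.toNat_natCast]

lemma emod_bounds {p : ℤ} (hp : 0 < p) (z : ℤ) : 0 ≤ z % p ∧ z % p < p :=
  ⟨Int.emod_nonneg _ hp.ne', Int.emod_lt_of_pos _ hp⟩

lemma residue_ne_zero {p : ℕ} {z : ℤ} (h : 0 ≤ z ∧ z < p) (hz : z ≠ 0) : (z : ZMod p) ≠ 0 := fun h0 =>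
  h.2.not_ge (Int.le_of_dvd (h.1.lt_of_ne' hz) ((ZMod.intCast_zmod_eq_zero_iff_dvd _ _).1 h0))

/-- The family `E` of `n` vectors spans the space of the vectors that satisfy the first `m` of the
linear equations with the coefficients `A`. -/
structure SpansKernel (p n : ℕ) (A : ℕ → ℕ → ZMod p) (m : ℕ) (E : ℕ → ℕ → ZMod p) : Prop where
  mem : ∀ t < n, ∀ i < m, ∑ l ∈ range n, A i l * E t l = 0
  span : ∀ x : ℕ → ZMod p, (∀ i < m, ∑ l ∈ range n, A i l * x l = 0) →
    ∃ y : ℕ → ZMod p, ∀ l < n, x l = ∑ t ∈ range n, y t * E t l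

lemma SpansKernel.congr {p n m : ℕ} {A E E' : ℕ → ℕ → ZMod p} (h : SpansKernel p n A m E)
    (hE : ∀ t < n, ∀ l < n, E' t l = E t l) : SpansKernel p n A m E' := by
  refine ⟨fun t ht i hi => ?_, fun x hx => ?_⟩
  · rw [← h.mem t ht i hi]
    exact sum_congr rfl fun l hl => by rw [hE t ht l (mem_range.1 hl)]
  · obtain ⟨y, hy⟩ := h.span x hx
    refine ⟨y, fun l hl => ?_⟩
    rw [hy l hl]
    exact sum_congr rfl fun t ht => by rw [hE t (mem_range.1 ht) l hl]

lemma spansKernel_zero (p n : ℕ) (A : ℕ → ℕ → ZMod p) :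
    SpansKernel p n A 0 fun t l => if t = l then 1 else 0 := by
  refine ⟨fun t _ i hi => absurd hi (by omega), fun x _ => ⟨x, fun l hl => ?_⟩⟩
  simp [hl]

/-- The step of the elimination: the values `v` of the next equation on the vectors of the family are
cleared with a vector on which the value does not vanish, if there is one. -/
lemma SpansKernel.step {p n m s : ℕ} [Fact p.Prime] {A E : ℕ → ℕ → ZMod p} {v : ℕ → ZMod p}
    (h : SpansKernel p n A m E) (hv : ∀ t < n, v t = ∑ l ∈ range n, A m l * E t l)
    (hs : (s = n ∧ ∀ t < n, v t = 0) ∨ (s < n ∧ v s ≠ 0)) :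
    SpansKernel p n A (m + 1) fun t l => (if s < n then v s else 1) * E t l - v t * E s l := by
  set w := if s < n then v s else 1 with hw
  have hw0 : w ≠ 0 := by
    rw [hw]
    rcases hs with ⟨rfl, -⟩ | ⟨h1, h2⟩
    · simp
    · rwa [if_pos h1]
  have key : ∀ i t, ∑ l ∈ range n, A i l * (w * E t l - v t * E s l) =
      w * ∑ l ∈ range n, A i l * E t l - v t * ∑ l ∈ range n, A i l * E s l := by
    intro i t
    rw [mul_sum, mul_sum, ← sum_sub_distrib]
    exact sum_congr rfl fun l _ => by ring
  refine ⟨fun t ht i hi => ?_, fun x hx => ?_⟩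
  · rw [key]
    rcases Nat.lt_succ_iff_lt_or_eq.1 hi with h1 | rfl
    · rw [h.mem t ht i h1]
      rcases hs with ⟨-, h2⟩ | ⟨h2, -⟩
      · rw [h2 t ht]; ring
      · rw [h.mem s h2 i h1]; ring
    · rw [← hv t ht]
      rcases hs with ⟨-, h2⟩ | ⟨h2, -⟩
      · rw [h2 t ht]; ring
      · rw [← hv s h2, hw, if_pos h2]; ring
  · obtain ⟨y, hy⟩ := h.span x fun i hi => hx i (by omega)
    have h0 : ∑ t ∈ range n, y t * v t = 0 := by
      rw [← hx m (by omega)]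
      calc ∑ t ∈ range n, y t * v t
          = ∑ t ∈ range n, ∑ l ∈ range n, y t * (A m l * E t l) :=
            sum_congr rfl fun t ht => by rw [hv t (mem_range.1 ht), mul_sum]
        _ = ∑ l ∈ range n, ∑ t ∈ range n, y t * (A m l * E t l) := sum_comm
        _ = _ := sum_congr rfl fun l hl => by
            rw [hy l (mem_range.1 hl), mul_sum]
            exact sum_congr rfl fun t _ => by ring
    refine ⟨fun t => w⁻¹ * y t, fun l hl => ?_⟩
    calc x l = ∑ t ∈ range n, y t * E t l - w⁻¹ * (∑ t ∈ range n, y t * v t) * E s l := by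
          rw [h0, hy l hl]; ring
      _ = _ := by
          rw [mul_assoc, sum_mul, mul_sum, ← sum_sub_distrib]
          refine sum_congr rfl fun t _ => ?_
          field_simp

namespace Par
variable {P : Par} {s : St} {R : St → Prop}

lemma cap_nine {x : ℕ} (i : ℕ) (hx : 8 ≤ x := by norm_num) : P.cap x i = P.lam := P.cap_small x i (.inr hx)

lemma len_nine {x : ℕ} (hx : 9 ≤ x) : P.len x = 4 * ((P.D + 2) * (P.D + 2)) := by
  unfold len
  iterate 9 rw [if_neg (by omega)]

/-- The program that puts the last index of a positive one among the first entries of the array `13`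
into the variable `23`, or their number (the variable `21`), if there is none. -/
def findProg : Program := blk [asg 23 (.var 21),
  forLoop 24 (.var 21) (asg 23 (.ite (.get 13 (.var 24)) (.var 24) (.var 23)))]

lemma does_find {n : ℕ} (h21 : s.v 21 = n) (hn : n ≤ 2 * P.D)
    (hR : ∀ s' σ, Frame [23, 24] [] s s' → s'.v 23 = (σ : ℕ) →
      ((σ = n ∧ ∀ t < n, s.a 13 t ≤ 0) ∨ (σ < n ∧ 0 < s.a 13 σ)) → R s') :
    Does P.ctx findProg s ((n + 1) * cellCost P.ctx P.lam) R := by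
  have hpos := bc_pos P.ctx P.lam
  have hbm := bc_le_cellCost P.ctx P.lam
  have h8 := P.bc_eight_le
  have hb : ∀ k ≤ n, bits (k : ℤ) ≤ P.lam := fun k hk => P.short_D (by omega)
  refine .cons (.asg_ok (n : ℤ) (by simp [h21])
    (fun _ => hb n le_rfl) (.cons (.forLoop n (hb n le_rfl)
    (I := fun k s' => s'.v 24 = k ∧ Frame [23, 24] [] s s' ∧ ∃ σ : ℕ, s'.v 23 = σ ∧
      ((σ = n ∧ ∀ t < k, s.a 13 t ≤ 0) ∨ (σ < n ∧ 0 < s.a 13 σ)))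
    (T := fun _ => bc P.ctx P.lam) ?_ ?_ ?_ ?_)))
  · exact ⟨by simp, (Frame.refl _ _ s).set.set, n, by simp, .inl ⟨rfl, by simp⟩⟩
  · exact fun k hk s' h => ⟨h.1, by simp [h.2.1.v 21, h21]⟩
  · intro k hk s' h _
    obtain ⟨h1, h2, σ, h3, h4⟩ := h
    have hσ : σ ≤ n := by omega
    have e13 : s'.a 13 k = s.a 13 k := by rw [h2.a 13 (by simp)]
    refine .asg_ok ((if 0 < s.a 13 k then k else σ : ℕ) : ℤ) ?_
      (fun _ => hb _ (by split_ifs <;> omega))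
      ⟨by simp [h1], by simp, h2.set.set,
        if 0 < s.a 13 k then k else σ, by simp, ?_⟩
    · simp [h1, h3, e13]
    · split_ifs with hc
      · exact .inr ⟨hk, hc⟩
      · rcases h4 with ⟨h4, h5⟩ | h4
        · refine .inl ⟨h4, fun t ht => ?_⟩
          rcases Nat.lt_succ_iff_lt_or_eq.1 ht with h6 | rfl
          · exact h5 t h6
          · exact not_lt.1 hc
        · exact .inr h4
  · rintro s' ⟨h1, h2, σ, h3, h4⟩
    refine .nil ?_ (hR s' σ h2 h3 h4)
    simp only [sum_const, card_range, nsmul_eq_mul, ctx_lam]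
    have : (0 : ℝ) ≤ n := by positivity
    nlinarith

lemma bits_residue {p : ℕ} {z : ℤ} (hpN : p ≤ P.N) (h0 : 0 ≤ z) (h1 : z < p) : bits z ≤ P.lam :=
  (bits_mono (by rw [abs_of_nonneg h0, Nat.abs_cast]; exact h1.le)).trans (P.short_N (n := p))

/-- The program for the power of `b` to the exponent `e` modulo the variable `12`; the result is in
the variable `15`. -/
def powProg (b e : Ex) : Program := blk [asg 15 1,
  forLoop 16 (.len e) (blk [asg 40 (.var 15 * .var 15 *
      .ite (.shr e (.len e - 1 - .var 16) - 2 * .shr e (.len e - .var 16)) b 1),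
    asg 41 (.var 12), modProg, asg 15 (.var 42)])]

lemma does_pow {b e : Ex} {p k : ℕ} {z : ℤ} (h12 : s.v 12 = p) (hp1 : 1 < p) (hpN : p ≤ P.N)
    (hk : k ≤ P.N) (hb : b.ok = true) (he : e.ok = true) (hbz : b.sz ≤ 10) (hez : e.sz ≤ 6)
    (hz0 : 0 ≤ z) (hz1 : z < p) (hY : ∀ i, s.a 3 i = 0)
    (hev : ∀ s', Frame [15, 16] [] s s' → b.eval s' = z ∧ e.eval s' = k)
    (hR : ∀ s', Frame [15, 16] [] s s' → s'.v 15 = z ^ k % p → R s') :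
    Does P.ctx (powProg b e) s ((P.N.size + 1) * cellCost P.ctx P.lam) R := by
  have hpos := bc_pos P.ctx P.lam
  have hbm := bc_le_cellCost P.ctx P.lam
  have hmc : cellCost P.ctx P.lam = 2 * modCost P.ctx P.lam := rfl
  have h8 := P.bc_eight_le
  have hp0 : (0 : ℤ) < p := mod_cast (by omega : 0 < p)
  have hkN : k.size ≤ P.N.size := Nat.size_le_size hk
  have hsz : P.N.size ≤ P.lam := by have := P.lam_ge; omega
  have hbk : bits (k : ℤ) = k.size := by simp [bits]
  have hmod := emod_bounds hp0
  have hlen : bits (k.size : ℤ) ≤ P.lam := bits_natCast (by omega)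
  refine .cons (.asg_ok 1 (by simp)
    (fun _ => bits_one_le.trans P.eight_le_lam) (.cons (.forLoop (x := 16) (e := .len e)
    (hok := he) (hsz := by change e.sz + 1 ≤ 57; omega) k.size hlen
    (I := fun j s' => s'.v 16 = j ∧ Frame [15, 16] [] s s' ∧ s'.v 15 = z ^ (k / 2 ^ (k.size - j)) % p)
    (T := fun _ => modCost P.ctx P.lam + 4 * bc P.ctx P.lam) ?_ ?_ ?_ ?_)))
  · refine ⟨by simp, (Frame.refl _ _ s).set.set, ?_⟩
    rw [Nat.sub_zero, Nat.div_eq_of_lt (Nat.lt_size_self k), pow_zero,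
      Int.emod_eq_of_lt (by norm_num) (mod_cast hp1)]
    simp
  · exact fun j hj s' h => ⟨h.1, by simp [(hev s' h.2.1).2, hbk]⟩
  · intro j hj s' h _
    have hev' := hev s' h.2.1
    set x := k / 2 ^ (k.size - j) with hx
    set y := k / 2 ^ (k.size - (j + 1)) with hy
    have hxy : y / 2 = x := by
      rw [hy, hx, Nat.div_div_eq_div_mul, ← pow_succ]; congr 2; omega
    have h12' : s'.v 12 = p := by rw [h.2.1.v 12, h12]
    set a := s'.v 15 with ha
    have ha1 : 0 ≤ a ∧ a < p := by rw [h.2.2]; exact hmod _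
    set c : ℤ := if 0 < (y : ℤ) - 2 * x then z else 1 with hc
    have hc1 : 0 ≤ c ∧ c ≤ p := by rw [hc]; split_ifs <;> omega
    have e1 : (Ex.var 15 * Ex.var 15 * Ex.ite (Ex.shr e (Ex.len e - 1 - Ex.var 16) -
        2 * Ex.shr e (Ex.len e - Ex.var 16)) b 1).eval s' = a * a * c := by
      have t1 : ((k.size : ℤ) - 1 - j).toNat = k.size - (j + 1) := by omega
      have t2 : ((k.size : ℤ) - j).toNat = k.size - j := by omega
      simp only [Ex.evals, hev'.1, hev'.2, hbk, h.1, t1, t2]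
      rw [hc, hy, hx]
      push_cast
      rfl
    have hb3 : bits (a * a * c) ≤ P.lam := by
      refine P.short ?_
      rw [abs_of_nonneg (mul_nonneg (mul_self_nonneg a) hc1.1)]
      calc a * a * c ≤ (P.N + 1) * (P.N + 1) * (P.N + 1) := by
            gcongr <;> first | exact hc1.1 | exact ha1.1 | omega
        _ = 1 * (P.N + 1) ^ 3 * 1 ^ 4 := by ring
        _ ≤ _ := by gcongr <;> omega
    refine .cons (.asg_ok (a * a * c) e1 (by norm_num)
      (hsz := show 2 + 2 + 1 + ((e.sz + (e.sz + 1 + 2 + 1 + 2 + 1) + 1 + (2 + (e.sz + (e.sz + 1 + 2 + 1) + 1) + 1) + 1) + b.sz + 2 + 1) + 1 ≤ 60 by omega)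
      (hok := by change (true && true && ((e.ok && (e.ok && true && true) && (true && (e.ok && (e.ok && true)))) && b.ok && true)) = true; rw [he, hb]; rfl)
      (.cons (.asg_ok (p : ℤ) (by simp [h12'])
      (by norm_num) (.cons (does_mod (L := P.lam) P.eight_le_lam (bet_of_le_top P.lam_le_top).1
        (by simpa using hb3) (by simpa using P.short_N (n := p)) (by simpa using hp0)
        (fun i => by simp [h.2.1.a 3, hY]) fun s2 u1 u2 u3 u4 => ?_)))))
    · have e42 : s2.v 42 = a * a * c % p := by rw [u1]; simp
      have h42 : bits (s2.v 42) ≤ P.lam := by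
        rw [e42]; exact bits_residue hpN (hmod _).1 (hmod _).2
      refine .cons (.asg (s2.v 42) P.eight_le_lam
        bet_lam (fun _ => ⟨by norm_num, h42⟩) rfl (hs := fun _ => h42) (.nil ?_ ⟨?_, by simp, ?_, ?_⟩))
      · simp only [ctx_lam]; linarith
      · simp [u4 16 (by norm_num), h.1]
      · refine (Frame.set ⟨fun x hx hxV => ?_, fun x hx => ?_⟩ (by simp)).set
        · rw [u4 x (by omega)]
          simp [show x ≠ 40 by omega, show x ≠ 41 by omega, h.2.1.v x hx hxV]
        · rw [u3]; simp [h.2.1.a x hx]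
      · simp only [St.set_v]
        norm_num
        rw [e42, h.2.2]
        have hyx : y = x + x ∧ c = 1 ∨ y = x + x + 1 ∧ c = z := by
          rw [hc]
          split_ifs with h5
          · exact .inr ⟨by omega, rfl⟩
          · exact .inl ⟨by omega, rfl⟩
        rcases hyx with ⟨h5, h6⟩ | ⟨h5, h6⟩
        · rw [h5, h6, pow_add, mul_one, ← Int.mul_emod]
        · rw [h5, h6, pow_succ, pow_add, Int.mul_emod, ← Int.mul_emod (z ^ x), ← Int.mul_emod]
  · intro s' h
    rw [Nat.sub_self, pow_zero, Nat.div_one] at h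
    refine .nil ?_ (hR s' h.2.1 h.2.2)
    simp only [sum_const, card_range, nsmul_eq_mul, ctx_lam]
    have h1 : (k.size : ℝ) ≤ P.N.size := mod_cast hkN
    have h2 : (0 : ℝ) ≤ k.size := by positivity
    have h3 : (k.size : ℝ) * (modCost P.ctx P.lam + 7 * bc P.ctx P.lam) ≤
        P.N.size * cellCost P.ctx P.lam := by
      refine mul_le_mul h1 ?_ (by linarith) (by linarith)
      linarith [bc_le_modCost P.ctx P.lam]
    linarith

/-- The program that computes in the array `11` a family of vectors that spans the solutions of the
linear equations modulo the variable `12` whose coefficients are in the array `10`; the variables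
`20` and `21` hold the numbers of equations and unknowns. -/
def kernelProg : Program := blk [
  tabDot 11 0 (.var 21) (.var 21) 1
    (.ite (.var 36 - .var 37) 0 (.ite (.var 37 - .var 36) 0 1)),
  forLoop 22 (.var 20) (blk [
    tabMod 13 0 1 (.var 21) (.var 21)
      (.get 10 (.var 22 * .var 21 + .var 38) * .get 11 (.var 37 * .var 21 + .var 38)) (.var 12),
    findProg,
    tabMod 12 0 (.var 21) (.var 21) 1
      (.ite (.var 21 - .var 23) (.get 13 (.var 23)) 1 * .get 11 (.var 36 * .var 21 + .var 37) -
        .get 13 (.var 36) * .get 11 (.var 23 * .var 21 + .var 37)) (.var 12),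
    tabDot 11 0 (.var 21) (.var 21) 1 (.get 12 (.var 36 * .var 21 + .var 37))])]

/-- Sums of a few terms of the size of products of residues are short. -/
lemma bits_sum_residues {p N n : ℕ} {f : ℕ → ℤ} (hpN : p ≤ P.N) (hN : N ≤ 2 * P.D + 2) (hn : n ≤ N)
    (h : ∀ j < N, |f j| ≤ (2 * P.D + 4) * ((p : ℤ) * p * p)) : bits (∑ j ∈ range n, f j) ≤ P.lam := by
  refine P.short ?_
  have hpN' : (p : ℤ) ≤ P.N + 1 := mod_cast (by omega : p ≤ P.N + 1)
  have hnD : (n : ℤ) ≤ 2 * (P.D + 2) := mod_cast (by omega : n ≤ 2 * (P.D + 2))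
  calc |∑ j ∈ range n, f j| ≤ ∑ j ∈ range n, |f j| := abs_sum_le_sum_abs _ _
    _ ≤ ∑ _j ∈ range n, (2 * P.D + 4) * ((p : ℤ) * p * p) :=
        sum_le_sum fun j hj => h j ((mem_range.1 hj).trans_le hn)
    _ = n * ((2 * P.D + 4) * ((p : ℤ) * p * p)) := by simp
    _ ≤ 2 * (P.D + 2) * ((2 * P.D + 4) * ((P.N + 1) * (P.N + 1) * (P.N + 1))) := by gcongr
    _ = 4 * ((P.N : ℤ) + 1) ^ 3 * (P.D + 2) ^ 2 := by ring
    _ ≤ _ := by gcongr <;> omega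

/-- The rule for a table of sums of products of residues modulo the variable `12`. -/
lemma does_smallMod {a p : ℕ} {base n1 n2 n3 e : Ex} (B N1 N2 N3 : ℕ) (f : ℕ → ℕ → ℕ → ℤ)
    (hpN : p ≤ P.N) (h12 : s.v 12 = p) (hY : ∀ i, s.a 3 i = 0)
    (hev : ∀ s', Same s s' →
      base.eval s' = B ∧ n1.eval s' = N1 ∧ n2.eval s' = N2 ∧ n3.eval s' = N3)
    (hf : ∀ r < N1, ∀ k < N2, ∀ j < N3, |f r k j| ≤ (2 * P.D + 4) * ((p : ℤ) * p * p))
    (hterm : ∀ r < N1, ∀ k < N2, ∀ j < N3, ∀ s', Near a B (N1 * N2) s s' → s'.v 36 = r →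
      s'.v 37 = k → s'.v 38 = j → e.eval s' = f r k j)
    (hlen : ∀ r < N1, ∀ k < N2, B + r * N2 + k < P.len a)
    (hR : ∀ s', s'.a = fill s.a a B (N1 * N2)
      (fun t => (∑ j ∈ range N3, f (t / N2) (t % N2) j) % p) → Same s s' → R s') (hp0 : 0 < p := by omega)
    (hN1 : N1 ≤ 2 * P.D + 2 := by omega) (hN2 : N2 ≤ 2 * P.D + 2 := by omega)
    (hN3 : N3 ≤ 2 * P.D + 2 := by omega) (ha : a < 16 := by norm_num)
    (ha' : a = 1 ∨ 8 ≤ a := by norm_num)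
    (hok : (base.ok && n1.ok && n2.ok && n3.ok && e.ok) = true := by decide)
    (hsz : base.sz ≤ 15 ∧ n1.sz ≤ 57 ∧ n2.sz ≤ 15 ∧ n3.sz ≤ 57 ∧ e.sz ≤ 57 := by decide) :
    Does P.ctx (tabMod a base n1 n2 n3 e (.var 12)) s
      ((N1 + 1) * (N2 + 1) * (N3 + 1) * cellCost P.ctx P.lam) R := by
  simp only [Bool.and_eq_true] at hok
  have hpb : bits (p : ℤ) ≤ P.lam := P.short_N
  have e12 : ∀ s', Near a B (N1 * N2) s s' → s'.v 12 = p := fun s' h => by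
    rw [h.v 12, h12]
  refine does_tabMod (L := P.lam) (M := p) (f := f) ⟨le_rfl, (bet_of_le_top P.lam_le_top).1,
    ⟨P.short_D (by omega), P.short_D (by omega), P.short_D (by omega)⟩, fun s' h => hev s' h.toSame,
    fun r hr k hk j hj s' h h36 h37 h38 => ⟨hterm r hr k hk j hj s' h h36 h37 h38,
      fun hf => hf.leaf hok.2⟩,
    fun r hr k hk n hn => bits_sum_residues hpN hN3 hn (hf r hr k hk),
    ⟨hok.1.1.1.1, hok.1.1.1.2, hok.1.1.2, hok.1.2⟩, hsz⟩
    (mod_cast hp0) hpb (by decide) (fun s' h => ⟨by simp [e12 s' h], fun hf => hf.leaf (by decide)⟩)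
    (fun r hr k hk => ⟨ha, hlen r hr k hk, ?_⟩) hY (by omega) hR
  change _ ≤ P.cap a _
  rw [P.cap_small a _ ha']; exact hpb

/-- The rule for a table of sums of products of residues that is not reduced. -/
lemma does_smallDot {a p : ℕ} {base n1 n2 n3 e : Ex} (B N1 N2 N3 : ℕ) (f : ℕ → ℕ → ℕ → ℤ)
    (hpN : p ≤ P.N)
    (hev : ∀ s', Same s s' →
      base.eval s' = B ∧ n1.eval s' = N1 ∧ n2.eval s' = N2 ∧ n3.eval s' = N3)
    (hf : ∀ r < N1, ∀ k < N2, ∀ j < N3, |f r k j| ≤ (2 * P.D + 4) * ((p : ℤ) * p * p))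
    (hterm : ∀ r < N1, ∀ k < N2, ∀ j < N3, ∀ s', Near a B (N1 * N2) s s' → s'.v 36 = r →
      s'.v 37 = k → s'.v 38 = j → e.eval s' = f r k j)
    (hlen : ∀ r < N1, ∀ k < N2, B + r * N2 + k < P.len a)
    (hR : ∀ s', s'.a = fill s.a a B (N1 * N2)
      (fun t => ∑ j ∈ range N3, f (t / N2) (t % N2) j) → Same s s' → R s')
    (hN1 : N1 ≤ 2 * P.D + 2 := by omega) (hN2 : N2 ≤ 2 * P.D + 2 := by omega)
    (hN3 : N3 ≤ 2 * P.D + 2 := by omega) (ha : a < 16 := by norm_num)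
    (ha' : a = 1 ∨ 8 ≤ a := by norm_num)
    (hok : (base.ok && n1.ok && n2.ok && n3.ok && e.ok) = true := by decide)
    (hsz : base.sz ≤ 15 ∧ n1.sz ≤ 57 ∧ n2.sz ≤ 15 ∧ n3.sz ≤ 57 ∧ e.sz ≤ 57 := by decide) :
    Does P.ctx (tabDot a base n1 n2 n3 e) s
      ((N1 + 1) * (N2 + 1) * (N3 + 1) * cellCost P.ctx P.lam) R := by
  simp only [Bool.and_eq_true] at hok
  have hs : ∀ r < N1, ∀ k < N2, ∀ n ≤ N3, bits (∑ j ∈ range n, f r k j) ≤ P.lam :=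
    fun r hr k hk n hn => bits_sum_residues hpN hN3 hn (hf r hr k hk)
  refine does_tabDot (L := P.lam) (f := f) ⟨le_rfl, (bet_of_le_top P.lam_le_top).1,
    ⟨P.short_D (by omega), P.short_D (by omega), P.short_D (by omega)⟩, fun s' h => hev s' h.toSame,
    fun r hr k hk j hj s' h h36 h37 h38 => ⟨hterm r hr k hk j hj s' h h36 h37 h38,
      fun hf => hf.leaf hok.2⟩, hs,
    ⟨hok.1.1.1.1, hok.1.1.1.2, hok.1.1.2, hok.1.2⟩, hsz⟩
    (fun r hr k hk _ => ⟨ha, hlen r hr k hk, ?_⟩) hR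
  change _ ≤ P.cap a _
  rw [P.cap_small a _ ha']; exact hs r hr k hk N3 le_rfl

lemma len_table {n1 n2 x : ℕ} (hx : 9 ≤ x := by norm_num) (h1 : n1 ≤ 2 * P.D + 2 := by omega)
    (h2 : n2 ≤ 2 * P.D + 2 := by omega) :
    ∀ r < n1, ∀ k < n2, 0 + r * n2 + k < P.len x := by
  intro r hr k hk
  rw [len_nine hx]
  have h : r * n2 + k < n1 * n2 := by nlinarith
  have : n1 * n2 ≤ (2 * P.D + 2) * (2 * P.D + 2) := Nat.mul_le_mul h1 h2
  nlinarith

lemma fill_table_zero {A : ℕ → ℕ → ℤ} {a n1 n2 r k : ℕ} {w : ℕ → ℕ → ℤ} (hr : r < n1) (hk : k < n2) :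
    fill A a 0 (n1 * n2) (fun t => w (t / n2) (t % n2)) a (r * n2 + k) = w r k := by
  have := fill_table (A := A) (a := a) (base := 0) (w := w) hr hk
  rwa [Nat.zero_add] at this

lemma le_bound {p : ℕ} {z : ℤ} (h : z ≤ (p : ℤ) * p * p) : z ≤ (2 * P.D + 4) * ((p : ℤ) * p * p) := by
  refine h.trans (le_mul_of_one_le_left (by positivity) ?_)
  omega

lemma abs_residue {p : ℕ} {x : ℤ} (hx : 0 ≤ x ∧ x < p) : |x| ≤ (p : ℤ) * p * p := by
  have hp : (1 : ℤ) ≤ p := by linarith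
  rw [abs_of_nonneg hx.1]
  nlinarith [mul_nonneg (sub_nonneg.2 hp) (sub_nonneg.2 hp)]

lemma abs_mul_residues {p : ℕ} {x y : ℤ} (hx : 0 ≤ x ∧ x < p) (hy : 0 ≤ y ∧ y < p) :
    |x * y| ≤ (p : ℤ) * p * p := by
  have hp : (1 : ℤ) ≤ p := by linarith
  rw [abs_of_nonneg (mul_nonneg hx.1 hy.1)]
  calc x * y ≤ p * p := by nlinarith
    _ ≤ p * p * p := by nlinarith

lemma abs_flag {p : ℕ} (hp : p.Prime) (c : Prop) [Decidable c] :
    |if c then (1 : ℤ) else 0| ≤ (2 * P.D + 4) * ((p : ℤ) * p * p) :=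
  le_bound (abs_residue (by have := hp.two_le; split_ifs <;> omega))

lemma fill_row {A : ℕ → ℕ → ℤ} {a n k : ℕ} (w : ℕ → ℕ → ℤ) (hk : k < n) :
    fill A a 0 (1 * n) (fun t => w (t / n) (t % n)) a k = w 0 k := by
  have := fill_table_zero (A := A) (a := a) (w := w) one_pos hk
  rwa [Nat.zero_mul, Nat.zero_add] at this

set_option maxHeartbeats 1600000 in
lemma does_kernel {p n m : ℕ} [Fact p.Prime] (A : ℕ → ℕ → ℤ) (h12 : s.v 12 = p) (hpN : p ≤ P.N)
    (h20 : s.v 20 = m) (h21 : s.v 21 = n) (hm : m ≤ 2 * P.D) (hn : n ≤ 2 * P.D)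
    (hY : ∀ i, s.a 3 i = 0) (hA : ∀ i < m, ∀ l < n, s.a 10 (i * n + l) = A i l)
    (hA0 : ∀ i < m, ∀ l < n, 0 ≤ A i l ∧ A i l < p)
    (hR : ∀ s' (E : ℕ → ℕ → ℤ), Frame [22, 23, 24] [11, 12, 13] s s' →
      (∀ t < n, ∀ l < n, s'.a 11 (t * n + l) = E t l ∧ 0 ≤ E t l ∧ E t l < p) →
      SpansKernel p n (fun i l => (A i l : ZMod p)) m (fun t l => (E t l : ZMod p)) → R s') :
    Does P.ctx kernelProg s (8 * (2 * P.D + 1) ^ 3 * cellCost P.ctx P.lam) R := by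
  have hp : p.Prime := Fact.out
  have hp0 : (0 : ℤ) < p := mod_cast hp.pos
  have hp1 : (1 : ℤ) < p := mod_cast hp.one_lt
  have hpos := bc_pos P.ctx P.lam
  have hbm := bc_le_cellCost P.ctx P.lam
  have hpp : (p : ℤ) * p ≤ p * p * p := le_mul_of_one_le_right (by positivity) hp1.le
  have hmod := emod_bounds hp0
  have hcast : ∀ z : ℤ, ((z % p : ℤ) : ZMod p) = z := fun z => by simp
  have hd : (n : ℝ) + 1 ≤ 2 * P.D + 1 := mod_cast (by omega : n + 1 ≤ 2 * P.D + 1)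
  have hmd : (m : ℝ) + 1 ≤ 2 * P.D + 1 := mod_cast (by omega : m + 1 ≤ 2 * P.D + 1)
  have hn0 : (0 : ℝ) ≤ n := by positivity
  have hm0 : (0 : ℝ) ≤ m := by positivity
  have h8 := P.bc_eight_le
  set d : ℝ := 2 * P.D + 1
  set C := cellCost P.ctx P.lam with hC
  have hC0 : 0 < C := cellCost_pos _ _
  set X := ((n : ℝ) + 1) * (n + 1) * C with hX
  have hnX : ((n : ℝ) + 1) * C ≤ X := by
    rw [hX, mul_assoc]; exact le_mul_of_one_le_left (by positivity) (by linarith)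
  have hCX : C ≤ X := (le_mul_of_one_le_left hC0.le (by linarith)).trans hnX
  refine .cons (does_smallDot (p := p) 0 n n 1
    (fun r k _ => if r = k then 1 else 0) hpN
    (fun s' h => by simp [@h.v, h21]) (fun _ _ _ _ _ _ => abs_flag hp _) ?_ len_table fun s1 ha1 hv1 => ?_)
  · intro r _ k _ j _ s' h h36 h37 h38
    simp only [Ex.evals, h36, h37]
    split_ifs <;> first | rfl | omega
  have hf1 : Frame [22, 23, 24] [11, 12, 13] s s1 := (Frame.refl _ _ s).of_fill hv1 ha1
  have hE1 : ∀ t < n, ∀ l < n, s1.a 11 (t * n + l) = if t = l then 1 else 0 := fun t ht l hl => by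
    rw [ha1, fill_table_zero (w := fun r k => ∑ j ∈ range 1, if r = k then 1 else 0) ht hl]
    simp
  refine .cons (.forLoop (x := 22) (e := .var 20) m
    (P.short_D (by omega)) (I := fun i s' => s'.v 22 = i ∧ Frame [22, 23, 24] [11, 12, 13] s s' ∧
      (∀ t < n, ∀ l < n, 0 ≤ s'.a 11 (t * n + l) ∧ s'.a 11 (t * n + l) < p) ∧
      SpansKernel p n (fun i l => (A i l : ZMod p)) i (fun t l => (s'.a 11 (t * n + l) : ZMod p)))
    (T := fun _ => 7 * X + bc P.ctx P.lam) ?_ ?_ ?_ fun s' h =>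
      Does.nil ?_ (hR s' _ h.2.1 (fun t ht l hl => ⟨rfl, h.2.2.1 t ht l hl⟩) h.2.2.2))
  · refine ⟨by simp, hf1.set, fun t ht l hl => ?_, ?_⟩
    · rw [St.set_a, hE1 t ht l hl]
      split_ifs <;> constructor <;> linarith
    · refine (spansKernel_zero p n _).congr fun t ht l hl => ?_
      rw [St.set_a, hE1 t ht l hl]; split_ifs <;> simp
  · exact fun i hi s' h => ⟨h.1, by simp [h.2.1.v 20, h20]⟩
  · intro i hi s2 h _
    obtain ⟨h22, hf2, hEb, hsp⟩ := h
    have h12' : s2.v 12 = p := by rw [hf2.v 12, h12]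
    have h21' : s2.v 21 = n := by rw [hf2.v 21, h21]
    have hY2 : ∀ i, s2.a 3 i = 0 := fun i => by rw [hf2.a 3, hY]
    set E : ℕ → ℕ → ℤ := fun t l => s2.a 11 (t * n + l) with hE
    set v : ℕ → ℤ := fun t => (∑ l ∈ range n, A i l * E t l) % p with hv
    refine .cons (does_smallMod (p := p) 0 1 n n (fun _ k j => A i j * E k j) hpN h12' hY2
      (fun s' h => by simp [@h.v, h21'])
      (fun r _ k hk j hj => le_bound (abs_mul_residues (hA0 i hi j hj) (hEb k hk j hj))) ?_ len_table
      fun s3 ha3 hv3 => ?_)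
    · intro r _ k hk j hj s' h h36 h37 h38
      rw [Ex.eval_mul, Ex.get_eval (n := i * n + j) (by simp [@h.v, h22, h21', h38]),
        Ex.get_eval (n := k * n + j) (by simp [@h.v, h21', h37, h38]), h.arr 10 _, h.arr 11 _,
        hf2.a 10, hA i hi j hj]
    have hf3 : Frame [22, 23, 24] [11, 12, 13] s2 s3 := (Frame.refl _ _ s2).of_fill hv3 ha3
    have h13 : ∀ t < n, s3.a 13 t = v t := fun t ht => by
      rw [ha3, fill_row (fun _ k => (∑ j ∈ range n, A i j * E k j) % p) ht]
    have h21'' : s3.v 21 = n := by rw [hv3.v 21, h21']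
    have h11 : ∀ t l, s3.a 11 (t * n + l) = E t l := fun t l => by
      rw [ha3, fill_ne (by norm_num)]
    refine .cons (does_find (n := n) h21'' hn fun s4 σ hf4 h23 hσ => ?_)
    have hσ' : (σ = n ∧ ∀ t < n, v t = 0) ∨ (σ < n ∧ 0 < v σ) := by
      rcases hσ with ⟨h1, h2⟩ | ⟨h1, h2⟩
      · refine .inl ⟨h1, fun t ht => le_antisymm ?_ (hmod _).1⟩
        rw [← h13 t ht]; exact h2 t ht
      · exact .inr ⟨h1, by rwa [h13 σ h1] at h2⟩
    set w : ℤ := if σ < n then v σ else 1 with hw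
    have hwb : 0 ≤ w ∧ w < p := by
      rw [hw]; split_ifs
      exacts [hmod _, ⟨by norm_num, hp1⟩]
    have hf4' : Frame [22, 23, 24] [11, 12, 13] s2 s4 := hf3.trans hf4
    have h21a : s4.v 21 = n := by rw [hf4.v 21, h21'']
    have h11a : ∀ t l, s4.a 11 (t * n + l) = E t l := fun t l => by rw [hf4.a 11, h11]
    have h13a : ∀ t < n, s4.a 13 t = v t := fun t ht => by rw [hf4.a 13, h13 t ht]
    refine .cons (does_smallMod (p := p) 0 n n 1 (fun r k _ => w * E r k - v r * E σ k) hpN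
      (by rw [hf4'.v 12, h12']) (fun i => by rw [hf4'.a 3, hY2]) (fun s' h => by simp [@h.v, h21a]) ?_ ?_ len_table fun s5 ha5 hv5 => ?_)
    · intro r hr k hk j _
      have h1 := mul_nonneg hwb.1 (hEb r hr k hk).1
      have h3 : w * E r k ≤ p * p := mul_le_mul hwb.2.le (hEb r hr k hk).2.le (hEb r hr k hk).1 hp0.le
      have h2 : 0 ≤ v r * E σ k ∧ v r * E σ k ≤ p * p := by
        rcases hσ' with ⟨-, h5⟩ | ⟨h5, -⟩
        · rw [h5 r hr, zero_mul]; exact ⟨le_rfl, by positivity⟩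
        · exact ⟨mul_nonneg (hmod _).1 (hEb σ h5 k hk).1,
            mul_le_mul (hmod _).2.le (hEb σ h5 k hk).2.le (hEb σ h5 k hk).1 hp0.le⟩
      refine le_bound ?_
      rw [abs_le]
      constructor <;> linarith
    · intro r hr k hk j hj s' h h36 h37 h38
      have e3 : (Ex.ite (Ex.var 21 - Ex.var 23) (Ex.get 13 (Ex.var 23)) 1).eval s' = w := by
        simp only [Ex.evals, h.v 21, h.v 23, h21a, h23, Int.toNat_natCast]
        rw [hw, h.arr 13 _]
        by_cases hc : σ < n
        · rw [if_pos (by omega), if_pos hc, h13a σ hc]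
        · rw [if_neg (by omega), if_neg hc]
      rw [Ex.eval_sub, Ex.eval_mul, Ex.eval_mul, e3,
        Ex.get_eval (n := r * n + k) (by simp [@h.v, h21a, h36, h37]), Ex.get_eval (n := r) (by simp [h36]),
        Ex.get_eval (n := σ * n + k) (by simp [@h.v, h21a, h23, h37]),
        h.arr 11 _, h.arr 11 _, h.arr 13 _, h11a, h11a, h13a r hr]
    have h21b : s5.v 21 = n := by rw [hv5.v 21, h21a]
    have hf5 : Frame [22, 23, 24] [11, 12, 13] s2 s5 := hf4'.of_fill hv5 ha5
    have h12a : ∀ r < n, ∀ k < n, s5.a 12 (r * n + k) = (w * E r k - v r * E σ k) % p := by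
      intro r hr k hk
      rw [ha5, fill_table_zero (w := fun r k => (∑ j ∈ range 1, (w * E r k - v r * E σ k)) % p) hr hk]
      simp
    refine .cons (does_smallDot (p := p) 0 n n 1 (fun r k _ => (w * E r k - v r * E σ k) % p) hpN
      (fun s' h => by simp [@h.v, h21b]) (fun _ _ _ _ _ _ => le_bound (abs_residue (hmod _)))
      (fun r hr k hk j hj s' h h36 h37 h38 => ?_) len_table fun s6 ha6 hv6 => ?_)
    · rw [Ex.get_eval (n := r * n + k) (by simp [@h.v, h21b, h36, h37]), h.arr 12 _, h12a r hr k hk]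
    have hf6 : Frame [22, 23, 24] [11, 12, 13] s s6 :=
      (hf2.trans hf5 (V'' := [22, 23, 24]) (A'' := [11, 12, 13])).of_fill hv6 ha6
    have h11b : ∀ r < n, ∀ k < n, s6.a 11 (r * n + k) = (w * E r k - v r * E σ k) % p := by
      intro r hr k hk
      rw [ha6, fill_table_zero (w := fun r k => ∑ j ∈ range 1, (w * E r k - v r * E σ k) % p) hr hk]
      simp
    refine .nil ?_ ⟨?_, by simp, hf6.set, fun t ht l hl => ?_, ?_⟩
    · simp only [← hC]
      push_cast
      linarith
    · rw [hv6.v 22, hv5.v 22, hf4.v 22,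
        hv3.v 22, h22]
    · rw [St.set_a, h11b t ht l hl]; exact hmod _
    · refine (hsp.step (s := σ) (v := fun t => (v t : ZMod p)) ?_ ?_).congr fun t ht l hl => ?_
      · intro t ht
        simp only [hv]
        rw [hcast]; push_cast; rfl
      · rcases hσ' with ⟨h1, h2⟩ | ⟨h1, h2⟩
        · exact .inl ⟨h1, fun t ht => by rw [h2 t ht]; simp⟩
        · exact .inr ⟨h1, residue_ne_zero (hmod _) h2.ne'⟩
      · rw [St.set_a, h11b t ht l hl, hcast, hw]
        push_cast
        split_ifs <;> simp [hE]
  · simp only [sum_const, card_range, nsmul_eq_mul, ctx_lam, ← hC]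
    have hXd : X ≤ d * d * C := by rw [hX]; gcongr
    have h1 : ((m : ℝ) + 1) * (7 * X + 4 * bc P.ctx P.lam) ≤ d * (8 * (d * d * C)) := by
      gcongr
      linarith
    push_cast
    linarith

end Par

/-! ### Power series solutions of the differential equation of a power -/

section Series
open PowerSeries
variable {p : ℕ} [Fact p.Prime]

/-- The differential operator `2 H d/dx + H'`. It annihilates `H ^ ((p - 1) / 2)` in
characteristic `p`. -/
noncomputable def halfOp (H S : (ZMod p)⟦X⟧) : (ZMod p)⟦X⟧ :=
  2 * H * PowerSeries.derivative (ZMod p) S + PowerSeries.derivative (ZMod p) H * S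

lemma coeff_halfOp (H S : (ZMod p)⟦X⟧) (k : ℕ) : coeff k (halfOp H S) =
    ∑ j ∈ range (k + 2), ((k + 1 + j : ℕ) : ZMod p) * coeff (k + 1 - j) H * coeff j S := by
  have h1 : coeff k (2 * H * PowerSeries.derivative (ZMod p) S) = ∑ x ∈ Finset.HasAntidiagonal.antidiagonal (k + 1),
      (2 * x.2 : ZMod p) * coeff x.1 H * coeff x.2 S := by
    rw [Finset.Nat.sum_antidiagonal_succ', mul_assoc, show (2 : (ZMod p)⟦X⟧) = PowerSeries.C 2 from (map_ofNat _ 2).symm,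
      PowerSeries.coeff_C_mul, PowerSeries.coeff_mul, mul_sum]
    simp only [PowerSeries.coeff_derivative]
    push_cast
    rw [mul_zero, zero_mul, zero_mul, zero_add]
    exact sum_congr rfl fun x _ => by ring
  have h2 : coeff k (PowerSeries.derivative (ZMod p) H * S) = ∑ x ∈ Finset.HasAntidiagonal.antidiagonal (k + 1),
      (x.1 : ZMod p) * coeff x.1 H * coeff x.2 S := by
    rw [Finset.Nat.sum_antidiagonal_succ, PowerSeries.coeff_mul]
    simp only [PowerSeries.coeff_derivative]
    push_cast
    rw [zero_mul, zero_mul, zero_add]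
    exact sum_congr rfl fun x _ => by ring
  rw [halfOp, map_add, h1, h2, ← sum_add_distrib, ← Finset.Nat.sum_antidiagonal_swap,
    Finset.Nat.sum_antidiagonal_eq_sum_range_succ_mk]
  refine sum_congr rfl fun j hj => ?_
  have hj' : j ≤ k + 1 := by simpa [Nat.lt_succ_iff] using hj
  simp only [Prod.swap]
  have h : ((k + 1 + j : ℕ) : ZMod p) = 2 * j + ((k + 1 - j : ℕ) : ZMod p) := by
    rw [Nat.cast_sub hj']; push_cast; ring
  rw [h]; ring

/-- The coefficients of the operator at `S` vanish, except possibly those whose index is `-1` modulo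
`p`. -/
def IsHalfSol (H S : (ZMod p)⟦X⟧) : Prop := ∀ k, ¬ p ∣ k + 1 → coeff k (halfOp H S) = 0

lemma IsHalfSol.sub {H S S' : (ZMod p)⟦X⟧} (h : IsHalfSol H S) (h' : IsHalfSol H S') :
    IsHalfSol H (S - S') := by
  intro k hk
  have e : halfOp H (S - S') = halfOp H S - halfOp H S' := by
    simp only [halfOp, map_sub]; ring
  rw [e, map_sub, h k hk, h' k hk, sub_zero]

/-- The coefficients of `Y` vanish outside the multiples of `p`. -/
def IsExpanded (Y : (ZMod p)⟦X⟧) : Prop := ∀ k, ¬ p ∣ k → coeff k Y = 0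

lemma IsHalfSol.mul {H S Y : (ZMod p)⟦X⟧} (h : IsHalfSol H S) (hY : IsExpanded Y) :
    IsHalfSol H (Y * S) := by
  have hd : PowerSeries.derivative (ZMod p) Y = 0 := by
    ext k
    rw [PowerSeries.coeff_derivative, map_zero]
    by_cases hk : p ∣ k + 1
    · have : ((k + 1 : ℕ) : ZMod p) = 0 := (ZMod.natCast_eq_zero_iff _ _).2 hk
      push_cast at this
      rw [this, mul_zero]
    · rw [hY _ hk, zero_mul]
  have e : halfOp H (Y * S) = Y * halfOp H S := by
    simp only [halfOp, Derivation.leibniz, hd, smul_eq_mul]; ring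
  intro k hk
  rw [e, PowerSeries.coeff_mul]
  refine sum_eq_zero fun x hx => ?_
  have hx' := Finset.HasAntidiagonal.mem_antidiagonal.1 hx
  by_cases h1 : p ∣ x.1
  · rw [h x.2 (fun h2 => hk ?_), mul_zero]
    rw [← hx', add_assoc]; exact dvd_add h1 h2
  · rw [hY _ h1, zero_mul]

lemma two_mul_ne_zero_of_odd (hp : p ≠ 2) {k : ℕ} (hk : ¬ p ∣ k) {c : ZMod p} (hc : c ≠ 0) :
    2 * (k : ZMod p) * c ≠ 0 := by
  have h2 : ((2 : ℕ) : ZMod p) ≠ 0 := fun h =>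
    hp ((Nat.prime_dvd_prime_iff_eq Fact.out Nat.prime_two).1 ((ZMod.natCast_eq_zero_iff _ _).1 h))
  have hk' : (k : ZMod p) ≠ 0 := fun h => hk ((ZMod.natCast_eq_zero_iff _ _).1 h)
  exact mul_ne_zero (mul_ne_zero (mod_cast h2) hk') hc

lemma IsHalfSol.eq_zero (hp : p ≠ 2) {H S : (ZMod p)⟦X⟧} (hH : coeff 0 H ≠ 0) (h : IsHalfSol H S)
    (h0 : ∀ k, p ∣ k → coeff k S = 0) : S = 0 := by
  ext k
  rw [map_zero]
  induction k using Nat.strong_induction_on with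
  | _ k ih =>
    by_cases hk : p ∣ k
    · exact h0 k hk
    · obtain ⟨m, rfl⟩ : ∃ m, k = m + 1 := ⟨k - 1, by
        have : k ≠ 0 := by rintro rfl; exact hk (dvd_zero p)
        omega⟩
      have h1 := h m hk
      rw [coeff_halfOp, sum_range_succ, sum_eq_zero, zero_add] at h1
      · have h2 := two_mul_ne_zero_of_odd hp hk hH
        rw [Nat.sub_self, show ((m + 1 + (m + 1) : ℕ) : ZMod p) = 2 * ((m + 1 : ℕ) : ZMod p) by
          push_cast; ring] at h1
        exact (mul_eq_zero.1 h1).resolve_left h2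
      · intro j hj
        rw [ih j (mem_range.1 hj), mul_zero]

lemma IsHalfSol.ext (hp : p ≠ 2) {H S S' : (ZMod p)⟦X⟧} (hH : coeff 0 H ≠ 0) (h : IsHalfSol H S)
    (h' : IsHalfSol H S') (h0 : ∀ k, p ∣ k → coeff k S = coeff k S') : S = S' :=
  sub_eq_zero.1 ((h.sub h').eq_zero hp hH fun k hk => by rw [map_sub, h0 k hk, sub_self])

/-- The coefficients of the solution with constant coefficient `1` whose other coefficients at the
multiples of `p` vanish; `η` are the coefficients of `H`. -/
noncomputable def solCoeff (η : ℕ → ZMod p) (k : ℕ) : ZMod p :=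
  if p ∣ k then if k = 0 then 1 else 0 else
    -(2 * k * η 0)⁻¹ * ∑ j : Fin k, ((k + j : ℕ) : ZMod p) * η (k - j) * solCoeff η j
termination_by k
decreasing_by exact j.2

lemma solCoeff_zero (η : ℕ → ZMod p) : solCoeff η 0 = 1 := by rw [solCoeff]; simp

lemma solCoeff_of_dvd (η : ℕ → ZMod p) {k : ℕ} (hk : p ∣ k) (h0 : k ≠ 0) : solCoeff η k = 0 := by
  rw [solCoeff, if_pos hk, if_neg h0]

lemma solCoeff_rec (hp : p ≠ 2) {η : ℕ → ZMod p} (h0 : η 0 ≠ 0) {k : ℕ} (hk : ¬ p ∣ k) :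
    2 * k * η 0 * solCoeff η k =
      -∑ j ∈ range k, ((k + j : ℕ) : ZMod p) * η (k - j) * solCoeff η j := by
  have h := two_mul_ne_zero_of_odd hp hk h0
  rw [solCoeff, if_neg hk, sum_range, neg_mul, mul_neg, mul_inv_cancel_left₀ h]

lemma isHalfSol_solCoeff (hp : p ≠ 2) {H : (ZMod p)⟦X⟧} (hH : coeff 0 H ≠ 0) :
    IsHalfSol H (PowerSeries.mk (solCoeff fun k => coeff k H)) := by
  intro k hk
  rw [coeff_halfOp, sum_range_succ]
  simp only [coeff_mk]
  have h := solCoeff_rec (η := fun k => coeff k H) hp hH hk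
  rw [Nat.sub_self, show ((k + 1 + (k + 1) : ℕ) : ZMod p) = 2 * ((k + 1 : ℕ) : ZMod p) by
    push_cast; ring, h, add_neg_cancel]

lemma isHalfSol_pow {H : (ZMod p)⟦X⟧} {n : ℕ} (hn : p = 2 * n + 1) : IsHalfSol H (H ^ n) := by
  intro k _
  have e : halfOp H (H ^ n) = 0 := by
    have h0 : ((2 * n + 1 : ℕ) : (ZMod p)⟦X⟧) = 0 := by
      rw [← hn, ← map_natCast (PowerSeries.C (R := ZMod p)), ZMod.natCast_self, map_zero]
    have h1 : 2 * H * (n • H ^ (n - 1) • PowerSeries.derivative (ZMod p) H) =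
        2 * (n : (ZMod p)⟦X⟧) * H ^ n * PowerSeries.derivative (ZMod p) H := by
      rcases Nat.eq_zero_or_pos n with rfl | hn
      · simp
      · obtain ⟨m, rfl⟩ : ∃ m, n = m + 1 := ⟨n - 1, by omega⟩
        rw [Nat.add_sub_cancel, nsmul_eq_mul, smul_eq_mul, pow_succ]; ring
    rw [halfOp, Derivation.leibniz_pow, h1]
    calc _ = ((2 * n + 1 : ℕ) : (ZMod p)⟦X⟧) * (H ^ n * PowerSeries.derivative (ZMod p) H) := by push_cast; ring
      _ = 0 := by rw [h0, zero_mul]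
  rw [e, map_zero]

lemma coeff_expanded_mul (η : ℕ → ZMod p) {Y : (ZMod p)⟦X⟧} (hY : IsExpanded Y) {k : ℕ} (hk : p ∣ k) :
    coeff k (Y * PowerSeries.mk (solCoeff η)) = coeff k Y := by
  rw [PowerSeries.coeff_mul, sum_eq_single (k, 0)]
  · simp [solCoeff_zero]
  · rintro ⟨a, b⟩ hx hne
    have hab : a + b = k := Finset.HasAntidiagonal.mem_antidiagonal.1 hx
    by_cases h1 : p ∣ a
    · have hb : b ≠ 0 := by rintro rfl; exact hne (by simp [← hab])
      rw [coeff_mk, solCoeff_of_dvd η ((Nat.dvd_add_right h1).1 (hab ▸ hk)) hb, mul_zero]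
    · rw [hY a h1, zero_mul]
  · simp

/-- The coefficient with an integer index; it is `0` for a negative index. -/
noncomputable def zsol (η : ℕ → ZMod p) (k : ℤ) : ZMod p := if 0 ≤ k then solCoeff η k.toNat else 0

lemma zsol_natCast (η : ℕ → ZMod p) (k : ℕ) : zsol η k = solCoeff η k := by simp [zsol]

lemma zsol_neg (η : ℕ → ZMod p) {k : ℤ} (hk : k < 0) : zsol η k = 0 := by simp [zsol, not_le.2 hk]

lemma zsol_rec (hp : p ≠ 2) {η : ℕ → ZMod p} {D : ℕ} (h0 : η 0 ≠ 0) (hD : ∀ j, D < j → η j = 0)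
    {k : ℕ} (hk : ¬ p ∣ k) : 2 * k * η 0 * zsol η k =
      ∑ r ∈ range D, zsol η (k - 1 - r) * ((r + 1 - 2 * k) * η (r + 1)) := by
  have hk0 : k ≠ 0 := by rintro rfl; exact hk (dvd_zero p)
  rw [zsol_natCast, solCoeff_rec hp h0 hk, ← sum_range_reflect, ← sum_neg_distrib]
  have h1 : ∀ r ∈ range k, -(((k + (k - 1 - r) : ℕ) : ZMod p) * η (k - (k - 1 - r)) *
      solCoeff η (k - 1 - r)) = zsol η (k - 1 - r) * ((r + 1 - 2 * k) * η (r + 1)) := by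
    intro r hr
    have hr' := mem_range.1 hr
    have e : (k : ℤ) - 1 - r = ((k - 1 - r : ℕ) : ℤ) := by omega
    rw [e, zsol_natCast, show k - (k - 1 - r) = r + 1 by omega]
    have e2 : ((k + (k - 1 - r) : ℕ) : ZMod p) = 2 * k - (r + 1) := by
      have : k + (k - 1 - r) + (r + 1) = 2 * k := by omega
      rw [eq_sub_iff_add_eq]
      exact_mod_cast congrArg (Nat.cast : ℕ → ZMod p) this
    rw [e2]; ring
  rw [sum_congr rfl h1]
  set f : ℕ → ZMod p := fun r => zsol η (k - 1 - r) * ((r + 1 - 2 * k) * η (r + 1)) with hf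
  change ∑ r ∈ range k, f r = ∑ r ∈ range D, f r
  rcases le_total k D with h | h
  · refine sum_subset (range_mono h) fun r _ hr => ?_
    rw [mem_range, not_lt] at hr
    simp only [hf]
    rw [zsol_neg η (by omega), zero_mul]
  · refine (sum_subset (range_mono h) fun r _ hr => ?_).symm
    rw [mem_range, not_lt] at hr
    simp only [hf]
    rw [hD (r + 1) (by omega), mul_zero, mul_zero]

end Series

section Window
variable {p : ℕ} [Fact p.Prime]

/-- The matrix of the recursion that leads to the coefficient with index `k`. -/
def recMatrix (η : ℕ → ZMod p) (D k : ℕ) : Mat D (ZMod p) := Matrix.of fun r j =>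
  if 0 < (j : ℕ) then if (j : ℕ) = r + 1 then 2 * k * η 0 else 0 else (r + 1 - 2 * k) * η (r + 1)

/-- The product of the first `k` matrices of the recursion. -/
def recProd (η : ℕ → ZMod p) (D : ℕ) : ℕ → Mat D (ZMod p)
  | 0 => 1
  | k + 1 => recProd η D k * recMatrix η D (k + 1)

lemma recMatrix_add (η : ℕ → ZMod p) (D i k : ℕ) :
    recMatrix η D (p * i + k) = recMatrix η D k := by
  have h : ((p * i + k : ℕ) : ZMod p) = k := by simp
  simp only [recMatrix, h]

/-- `D` consecutive coefficients, the last one first. -/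
noncomputable def window (η : ℕ → ZMod p) (D : ℕ) (k : ℤ) : Fin D → ZMod p := fun j => zsol η (k - j)

lemma window_step (hp : p ≠ 2) {η : ℕ → ZMod p} {D : ℕ} (h0 : η 0 ≠ 0) (hD : ∀ j, D < j → η j = 0)
    {k : ℕ} (hk : ¬ p ∣ k) :
    Matrix.vecMul (window η D (k - 1)) (recMatrix η D k) = (2 * k * η 0) • window η D k := by
  funext j
  simp only [Matrix.vecMul, dotProduct, recMatrix, Matrix.of_apply, window, Pi.smul_apply, smul_eq_mul]
  rcases Nat.eq_zero_or_pos (j : ℕ) with hj | hj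
  · simp only [hj, lt_irrefl, if_false, Nat.cast_zero, sub_zero]
    rw [zsol_rec hp h0 hD hk, sum_range]
  · have hj1 : (j : ℕ) - 1 < D := by omega
    rw [sum_eq_single ⟨j - 1, hj1⟩]
    · rw [if_pos hj, if_pos (by simp only []; omega), mul_comm]
      congr 2
      push_cast [Nat.cast_sub hj]
      ring
    · intro r _ hr
      rw [if_pos hj, if_neg, mul_zero]
      intro h
      exact hr (Fin.ext (by simp only []; omega))
    · simp

lemma window_recProd (hp : p ≠ 2) {η : ℕ → ZMod p} {D : ℕ} (h0 : η 0 ≠ 0)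
    (hD : ∀ j, D < j → η j = 0) (i : ℕ) {k : ℕ} (hk : k < p) :
    Matrix.vecMul (window η D ((p : ℤ) * i)) (recProd η D k) =
      ((k.factorial : ZMod p) * (2 * η 0) ^ k) • window η D ((p : ℤ) * i + k) := by
  induction k with
  | zero => simp [recProd]
  | succ k ih =>
    have hk1 : ¬ p ∣ p * i + (k + 1) := fun h =>
      absurd (Nat.le_of_dvd (by omega) ((Nat.dvd_add_right (Dvd.intro _ rfl)).1 h)) (by omega)
    have h := window_step hp h0 hD hk1
    have hc : ((p * i + (k + 1) : ℕ) : ZMod p) = (k + 1 : ℕ) := by simp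
    rw [recMatrix_add, hc] at h
    have e1 : ((p * i + (k + 1) : ℕ) : ℤ) - 1 = (p : ℤ) * i + k := by push_cast; ring
    have e2 : ((p * i + (k + 1) : ℕ) : ℤ) = (p : ℤ) * i + (k + 1 : ℕ) := by push_cast; ring
    rw [e1, e2] at h
    rw [recProd, ← Matrix.vecMul_vecMul, ih (by omega), Matrix.smul_vecMul, h, smul_smul,
      Nat.factorial_succ]
    congr 1
    push_cast
    ring

lemma window_period (hp : p ≠ 2) {η : ℕ → ZMod p} {D : ℕ} (h0 : η 0 ≠ 0)
    (hD : ∀ j, D < j → η j = 0) (i : ℕ) (k : Fin D) : zsol η ((p : ℤ) * (i + 1) - (k + 1)) =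
      ∑ j : Fin D, zsol η ((p : ℤ) * i - j) * (-recProd η D (p - 1)) j k := by
  have hpp : p.Prime := Fact.out
  have h := congrFun (window_recProd hp h0 hD i (show p - 1 < p by have := hpp.pos; omega)) k
  have h2 : (2 : ZMod p) * η 0 ≠ 0 := by
    have := two_mul_ne_zero_of_odd (p := p) hp (k := 1) (by simpa using hpp.one_lt.ne') h0
    simpa using this
  rw [ZMod.wilsons_lemma, ZMod.pow_card_sub_one_eq_one h2] at h
  simp only [Matrix.vecMul, dotProduct, window, Pi.smul_apply, smul_eq_mul, mul_one, neg_mul,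
    one_mul] at h
  simp only [Matrix.neg_apply, mul_neg, sum_neg_distrib]
  rw [h, neg_neg]
  congr 1
  push_cast [Nat.cast_sub hpp.one_le]
  ring

lemma zsol_mul (η : ℕ → ZMod p) (i : ℕ) : zsol η ((p : ℤ) * i) = if i = 0 then 1 else 0 := by
  have hpp : p.Prime := Fact.out
  have h : (p : ℤ) * i = ((p * i : ℕ) : ℤ) := by push_cast; rfl
  rw [h, zsol_natCast]
  split_ifs with hi
  · rw [hi, Nat.mul_zero, solCoeff_zero]
  · exact solCoeff_of_dvd η (Dvd.intro _ rfl) (Nat.mul_ne_zero hpp.ne_zero hi)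

end Window

/-! ### The coefficients of the power of a squarefree polynomial -/

section Power
variable {p : ℕ} [Fact p.Prime]

/-- The coefficients of `φ(x ^ p) S`, where `S` is the normalized solution. -/
lemma coeff_expand_mul (η : ℕ → ZMod p) (φ : (ZMod p)[X]) (i j : ℕ) (hj : 1 ≤ j) (hij : j ≤ p * i)
    {I : ℕ} (hI : ∀ l, I ≤ l → φ.coeff l = 0) :
    PowerSeries.coeff (p * i - j) (((expand (ZMod p) p φ : (ZMod p)[X]) : PowerSeries (ZMod p)) *
      PowerSeries.mk (solCoeff η)) =
      ∑ l ∈ range I, if l < i then φ.coeff l * zsol η ((p : ℤ) * (i - l) - j) else 0 := by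
  have hpp : p.Prime := Fact.out
  rw [PowerSeries.coeff_mul, Finset.Nat.sum_antidiagonal_eq_sum_range_succ_mk]
  simp only [Polynomial.coeff_coe, coeff_expand hpp.pos, PowerSeries.coeff_mk]
  set F : ℕ → ZMod p := fun l => if l < i then φ.coeff l * zsol η ((p : ℤ) * (i - l) - j) else 0 with hF
  have h1 : ∀ l, p * l ≤ p * i - j → F l = φ.coeff l * solCoeff η (p * i - j - p * l) := by
    intro l hl
    have hli : l < i := Nat.lt_of_mul_lt_mul_left (a := p) (by omega)
    simp only [hF]
    rw [if_pos hli, ← zsol_natCast]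
    congr 2
    push_cast [Nat.cast_sub hl, Nat.cast_sub hij]
    ring
  have h2 : ∀ l, p * i - j < p * l → F l = 0 := by
    intro l hl
    simp only [hF]
    rw [zsol_neg, mul_zero, ite_self]
    have : (p * i : ℤ) < p * l + j := mod_cast (by omega : p * i < p * l + j)
    linarith
  have h4 : ∀ l, i ≤ l → F l = 0 := fun l hl => if_neg (not_lt.2 hl)
  have h3 : ∑ k ∈ range (p * i - j).succ, (if p ∣ k then φ.coeff (k / p) else 0) *
      solCoeff η (p * i - j - k) = ∑ l ∈ range i, F l := by
    rw [← sum_filter_of_ne (p := fun l => p * l ≤ p * i - j)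
      fun l _ h => not_lt.1 fun h' => h (h2 l h')]
    symm
    refine sum_of_injOn (fun l => p * l) (fun a _ b _ h => Nat.eq_of_mul_eq_mul_left hpp.pos h)
      (fun l hl => mem_coe.2 (mem_range_succ_iff.2 (mem_filter.1 hl).2)) ?_ ?_
    · intro k hk hk'
      rw [if_neg, zero_mul]
      rintro ⟨l, rfl⟩
      have hl := mem_range_succ_iff.1 hk
      refine hk' ⟨l, mem_coe.2 (mem_filter.2 ⟨mem_range.2 ?_, hl⟩), rfl⟩
      exact Nat.lt_of_mul_lt_mul_left (a := p) (by omega)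
    · intro l hl
      rw [h1 l (mem_filter.1 hl).2, if_pos (Dvd.intro _ rfl), Nat.mul_div_cancel_left _ hpp.pos]
  rw [h3]
  rcases le_total i I with h | h
  · exact sum_subset (range_mono h) fun l _ hl => h4 l (not_lt.1 (mt mem_range.2 hl))
  · refine (sum_subset (range_mono h) fun l _ hl => ?_).symm
    simp [hF, hI l (not_lt.1 (mt mem_range.2 hl))]

lemma isExpanded_expand (φ : (ZMod p)[X]) : IsExpanded ((expand (ZMod p) p φ : (ZMod p)[X]) : PowerSeries (ZMod p)) := by
  intro k hk
  rw [Polynomial.coeff_coe, coeff_expand (Fact.out : p.Prime).pos, if_neg hk]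

/-- Since no irreducible factor of `H` is repeated, `H ^ n` contributes less than `q` to the
multiplicities. -/
lemma dvd_of_mul_pow_eq {K : Type*} [Field K] {H Φ φ S : K[X]} {n q : ℕ} (hH : Squarefree H)
    (hn : n < q) (hΦ : Φ ≠ 0) (h : S * Φ ^ q = H ^ n * φ ^ q) : Φ ∣ φ := by
  refine (UniqueFactorizationMonoid.dvd_iff_emultiplicity_le hΦ).2 fun π hπ => ?_
  have hπH := ((squarefree_iff_emultiplicity_le_one H).1 hH π).resolve_right hπ.not_isUnit
  have h1 : q * emultiplicity π Φ ≤ n * 1 + q * emultiplicity π φ := by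
    rw [← emultiplicity_pow hπ, ← emultiplicity_pow hπ]
    refine (emultiplicity_le_emultiplicity_of_dvd_right (Dvd.intro_left S h)).trans ?_
    rw [emultiplicity_mul hπ, emultiplicity_pow hπ]
    gcongr
  by_contra hc
  rw [not_le] at hc
  lift emultiplicity π φ to ℕ using ne_top_of_lt hc with a
  have h2 := (mul_le_mul_right (Order.add_one_le_of_lt hc) (q : ℕ∞)).trans h1
  norm_cast at h2
  linarith

variable {H : (ZMod p)[X]} {n I : ℕ}

lemma coe_pow_eq (hp : p ≠ 2) (hn : p = 2 * n + 1) (h0 : H.coeff 0 ≠ 0) :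
    ((H ^ n : (ZMod p)[X]) : PowerSeries (ZMod p)) =
      ((expand (ZMod p) p (contract p (H ^ n)) : (ZMod p)[X]) : PowerSeries (ZMod p)) *
        PowerSeries.mk (solCoeff H.coeff) := by
  have hpp : p.Prime := Fact.out
  have hH : PowerSeries.coeff 0 (H : PowerSeries (ZMod p)) ≠ 0 := by rwa [Polynomial.coeff_coe]
  have hsol := isHalfSol_solCoeff hp hH
  simp only [Polynomial.coeff_coe] at hsol
  refine IsHalfSol.ext hp hH ?_ (hsol.mul (isExpanded_expand _)) fun k hk => ?_
  · rw [Polynomial.coe_pow]; exact isHalfSol_pow hn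
  · rw [coeff_expanded_mul _ (isExpanded_expand _) hk, Polynomial.coeff_coe, Polynomial.coeff_coe,
      coeff_expand hpp.pos, if_pos hk, coeff_contract hpp.ne_zero, Nat.div_mul_cancel hk]

lemma coeff_contract_pow_eq_zero (hI : n * H.natDegree < p * I) {l : ℕ} (hl : I ≤ l) :
    (contract p (H ^ n)).coeff l = 0 := by
  rw [coeff_contract (Fact.out : p.Prime).ne_zero]
  refine coeff_eq_zero_of_natDegree_lt ?_
  have h1 : (H ^ n).natDegree ≤ n * H.natDegree := natDegree_pow_le
  have h2 := Nat.mul_le_mul_left p hl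
  rw [mul_comm l p]; omega

lemma coeff_pow_eq (hp : p ≠ 2) (hn : p = 2 * n + 1) (h0 : H.coeff 0 ≠ 0)
    (hI : n * H.natDegree < p * I) {i j : ℕ} (hj : 1 ≤ j) (hij : j ≤ p * i) :
    (H ^ n).coeff (p * i - j) = ∑ l ∈ range I,
      if l < i then (H ^ n).coeff (l * p) * zsol H.coeff ((p : ℤ) * (i - l) - j) else 0 := by
  have h := coeff_expand_mul H.coeff (contract p (H ^ n)) i j hj hij
    fun l hl => coeff_contract_pow_eq_zero hI hl
  rw [← coe_pow_eq hp hn h0, Polynomial.coeff_coe] at h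
  simpa only [coeff_contract (Fact.out : p.Prime).ne_zero] using h

lemma kernel_pow (hp : p ≠ 2) (hn : p = 2 * n + 1) (h0 : H.coeff 0 ≠ 0)
    (hI : n * H.natDegree + H.natDegree < p * I) {m : ℕ} (hm : m < H.natDegree) :
    ∑ l ∈ range I, (H ^ n).coeff (l * p) * zsol H.coeff ((p : ℤ) * (I - l) - (m + 1)) = 0 := by
  have h := coeff_pow_eq hp hn h0 (I := I) (by omega) (i := I) (j := m + 1) (by omega) (by omega)
  rw [coeff_eq_zero_of_natDegree_lt] at h
  · rw [h]
    refine sum_congr rfl fun l hl => ?_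
    rw [if_pos (mem_range.1 hl)]
    push_cast; rfl
  · have h1 : (H ^ n).natDegree ≤ n * H.natDegree := natDegree_pow_le
    omega

/-- A combination of shifts of the normalized solution that ends early is a multiple of the power of
`H`: it solves the same differential equation, and its quotient by that power is a `p`-th power,
which is constant because `H` is squarefree. -/
lemma exists_smul_of_kernel (hp : p ≠ 2) (hn : p = 2 * n + 1) (h0 : H.coeff 0 ≠ 0)
    (hsq : Squarefree H) (hI : n * H.natDegree + H.natDegree < p * I)
    (hI' : p * I ≤ n * H.natDegree + H.natDegree + p) {x : ℕ → ZMod p}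
    (hx : ∀ m < H.natDegree,
      ∑ l ∈ range I, x l * zsol H.coeff ((p : ℤ) * (I - l) - (m + 1)) = 0) :
    ∃ c, ∀ l < I, x l = c * (H ^ n).coeff (l * p) := by
  have hpp : p.Prime := Fact.out
  set D := H.natDegree with hD
  set φ : (ZMod p)[X] := ∑ l ∈ range I, monomial l (x l) with hφ
  have hφc : ∀ l, φ.coeff l = if l < I then x l else 0 := by simp [hφ, coeff_monomial]
  have hφI : ∀ l, I ≤ l → φ.coeff l = 0 := fun l hl => by rw [hφc, if_neg (not_lt.2 hl)]
  set R : PowerSeries (ZMod p) := ((expand (ZMod p) p φ : (ZMod p)[X]) : PowerSeries (ZMod p)) *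
    PowerSeries.mk (solCoeff H.coeff) with hR
  have hH : PowerSeries.coeff 0 (H : PowerSeries (ZMod p)) ≠ 0 := by rwa [Polynomial.coeff_coe]
  have hsol : IsHalfSol (H : PowerSeries (ZMod p)) (PowerSeries.mk (solCoeff H.coeff)) := by
    have := isHalfSol_solCoeff hp hH
    simpa only [Polynomial.coeff_coe] using this
  have hRsol : IsHalfSol (H : PowerSeries (ZMod p)) R := hsol.mul (isExpanded_expand φ)
  have hgap : ∀ k, p * I - D ≤ k → k < p * I → PowerSeries.coeff k R = 0 := by
    intro k h1 h2
    have h3 := coeff_expand_mul H.coeff φ I (p * I - k) (by omega) (by omega) hφI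
    rw [show p * I - (p * I - k) = k by omega] at h3
    rw [hR, h3, ← hx (p * I - k - 1) (by omega)]
    refine sum_congr rfl fun l hl => ?_
    rw [if_pos (mem_range.1 hl), hφc, if_pos (mem_range.1 hl)]
    congr 2
    have : ((p * I - k : ℕ) : ℤ) = ((p * I - k - 1 : ℕ) : ℤ) + 1 := by omega
    rw [this]
  set S := PowerSeries.trunc (p * I) R with hS
  have hSc : ∀ k, S.coeff k = if k < p * I then PowerSeries.coeff k R else 0 := fun k =>
    PowerSeries.coeff_trunc k (p * I) R
  have hS0 : ∀ k, p * I - D ≤ k → S.coeff k = 0 := fun k hk =>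
    (hSc k).trans (ite_eq_right_iff.2 (hgap k hk))
  have hSsol : IsHalfSol (H : PowerSeries (ZMod p)) (S : PowerSeries (ZMod p)) := by
    intro k hk
    rcases Nat.lt_or_ge (k + 1) (p * I) with h | h
    · rw [← hRsol k hk, coeff_halfOp, coeff_halfOp]
      refine sum_congr rfl fun j hj => ?_
      rw [Polynomial.coeff_coe, Polynomial.coeff_coe, hSc, if_pos (by have := mem_range.1 hj; omega)]
    · rw [coeff_halfOp]
      refine sum_eq_zero fun j hj => ?_
      rw [Polynomial.coeff_coe, Polynomial.coeff_coe]
      rcases Nat.lt_or_ge D (k + 1 - j) with h1 | h1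
      · rw [coeff_eq_zero_of_natDegree_lt h1, mul_zero, zero_mul]
      · rw [hS0 j (by omega), mul_zero]
  have hRS : (S : PowerSeries (ZMod p)) = R := by
    refine IsHalfSol.ext hp hH hSsol hRsol fun k hk => ?_
    rw [Polynomial.coeff_coe, hSc]
    split_ifs with h
    · rfl
    · rw [hR, coeff_expanded_mul _ (isExpanded_expand _) hk, Polynomial.coeff_coe, coeff_expand hpp.pos,
        if_pos hk, hφI]
      exact (Nat.le_div_iff_mul_le hpp.pos).2 (by rw [mul_comm]; omega)
  set Φ := contract p (H ^ n) with hΦ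
  have hΦc : ∀ l, Φ.coeff l = (H ^ n).coeff (l * p) := fun l => coeff_contract hpp.ne_zero _ _
  have hΦ0 : Φ ≠ 0 := by
    intro h
    have h1 := hΦc 0
    rw [h, coeff_zero, Nat.zero_mul, coeff_zero_eq_eval_zero, eval_pow, ← coeff_zero_eq_eval_zero] at h1
    exact pow_ne_zero n h0 h1.symm
  have hH0 : H ≠ 0 := hsq.ne_zero
  have key : S * Φ ^ p = H ^ n * φ ^ p := by
    rw [← ZMod.expand_card Φ, ← ZMod.expand_card φ, ← Polynomial.coe_inj, Polynomial.coe_mul, Polynomial.coe_mul, hRS, hR,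
      coe_pow_eq hp hn h0]
    ring
  obtain ⟨c, hc⟩ := dvd_of_mul_pow_eq hsq (by omega) hΦ0 key
  have hSe : S = H ^ n * c ^ p := by
    have h : S * Φ ^ p = H ^ n * c ^ p * Φ ^ p := by rw [key, hc, mul_pow]; ring
    exact mul_right_cancel₀ (pow_ne_zero p hΦ0) h
  have hc0 : c.natDegree = 0 := by
    by_contra hc0
    have hcz : c ≠ 0 := by rintro rfl; exact hc0 natDegree_zero
    have h1 := natDegree_mul (pow_ne_zero n hH0) (pow_ne_zero p hcz)
    rw [← hSe, natDegree_pow, natDegree_pow, ← hD] at h1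
    have h2 : S.natDegree < p * I - D := by
      by_contra h
      rw [leadingCoeff_eq_zero.1 (hS0 _ (not_lt.1 h)), eq_comm, mul_eq_zero] at hSe
      exact hSe.elim (pow_ne_zero n hH0) (pow_ne_zero p hcz)
    have := Nat.mul_le_mul_left p (Nat.one_le_iff_ne_zero.2 hc0)
    omega
  refine ⟨c.coeff 0, fun l hl => ?_⟩
  have h := hφc l
  rw [if_pos hl, hc, eq_C_of_natDegree_eq_zero hc0, mul_comm, coeff_C_mul, hΦc] at h
  exact h.symm

/-- The system of linear equations that expresses `a H + b H' = 0`; the unknowns are the coefficients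
of `a` and `b`, both of degree less than the degree `D` of `H`. -/
def bezoutCoeff (η : ℕ → ZMod p) (D m l : ℕ) : ZMod p :=
  if l < D then if l ≤ m then η (m - l) else 0
  else if l - D ≤ m then ((m - (l - D) : ℕ) + 1) * η (m - (l - D) + 1) else 0

lemma squarefree_iff_kernel (hD : 1 ≤ H.natDegree) : Squarefree H ↔
    ∀ x : ℕ → ZMod p, (∀ m < 2 * H.natDegree,
      ∑ l ∈ range (2 * H.natDegree), bezoutCoeff H.coeff H.natDegree m l * x l = 0) →
      ∀ l < 2 * H.natDegree, x l = 0 := by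
  set D := H.natDegree with hDd
  have hH0 : H ≠ 0 := by rintro rfl; simp at hDd; omega
  rw [← PerfectField.separable_iff_squarefree]
  have hsum : ∀ (x : ℕ → ZMod p) (m : ℕ), ((∑ l ∈ range D, monomial l (x l)) * H +
      (∑ l ∈ range D, monomial l (x (D + l))) * derivative H).coeff m =
      ∑ l ∈ range (2 * D), bezoutCoeff H.coeff D m l * x l := by
    intro x m
    have h1 : ∀ (G : (ZMod p)[X]) (y : ℕ → ZMod p), ((∑ l ∈ range D, monomial l (y l)) * G).coeff m =
        ∑ l ∈ range D, if l ≤ m then G.coeff (m - l) * y l else 0 := by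
      intro G y
      rw [sum_mul, finsetSum_coeff]
      refine sum_congr rfl fun l _ => ?_
      rw [← C_mul_X_pow_eq_monomial, mul_assoc, coeff_C_mul, mul_comm (X ^ l), coeff_mul_X_pow']
      split_ifs <;> ring
    rw [coeff_add, h1, h1, two_mul, sum_range_add]
    congr 1 <;> refine sum_congr rfl fun l hl => ?_
    · rw [bezoutCoeff, if_pos (mem_range.1 hl)]
      split_ifs <;> ring
    · rw [bezoutCoeff, if_neg (show ¬ D + l < D by omega), Nat.add_sub_cancel_left, coeff_derivative]
      split_ifs <;> ring
  have hbig : ∀ m, 2 * D ≤ m → ∀ l < 2 * D, bezoutCoeff H.coeff D m l = 0 := by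
    intro m hm l hl
    unfold bezoutCoeff
    split_ifs <;> first | rfl | simp [coeff_eq_zero_of_natDegree_lt (p := H) (n := m - l) (by omega)] |
      simp [coeff_eq_zero_of_natDegree_lt (p := H) (n := m - (l - D) + 1) (by omega)]
  constructor
  · intro hsep x hx
    set a := ∑ l ∈ range D, monomial l (x l) with ha
    set b := ∑ l ∈ range D, monomial l (x (D + l)) with hb
    have h0 : a * H + b * derivative H = 0 := by
      ext m
      rw [hsum, coeff_zero]
      rcases Nat.lt_or_ge m (2 * D) with hm | hm
      · exact hx m hm
      · exact sum_eq_zero fun l hl => by rw [hbig m hm l (mem_range.1 hl), zero_mul]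
    have hco : ∀ (y : ℕ → ZMod p) l, l < D → (∑ l ∈ range D, monomial l (y l)).coeff l = y l := by
      intro y l hl
      simp [coeff_monomial, hl]
    have hb0 : b = 0 := by
      refine eq_zero_of_dvd_of_degree_lt (p := H) (hsep.dvd_of_dvd_mul_right (Dvd.intro (-a) ?_)) ?_
      · linear_combination (-1 : (ZMod p)[X]) * h0
      · rw [degree_eq_natDegree hH0]
        refine (degree_sum_le _ _).trans_lt ((Finset.sup_lt_iff (WithBot.bot_lt_coe D)).2 fun l hl => ?_)
        exact (degree_monomial_le l _).trans_lt (Nat.cast_lt.2 (mem_range.1 hl))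
    have ha0 : a = 0 := by
      rw [hb0, zero_mul, add_zero] at h0
      exact (mul_eq_zero.1 h0).resolve_right hH0
    intro l hl
    rcases Nat.lt_or_ge l D with h | h
    · rw [← hco x l h, ← ha, ha0, coeff_zero]
    · obtain ⟨l', rfl⟩ := Nat.exists_eq_add_of_le h
      rw [← hco (fun l => x (D + l)) l' (by omega), ← hb, hb0, coeff_zero]
  · intro hker
    -- the square system is regular, so that it also has a solution with right side `1`
    let A : Mat (2 * D) (ZMod p) := Matrix.of fun m l => bezoutCoeff H.coeff D m l
    let ext (x : Fin (2 * D) → ZMod p) (l : ℕ) : ZMod p := if h : l < 2 * D then x ⟨l, h⟩ else 0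
    have hA : ∀ x (m : Fin (2 * D)), ∑ l ∈ range (2 * D), bezoutCoeff H.coeff D m l * ext x l =
        A.mulVec x m := by
      intro x m
      simp [sum_range, ext, A, Matrix.mulVec, dotProduct]
    have hu : IsUnit A := Matrix.mulVec_injective_iff_isUnit.1
      ((injective_iff_map_eq_zero A.mulVecLin).2 fun x hx => funext fun l => by
        simpa [ext] using hker (ext x) (fun m hm => (hA x ⟨m, hm⟩).trans (congrFun hx _)) l l.2)
    obtain ⟨x, hx⟩ := Matrix.mulVec_surjective_iff_isUnit.2 hu fun m => if (m : ℕ) = 0 then 1 else 0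
    refine ⟨_, _, Polynomial.ext fun m => (hsum (ext x) m).trans ?_⟩
    rw [coeff_one]
    rcases Nat.lt_or_ge m (2 * D) with hm | hm
    · exact (hA x ⟨m, hm⟩).trans (congrFun hx _)
    · rw [if_neg (by omega)]
      exact sum_eq_zero fun l hl => by rw [hbig m hm l (mem_range.1 hl), zero_mul]

end Power

namespace Par
variable {P : Par} {s : St} {R : St → Prop}

/-! ### The test for good reduction -/

/-- The reduction of the polynomial with the coefficients `h`. -/
noncomputable def redPoly (P : Par) (p : ℕ) : (ZMod p)[X] :=
  ∑ j ∈ range (P.D + 1), monomial j (P.h j : ZMod p)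

/-- The reduced polynomial is squarefree of the right degree, and its constant coefficient does not
vanish. -/
def Good (P : Par) (p : ℕ) : Prop :=
  (P.h 0 : ZMod p) ≠ 0 ∧ (P.h P.D : ZMod p) ≠ 0 ∧ Squarefree (P.redPoly p)

lemma coeff_redPoly (hz : ∀ j, P.D < j → P.h j = 0) (p j : ℕ) :
    (P.redPoly p).coeff j = P.h j := by
  simp only [redPoly, finsetSum_coeff, coeff_monomial]
  rw [sum_ite_eq']
  split_ifs with h
  · rfl
  · rw [hz j (by simpa [Nat.lt_succ_iff] using h)]; simp

lemma natDegree_redPoly (hz : ∀ j, P.D < j → P.h j = 0) {p : ℕ} (h : (P.h P.D : ZMod p) ≠ 0) :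
    (P.redPoly p).natDegree = P.D := by
  refine natDegree_eq_of_le_of_coeff_ne_zero ?_ (by rwa [coeff_redPoly hz])
  rw [natDegree_le_iff_coeff_eq_zero]
  intro j hj
  rw [coeff_redPoly hz, hz j hj]; simp

/-- A bound on the time for a table of small numbers. -/
noncomputable def unit (P : Par) : ℝ := (2 * P.D + 3) ^ 3 * cellCost P.ctx P.W

lemma unit_le (P : Par) (n1 n2 n3 : ℕ) (h1 : n1 ≤ 2 * P.D + 2 := by omega)
    (h2 : n2 ≤ 2 * P.D + 2 := by omega) (h3 : n3 ≤ 2 * P.D + 2 := by omega) :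
    ((n1 : ℝ) + 1) * (n2 + 1) * (n3 + 1) * cellCost P.ctx P.lam ≤ P.unit := by
  have g : ∀ n : ℕ, n ≤ 2 * P.D + 2 → (n : ℝ) + 1 ≤ 2 * P.D + 3 := fun n h => by
    have : (n : ℝ) ≤ (2 * P.D + 2 : ℕ) := mod_cast h
    push_cast at this; linarith
  have hc := cellCost_mono P.ctx (show P.lam ≤ P.W by have := P.lam_le_W; omega)
  have hc0 := cellCost_pos P.ctx P.lam
  have := g n1 h1
  have := g n2 h2
  have := g n3 h3
  unfold unit
  rw [show (2 * (P.D : ℝ) + 3) ^ 3 = (2 * P.D + 3) * (2 * P.D + 3) * (2 * P.D + 3) by ring]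
  gcongr

lemma bc_le_unit : 800 * bc P.ctx P.lam ≤ P.unit := by
  have h := P.unit_le 0 0 0
  have := bc_le_cellCost P.ctx P.lam
  simp only [Nat.cast_zero, zero_add, one_mul] at h
  linarith

lemma kernelCost_le : 8 * (2 * (P.D : ℝ) + 1) ^ 3 * cellCost P.ctx P.lam ≤ 8 * P.unit := by
  have h := P.unit_le (2 * P.D) (2 * P.D) (2 * P.D)
  push_cast at h
  nlinarith

/-- The program that puts the coefficients modulo the variable `12` into the array `9`. -/
def reduceProg : Program := tabMod 9 0 1 (2 * .var 2 + 2) 1 (.get 2 (.var 37)) (.var 12)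

lemma does_reduce {p : ℕ} (hs : Holds P s) (h12 : s.v 12 = p) (hp : p ∈ P.primes)
    (hR : ∀ s', Frame [] [9] s s' → (∀ k ≤ 2 * P.D + 1, s'.a 9 k = P.h k % p) → R s') :
    Does P.ctx reduceProg s P.unit R := by
  have hp' := mem_primes.1 hp
  have hp0 : (0 : ℤ) < p := mod_cast hp'.2.1.pos
  have hpb : bits (p : ℤ) ≤ P.lam := P.short_N
  have hlW : P.lam ≤ P.W := by have := P.lam_le_W; omega
  refine .time_le (does_tabMod (L := P.W) (M := p) (B := 0) (N1 := 1) (N2 := 2 * P.D + 2) (N3 := 1)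
    (f := fun _ k _ => P.h k) ⟨hlW, (bet_of_le_top ?_).1, ⟨bits_one, P.short_D (by omega), bits_one⟩, fun s' h => ?_, fun r hr k hk j hj s' h h36 h37 h38 => ?_,
      fun r hr k hk n hn => bits_sum_one hn ?_, by decide, by decide⟩ hp0 (hpb.trans hlW) (by decide)
    (fun s' h => ⟨by simp [@h.v, h12], fun hf => (hf.leaf (by decide)).mono hlW⟩)
    (fun r hr k hk => ⟨by norm_num, ?_, ?_⟩) hs.stack (by norm_num) fun s' ha hv => hR s'
      ((Frame.refl _ _ s).of_fill hv ha) fun k hk => ?_) ?_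
  · exact (leaves_mul_le (P := P) (v := 1) le_rfl (le_refl P.W)) |>.trans' (by
      rw [leaves_one]; exact (Nat.le_mul_of_pos_left _ P.one_le_B).trans (Nat.le_add_right _ _))
  · simp [@h.v, hs.v2]
  · have e1 : s'.a 2 k = P.h k := by rw [h.arr 2 _, hs.h]
    refine ⟨by simp [h37, e1], fun hf => ?_⟩
    rw [Ex.leaf_get, Ex.eval_var, h37, Int.toNat_natCast, e1]
    exact ⟨(hf.leaf (by decide)).mono hlW, (P.hh k).trans (by unfold W; omega)⟩
  · exact (P.hh k).trans (by unfold W; omega)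
  · exact len_table (by norm_num) (by omega) le_rfl r hr k hk
  · change _ ≤ P.cap 9 _
    rw [cap_nine]; exact hpb
  · rw [ha, fill_row (fun _ k => (∑ j ∈ range 1, P.h k) % p) (by omega), sum_range_one]
  · have := cellCost_pos P.ctx P.W
    unfold unit
    gcongr
    push_cast
    have : (2 : ℝ) ≤ P.D := mod_cast P.hD
    nlinarith [sq_nonneg ((P.D : ℝ))]

/-- The program that tests for good reduction modulo the variable `12`; the variable `26` becomes
`1` if the test succeeds, and `0` otherwise. -/
def testProg : Program := blk [reduceProg, asg 20 (2 * .var 2), asg 21 (2 * .var 2),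
  asg 25 (.var 2 + 1),
  tabMod 10 0 (.var 20) (.var 21) 1 (.ite (.var 2 - .var 37)
    (.ite (.var 36 + 1 - .var 37) (.get 9 (.var 36 - .var 37)) 0)
    (.ite (.var 36 + .var 25 - .var 37) ((.var 36 + .var 25 - .var 37) *
      .get 9 (.var 36 + .var 25 - .var 37)) 0)) (.var 12),
  kernelProg, tabDot 13 0 1 (.var 21) (.var 21) (.get 11 (.var 37 * .var 21 + .var 38)), findProg,
  asg 26 (.ite (.get 9 0) (.ite (.get 9 (.var 2)) (.ite (.var 21 - .var 23) 0 1) 0) 0)]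

/-- The rule for finding a nonzero vector in the table of solutions. -/
lemma does_findRow {p n : ℕ} {E : ℕ → ℕ → ℤ} (h21 : s.v 21 = n) (hn : n ≤ 2 * P.D) (hpN : p ≤ P.N)
    (hE : ∀ t < n, ∀ l < n, s.a 11 (t * n + l) = E t l ∧ 0 ≤ E t l ∧ E t l < p)
    {T : ℝ} {Ps : List Program}
    (hR : ∀ s' σ, Frame [23, 24] [13] s s' → s'.v 23 = (σ : ℕ) →
      ((σ = n ∧ ∀ t < n, ∀ l < n, E t l = 0) ∨ (σ < n ∧ ∃ l < n, E σ l ≠ 0)) →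
      Does P.ctx (blk Ps) s' (T - 2 * P.unit) R) :
    Does P.ctx (blk (tabDot 13 0 1 (.var 21) (.var 21) (.get 11 (.var 37 * .var 21 + .var 38)) ::
      findProg :: Ps)) s T R := by
  have hnD : n ≤ 2 * P.D + 2 := by omega
  have hsum : ∀ t < n, (∑ j ∈ range n, E t j ≤ 0 ↔ ∀ l < n, E t l = 0) := fun t ht => by
    have h0 : ∀ l ∈ range n, 0 ≤ E t l := fun l hl => (hE t ht l (mem_range.1 hl)).2.1
    rw [(sum_nonneg h0).ge_iff_eq', sum_eq_zero_iff_of_nonneg h0]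
    simp only [mem_range]
  refine .cons (does_smallDot (p := p) 0 1 n n (fun _ k j => E k j) hpN (fun s' h => by simp [@h.v, h21])
    (fun r _ k hk j hj => le_bound (abs_residue (hE k hk j hj).2)) ?_ len_table fun s1 ha1 hv1 => ?_)
  · intro r _ k hk j hj s' h h36 h37 h38
    rw [Ex.get_eval (n := k * n + j) (by simp [@h.v, h21, h37, h38]), h.arr 11 _, (hE k hk j hj).1]
  have h13 : ∀ t < n, s1.a 13 t = ∑ j ∈ range n, E t j := fun t ht => by
    rw [ha1, fill_row (fun _ k => ∑ j ∈ range n, E k j) ht]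
  refine .cons (does_find (n := n) (by rw [hv1.v 21, h21]) hn fun s2 σ hf2 h23 hσ =>
    Does.time_le (hR s2 σ ?_ h23 ?_) ?_)
  · exact (((Frame.refl [23, 24] [13] s).of_fill hv1 ha1)).trans hf2
  · rcases hσ with ⟨h1, h2⟩ | ⟨h1, h2⟩
    · exact .inl ⟨h1, fun t ht => (hsum t ht).1 (by rw [← h13 t ht]; exact h2 t ht)⟩
    · refine .inr ⟨h1, ?_⟩
      by_contra h
      push Not at h
      rw [h13 σ h1] at h2
      exact absurd ((hsum σ h1).2 h) (not_le.2 h2)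
  · have h1 := P.unit_le 1 n n
    have h2 := P.unit_le n 0 0
    simp only [Nat.cast_zero, zero_add, mul_one] at h2
    linarith

lemma does_test {p : ℕ} (hs : Holds P s) (hz : ∀ j, P.D < j → P.h j = 0) (h12 : s.v 12 = p)
    (hp : p ∈ P.primes)
    (hR : ∀ s', Frame [20, 21, 22, 23, 24, 25, 26] [9, 10, 11, 12, 13] s s' →
      (∀ k ≤ 2 * P.D + 1, s'.a 9 k = P.h k % p) →
      ((s'.v 26 = 1 ∧ P.Good p) ∨ (s'.v 26 = 0 ∧ ¬ P.Good p)) → R s') :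
    Does P.ctx testProg s (13 * P.unit) R := by
  have hp' := mem_primes.1 hp
  have hpN := hp'.1
  have : Fact p.Prime := ⟨hp'.2.1⟩
  have hp0 : (0 : ℤ) < p := mod_cast hp'.2.1.pos
  have hmod := emod_bounds hp0
  have hcast : ∀ z : ℤ, ((z % p : ℤ) : ZMod p) = z := fun z => by simp
  have hD := P.hD
  have hpos := bc_pos P.ctx P.lam
  have hbu := bc_le_unit (P := P)
  have hku := kernelCost_le (P := P)
  have h8 := P.bc_eight_le
  have hb2 : bits ((2 * P.D : ℕ) : ℤ) ≤ P.lam := P.short_D (by omega)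
  refine .cons (does_reduce hs h12 hp fun s1 hf1 h9 => ?_)
  refine .cons (.asg_ok ((2 * P.D : ℕ) : ℤ)
    (by simp [hf1.v 2 (by norm_num), hs.v2]) (fun _ => hb2) (.cons (.asg_ok ((2 * P.D : ℕ) : ℤ) (by simp [hf1.v 2 (by norm_num), hs.v2]) (fun _ => hb2)
    (.cons (.asg_ok ((P.D + 1 : ℕ) : ℤ)
    (by simp [hf1.v 2 (by norm_num), hs.v2]) (fun _ => P.short_D (by omega)) ?_)))))
  set s2 := ((s1.set 20 ((2 * P.D : ℕ) : ℤ)).set 21 ((2 * P.D : ℕ) : ℤ)).set 25 ((P.D + 1 : ℕ) : ℤ) with hs2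
  have hf2 : Frame [20, 21, 22, 23, 24, 25, 26] [9, 10, 11, 12, 13] s s2 :=
    (((hf1.mono (V' := [20, 21, 22, 23, 24, 25, 26]) (A' := [9, 10, 11, 12, 13])).set).set).set
  have hH2 := hs.frame hf2
  have h9' : ∀ k ≤ 2 * P.D + 1, s2.a 9 k = P.h k % p := fun k hk => by rw [hs2]; simp [h9 k hk]
  have h20 : s2.v 20 = (2 * P.D : ℕ) := by simp [hs2]
  have h21 : s2.v 21 = (2 * P.D : ℕ) := by simp [hs2]
  have h25' : s2.v 25 = (P.D + 1 : ℕ) := by simp [hs2]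
  have h12' : s2.v 12 = p := by rw [hf2.v 12, h12]
  set A : ℕ → ℕ → ℤ := fun m l => if l < P.D then if l ≤ m then P.h (m - l) % p else 0
    else if l - P.D ≤ m then ((m - (l - P.D) : ℕ) + 1) * (P.h (m - (l - P.D) + 1) % p) else 0 with hA
  refine .cons (does_smallMod (p := p) 0 (2 * P.D) (2 * P.D) 1 (fun m l _ => A m l) hpN h12' hH2.stack
    (fun s' h => by simp [@h.v, h20, h21]) ?_ ?_ len_table
    fun s3 ha3 hv3 => ?_)
  · intro m hm l hl _ _
    have hzero : |(0 : ℤ)| ≤ (2 * P.D + 4) * ((p : ℤ) * p * p) := by rw [abs_zero]; positivity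
    simp only [hA]
    split_ifs
    · exact le_bound (abs_residue (hmod _))
    · exact hzero
    · rw [abs_mul]
      exact mul_le_mul (by rw [abs_of_nonneg (by positivity)]; omega) (abs_residue (hmod _))
        (abs_nonneg _) (by positivity)
    · exact hzero
  · intro m hm l hl j _ s' h h36 h37 _
    have h2' : s'.v 2 = P.D := by rw [h.v 2, hH2.v2]
    have h25s : s'.v 25 = (P.D + 1 : ℕ) := by rw [h.v 25, h25']
    have hn9 : ∀ i, s'.a 9 i = s2.a 9 i := fun i => h.arr 9 _
    simp only [Ex.evals, h36, h37, h2', h25s, hA, hn9]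
    by_cases hl' : l < P.D
    · rw [if_pos (by omega), if_pos hl']
      by_cases hm' : l ≤ m
      · rw [if_pos (by omega), if_pos hm', show ((m : ℤ) - l).toNat = m - l by omega, h9' _ (by omega)]
      · rw [if_neg (by omega), if_neg hm']
    · rw [if_neg (by omega), if_neg hl']
      by_cases hm' : l - P.D ≤ m
      · rw [if_pos (by omega), if_pos hm',
          show ((m : ℤ) + (P.D + 1 : ℕ) - l).toNat = m - (l - P.D) + 1 by omega, h9' _ (by omega)]
        congr 1; omega
      · rw [if_neg (by omega), if_neg hm']
  have hf3 : Frame [20, 21, 22, 23, 24, 25, 26] [9, 10, 11, 12, 13] s s3 := hf2.of_fill hv3 ha3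
  have h10 : ∀ m < 2 * P.D, ∀ l < 2 * P.D, s3.a 10 (m * (2 * P.D) + l) = A m l % p := by
    intro m hm l hl
    rw [ha3, fill_table_zero (w := fun m l => (∑ j ∈ range 1, A m l) % p) hm hl,
      sum_range_one]
  refine .cons (does_kernel (p := p) (n := 2 * P.D) (m := 2 * P.D) (fun m l => A m l % p)
    (by rw [hv3.v 12, h12']) hpN (by rw [hv3.v 20, h20])
    (by rw [hv3.v 21, h21]) le_rfl le_rfl (hs.frame hf3).stack h10
    (fun m _ l _ => hmod _) fun s4 E hf4 hE hsp => ?_)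
  have h214 : s4.v 21 = (2 * P.D : ℕ) := by
    rw [hf4.v 21, hv3.v 21, h21]
  refine does_findRow (n := 2 * P.D) h214 le_rfl hpN hE fun s5 σ hf5 h23 hσ => ?_
  have hf5' : Frame [20, 21, 22, 23, 24, 25, 26] [9, 10, 11, 12, 13] s s5 :=
    (hf3.trans hf4 (V'' := [20, 21, 22, 23, 24, 25, 26]) (A'' := [9, 10, 11, 12, 13])).trans hf5
  have h95 : ∀ k ≤ 2 * P.D + 1, s5.a 9 k = P.h k % p := fun k hk => by
    rw [hf5.a 9, hf4.a 9, ha3, fill_ne (by norm_num), h9' k hk]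
  have h215 : s5.v 21 = (2 * P.D : ℕ) := by rw [hf5.v 21, h214]
  have h25 : s5.v 2 = P.D := by rw [hf5'.v 2, hs.v2]
  have hker : (∀ x : ℕ → ZMod p, (∀ m < 2 * P.D, ∑ l ∈ range (2 * P.D),
      bezoutCoeff (P.redPoly p).coeff P.D m l * x l = 0) → ∀ l < 2 * P.D, x l = 0) ↔ σ = 2 * P.D := by
    have hAb : ∀ m l, ((A m l % p : ℤ) : ZMod p) = bezoutCoeff (P.redPoly p).coeff P.D m l := by
      intro m l
      rw [hcast]
      simp only [hA, bezoutCoeff, coeff_redPoly hz]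
      split_ifs
      · rw [hcast]
      · simp
      · push_cast; simp
      · simp
    have hsp' : SpansKernel p (2 * P.D) (bezoutCoeff (P.redPoly p).coeff P.D) (2 * P.D)
        (fun t l => (E t l : ZMod p)) := by
      have e : (fun i l => ((A i l % p : ℤ) : ZMod p)) = bezoutCoeff (P.redPoly p).coeff P.D := by
        funext m l; exact hAb m l
      rwa [e] at hsp
    constructor
    · intro h
      rcases hσ with ⟨h1, -⟩ | ⟨h1, l, hl, h2⟩
      · exact h1
      · exfalso
        exact residue_ne_zero (hE σ h1 l hl).2 h2
          (h (fun l => (E σ l : ZMod p)) (fun m hm => hsp'.mem σ h1 m hm) l hl)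
    · intro h x hx l hl
      obtain ⟨y, hy⟩ := hsp'.span x hx
      rw [hy l hl]
      refine sum_eq_zero fun t ht => ?_
      rcases hσ with ⟨-, h1⟩ | ⟨h1, -⟩
      · rw [h1 t (mem_range.1 ht) l hl]; simp
      · omega
  have hpos' : ∀ z : ℤ, 0 < z % p ↔ (z : ZMod p) ≠ 0 := fun z => by
    rw [Ne, ZMod.intCast_zmod_eq_zero_iff_dvd, Int.dvd_iff_emod_eq_zero]
    have := (hmod z).1
    omega
  have hgood : P.Good p ↔ (P.h 0 : ZMod p) ≠ 0 ∧ (P.h P.D : ZMod p) ≠ 0 ∧ σ = 2 * P.D := by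
    unfold Good
    refine and_congr_right fun _ => and_congr_right fun h => ?_
    have hd := natDegree_redPoly hz h
    rw [← hker, squarefree_iff_kernel (by rw [hd]; omega), hd]
  classical
  have hσ2 : σ ≤ 2 * P.D := by rcases hσ with h | h <;> omega
  refine .cons (.asg_ok (if P.Good p then 1 else 0) ?_
    (fun _ => ?_) (.nil ?_ (hR _ (hf5'.set) (fun k hk => by simp [h95 k hk]) ?_)))
  · simp only [Ex.evals, h215, h25, h23,
      Int.toNat_natCast, Int.toNat_zero]
    rw [h95 P.D (by omega), h95 0 (by omega)]
    by_cases g0 : (P.h 0 : ZMod p) ≠ 0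
    · rw [if_pos ((hpos' _).2 g0)]
      by_cases gD : (P.h P.D : ZMod p) ≠ 0
      · rw [if_pos ((hpos' _).2 gD)]
        by_cases gσ : σ = 2 * P.D
        · rw [if_neg (by omega), if_pos (hgood.2 ⟨g0, gD, gσ⟩)]
        · rw [if_pos (by omega), if_neg (fun h => gσ (hgood.1 h).2.2)]
      · rw [if_neg (fun h => gD ((hpos' _).1 h)), if_neg (fun h => gD (hgood.1 h).2.1)]
    · rw [if_neg (fun h => g0 ((hpos' _).1 h)), if_neg (fun h => g0 (hgood.1 h).1)]
  · split_ifs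
    exacts [bits_one, by simp]
  · have g := P.unit_le (2 * P.D) (2 * P.D) 1
    simp only [ctx_lam]
    linarith
  · by_cases h : P.Good p
    · left; simp [h]
    · right; simp [h]

end Par

namespace Par
variable {P : Par} {s : St} {R : St → Prop}

/-! ### The Hasse–Witt matrix at a prime of good reduction -/

/-- The program that puts the negative of the product in the current leaf into the array `12`. -/
def transProg : Program := tabMod 12 0 (.var 2) (.var 2) 1
  (0 - entry 6 ((.var 5 + .var 10) * .var 33) 36 37) (.var 12)

lemma does_trans {p i : ℕ} {X : Mat P.D ℤ} (hs : Holds P s) (h12 : s.v 12 = p)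
    (hp : p ∈ P.primes) (h10 : s.v 10 = i) (hX : MatAt s 6 (P.B + i) X)
    (hXb : ∀ r k, 0 ≤ X r k ∧ X r k < p)
    (hR : ∀ s', Frame [] [12] s s' →
      (∀ r k : Fin P.D, s'.a 12 (r * P.D + k) = (-X r k) % p) → R s') :
    Does P.ctx transProg s P.unit R := by
  have hp' := mem_primes.1 hp
  have hp0 : (0 : ℤ) < p := mod_cast hp'.2.1.pos
  have hpb : bits (p : ℤ) ≤ P.lam := P.short_N
  have hXs : ∀ r k, bits (X r k) ≤ P.lam := fun r k => bits_residue hp'.1 (hXb r k).1 (hXb r k).2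
  refine .time_le (does_tabMod (L := P.lam) (M := p) (B := 0) (N1 := P.D) (N2 := P.D) (N3 := 1)
    (f := fun r k _ => 0 - s.a 6 ((P.B + i) * (P.D * P.D) + r * P.D + k))
    ⟨le_rfl, (bet_of_le_top P.lam_le_top).1, ⟨bits_D, bits_D, bits_one⟩, fun s' h => ?_, fun r hr k hk j hj s' h h36 h37 h38 => ?_,
      fun r hr k hk n hn => bits_sum_one hn ?_, by decide, by decide⟩ hp0 hpb (by decide)
    (fun s' h => ⟨by simp [@h.v, h12], fun hf => hf.leaf (by decide)⟩)
    (fun r hr k hk => ⟨by norm_num, ?_, ?_⟩) hs.stack (by norm_num) fun s' ha hv => hR s'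
      ((Frame.refl _ _ s).of_fill hv ha) fun r k => ?_) ?_
  · simp [@h.v, hs.v2]
  · have b := entry_spec (L := P.lam) (u := P.B + i) (i := (.var 5 + .var 10) * .var 33) (by decide)
      (by simp [@h.v, hs.v2]) (by simp [@h.v, hs.v5, hs.v33, h10]) h36 h37
      (h.arr 6 ((P.B + i) * (P.D * P.D) + r * P.D + k) (by norm_num)) le_rfl
      (by rw [hX ⟨r, hr⟩ ⟨k, hk⟩]; exact hXs _ _)
    exact ⟨by rw [Ex.eval_sub, b.1]; rfl, fun hf => ⟨by simp [Ex.Leaf], b.2 hf⟩⟩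
  · rw [hX ⟨r, hr⟩ ⟨k, hk⟩, zero_sub]
    simpa [bits] using hXs ⟨r, hr⟩ ⟨k, hk⟩
  · exact len_table (by norm_num) (by omega) (by omega) r hr k hk
  · change _ ≤ P.cap 12 _
    rw [cap_nine]; exact hpb
  · rw [ha, fill_table_zero (w := fun r k => (∑ j ∈ range 1,
      (0 - s.a 6 ((P.B + i) * (P.D * P.D) + r * P.D + k))) % p) r.2 k.2, sum_range_one, hX r k,
      zero_sub]
  · exact P.unit_le _ _ 1

/-- The program that computes the table of the coefficients of the normalized solution whose indices
are within `D` below a multiple of the prime. -/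
def solProg : Program := blk [tabDot 14 0 1 (.var 2 + 1) 1 (.ite (.var 37) 0 1),
  forLoop 27 (.var 2 + 1) (tabMod 14 ((.var 27 + 1) * (.var 2 + 1)) 1 (.var 2 + 1) (.var 2)
    (.ite (.var 37) (.get 14 (.var 27 * (.var 2 + 1) + .var 38) *
      .get 12 (.var 38 * .var 2 + .var 37 - 1)) 0) (.var 12))]

lemma does_sol {p : ℕ} [Fact p.Prime] {η : ℕ → ZMod p} (hs : Holds P s) (h12 : s.v 12 = p)
    (hp : p ∈ P.primes) (h0 : η 0 ≠ 0) (hD : ∀ j, P.D < j → η j = 0)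
    (hT : ∀ r k : Fin P.D, 0 ≤ s.a 12 (r * P.D + k) ∧ s.a 12 (r * P.D + k) < p ∧
      ((s.a 12 (r * P.D + k) : ℤ) : ZMod p) = (-recProd η P.D (p - 1)) r k)
    (hR : ∀ s', Frame [27] [14] s s' → (∀ i ≤ P.D + 1, ∀ m ≤ P.D, 0 ≤ s'.a 14 (i * (P.D + 1) + m) ∧
      s'.a 14 (i * (P.D + 1) + m) < p ∧
      ((s'.a 14 (i * (P.D + 1) + m) : ℤ) : ZMod p) = zsol η ((p : ℤ) * i - m)) → R s') :
    Does P.ctx solProg s (4 * P.unit) R := by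
  have hp' := mem_primes.1 hp
  have hpN := hp'.1
  have hp0 : (0 : ℤ) < p := mod_cast hp'.2.1.pos
  have hp1 : (1 : ℤ) < p := mod_cast hp'.2.1.one_lt
  have hmod := emod_bounds hp0
  have hbu := bc_le_unit (P := P)
  have hpos := bc_pos P.ctx P.lam
  have hbm := bc_le_cellCost P.ctx P.lam
  have h8 := P.bc_eight_le
  refine .cons (does_smallDot (p := p) 0 1 (P.D + 1) 1 (fun _ k _ => if k = 0 then 1 else 0) hpN
    (fun s' h => by simp [@h.v, hs.v2]) (fun _ _ _ _ _ _ => abs_flag hp'.2.1 _) ?_ len_table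
    fun s1 ha1 hv1 => ?_)
  · intro r _ k _ j _ s' h h36 h37 h38
    simp only [Ex.evals, h37]
    split_ifs <;> first | rfl | omega
  have hf1 : Frame [27] [14] s s1 := (Frame.refl _ _ s).of_fill hv1 ha1
  refine .cons (.forLoop (x := 27) (e := .var 2 + 1)
    (P.D + 1) (P.short_D (by omega)) (I := fun i s' => s'.v 27 = i ∧ Frame [27] [14] s s' ∧
      ∀ i' ≤ i, ∀ m ≤ P.D, 0 ≤ s'.a 14 (i' * (P.D + 1) + m) ∧ s'.a 14 (i' * (P.D + 1) + m) < p ∧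
        ((s'.a 14 (i' * (P.D + 1) + m) : ℤ) : ZMod p) = zsol η ((p : ℤ) * i' - m))
    (T := fun _ => ((1 : ℕ) + 1) * ((P.D + 1 : ℕ) + 1) * (P.D + 1) * cellCost P.ctx P.lam) ?_ ?_ ?_ fun s' h =>
      Does.nil ?_ (hR s' h.2.1 h.2.2))
  · refine ⟨by simp, hf1.set, fun i' hi' m hm => ?_⟩
    obtain rfl : i' = 0 := by omega
    have e : s1.a 14 (0 * (P.D + 1) + m) = if m = 0 then 1 else 0 := by
      rw [ha1, Nat.zero_mul, Nat.zero_add, fill_row (fun _ k => ∑ j ∈ range 1, if k = 0 then 1 else 0)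
        (by omega), sum_range_one]
    rw [St.set_a, e]
    split_ifs with hm0
    · refine ⟨by norm_num, hp1, ?_⟩
      have := zsol_mul η 0
      simp only [Nat.cast_zero, mul_zero] at this
      simp [hm0, this]
    · refine ⟨le_rfl, hp0, ?_⟩
      rw [zsol_neg η (by push_cast; omega)]; simp
  · exact fun i hi s' h => ⟨h.1, by simp [(hs.frame h.2.1).v2]⟩
  · intro i hi s2 h _
    obtain ⟨h27, hf2, hG⟩ := h
    have hs2 := hs.frame hf2
    have h122 : s2.v 12 = p := by rw [hf2.v 12, h12]
    set G : ℕ → ℤ := fun m => s2.a 14 (i * (P.D + 1) + m) with hGd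
    set t : ℕ → ℕ → ℤ := fun r k => s.a 12 (r * P.D + k) with ht
    refine (does_smallMod (p := p) ((i + 1) * (P.D + 1)) 1 (P.D + 1) P.D
      (fun _ k j => if 0 < k then G j * t j (k - 1) else 0) hpN h122 hs2.stack
      (fun s' h => by simp [@h.v, h27, hs2.v2]) ?_ ?_ ?_ fun s3 ha3 hv3 => ?_)
    · intro r _ k hk j hj
      refine le_bound ?_
      split_ifs with hk0
      · have h1 := hG i le_rfl j hj.le
        have h2 := hT ⟨j, hj⟩ ⟨k - 1, by omega⟩
        exact abs_mul_residues ⟨h1.1, h1.2.1⟩ ⟨h2.1, h2.2.1⟩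
      · rw [abs_zero]; positivity
    · intro r _ k hk j hj s' h h36 h37 h38
      have hv2 : s'.v 2 = P.D := by rw [h.v 2, hs2.v2]
      have hv27 : s'.v 27 = i := by rw [h.v 27, h27]
      simp only [Ex.evals, h37, h38, hv2, hv27]
      by_cases hk0 : 0 < k
      · rw [if_pos (by omega), if_pos hk0]
        have e1 : ((i : ℤ) * (P.D + 1) + j).toNat = i * (P.D + 1) + j := by
          rw [← Int.toNat_natCast (_ + _)]; push_cast; rfl
        have e2 : ((j : ℤ) * P.D + k - 1).toNat = j * P.D + (k - 1) := by
          rw [← Int.toNat_natCast (_ + _)]; push_cast [Nat.cast_sub hk0]; congr 1; ring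
        have : (i + 1) * (P.D + 1) = i * (P.D + 1) + (P.D + 1) := by ring
        rw [e1, e2, h.arr 12 _, hf2.a 12, h.arr 14 _ (by omega)]
      · rw [if_neg (by omega), if_neg hk0]
    · intro r hr k hk
      rw [len_nine (by norm_num)]
      have h1 : (i + 1) * (P.D + 1) ≤ (P.D + 1) * (P.D + 1) := Nat.mul_le_mul_right _ (by omega)
      obtain rfl : r = 0 := by omega
      nlinarith
    · refine ⟨by rw [hv3.v 27, h27], by simp, (hf2.of_fill hv3 ha3).set,
        fun i' hi' m hm => ?_⟩
      rw [St.set_a]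
      rcases Nat.lt_succ_iff_lt_or_eq.1 (Nat.lt_succ_of_le hi') with h1 | rfl
      · rw [ha3, fill_of_lt]
        · exact hG i' (by omega) m hm
        · calc i' * (P.D + 1) + m < (i' + 1) * (P.D + 1) := by rw [add_mul]; omega
            _ ≤ (i + 1) * (P.D + 1) := Nat.mul_le_mul_right _ (by omega)
      · have e := fill_table (A := s2.a) (a := 14) (base := (i + 1) * (P.D + 1)) (n1 := 1) (n2 := P.D + 1)
          (r := 0) (k := m) (w := fun _ k => (∑ j ∈ range P.D, if 0 < k then G j * t j (k - 1) else 0) % p)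
          (by norm_num) (by omega)
        rw [Nat.zero_mul, Nat.add_zero ((i + 1) * (P.D + 1))] at e
        rw [ha3, e]
        refine ⟨(hmod _).1, (hmod _).2, ?_⟩
        rcases Nat.eq_zero_or_pos m with rfl | hm0
        · have := zsol_mul η (i + 1)
          simp only [lt_irrefl, if_false, sum_const_zero, Nat.cast_zero, sub_zero]
          rw [this]; simp
        · have h2 := window_period hp'.2.2 h0 hD i ⟨m - 1, by omega⟩
          have e3 : (p : ℤ) * (i + 1 : ℕ) - m = p * (i + 1) - ((m - 1 : ℕ) + 1) := by
            push_cast [Nat.cast_sub hm0]; ring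
          simp only [if_pos hm0]
          rw [e3, h2, ZMod.intCast_mod, Int.cast_sum, sum_range]
          refine sum_congr rfl fun j _ => ?_
          have h3 := (hG i le_rfl j j.2.le).2.2
          have h4 := (hT j ⟨m - 1, by omega⟩).2.2
          rw [Int.cast_mul, h3, h4]
  · have g1 := P.unit_le 1 (P.D + 1) 1
    have g2 := P.unit_le (P.D + 1) (P.D + 1) (P.D + 1)
    simp only [sum_const, card_range, nsmul_eq_mul, ctx_lam]
    push_cast at g1 g2 ⊢
    set C := cellCost P.ctx P.lam
    set d : ℝ := P.D + 1 + 1 with hd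
    have hC : 0 < C := cellCost_pos _ _
    have e1 : ((P.D : ℝ) + 1) * ((1 + 1) * d * (P.D + 1) * C) ≤ d * (2 * d * d * C) := by
      gcongr <;> linarith
    have e2 : d * (8 * bc P.ctx P.lam) ≤ d * C := by gcongr; linarith
    have e3 : d * C ≤ d * d * (d * C) := le_mul_of_one_le_left (by positivity) (by
      have : (0 : ℝ) ≤ P.D := by positivity
      nlinarith)
    have e4 : d * bc P.ctx P.lam = (P.D + 2) * bc P.ctx P.lam := by rw [hd]; ring
    linarith

end Par

namespace Par
variable {P : Par} {s : St} {R : St → Prop}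

/-- The number of unknowns of the second linear system is `⌊D (p + 1) / (2 p)⌋ + 1`. -/
def unknowns (P : Par) (p : ℕ) : ℕ := P.D * ((p + 1) / 2) / p + 1

lemma unknowns_bounds {p n : ℕ} (hn : p = 2 * n + 1) :
    n * P.D + P.D < p * P.unknowns p ∧ p * P.unknowns p ≤ n * P.D + P.D + p ∧ P.unknowns p ≤ P.D + 1 := by
  have h1 : (p + 1) / 2 = n + 1 := by omega
  have hp : 0 < p := by omega
  unfold unknowns
  rw [h1]
  have h2 := Nat.div_add_mod (P.D * (n + 1)) p
  have h3 := Nat.mod_lt (P.D * (n + 1)) hp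
  have h4 : P.D * (n + 1) = n * P.D + P.D := by ring
  refine ⟨?_, ?_, ?_⟩
  · rw [Nat.mul_add]; omega
  · rw [Nat.mul_add]; omega
  · have : P.D * (n + 1) / p ≤ P.D := Nat.div_le_of_le_mul (by rw [mul_comm p]; gcongr; omega)
    omega

/-- The program that computes the coefficients of `H ^ ((p - 1) / 2)` whose indices are multiples of
`p`, up to a common factor: it solves a system of linear equations. -/
def multiplesProg : Program := blk [
  tabDot 13 0 1 1 (.var 2 + 1)
    (.ite (.var 2 * .shr (.var 12 + 1) 1 + 1 - .var 12 * (.var 38 + 1)) 1 0),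
  asg 20 (.var 2), asg 21 (.get 13 0 + 1),
  tabDot 10 0 (.var 20) (.var 21) 1 (.get 14 ((.var 21 - .var 37) * (.var 2 + 1) + .var 36 + 1)),
  kernelProg, tabDot 13 0 1 (.var 21) (.var 21) (.get 11 (.var 37 * .var 21 + .var 38)), findProg]

/-- The number of the positive integers up to `D + 1` whose multiple with `p` is at most `N`. -/
lemma sum_multiples {p N n : ℕ} (hp : 0 < p) (hN : N / p ≤ n) :
    ∑ j ∈ range n, (if 0 < (N : ℤ) + 1 - p * (j + 1) then 1 else 0 : ℤ) = (N / p : ℕ) := by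
  rw [sum_ite, sum_const_zero, add_zero, sum_const, nsmul_eq_mul, mul_one]
  congr 1
  have : (range n).filter (fun j : ℕ => 0 < (N : ℤ) + 1 - p * (j + 1)) = range (N / p) := by
    ext j
    rw [mem_filter, mem_range, mem_range]
    have h : 0 < (N : ℤ) + 1 - p * (j + 1) ↔ j < N / p := by
      rw [← Nat.succ_le_iff, Nat.le_div_iff_mul_le hp]
      have : (p : ℤ) * (j + 1) = ((j.succ * p : ℕ) : ℤ) := by push_cast; ring
      rw [this]; omega
    rw [h]; omega
  rw [this, card_range]

lemma does_multiples {p n : ℕ} [Fact p.Prime] (hs : Holds P s) (hz : ∀ j, P.D < j → P.h j = 0)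
    (h12 : s.v 12 = p) (hp : p ∈ P.primes) (hn : p = 2 * n + 1) (hg : P.Good p)
    (hG : ∀ i ≤ P.D + 1, ∀ m ≤ P.D, 0 ≤ s.a 14 (i * (P.D + 1) + m) ∧
      s.a 14 (i * (P.D + 1) + m) < p ∧
      ((s.a 14 (i * (P.D + 1) + m) : ℤ) : ZMod p) = zsol (P.redPoly p).coeff ((p : ℤ) * i - m))
    (hR : ∀ s' (σ : ℕ) (c : ZMod p), Frame [20, 21, 22, 23, 24] [10, 11, 12, 13] s s' →
      s'.v 21 = P.unknowns p → s'.v 23 = σ → c ≠ 0 →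
      (∀ l < P.unknowns p, 0 ≤ s'.a 11 (σ * P.unknowns p + l) ∧ s'.a 11 (σ * P.unknowns p + l) < p ∧
        ((s'.a 11 (σ * P.unknowns p + l) : ℤ) : ZMod p) = c * ((P.redPoly p) ^ n).coeff (l * p)) → R s') :
    Does P.ctx multiplesProg s (13 * P.unit) R := by
  have hp' := mem_primes.1 hp
  have hpN := hp'.1
  have hp2 := hp'.2.2
  have hp0 : (0 : ℤ) < p := mod_cast hp'.2.1.pos
  have hbu := bc_le_unit (P := P)
  have hku := kernelCost_le (P := P)
  have hpos := bc_pos P.ctx P.lam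
  have h8 := P.bc_eight_le
  have hD := P.hD
  have hI := unknowns_bounds (P := P) hn
  set I := P.unknowns p with hId
  have hI2 : I ≤ 2 * P.D := by omega
  set H := P.redPoly p with hH
  have hdeg : H.natDegree = P.D := natDegree_redPoly hz hg.2.1
  have hH0 : H.coeff 0 ≠ 0 := by rw [hH, coeff_redPoly hz]; exact hg.1
  have hcount : ∑ j ∈ range (P.D + 1),
      (if 0 < ((P.D * ((p + 1) / 2) : ℕ) : ℤ) + 1 - p * (j + 1) then 1 else 0 : ℤ) = (I - 1 : ℕ) := by
    rw [sum_multiples hp'.2.1.pos]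
    · rfl
    · have : I = P.D * ((p + 1) / 2) / p + 1 := rfl
      omega
  refine .cons (does_smallDot (p := p) 0 1 1 (P.D + 1)
    (fun _ _ j => if 0 < ((P.D * ((p + 1) / 2) : ℕ) : ℤ) + 1 - p * (j + 1) then 1 else 0) hpN
    (fun s' h => by simp [@h.v, hs.v2]) (fun _ _ _ _ _ _ => abs_flag hp'.2.1 _) ?_ len_table
    fun s1 ha1 hv1 => ?_)
  · intro r _ k _ j _ s' h h36 h37 h38
    have e1 : (Ex.var 2 * Ex.shr (Ex.var 12 + 1) 1).eval s' = (P.D * ((p + 1) / 2) : ℕ) := by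
      simp [@h.v, hs.v2, h12]
    have e2 : (Ex.var 12 * (Ex.var 38 + 1)).eval s' = p * (j + 1) := by simp [@h.v, h12, h38]
    rw [Ex.eval_ite, Ex.eval_sub, Ex.eval_add, e1, e2]
    simp
  have h130 : s1.a 13 0 = (I - 1 : ℕ) := by
    rw [ha1, fill_row (fun _ _ => ∑ j ∈ range (P.D + 1), (if 0 < ((P.D * ((p + 1) / 2) : ℕ) : ℤ) + 1 -
      p * (j + 1) then 1 else 0 : ℤ)) one_pos, hcount]
  refine .cons (.asg_ok (P.D : ℤ)
    (by simp [@hv1.v, hs.v2]) (fun _ => P.bits_D) (.cons (.asg_ok (I : ℤ) ?_ (fun _ => P.short_D (by omega)) ?_)))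
  · simp only [Ex.evals, Int.toNat_zero, St.set_a, h130]
    have : 1 ≤ I := by rw [hId]; exact Nat.le_add_left _ _
    omega
  set s2 := (s1.set 20 (P.D : ℤ)).set 21 (I : ℤ) with hs2
  have hf2 : Frame [20, 21, 22, 23, 24] [10, 11, 12, 13] s s2 :=
    (((Frame.refl _ _ s).of_fill hv1 ha1).set).set
  have h20 : s2.v 20 = P.D := by simp [hs2]
  have h21 : s2.v 21 = I := by simp [hs2]
  have hH2 := hs.frame hf2
  have h142 : ∀ i, s2.a 14 i = s.a 14 i := fun i => by rw [hf2.a 14]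
  set A : ℕ → ℕ → ℤ := fun m l => s.a 14 ((I - l) * (P.D + 1) + (m + 1)) with hA
  have hAG : ∀ m < P.D, ∀ l < I, 0 ≤ A m l ∧ A m l < p ∧
      (A m l : ZMod p) = zsol H.coeff ((p : ℤ) * (I - l) - (m + 1)) := by
    intro m hm l hl
    have h := hG (I - l) (by omega) (m + 1) (by omega)
    rw [Nat.cast_sub hl.le] at h
    exact_mod_cast h
  refine .cons (does_smallDot (p := p) 0 P.D I 1 (fun m l _ => A m l) hpN
    (fun s' h => by simp [@h.v, h20, h21]) (fun m hm l hl _ _ => le_bound (abs_residue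
      ⟨(hAG m hm l hl).1, (hAG m hm l hl).2.1⟩)) ?_ len_table fun s3 ha3 hv3 => ?_)
  · intro m hm l hl j _ s' h h36 h37 _
    have e : ((Ex.var 21 - Ex.var 37) * (Ex.var 2 + 1) + Ex.var 36 + 1).eval s' =
        ((I - l) * (P.D + 1) + (m + 1) : ℕ) := by
      simp only [Ex.evals, h36, h37,
        h.v 21, h.v 2, h21, hH2.v2]
      push_cast [Nat.cast_sub hl.le]
      ring
    rw [Ex.get_eval e, h.arr 14 _, h142]
  have hf3 : Frame [20, 21, 22, 23, 24] [10, 11, 12, 13] s s3 := hf2.of_fill hv3 ha3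
  have h10 : ∀ m < P.D, ∀ l < I, s3.a 10 (m * I + l) = A m l := by
    intro m hm l hl
    rw [ha3, fill_table_zero (w := fun m l => ∑ j ∈ range 1, A m l) hm hl, sum_range_one]
  refine .cons (does_kernel (p := p) (n := I) (m := P.D) A
    (by rw [hf3.v 12, h12]) hpN (by rw [hv3.v 20, h20])
    (by rw [hv3.v 21, h21]) (by omega) hI2 (hs.frame hf3).stack h10
    (fun m hm l hl => ⟨(hAG m hm l hl).1, (hAG m hm l hl).2.1⟩) fun s4 E hf4 hE hsp => ?_)
  have h214 : s4.v 21 = I := by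
    rw [hf4.v 21, hv3.v 21, h21]
  refine does_findRow (n := I) h214 hI2 hpN hE fun s5 σ hf5 h23 hσ => ?_
  have hf5' : Frame [20, 21, 22, 23, 24] [10, 11, 12, 13] s s5 :=
    (hf3.trans hf4 (V'' := [20, 21, 22, 23, 24]) (A'' := [10, 11, 12, 13])).trans hf5
  have hAx : ∀ x : ℕ → ZMod p, ∀ m < P.D, ∑ l ∈ range I, (A m l : ZMod p) * x l =
      ∑ l ∈ range I, x l * zsol H.coeff ((p : ℤ) * (I - l) - (m + 1)) := by
    intro x m hm
    refine sum_congr rfl fun l hl => ?_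
    rw [(hAG m hm l (mem_range.1 hl)).2.2, mul_comm]
  have hF0 : (H ^ n).coeff (0 * p) ≠ 0 := by
    rw [Nat.zero_mul, coeff_zero_eq_eval_zero, eval_pow, ← coeff_zero_eq_eval_zero]
    exact pow_ne_zero n hH0
  have hI1 : 0 < I := by rw [hId]; exact Nat.succ_pos _
  have hσ' : σ < I ∧ ∃ l < I, E σ l ≠ 0 := by
    refine hσ.resolve_left ?_
    rintro ⟨-, h2⟩
    obtain ⟨y, hy⟩ := hsp.span (fun l => (H ^ n).coeff (l * p)) (fun m hm => by
      rw [hAx _ m hm]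
      exact kernel_pow hp2 hn hH0 (by rw [hdeg]; exact hI.1) (by rw [hdeg]; exact hm))
    apply hF0
    rw [hy 0 hI1]
    refine sum_eq_zero fun t ht => ?_
    rw [h2 t (mem_range.1 ht) 0 hI1]; simp
  obtain ⟨c, hc⟩ := exists_smul_of_kernel hp2 hn hH0 hg.2.2 (I := I) (by rw [hdeg]; exact hI.1)
    (by rw [hdeg]; exact hI.2.1) (x := fun l => (E σ l : ZMod p)) (fun m hm => by
      rw [hdeg] at hm
      rw [← hAx _ m hm]; exact hsp.mem σ hσ'.1 m hm)
  refine .nil ?_ (hR s5 σ c hf5' (by rw [hf5.v 21, h214]) h23 ?_ fun l hl => ?_)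
  · have g1 := P.unit_le 1 1 (P.D + 1)
    have g2 := P.unit_le P.D I 1
    simp only [ctx_lam]
    linarith
  · rintro rfl
    obtain ⟨l, hl, h1⟩ := hσ'.2
    have h2 := hc l hl
    rw [zero_mul] at h2
    exact residue_ne_zero (hE σ hσ'.1 l hl).2 h1 h2
  · have h4 := hE σ hσ'.1 l hl
    rw [hf5.a 11, h4.1]
    exact ⟨h4.2.1, h4.2.2, hc l hl⟩

end Par

namespace Par
variable {P : Par} {s : St} {R : St → Prop}

/-- The changes by the computation of a matrix. -/
abbrev LeafFrame : St → St → Prop :=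
  Frame [9, 15, 16, 17, 20, 21, 22, 23, 24, 27] [0, 1, 10, 11, 12, 13, 14, 15]

/-- The entry with the indices `i` and `j` of the Hasse–Witt matrix. -/
noncomputable def entry (P : Par) (p i j : ℕ) : ZMod p :=
  if P.sh * j + 1 ≤ p * (P.sh * i + 1) then
    (P.redPoly p ^ ((p - 1) / 2)).coeff (p * (P.sh * i + 1) - (P.sh * j + 1)) else 0

/-- The program that writes the prime in the variable `12` and its Hasse–Witt matrix to the output. -/
def matrixProg : Program := blk [transProg, solProg, multiplesProg,
  powProg (.get 9 0) (.shr (.var 12) 1), asg 17 (.var 15),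
  powProg (.get 11 (.var 23 * .var 21)) (.var 12 - 2),
  tabMod 15 0 1 (.var 21) 1 (.get 11 (.var 23 * .var 21 + .var 37) * .var 15 * .var 17) (.var 12),
  tabMod 1 (.var 9 * .var 8 * .var 8) (.var 8) (.var 8) (.var 21)
    (.ite (.var 3 * .var 36 + 1 - .var 38) (.get 15 (.var 38) *
      .get 14 ((.var 3 * .var 36 + 1 - .var 38) * (.var 2 + 1) + (.var 3 * .var 37 + 1))) 0) (.var 12),
  put 0 (.var 9) (.var 12), asg 9 (.var 9 + 1)]

lemma g_bounds (P : Par) {i : ℕ} (hi : i < P.g) : P.sh * i + 1 ≤ P.D ∧ P.g ≤ P.D := by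
  have h := P.hgD
  have hg := P.hg
  rcases P.hsh with h1 | h1 <;> rw [h1] at h ⊢ <;> omega

lemma len_one {cnt r k : ℕ} (hcnt : cnt < P.primes.card) (hr : r < P.g) (hk : k < P.g) :
    cnt * P.g * P.g + r * P.g + k < P.len 1 := by
  have e : P.len 1 = P.primes.card * P.g * P.g := by simp [len]
  rw [e]
  have h1 : r * P.g + k < P.g * P.g := by nlinarith
  have h2 : (cnt + 1) * P.g * P.g ≤ P.primes.card * P.g * P.g :=
    Nat.mul_le_mul_right _ (Nat.mul_le_mul_right _ hcnt)
  have h3 : (cnt + 1) * P.g * P.g = cnt * P.g * P.g + P.g * P.g := by ring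
  omega

set_option maxHeartbeats 1600000 in
lemma does_matrix {p i cnt : ℕ} [Fact p.Prime] {X : Mat P.D ℤ} (hs : Holds P s)
    (hz : ∀ j, P.D < j → P.h j = 0) (h12 : s.v 12 = p) (hp : p ∈ P.primes) (hg : P.Good p)
    (h10 : s.v 10 = i) (hX : MatAt s 6 (P.B + i) X) (hXb : ∀ r k, 0 ≤ X r k ∧ X r k < p)
    (hXc : X.map (Int.cast : ℤ → ZMod p) = recProd (fun j => (P.h j : ZMod p)) P.D (p - 1))
    (h9a : ∀ k ≤ 2 * P.D + 1, s.a 9 k = P.h k % p) (h9 : s.v 9 = cnt) (hcnt : cnt < P.primes.card)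
    (hR : ∀ s', LeafFrame s s' →
      s'.v 9 = (cnt + 1 : ℕ) → (∀ k, s'.a 0 k = if k = cnt then (p : ℤ) else s.a 0 k) →
      (∀ k < cnt * P.g * P.g, s'.a 1 k = s.a 1 k) →
      (∀ i < P.g, ∀ j < P.g, s'.a 1 (cnt * P.g * P.g + i * P.g + j) = (P.entry p i j).val) → R s') :
    Does P.ctx matrixProg s (24 * P.unit + 2 * (P.N.size + 1) * cellCost P.ctx P.W) R := by
  have hp' := mem_primes.1 hp
  have hpN := hp'.1
  have hp2 := hp'.2.2
  have hp0 : (0 : ℤ) < p := mod_cast hp'.2.1.pos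
  have hp3 : 3 ≤ p := by
    have := hp'.2.1.two_le
    omega
  have hodd : p = 2 * ((p - 1) / 2) + 1 := by
    have := hp'.2.1.eq_two_or_odd
    omega
  set n := (p - 1) / 2 with hn
  have hmod := emod_bounds hp0
  have hbu := bc_le_unit (P := P)
  have hpos := bc_pos P.ctx P.lam
  have h8 := P.bc_eight_le
  have hcW := cellCost_mono P.ctx (show P.lam ≤ P.W by have := P.lam_le_W; omega)
  have hI := unknowns_bounds (P := P) hodd
  have hη : (P.redPoly p).coeff = fun j => (P.h j : ZMod p) := funext fun j => coeff_redPoly hz p j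
  have hH0 : (P.redPoly p).coeff 0 ≠ 0 := by rw [hη]; exact hg.1
  have hdeg : (P.redPoly p).natDegree = P.D := natDegree_redPoly hz hg.2.1
  refine .cons (does_trans hs h12 hp h10 hX hXb fun s1 hf1 hT1 => ?_)
  refine .cons (does_sol (p := p) (η := (P.redPoly p).coeff) (hs.frame hf1)
    (by rw [hf1.v 12, h12]) hp hH0
    (fun j hj => by rw [coeff_redPoly hz, hz j hj]; simp) (fun r k => ?_) fun s2 hf2 hG2 => ?_)
  · rw [hT1]
    refine ⟨(hmod _).1, (hmod _).2, ?_⟩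
    rw [hη, ← hXc]
    simp
  have hff2 : LeafFrame s s2 :=
    hf1.trans hf2
  have hs2 := hs.frame hff2
  refine .cons (does_multiples (p := p) (n := n) hs2 hz
    (by rw [hff2.v 12, h12]) hp hodd hg hG2
    fun s3 σ c hf3 h21 h23 hc h11 => ?_)
  set I := P.unknowns p with hId
  have hff3 : LeafFrame s s3 :=
    hff2.trans hf3
  have hs3 := hs.frame hff3
  have h12' : s3.v 12 = p := by rw [hff3.v 12, h12]
  have h93 : s3.a 9 0 = P.h 0 % p := by rw [hff3.a 9, h9a 0 (by omega)]
  refine .cons (does_pow (p := p) (k := n) (z := P.h 0 % p) h12' hp'.2.1.one_lt hpN (by omega)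
    (by decide) (by decide) (by decide) (by decide) (hmod _).1 (hmod _).2 hs3.stack
    (fun s' h => ⟨by simp [h.a 9, h93], ?_⟩) fun s4 hf4 h15 => ?_)
  · simp only [Ex.evals, h.v 12, h12']
    norm_num
    omega
  set w := (P.h 0 % p) ^ n % (p : ℤ) with hw
  have hwb := hmod ((P.h 0 % p) ^ n)
  refine .cons (.asg_ok w (by simp [h15])
    (fun _ => bits_residue hpN hwb.1 hwb.2) ?_)
  set s5 := s4.set 17 w with hs5
  have hf5 : Frame [15, 16, 17] [] s3 s5 := (hf4.mono).set
  set z := s3.a 11 (σ * I) with hzd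
  have hI0 : 0 < I := by rw [hId]; exact Nat.succ_pos _
  have hzb := h11 0 hI0
  rw [Nat.add_zero, ← hzd] at hzb
  have h12a : s5.v 12 = p := by rw [hf5.v 12, h12']
  have h21a : s5.v 21 = I := by rw [hf5.v 21, h21]
  have h23a : s5.v 23 = σ := by rw [hf5.v 23, h23]
  refine .cons (does_pow (p := p) (k := p - 2) (z := z) h12a hp'.2.1.one_lt hpN (by omega)
    (by decide) (by decide) (by decide) (by decide) hzb.1 hzb.2.1 (hs3.frame hf5).stack
    (fun s' h => ⟨?_, ?_⟩) fun s6 hf6 h156 => ?_)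
  · rw [Ex.get_eval (n := σ * I) (by simp [h.v 23, h.v 21, h23a, h21a]), h.a 11, hf5.a 11]
  · simp only [Ex.evals, h.v 12, h12a]
    omega
  set y := z ^ (p - 2) % (p : ℤ) with hy
  have hyb := hmod (z ^ (p - 2))
  have hf6' : Frame [15, 16, 17] [] s3 s6 := hf5.trans hf6
  have h176 : s6.v 17 = w := by rw [hf6.v 17]; simp [hs5]
  have h216 : s6.v 21 = I := by rw [hf6.v 21, h21a]
  have h236 : s6.v 23 = σ := by rw [hf6.v 23, h23a]
  have h126 : s6.v 12 = p := by rw [hf6.v 12, h12a]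
  have hff6 : LeafFrame s s6 :=
    hff3.trans hf6'
  refine .cons (does_smallMod (p := p) 0 1 I 1 (fun _ l _ => s3.a 11 (σ * I + l) * y * w) hpN h126 (hs.frame hff6).stack
    (fun s' h => by simp [@h.v, h216]) ?_ ?_ len_table
    fun s7 ha7 hv7 => ?_)
  · intro r _ l hl _ _
    have h := h11 l hl
    refine le_bound ?_
    rw [abs_of_nonneg (mul_nonneg (mul_nonneg h.1 hyb.1) hwb.1)]
    have h1 : s3.a 11 (σ * I + l) * y ≤ p * p := mul_le_mul h.2.1.le hyb.2.le hyb.1 hp0.le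
    exact mul_le_mul h1 hwb.2.le hwb.1 (by positivity)
  · intro r _ l hl j _ s' h h36 h37 _
    rw [Ex.eval_mul, Ex.eval_mul, Ex.get_eval (n := σ * I + l)
      (by simp [h.v 23, h.v 21, h236, h216, h37]), h.arr 11 _,
      hf6'.a 11, Ex.eval_var, Ex.eval_var, h.v 15, h.v 17, h156, h176]
  have h157 : ∀ l < I, 0 ≤ s7.a 15 l ∧ s7.a 15 l < p ∧
      ((s7.a 15 l : ℤ) : ZMod p) = ((P.redPoly p) ^ n).coeff (l * p) := by
    intro l hl
    rw [ha7, fill_row (fun _ l => (∑ j ∈ range 1, s3.a 11 (σ * I + l) * y * w) % p) hl, sum_range_one]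
    refine ⟨(hmod _).1, (hmod _).2, ?_⟩
    have hF0 : ((P.redPoly p) ^ n).coeff (0 * p) = (P.h 0 : ZMod p) ^ n := by
      rw [Nat.zero_mul, coeff_zero_eq_eval_zero, eval_pow, ← coeff_zero_eq_eval_zero, coeff_redPoly hz]
    have hzc := hzb.2.2
    rw [hF0] at hzc
    have hne : (P.h 0 : ZMod p) ^ n ≠ 0 := pow_ne_zero n hg.1
    have hyw : ((y * w : ℤ) : ZMod p) = c⁻¹ := by
      rw [hy, hw, Int.cast_mul, ZMod.intCast_mod, ZMod.intCast_mod, Int.cast_pow, Int.cast_pow,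
        ZMod.intCast_mod, hzc]
      have h1 : (c * (P.h 0 : ZMod p) ^ n) ^ (p - 2) * (c * (P.h 0 : ZMod p) ^ n) = 1 := by
        rw [← pow_succ, show p - 2 + 1 = p - 1 by omega]
        exact ZMod.pow_card_sub_one_eq_one (mul_ne_zero hc hne)
      refine eq_inv_of_mul_eq_one_left ?_
      rw [← h1]
      ring
    rw [ZMod.intCast_mod, mul_assoc, Int.cast_mul, hyw, (h11 l hl).2.2, mul_comm c, mul_assoc,
      mul_inv_cancel₀ hc, mul_one]
  have hf7 : LeafFrame s s7 :=
    hff6.of_fill hv7 ha7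
  have hs7 := hs.frame hf7
  have h217 : s7.v 21 = I := by rw [hv7.v 21, h216]
  have h127 : s7.v 12 = p := by rw [hv7.v 12, h126]
  have h97 : s7.v 9 = cnt := by
    rw [hv7.v 9, hf6'.v 9, hf3.v 9,
      hf2.v 9, hf1.v 9, h9]
  have h14 : ∀ k, s7.a 14 k = s2.a 14 k := fun k => by
    rw [ha7, fill_ne (by norm_num), hf6'.a 14, hf3.a 14]
  set f : ℕ → ℕ → ℕ → ℤ := fun i j l => if l < P.sh * i + 1 then
    s7.a 15 l * s2.a 14 ((P.sh * i + 1 - l) * (P.D + 1) + (P.sh * j + 1)) else 0 with hf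
  have hgD : P.g ≤ P.D := (P.g_bounds (i := 0) (by have := P.hg; omega)).2
  refine .cons (does_smallMod (p := p) (cnt * P.g * P.g) P.g P.g I f hpN h127 hs7.stack
    (fun s' h => by simp [@h.v, h97, hs7.v8, h217])
    ?_ ?_ (fun r hr k hk => len_one hcnt hr hk)
    fun s8 ha8 hv8 => ?_)
  · intro i hi j hj l hl
    refine le_bound ?_
    simp only [hf]
    split_ifs with hli
    · have h1 := h157 l hl
      have hi' := (P.g_bounds hi).1
      have h2 := hG2 (P.sh * i + 1 - l) (by omega) (P.sh * j + 1) (P.g_bounds hj).1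
      exact abs_mul_residues ⟨h1.1, h1.2.1⟩ ⟨h2.1, h2.2.1⟩
    · rw [abs_zero]; positivity
  · intro i hi j hj l hl s' h h36 h37 h38
    have hv3 : s'.v 3 = P.sh := by rw [h.v 3, hs7.v3]
    have hv2 : s'.v 2 = P.D := by rw [h.v 2, hs7.v2]
    simp only [Ex.evals, h36, h37, h38, hv3, hv2, hf]
    by_cases hli : l < P.sh * i + 1
    · have h1 : (0 : ℤ) < P.sh * i + 1 - l := by
        have : (l : ℤ) < (P.sh * i + 1 : ℕ) := mod_cast hli
        push_cast at this; linarith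
      rw [if_pos h1, if_pos hli]
      have e : ((P.sh : ℤ) * i + 1 - l) * (P.D + 1) + (P.sh * j + 1) =
          ((P.sh * i + 1 - l) * (P.D + 1) + (P.sh * j + 1) : ℕ) := by
        push_cast [Nat.cast_sub hli.le]; ring
      rw [e, Int.toNat_natCast, Int.toNat_natCast, h.arr 15 _, h.arr 14 _, h14]
    · have h1 : ¬ (0 : ℤ) < P.sh * i + 1 - l := by
        have : ((P.sh * i + 1 : ℕ) : ℤ) ≤ l := mod_cast not_lt.1 hli
        push_cast at this; linarith
      rw [if_neg h1, if_neg hli]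
  have hf8 : LeafFrame s s8 :=
    hf7.of_fill hv8 ha8
  have h98 : s8.v 9 = cnt := by rw [hv8.v 9, h97]
  have h128 : s8.v 12 = p := by rw [hv8.v 12, h127]
  have h0 : ∀ k, s8.a 0 k = s.a 0 k := fun k => by
    rw [ha8, fill_ne (by norm_num), ha7, fill_ne (by norm_num), hf6'.a 0, hf3.a 0,
      hf2.a 0, hf1.a 0]
  have h1 : ∀ k, s7.a 1 k = s.a 1 k := fun k => by
    rw [ha7, fill_ne (by norm_num), hf6'.a 1, hf3.a 1,
      hf2.a 1, hf1.a 1]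
  have hcard : P.primes.card ≤ P.N + 1 := by
    unfold primes
    exact (card_filter_le _ _).trans (by simp)
  have hpb : bits (p : ℤ) ≤ P.lam := P.short_N
  refine .cons (.put_ok cnt (p : ℤ) (by simp [h98])
    (by simp [h128]) (fun _ => ⟨by norm_num, ?_, ?_⟩) (.cons (.asg_ok ((cnt + 1 : ℕ) : ℤ) (by simp [h98]) (fun _ => P.short_N)
    (.nil ?_ (hR _ (hf8.put.set) (by simp) (fun k => ?_) (fun k hk => ?_)
      fun i hi j hj => ?_)))))
  · have e : P.len 0 = max (P.D + 1) P.primes.card := by simp [len]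
    change cnt < P.len 0
    rw [e]; exact hcnt.trans_le (le_max_right _ _)
  · have e : P.cap 0 cnt = if cnt ≤ P.D then P.lf + P.lam else P.lam := by simp [cap]
    change _ ≤ P.cap 0 cnt
    rw [e]; split_ifs <;> omega
  · have g1 := P.unit_le 1 I 1
    have g2 := P.unit_le P.g P.g I
    have g3 : ((P.N.size : ℝ) + 1) * cellCost P.ctx P.lam ≤ (P.N.size + 1) * cellCost P.ctx P.W := by gcongr
    simp only [ctx_lam]
    linarith
  · rw [St.set_a, St.put_a]
    by_cases hk : k = cnt
    · rw [if_pos ⟨rfl, hk⟩, if_pos hk]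
    · rw [if_neg (fun h => hk h.2), if_neg hk, h0]
  · rw [St.set_a, St.put_a, if_neg (by simp), ha8, fill_of_lt hk, h1]
  · rw [St.set_a, St.put_a, if_neg (by simp), ha8, fill_table (w := fun i j =>
      (∑ l ∈ range I, f i j l) % p) hi hj]
    have key : ((∑ l ∈ range I, f i j l : ℤ) : ZMod p) = P.entry p i j := by
      have hi' := (P.g_bounds hi).1
      have e1 : ∀ l ∈ range I, ((f i j l : ℤ) : ZMod p) = if l < P.sh * i + 1 then
          ((P.redPoly p) ^ n).coeff (l * p) * zsol (P.redPoly p).coeff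
            ((p : ℤ) * ((P.sh * i + 1 : ℕ) - l) - (P.sh * j + 1 : ℕ)) else 0 := by
        intro l hl
        simp only [hf]
        split_ifs with hli
        · have h1 := h157 l (mem_range.1 hl)
          have h2 := hG2 (P.sh * i + 1 - l) (by omega) (P.sh * j + 1) (P.g_bounds hj).1
          rw [Int.cast_mul, h1.2.2, h2.2.2, Nat.cast_sub hli.le]
        · simp
      rw [Int.cast_sum, sum_congr rfl e1]
      unfold entry
      split_ifs with hij
      · rw [coeff_pow_eq hp2 hodd hH0 (I := I) (by rw [hdeg]; omega) (by omega) hij]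
      · refine sum_eq_zero fun l hl => ?_
        split_ifs with hli
        · rw [zsol_neg, mul_zero]
          have h1 : (p : ℤ) * (P.sh * i + 1 : ℕ) < (P.sh * j + 1 : ℕ) := mod_cast not_le.1 hij
          have h2 : (p : ℤ) * ((P.sh * i + 1 : ℕ) - l) ≤ p * (P.sh * i + 1 : ℕ) := by
            gcongr; linarith [Int.natCast_nonneg l]
          linarith
        · rfl
    rw [← key, ← ZMod.val_intCast]

end Par

/-! ### Products over the leaves of a tree -/

lemma heap_map {α β : Type*} [Mul α] [Mul β] {B : ℕ} (leaf : ℕ → α) (φ : α → β)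
    (hφ : ∀ x y, φ (x * y) = φ x * φ y) {v : ℕ} (h : 1 ≤ v) (hv : v < 2 * B) :
    φ (heap B leaf v) = heap B (fun i => φ (leaf i)) v := by
  refine heap_induction (B := B) (p := fun v => φ (heap B leaf v) = heap B (fun i => φ (leaf i)) v)
    (fun i _ => ?_) (fun v h1 h2 h3 h4 => ?_) v h hv
  · rw [heap_leaf, heap_leaf]
  · rw [heap_node leaf h1 h2, heap_node _ h1 h2, hφ, h3, h4]

/-- The number of the first leaf below the node `v`. -/
def firstLeaf (b v : ℕ) : ℕ := v * leaves b v - 2 ^ b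

lemma two_pow_le_mul_leaves {b v : ℕ} (h : 1 ≤ v) (hv : v < 2 * 2 ^ b) : 2 ^ b ≤ v * leaves b v := by
  have h1 : 1 ≤ v.size := Nat.size_pos.2 h
  have h2 : v.size ≤ b + 1 := Nat.size_le.2 (by rw [pow_succ]; omega)
  have h3 : 2 ^ (v.size - 1) ≤ v := Nat.lt_size.1 (by omega)
  calc 2 ^ b = 2 ^ (v.size - 1) * 2 ^ (b + 1 - v.size) := by rw [← pow_add]; congr 1; omega
    _ ≤ _ := Nat.mul_le_mul_right _ h3

lemma firstLeaf_children {b v : ℕ} (h : 1 ≤ v) (hv : v < 2 ^ b) :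
    firstLeaf b (2 * v) = firstLeaf b v ∧
      firstLeaf b (2 * v + 1) = firstLeaf b v + leaves b (2 * v) := by
  have h1 := leaves_children h hv
  have h2 := two_pow_le_mul_leaves h (by omega : v < 2 * 2 ^ b)
  have h3 : 2 * v * leaves b (2 * v) = v * leaves b v := by rw [← h1.1]; ring
  have h4 : leaves b (2 * v + 1) = leaves b (2 * v) := by omega
  unfold firstLeaf
  refine ⟨by rw [h3], ?_⟩
  rw [h4, add_mul, h3]
  omega

lemma firstLeaf_one (b : ℕ) : firstLeaf b 1 = 0 := by simp [firstLeaf, leaves_one]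

lemma firstLeaf_leaf {b i : ℕ} (h : i < 2 ^ b) : firstLeaf b (2 ^ b + i) = i := by
  simp [firstLeaf, leaves_leaf h]

/-- The node `v` holds the product of its leaves, in order: it leads from the product of all earlier
factors to the product up to the last leaf below `v`. -/
lemma mul_heap {α : Type*} [Semigroup α] {b : ℕ} {leaf : ℕ → α} {q : ℕ → α}
    (hq : ∀ i < 2 ^ b, q (i + 1) = q i * leaf i) {v : ℕ} (h : 1 ≤ v) (hv : v < 2 * 2 ^ b) :
    q (firstLeaf b v) * heap (2 ^ b) leaf v = q (firstLeaf b v + leaves b v) := by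
  refine heap_induction (B := 2 ^ b) (p := fun v => q (firstLeaf b v) * heap (2 ^ b) leaf v =
    q (firstLeaf b v + leaves b v)) (fun i hi => ?_) (fun v h1 h2 h3 h4 => ?_) v h hv
  · rw [heap_leaf, firstLeaf_leaf hi, leaves_leaf hi, hq i hi]
  · have h5 := firstLeaf_children h1 h2
    have h6 := leaves_children h1 h2
    rw [heap_node _ h1 h2, ← mul_assoc, ← h5.1, h3, h5.1, ← h5.2, h4, h5.2]
    congr 1
    omega

namespace Par
variable {P : Par}

/-- The product of the odd primes below `k`, as far as they are at most `N`. -/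
def rad (P : Par) (k : ℕ) : ℕ := ∏ j ∈ range k, P.modulus j

lemma rad_pos (k : ℕ) : 0 < P.rad k :=
  prod_pos fun j _ => P.one_le_modulus j

lemma rad_le (k : ℕ) : P.rad k ≤ 4 ^ P.N := by
  refine le_trans ?_ (primorial_le_four_pow P.N)
  unfold rad modulus primorial
  rw [← prod_filter]
  refine Finset.prod_le_prod_of_subset_of_one_le' (fun j hj => ?_) fun j hj _ => ?_
  · have h := mem_primes.1 (mem_filter.1 hj).2
    exact mem_filter.2 ⟨mem_range.2 (by omega), h.2.1⟩
  · exact (mem_filter.1 hj).2.one_le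

lemma rad_mul_modTree (lo : ℕ) : (P.rad lo : ℤ) * P.modTree lo 1 = P.rad (lo + P.B) := by
  have h := mul_heap (b := P.b) (leaf := fun i => (P.modulus (lo + i) : ℤ))
    (q := fun i => (P.rad (lo + i) : ℤ)) (fun i _ => by
      simp only [rad, ← add_assoc, prod_range_succ, Nat.cast_mul]) (v := 1) le_rfl
    (by have := P.one_le_B; unfold B at this; omega)
  rw [firstLeaf_one, leaves_one, zero_add] at h
  exact h

lemma dvd_rad {p k : ℕ} (hp : p ∈ P.primes) (hk : P.N < k) : p ∣ P.rad k := by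
  have h := mem_primes.1 hp
  have h1 : P.modulus p = p := if_pos hp
  conv_lhs => rw [← h1]
  exact dvd_prod_of_mem _ (mem_range.2 (by omega))

section Mod
variable {p : ℕ} [Fact p.Prime]

/-- The products of the matrices of the recursion, from the integer matrices. -/
noncomputable def modProd (P : Par) (p k : ℕ) [Fact p.Prime] : Mat P.D (ZMod p) :=
  recProd (fun j => (P.h j : ZMod p)) P.D k

lemma map_step (k : ℕ) : (P.step k).map (Int.cast : ℤ → ZMod p) =
    recMatrix (fun j => (P.h j : ZMod p)) P.D k := by
  ext r j
  simp only [Matrix.map_apply, step, stepEntry, recMatrix, Matrix.of_apply]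
  split_ifs <;> push_cast <;> rfl

lemma map_mul_cast (X Y : Mat P.D ℤ) :
    (X * Y).map (Int.cast : ℤ → ZMod p) = X.map Int.cast * Y.map Int.cast :=
  Matrix.map_mul (f := Int.castRingHom (ZMod p))

lemma map_emod {m : ℤ} (hm : (p : ℤ) ∣ m) (X : Mat P.D ℤ) :
    (X.map (· % m)).map (Int.cast : ℤ → ZMod p) = X.map Int.cast := by
  ext r k
  simp only [Matrix.map_apply]
  rw [ZMod.intCast_eq_intCast_iff]
  exact (Int.mod_modEq _ _).of_dvd hm

lemma modProd_mul_matTree (lo : ℕ) {v : ℕ} (h : 1 ≤ v) (hv : v < 2 * P.B) :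
    P.modProd p (lo + firstLeaf P.b v) * (P.matTree (lo + 1) v).map Int.cast =
      P.modProd p (lo + firstLeaf P.b v + leaves P.b v) := by
  have e : (P.matTree (lo + 1) v).map (Int.cast : ℤ → ZMod p) =
      heap P.B (fun i => recMatrix (fun j => (P.h j : ZMod p)) P.D (lo + 1 + i)) v := by
    rw [matTree, heap_map (B := P.B) (fun i => P.step (lo + 1 + i))
      (fun X => X.map (Int.cast : ℤ → ZMod p)) map_mul_cast h hv]
    simp only [map_step]
  have h1 := mul_heap (b := P.b)
    (leaf := fun i => recMatrix (fun j => (P.h j : ZMod p)) P.D (lo + 1 + i))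
    (q := fun i => P.modProd p (lo + i)) (fun i _ => by
      rw [show lo + 1 + i = lo + i + 1 by omega]; rfl) h hv
  rw [e, add_assoc]
  exact h1

lemma map_prefTree {lo : ℕ} {V : Mat P.D ℤ}
    (hV : V.map (Int.cast : ℤ → ZMod p) = P.modProd p lo) (v : ℕ) (h : 1 ≤ v) (hv : v < 2 * P.B)
    (hp : (p : ℤ) ∣ P.modTree (lo + 1) v) :
    (P.prefTree (lo + 1) V v).map (Int.cast : ℤ → ZMod p) = P.modProd p (lo + firstLeaf P.b v) := by
  induction v using Nat.strong_induction_on with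
  | _ v ih =>
    rcases Nat.lt_or_ge v 2 with h1 | h1
    · obtain rfl : v = 1 := by omega
      rw [prefTree_one, map_emod hp, hV, firstLeaf_one, Nat.add_zero]
    · obtain ⟨u, hu⟩ : ∃ u, u = v / 2 := ⟨_, rfl⟩
      have hu1 : 1 ≤ u := by omega
      have huB : u < P.B := by omega
      have hnode : P.modTree (lo + 1) u = P.modTree (lo + 1) (2 * u) * P.modTree (lo + 1) (2 * u + 1) :=
        heap_node _ hu1 huB
      have hch := firstLeaf_children hu1 huB
      rcases Nat.mod_two_eq_zero_or_one v with h2 | h2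
      · obtain rfl : v = 2 * u := by omega
        rw [prefTree_two_mul _ _ hu1, map_emod hp,
          ih u (by omega) hu1 (by omega) (hnode ▸ Dvd.dvd.mul_right hp _), hch.1]
      · obtain rfl : v = 2 * u + 1 := by omega
        rw [prefTree_two_mul_add_one _ _ hu1, map_emod hp, map_mul_cast,
          ih u (by omega) hu1 (by omega) (hnode ▸ Dvd.dvd.mul_left hp _), ← hch.1,
          modProd_mul_matTree lo (by omega) (by omega), hch.2, hch.1, add_assoc]

lemma map_root {lo : ℕ} {V : Mat P.D ℤ} {m : ℤ} (hm : (p : ℤ) ∣ m)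
    (hV : V.map (Int.cast : ℤ → ZMod p) = P.modProd p lo) :
    (((V * P.matTree (lo + 1) 1).map (· % m)).map (· % m)).map (Int.cast : ℤ → ZMod p) =
      P.modProd p (lo + P.B) := by
  have h1 := modProd_mul_matTree (P := P) (p := p) lo (v := 1) le_rfl (by have := P.one_le_B; omega)
  rw [firstLeaf_one, leaves_one, Nat.add_zero] at h1
  rw [map_emod hm, map_emod hm, map_mul_cast, hV, h1]
  rfl

end Mod

/-! ### The leaves of a block -/

variable {s : St} {R : St → Prop}

open Classical in
/-- The number of primes below `k` at which the output is due. -/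
noncomputable def goodCount (P : Par) (k : ℕ) : ℕ := k.count fun p => p ∈ P.primes ∧ P.Good p

lemma goodCount_le (k : ℕ) : P.goodCount k ≤ k := by
  classical exact Nat.count_le _

lemma goodCount_succ_of_not {k : ℕ} (h : ¬ (k ∈ P.primes ∧ P.Good k)) :
    P.goodCount (k + 1) = P.goodCount k := by
  classical exact Nat.count_succ_eq_count_iff.2 h

lemma goodCount_succ {k : ℕ} (h : k ∈ P.primes) (hg : P.Good k) :
    P.goodCount (k + 1) = P.goodCount k + 1 := by
  classical exact Nat.count_succ_eq_succ_count_iff.2 ⟨h, hg⟩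

lemma goodCount_mono {k k' : ℕ} (h : k ≤ k') : P.goodCount k ≤ P.goodCount k' := by
  classical exact Nat.count_monotone _ h

lemma goodCount_lt {k : ℕ} (h : k ∈ P.primes) (hg : P.Good k) : P.goodCount k < P.primes.card := by
  classical
  have h1 : P.goodCount (k + 1) ≤ P.primes.card := by
    rw [goodCount, Nat.count_eq_card_filter_range]
    exact card_le_card fun p hp => (mem_filter.1 hp).2.1
  have := P.goodCount_succ h hg
  omega

/-- The output is complete for the primes below `k`. -/
structure Written (P : Par) (k : ℕ) (s : St) : Prop where
  count : s.v 9 = P.goodCount k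
  prime : ∀ p < k, p ∈ P.primes → P.Good p → s.a 0 (P.goodCount p) = p
  entry : ∀ p < k, p ∈ P.primes → P.Good p → ∀ i < P.g, ∀ j < P.g,
    s.a 1 (P.goodCount p * P.g * P.g + i * P.g + j) = (P.entry p i j).val

lemma Written.congr {k : ℕ} {s s' : St} (h : P.Written k s) (h9 : s'.v 9 = s.v 9)
    (h0 : s'.a 0 = s.a 0) (h1 : s'.a 1 = s.a 1) : P.Written k s' :=
  ⟨by rw [h9, h.count], fun p h2 h3 h4 => by rw [h0, h.prime p h2 h3 h4],
    fun p h2 h3 h4 i hi j hj => by rw [h1, h.entry p h2 h3 h4 i hi j hj]⟩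

lemma Written.succ_of_not {k : ℕ} {s : St} (h : P.Written k s) (hk : ¬ (k ∈ P.primes ∧ P.Good k)) :
    P.Written (k + 1) s := by
  refine ⟨by rw [goodCount_succ_of_not hk, h.count], fun p h2 h3 h4 => ?_, fun p h2 h3 h4 => ?_⟩
  · rcases Nat.lt_succ_iff_lt_or_eq.1 h2 with h5 | rfl
    · exact h.prime p h5 h3 h4
    · exact absurd ⟨h3, h4⟩ hk
  · rcases Nat.lt_succ_iff_lt_or_eq.1 h2 with h5 | rfl
    · exact h.entry p h5 h3 h4
    · exact absurd ⟨h3, h4⟩ hk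

/-- The program that treats the leaves of the current block. -/
def leafProg : Program := forLoop 10 (.var 5) (branch (.get 4 (.var 5 + .var 10) - 1)
  (blk [asg 12 (.var 34 + .var 10), testProg, branch (.var 26) matrixProg (blk [])]) (blk []))

/-- The time for a leaf. -/
noncomputable def leafCost (P : Par) : ℝ := 40 * P.unit + 2 * (P.N.size + 1) * cellCost P.ctx P.W

/-- The variables that are used for a leaf. -/
abbrev leafVars : List ℕ := [9, 10, 12, 15, 16, 17, 20, 21, 22, 23, 24, 25, 26, 27]

/-- The arrays that are used for a leaf. -/
abbrev leafArrs : List ℕ := [0, 1, 9, 10, 11, 12, 13, 14, 15]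

lemma does_leafProg {lo : ℕ} {V : Mat P.D ℤ} (hs : Holds P s)
    (hz : ∀ j, P.D < j → P.h j = 0) (h34 : s.v 34 = (lo + 1 : ℕ)) (hlo : lo + 1 ≤ 3 * P.N + 1)
    (hm : ∀ v, 1 ≤ v → v < 2 * P.B → s.a 4 v = P.modTree (lo + 1) v)
    (hX : ∀ v, 1 ≤ v → v < 2 * P.B → MatAt s 6 v (P.prefTree (lo + 1) V v))
    (hV : ∀ p [Fact p.Prime], p ∈ P.primes → V.map (Int.cast : ℤ → ZMod p) = P.modProd p lo)
    (hw : P.Written (lo + 1) s)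
    (hR : ∀ s', Frame leafVars leafArrs s s' → P.Written (lo + 1 + P.B) s' → R s') :
    Does P.ctx leafProg s (2 * P.B * P.leafCost) R := by
  have hbu := bc_le_unit (P := P)
  have hpos := bc_pos P.ctx P.lam
  have h8 := P.bc_eight_le
  have hB1 := P.one_le_B
  have hcW := cellCost_pos P.ctx P.W
  have hlc : 40 * P.unit ≤ P.leafCost := by
    unfold leafCost
    have : 0 ≤ 2 * ((P.N.size : ℝ) + 1) * cellCost P.ctx P.W := by positivity
    linarith
  unfold leafProg
  refine .time_le (.forLoop (x := 10) (e := .var 5) P.B P.bits_B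
    (I := fun i s' => s'.v 10 = i ∧ Frame leafVars leafArrs s s' ∧ P.Written (lo + 1 + i) s')
    (T := fun _ => P.leafCost) ?_ ?_ ?_ fun s' h => hR s' h.2.1 h.2.2) ?_
  · exact ⟨by simp, (Frame.refl _ _ s).set (by simp [leafVars]), hw.congr (by simp) rfl rfl⟩
  · intro i hi s' h
    exact ⟨h.1, by simp [(hs.frame h.2.1).v5]⟩
  · intro i hi s1 h _
    obtain ⟨h10, hf1, hw1⟩ := h
    have hs1 := hs.frame hf1
    have e4 : (Ex.var 5 + Ex.var 10).eval s1 = (P.B + i : ℕ) := by simp [hs1.v5, h10]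
    have h4 : s1.a 4 (P.B + i) = P.modulus (lo + 1 + i) := by
      rw [hf1.a 4, hm _ (by omega) (by omega), modTree, heap_leaf]
    have hmb : bits (P.modulus (lo + 1 + i) : ℤ) ≤ P.lam := by
      unfold modulus
      split_ifs with h
      · exact P.short_N (by have := (mem_primes.1 h).1; omega)
      · exact P.bits_one
    have hev : (Ex.get 4 (Ex.var 5 + Ex.var 10) - 1).eval s1 = (P.modulus (lo + 1 + i) : ℤ) - 1 := by
      rw [Ex.eval_sub, Ex.eval_get, e4, Int.toNat_natCast, h4]; rfl
    refine .branch (L := P.lam) P.eight_le_lam bet_lam (fun hf => ?_) (fun hpos' => ?_)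
      (fun hneg => ?_)
    · refine ⟨⟨hf.leaf (by decide), ?_⟩, by simp [Ex.Leaf]⟩
      rw [e4, Int.toNat_natCast, h4]; exact hmb
    · rw [hev] at hpos'
      have hp : lo + 1 + i ∈ P.primes := by
        by_contra h
        rw [modulus, if_neg h] at hpos'
        simp at hpos'
      rw [modulus, if_pos hp] at h4
      set p := lo + 1 + i with hpd
      have hp' := mem_primes.1 hp
      have : Fact p.Prime := ⟨hp'.2.1⟩
      refine .cons (.asg_ok (p : ℤ) ?_
        (fun _ => P.short_N) ?_)
      · simp [hf1.v 34, h34, h10, hpd]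
      have hf2 : Frame leafVars leafArrs s (s1.set 12 p) := hf1.set
      refine .cons (does_test (p := p) (hs.frame hf2) hz (by simp) hp fun s3 hf3 h9 hg => ?_)
      have hf3' : Frame leafVars leafArrs s s3 := hf2.trans hf3
      have hs3 := hs.frame hf3'
      have hv10 : s3.v 10 = i := by rw [hf3.v 10]; simp [h10]
      have hw3 : P.Written p s3 := by
        refine hw1.congr ?_ ?_ ?_
        · rw [hf3.v 9]; simp
        · rw [hf3.a 0]; rfl
        · rw [hf3.a 1]; rfl
      refine .cons (.branch_ok (fun h26 => ?_) (fun h26 => ?_)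
        (T := 24 * P.unit + 2 * (P.N.size + 1) * cellCost P.ctx P.W + 2 * bc P.ctx P.lam))
      · have hgood : P.Good p := by
          rcases hg with h | h
          · exact h.2
          · rw [Ex.eval_var, h.1] at h26; exact absurd h26 (lt_irrefl _)
        have hbd := prefTree_bounds (P := P) (lo + 1) V (v := P.B + i) (by omega) (by omega)
        have hmt : P.modTree (lo + 1) (P.B + i) = p := by
          rw [modTree, heap_leaf, modulus, if_pos hp]
        rw [hmt] at hbd
        refine .time_le (does_matrix (p := p) (i := i) (cnt := P.goodCount p)
          (X := P.prefTree (lo + 1) V (P.B + i)) hs3 hz ?_ hp hgood hv10 ?_ hbd ?_ h9 hw3.count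
          (P.goodCount_lt hp hgood) fun s4 hf4 h94 h04 h14 hW => .nil ?_ ⟨?_, ?_, ?_, ?_⟩) ?_
        · rw [hf3.v 12]; simp
        · exact (hX _ (by omega) (by omega)).congr (by rw [hf3'.a 6])
        · rw [map_prefTree (hV p hp) _ (by omega) (by omega) (by rw [hmt])]
          have : firstLeaf P.b (P.B + i) = i := firstLeaf_leaf hi
          rw [this, modProd]
          congr 1
          omega
        · unfold leafCost
          simp only [ctx_lam]
          linarith
        · rw [hf4.v 10, hv10]
        · simp
        · exact (hf3'.trans hf4 (V'' := leafVars) (A'' := leafArrs)).set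
        · have hc := P.goodCount_succ hp hgood
          have hmono : ∀ q < p, q ∈ P.primes → P.Good q → P.goodCount q < P.goodCount p := by
            intro q h1 h2 h3
            have := P.goodCount_succ h2 h3
            have := P.goodCount_mono (k := q + 1) (k' := p) h1
            omega
          refine Written.congr (s := s4) ⟨?_, fun q h1 h2 h3 => ?_, fun q h1 h2 h3 i' hi' j' hj' => ?_⟩
            (by simp) rfl rfl
          · rw [h94]; exact congrArg _ hc.symm
          · rcases Nat.lt_succ_iff_lt_or_eq.1 h1 with h5 | h5
            · rw [h04, if_neg (hmono q h5 h2 h3).ne, hw3.prime q h5 h2 h3]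
            · have h6 : q = p := h5
              rw [h6, h04, if_pos rfl]
          · rcases Nat.lt_succ_iff_lt_or_eq.1 h1 with h5 | rfl
            · rw [h14, hw3.entry q h5 h2 h3 i' hi' j' hj']
              have h6 := Nat.mul_le_mul_right P.g (Nat.mul_le_mul_right P.g
                (Nat.succ_le_of_lt (hmono q h5 h2 h3)))
              have h7 : (P.goodCount q).succ * P.g * P.g = P.goodCount q * P.g * P.g + P.g * P.g := by
                rw [Nat.succ_eq_add_one]; ring
              have h8 := index_lt hi' hj'
              omega
            · exact hW i' hi' j' hj'
        · simp only [ctx_lam]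
          linarith
      · have hgood : ¬ P.Good p := by
          rcases hg with h | h
          · rw [Ex.eval_var, h.1] at h26; norm_num at h26
          · exact h.2
        refine .nil ?_ (.nil ?_ ⟨hv10, by simp, hf3'.set, ?_⟩)
        · simp only [ctx_lam]
          have : 0 < P.unit := by linarith
          have : 0 ≤ 2 * ((P.N.size : ℝ) + 1) * cellCost P.ctx P.W := by positivity
          linarith
        · unfold leafCost
          simp only [ctx_lam]
          linarith
        · exact (hw3.succ_of_not fun h => hgood h.2).congr (by simp) rfl rfl
    · rw [hev] at hneg
      have hp : lo + 1 + i ∉ P.primes := by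
        intro h
        rw [modulus, if_pos h] at hneg
        have := (mem_primes.1 h).2.1.two_le
        have : (2 : ℤ) ≤ (lo + 1 + i : ℕ) := mod_cast this
        linarith
      refine .nil ?_ ⟨h10, by simp, hf1.set (by simp [leafVars]), ?_⟩
      · linarith
      · exact (hw1.succ_of_not fun h => hp h.1).congr (by simp) rfl rfl
  · simp only [sum_const, card_range, nsmul_eq_mul, ctx_lam]
    have hB : (1 : ℝ) ≤ P.B := mod_cast hB1
    have h1 : (P.B : ℝ) * (6 * bc P.ctx P.lam) ≤ P.B * P.leafCost := by gcongr; linarith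
    have h2 : 1 * bc P.ctx P.lam ≤ P.B * bc P.ctx P.lam := by gcongr
    linarith

end Par

/-! ### The two passes over the blocks -/

namespace Par
variable {P : Par} {s : St} {R : St → Prop}

/-- The program of the first pass, for the product of all odd primes up to `N`. -/
def radProg : Program := blk [put 4 0 1, forLoop 7 (.var 6) (blk [asg 34 (.var 7 * .var 5 + 1),
  modTreeProg, put 4 0 (.get 4 0 * .get 4 1)])]

lemma block_le {c nb : ℕ} (hc : c < nb) (hnb : (nb - 1) * P.B ≤ P.N) : c * P.B + 1 ≤ 3 * P.N + 1 := by
  have : c * P.B ≤ (nb - 1) * P.B := Nat.mul_le_mul_right _ (by omega)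
  omega

lemma len_four : P.len 4 = 2 * P.B + 1 := by simp [len]

lemma top_bet : 64 * (P.top + 1) ≤ P.ctx.bet := (bet_of_le_top (P := P) le_rfl).2

lemma does_rad {nb : ℕ} (hs : Holds P s) (h6 : s.v 6 = nb) (hnb : (nb - 1) * P.B ≤ P.N)
    (hnb' : nb ≤ P.N + 1)
    (hR : ∀ s', Frame [7, 10, 11, 34] [4, 8] s s' → s'.a 4 0 = P.rad (nb * P.B + 1) → R s') :
    Does P.ctx radProg s ((nb + 1) * (P.modTreeCost + 2 * cellCost P.ctx P.top)) R := by
  have hlt := P.lam_le_top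
  have hpos := bc_pos P.ctx P.lam
  have h8 := P.bc_eight_le
  have htop : bc P.ctx P.lam ≤ bc P.ctx P.top := bc_mono _ hlt
  have hct := bc_le_cellCost P.ctx P.top
  have hm0 : 0 ≤ P.modTreeCost := by
    unfold modTreeCost sieveCost
    have := cellCost_pos P.ctx P.lam
    have := bc_pos P.ctx (P.B * P.lam)
    positivity
  have hradb : ∀ k, bits (P.rad k : ℤ) ≤ P.top ∧ bits (P.rad k : ℤ) ≤ 2 * P.N + 1 := fun k =>
    bits_le_top_of_abs (by rw [Nat.abs_cast]; exact_mod_cast P.rad_le k)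
  have hc0 : P.nodeCap 0 = 2 * P.N + 1 := by simp [nodeCap]
  have hBt : P.B * P.lam ≤ P.top := by
    have := leaves_mul_le (P := P) (v := 1) le_rfl (show P.lam ≤ P.W by have := P.lam_le_W; omega)
    rw [leaves_one] at this
    exact (Nat.le_add_right _ _).trans this
  have hB1 := P.one_le_B
  refine .cons (.put_ok 0 1 (by simp) (by simp)
    (fun _ => ⟨by norm_num, ?_, ?_⟩) (.cons (.forLoop (x := 7) (e := .var 6) nb P.short_N (I := fun c s' => s'.v 7 = c ∧
      Frame [7, 10, 11, 34] [4, 8] s s' ∧ s'.a 4 0 = P.rad (c * P.B + 1))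
    (T := fun _ => P.modTreeCost + cellCost P.ctx P.top) ?_ ?_ ?_ fun s' h =>
      Does.nil ?_ (hR s' h.2.1 h.2.2))))
  · change 0 < P.len 4
    rw [len_four]; omega
  · change _ ≤ P.cap 4 0
    rw [cap_four, hc0]; simp [bits]
  · refine ⟨by simp, (Frame.refl _ _ s).put.set, ?_⟩
    simp [rad, modulus, mem_primes, Nat.not_prime_zero]
  · intro c hc s' h
    exact ⟨h.1, by simp [h.2.1.v 6, h6]⟩
  · intro c hc s1 h _
    obtain ⟨h7, hf1, hr1⟩ := h
    have hs1 := hs.frame hf1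
    have hlo := P.block_le hc hnb
    refine .cons (.asg_ok ((c * P.B + 1 : ℕ) : ℤ)
      (by simp [h7, hs1.v5]) (fun _ => P.short_N) ?_)
    have hf2 : Frame [7, 10, 11, 34] [4, 8] s (s1.set 34 ((c * P.B + 1 : ℕ) : ℤ)) := hf1.set
    refine .cons (does_modTree (lo := c * P.B + 1) (hs.frame hf2) (by simp) hlo
      fun s3 hf3 hm3 h30 _ => ?_)
    have e1 : s3.a 4 1 = P.modTree (c * P.B + 1) 1 := hm3 1 le_rfl (by omega)
    have e0 : s3.a 4 0 = P.rad (c * P.B + 1) := by rw [h30]; exact hr1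
    have hnext : (P.rad (c * P.B + 1) : ℤ) * P.modTree (c * P.B + 1) 1 = P.rad ((c + 1) * P.B + 1) := by
      rw [rad_mul_modTree]; congr 2; ring
    have hb1 := bits_modTree (P := P) (c * P.B + 1) (v := 1) le_rfl (by omega)
    rw [leaves_one] at hb1
    refine .cons (.put (L := P.top) 0 (P.rad ((c + 1) * P.B + 1) : ℤ)
      (P.eight_le_lam.trans hlt) top_bet (fun hf => (hf.leaf (by decide)).mono hlt) (fun hf => ?_)
      (by simp) ?_ (fun _ => ⟨by norm_num, ?_, ?_⟩) (.nil ?_ ⟨?_, by simp, ?_, ?_⟩))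
    · refine ⟨⟨by simp [Ex.Leaf], ?_⟩, ⟨by simp [Ex.Leaf], ?_⟩⟩
      · change bits (s3.a 4 0) ≤ _
        rw [e0]; exact (hradb _).1
      · change bits (s3.a 4 1) ≤ _
        rw [e1]; exact hb1.trans hBt
    · rw [← hnext]
      simp [e0, e1]
    · change 0 < P.len 4
      rw [len_four]; omega
    · change _ ≤ P.cap 4 0
      rw [cap_four, hc0]; exact (hradb _).2
    · simp only [ctx_lam]
      linarith
    · simp [hf3.v 7, h7]
    · exact ((hf2.trans hf3 (V'' := [7, 10, 11, 34]) (A'' := [4, 8])).put).set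
    · simp
  · simp only [sum_const, card_range, nsmul_eq_mul, ctx_lam]
    have : (0 : ℝ) ≤ nb := by positivity
    nlinarith

/-- The program for a block in the second pass. -/
def blockProg : Program := blk [asg 34 (.var 7 * .var 5 + 1), modTreeProg, matTreeProg, prefTreeProg,
  leafProg]

/-- The time for a block. -/
noncomputable def blockCost (P : Par) : ℝ :=
  P.modTreeCost + P.matTreeCost + P.prefTreeCost + 2 * P.B * P.leafCost + cellCost P.ctx P.lam

/-- The variables that are used by a block. -/
abbrev blockVars : List ℕ := [7, 9, 10, 11, 12, 15, 16, 17, 20, 21, 22, 23, 24, 25, 26, 27, 34]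

/-- The arrays that are used by a block. -/
abbrev blockArrs : List ℕ := [0, 1, 4, 5, 6, 8, 9, 10, 11, 12, 13, 14, 15]

/-- The state before the block `c` of the second pass. -/
structure AtBlock (P : Par) (m : ℕ) (c : ℕ) (s : St) : Prop where
  rad : s.a 4 (2 * P.B) = m
  root : ∃ V : Mat P.D ℤ, MatAt s 6 0 V ∧ (∀ r k, |V r k| ≤ 4 ^ P.N) ∧
    ∀ p [Fact p.Prime], p ∈ P.primes → V.map (Int.cast : ℤ → ZMod p) = P.modProd p (c * P.B)
  written : P.Written (c * P.B + 1) s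

lemma does_block {m c nb : ℕ} (hs : Holds P s) (hz : ∀ j, P.D < j → P.h j = 0) (h7 : s.v 7 = c)
    (hc : c < nb) (hnb : (nb - 1) * P.B ≤ P.N) (hm0 : 0 < m) (hm : m ≤ 4 ^ P.N)
    (hd : ∀ p ∈ P.primes, p ∣ m) (h : P.AtBlock m c s)
    (hR : ∀ s', Frame blockVars blockArrs s s' → s'.v 7 = c → P.AtBlock m (c + 1) s' → R s') :
    Does P.ctx blockProg s P.blockCost R := by
  have hpos := bc_pos P.ctx P.lam
  have hbm := bc_le_cellCost P.ctx P.lam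
  have h8 := P.bc_eight_le
  obtain ⟨hrad, ⟨V, hV, hVb, hVc⟩, hw⟩ := h
  have hlo := P.block_le hc hnb
  refine .cons (.asg_ok ((c * P.B + 1 : ℕ) : ℤ)
    (by simp [h7, hs.v5]) (fun _ => P.short_N) ?_)
  have hf2 : Frame blockVars blockArrs s (s.set 34 ((c * P.B + 1 : ℕ) : ℤ)) :=
    (Frame.refl _ _ s).set
  refine .cons (does_modTree (lo := c * P.B + 1) (hs.frame hf2) (by simp) hlo
    fun s3 hf3 hm3 _ h3B => ?_)
  have hf3' : Frame blockVars blockArrs s s3 := hf2.trans hf3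
  refine .cons (does_matTree (lo := c * P.B + 1) (hs.frame hf3')
    (by rw [hf3.v 34]; simp) hlo fun s4 hf4 ht4 => ?_)
  have hf4' : Frame blockVars blockArrs s s4 := hf3'.trans hf4
  refine .cons (does_prefTree (lo := c * P.B + 1) (hs.frame hf4') hlo
    (fun v h1 h2 => by rw [hf4.a 4, hm3 v h1 h2]) (rad := m)
    (by rw [hf4.a 4, h3B]; exact hrad)
    (mod_cast hm0) (mod_cast hm) ht4 (V := V)
    (hV.congr (by rw [hf4.a 6, hf3.a 6]; rfl)) hVb fun s5 hf5 hp5 hr5 => ?_)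
  have hf5' : Frame blockVars blockArrs s s5 := hf4'.trans hf5
  have h45 : s5.a 4 = s3.a 4 := by rw [hf5.a 4, hf4.a 4]
  refine .cons (does_leafProg (lo := c * P.B) (V := V) (hs.frame hf5') hz
    (by rw [hf5.v 34, hf4.v 34,
      hf3.v 34]; simp) hlo (fun v h1 h2 => by rw [h45, hm3 v h1 h2]) hp5 hVc
    (hw.congr ?_ ?_ ?_) fun s6 hf6 hw6 => .nil ?_ (hR s6 (hf5'.trans hf6) ?_
      ⟨?_, ⟨((V * P.matTree (c * P.B + 1) 1).map (· % (m : ℤ))).map (· % (m : ℤ)), ?_, ?_, ?_⟩, ?_⟩))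
  · rw [hf5.v 9, hf4.v 9,
      hf3.v 9]; simp
  · rw [hf5.a 0, hf4.a 0, hf3.a 0]; rfl
  · rw [hf5.a 1, hf4.a 1, hf3.a 1]; rfl
  · unfold blockCost
    simp only [ctx_lam]
    linarith
  · rw [hf6.v 7, hf5.v 7,
      hf4.v 7, hf3.v 7]
    simp [h7]
  · rw [hf6.a 4, h45, h3B]; exact hrad
  · exact hr5.congr (by rw [hf6.a 6])
  · intro r k
    have h0 : (0 : ℤ) < m := mod_cast hm0
    rw [Matrix.map_apply, abs_of_nonneg (Int.emod_nonneg _ h0.ne')]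
    exact (Int.emod_lt_of_pos _ h0).le.trans (mod_cast hm)
  · intro p hpp hp
    rw [map_root (mod_cast hd p hp) (hVc p hp)]
    congr 1; ring
  · have e : (c + 1) * P.B + 1 = c * P.B + 1 + P.B := by ring
    rw [e]; exact hw6

/-- The program after the parameters have been set up. -/
def coreProg : Program := blk [radProg, put 4 (2 * .var 5) (.get 4 0),
  tabDot 6 0 (.var 2) (.var 2) 1 (.ite (.var 36 - .var 37) 0 (.ite (.var 37 - .var 36) 0 1)),
  asg 9 0, forLoop 7 (.var 6) blockProg, asg 0 (.var 9)]

/-- The time for all blocks. -/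
noncomputable def coreCost (P : Par) (nb : ℕ) : ℝ :=
  (nb + 1) * (2 * P.blockCost + 4 * cellCost P.ctx P.top) + P.unit

lemma blockCost_nonneg (P : Par) : 0 ≤ P.blockCost ∧ P.modTreeCost ≤ P.blockCost := by
  have := cellCost_pos P.ctx P.lam
  have := cellCost_pos P.ctx P.W
  have := cellCost_pos P.ctx P.top
  have := bc_pos P.ctx (P.B * P.lam)
  have := bc_pos P.ctx (P.B * (160 * P.W))
  have h0 : 0 ≤ P.modTreeCost := by unfold modTreeCost sieveCost; positivity
  have h1 : 0 ≤ P.matTreeCost := by unfold matTreeCost; positivity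
  have h2 : 0 ≤ P.prefTreeCost := by unfold prefTreeCost; positivity
  have h3 : 0 ≤ 2 * (P.B : ℝ) * P.leafCost := by unfold leafCost unit; positivity
  unfold blockCost
  constructor <;> linarith

lemma does_core {nb : ℕ} (hs : Holds P s) (hz : ∀ j, P.D < j → P.h j = 0) (h6 : s.v 6 = nb)
    (hnb : (nb - 1) * P.B ≤ P.N) (hnb' : nb ≤ P.N + 1) (hnbN : P.N ≤ nb * P.B)
    (hR : ∀ s' : St, s'.v 0 = (P.goodCount (nb * P.B + 1) : ℤ) → P.Written (nb * P.B + 1) s' → R s') :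
    Does P.ctx coreProg s (P.coreCost nb) R := by
  have hlt := P.lam_le_top
  have hpos := bc_pos P.ctx P.lam
  have h8 := P.bc_eight_le
  have htop : bc P.ctx P.lam ≤ bc P.ctx P.top := bc_mono _ hlt
  have hct := bc_le_cellCost P.ctx P.top
  have hbu := bc_le_unit (P := P)
  have hB1 := P.one_le_B
  have hN1 := P.one_le_N
  set m := P.rad (nb * P.B + 1) with hm
  have hmb : bits (m : ℤ) ≤ P.top ∧ bits (m : ℤ) ≤ 2 * P.N + 1 :=
    bits_le_top_of_abs (by rw [Nat.abs_cast]; exact_mod_cast P.rad_le _)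
  have hc0 : P.nodeCap (2 * P.B) = 2 * P.N + 1 := by simp [nodeCap]
  refine .cons (does_rad hs h6 hnb hnb' fun s1 hf1 hr1 => ?_)
  have hs1 := hs.frame hf1
  refine .cons (.put (L := P.top) (2 * P.B) (m : ℤ)
    (P.eight_le_lam.trans hlt) top_bet (fun hf => (hf.leaf (by decide)).mono hlt)
    (fun hf => ⟨by simp [Ex.Leaf], ?_⟩) (by simp [hs1.v5]) (by simp [hr1, hm])
    (fun _ => ⟨by norm_num, ?_, ?_⟩) ?_)
  · change bits (s1.a 4 0) ≤ _
    rw [hr1]; exact hmb.1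
  · change 2 * P.B < P.len 4
    rw [len_four]; omega
  · change _ ≤ P.cap 4 _
    rw [cap_four, hc0]; exact hmb.2
  set s2 := s1.put 4 (2 * P.B) (m : ℤ) with hs2d
  have hf2 : Frame blockVars blockArrs s s2 :=
    ((hf1.mono (V' := blockVars) (A' := blockArrs)).put)
  have hs2 := hs.frame hf2
  refine .cons (does_tabDot (L := P.lam) (B := 0 * (P.D * P.D)) (N1 := P.D) (N2 := P.D) (N3 := 1)
    (f := fun r k _ => if r = k then 1 else 0) ⟨le_rfl, (bet_of_le_top P.lam_le_top).1, ⟨bits_D, bits_D, bits_one⟩, fun s' h => ?_, fun r hr k hk j hj s' h h36 h37 h38 => ?_,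
      fun r hr k hk n hn => bits_sum_one hn ?_, by decide, by decide⟩
    (fun r hr k hk _ => ⟨by norm_num, lt_len_six (by omega) hr hk, ?_⟩) fun s3 ha3 hv3 => ?_)
  · simp [@h.v, hs2.v2]
  · refine ⟨?_, fun hf => hf.leaf (by decide)⟩
    simp only [Ex.evals, h36, h37]
    split_ifs <;> first | rfl | omega
  · split_ifs
    · exact P.bits_one
    · simp
  · change _ ≤ P.cap 6 _
    rw [cap_six hr hk, sum_range_one]
    have : P.nodeCap 0 = 2 * P.N + 1 := by simp [nodeCap]
    rw [this]
    split_ifs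
    · simp [bits]
    · simp
  have hid : MatAt s3 6 0 (1 : Mat P.D ℤ) := by
    refine MatAt.of_fill (w := fun r k => ∑ j ∈ range 1, if r = k then 1 else 0) ha3 fun r k => ?_
    rw [sum_range_one, Matrix.one_apply]
    simp only [Fin.ext_iff]
  have hf3 : Frame blockVars blockArrs s s3 := hf2.of_fill hv3 ha3
  have h43 : s3.a 4 (2 * P.B) = m := by rw [ha3, fill_ne (by norm_num)]; simp [hs2d]
  refine .cons (.asg_ok 0 (by simp) (fun _ => by simp) ?_)
  have hg1 : ∀ k ≤ 2, ¬ k ∈ P.primes := by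
    intro k hk h
    have h := mem_primes.1 h
    have := h.2.1.two_le
    omega
  have hgc : P.goodCount 1 = 0 := (P.goodCount_succ_of_not fun h => hg1 0 (by omega) h.1).trans
    (Nat.le_zero.1 (P.goodCount_le 0))
  refine .cons (.forLoop (x := 7) (e := .var 6) nb P.short_N (I := fun c s' => s'.v 7 = c ∧
      Frame blockVars blockArrs s s' ∧ P.AtBlock m c s')
    (T := fun _ => P.blockCost) ?_ ?_ ?_ fun s' h => ?_)
  · refine ⟨by simp, hf3.set.set, ⟨by simpa using h43, ⟨1, hid.congr (by simp), ?_, ?_⟩, ?_⟩⟩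
    · intro r k
      rw [Matrix.one_apply]
      split_ifs
      · rw [abs_one]; exact one_le_pow₀ (by norm_num)
      · rw [abs_zero]; positivity
    · intro p _ _
      rw [Nat.zero_mul]
      simp [modProd, recProd]
    · rw [Nat.zero_mul, Nat.zero_add]
      refine ⟨by simp [hgc], fun p hp hpp => ?_, fun p hp hpp => ?_⟩
      · exact absurd hpp (hg1 p (by omega))
      · exact absurd hpp (hg1 p (by omega))
  · intro c hc s' h
    exact ⟨h.1, by simp [h.2.1.v 6, h6]⟩
  · intro c hc s4 h _
    refine does_block (nb := nb) (hs.frame h.2.1) hz h.1 hc hnb (P.rad_pos _) (P.rad_le _)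
      (fun p hp => dvd_rad hp (by omega)) h.2.2 fun s5 hf5 h75 h5 => ?_
    refine ⟨h75, by simp, (h.2.1.trans hf5 (V'' := blockVars) (A'' := blockArrs)).set, ?_⟩
    obtain ⟨h51, ⟨V, h52, h53, h54⟩, h55⟩ := h5
    exact ⟨h51, ⟨V, h52.congr (by simp), h53, h54⟩, h55.congr (by simp) rfl rfl⟩
  · have hw := h.2.2.written
    have hgN := P.goodCount_le (nb * P.B + 1)
    have : nb * P.B ≤ (nb - 1) * P.B + P.B := by
      rw [← Nat.succ_mul]; exact Nat.mul_le_mul_right _ (by omega)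
    have := P.B_le
    refine .cons (.asg_ok (P.goodCount (nb * P.B + 1) : ℤ)
      (by simp [hw.count]) (fun _ => P.short_N) (.nil ?_ (hR _ (by simp)
        (hw.congr (by simp) rfl rfl))))
    have hu := P.unit_le P.D P.D 1
    have hn0 : (0 : ℝ) ≤ nb := by positivity
    obtain ⟨hb0, hmt⟩ := P.blockCost_nonneg
    have g1 : ((nb : ℝ) + 1) * P.modTreeCost ≤ (nb + 1) * P.blockCost := by gcongr
    have g2 : ((nb : ℝ) + 1) * (3 * bc P.ctx P.lam + 7 * bc P.ctx P.top) ≤ (nb + 1) * cellCost P.ctx P.top := by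
      gcongr
      have := bc_pos P.ctx P.top
      linarith
    have hB0 : 0 ≤ (nb : ℝ) * bc P.ctx P.top := by
      have := bc_pos P.ctx P.top
      positivity
    have hC0 : 0 ≤ (nb : ℝ) * cellCost P.ctx P.top := by
      have := cellCost_pos P.ctx P.top
      positivity
    unfold coreCost
    simp only [sum_const, card_range, nsmul_eq_mul, ctx_lam]
    linarith

/-! ### The main program -/

/-- The abstract memory at the start. -/
def inputSt (f : ℤ[X]) (N : ℕ) : St where
  v x := if x = 0 then N else if x = 1 then f.natDegree else 0
  a x i := if x = 0 then f.coeff i else 0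

/-- The parameters are those for the polynomial `f`: if `f = x F(x)`, the polynomial `h` is
`F(x ^ 2)`, otherwise it is `f`. In both cases `h 0 ≠ 0`. -/
structure IsFor (P : Par) (f : ℤ[X]) : Prop where
  deg : f.natDegree = 2 * P.g + 1 ∨ f.natDegree = 2 * P.g + 2
  sh : P.sh = if f.coeff 0 = 0 then 2 else 1
  D : P.D = if f.coeff 0 = 0 then 2 * (f.natDegree - 1) else f.natDegree
  b : P.b = P.N.size - 2 * P.N.size.size
  h : ∀ j, P.h j =
    if f.coeff 0 = 0 then if Even j then f.coeff (j / 2 + 1) else 0 else f.coeff j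
  lf : ∀ j, bits (f.coeff j) ≤ P.lf

/-- The program that computes the parameters from the input. -/
def initProg : List Program := [asg 8 (.shr (.var 1 - 1) 1), asg 3 (.ite (.get 0 0 * .get 0 0) 1 2),
  asg 2 (.ite (2 - .var 3) (.var 1) (2 * .var 1 - 2)),
  tabDot 2 0 1 (.var 2 + 1) 1 (.ite (2 - .var 3) (.get 0 (.var 37))
    (.ite (.var 37 - 2 * .shr (.var 37) 1) 0 (.get 0 (.shr (.var 37) 1 + 1)))),
  asg 10 (.len (.var 0)), asg 11 (.shr (.var 10 + 1) 1),
  asg 10 (.ite (.var 10 - 2 * .len (.var 10)) (.var 10 - 2 * .len (.var 10)) 0), asg 12 1, .instr (.shl 40 12 10), .instr (.shl 41 12 11),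
  asg 5 (.var 40), asg 35 (.var 41), asg 33 (.var 2 * .var 2), asg 6 (.shr (.var 0) (.var 10) + 1),
  coreProg]

/-- The number of blocks. -/
def nb (P : Par) : ℕ := P.N / P.B + 1

/-- The time for the whole computation. -/
noncomputable def totalCost (P : Par) : ℝ := P.coreCost P.nb + 2 * P.unit

lemma describes_input {f : ℤ[X]} (hP : P.IsFor f) :
    Describes P.ctx (inputStore f P.N) (inputSt f P.N) := by
  have hv : ∀ x, (inputStore f P.N).var x = (inputSt f P.N).v x := by
    intro x
    simp only [inputStore, inputSt, Finsupp.add_apply, Finsupp.single_apply]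
    split_ifs <;> omega
  have hd : f.natDegree ≤ P.D := by
    have := P.hg
    have := hP.deg
    rw [hP.D]; split_ifs <;> omega
  have hN : bits (P.N : ℤ) ≤ P.lam := P.short_N
  have hb : ∀ x, bits ((inputSt f P.N).v x) ≤ P.lam := by
    intro x
    simp only [inputSt]
    split_ifs
    · exact hN
    · exact P.short_D (by omega)
    · simp [bits_zero]
  have hlb : P.lam ≤ P.bet := by have := P.bet_ge; omega
  refine ⟨⟨fun x _ => hb x, fun x _ => (hb x).trans hlb, fun x i h => ?_⟩, fun x _ => hv x,
    fun x _ => by rw [hv]; exact (hb x).trans hlb, fun x hx => ?_, fun x i => rfl⟩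
  · by_cases hx : x = 0
    · subst hx
      have hi : i ≤ P.D := (le_natDegree_of_ne_zero (by simpa [inputSt] using h)).trans hd
      refine ⟨by norm_num, ?_, ?_⟩
      · change i < P.len 0
        simp only [len, if_pos]
        omega
      · change bits (f.coeff i) ≤ P.cap 0 i
        simp only [cap, if_pos hi, if_true]
        exact (hP.lf i).trans (by omega)
    · simp [inputSt, hx] at h
  · rw [hv]; simp only [inputSt]; rw [if_neg (by omega), if_neg (by omega)]

set_option maxHeartbeats 1600000 in
lemma does_main {f : ℤ[X]} (hP : P.IsFor f) (hz : ∀ j, P.D < j → P.h j = 0)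
    (hR : ∀ s' : St, s'.v 0 = (P.goodCount (P.nb * P.B + 1) : ℤ) → P.Written (P.nb * P.B + 1) s' → R s') :
    Does P.ctx (blk initProg) (inputSt f P.N) P.totalCost R := by
  have hg := P.hg
  have hdeg := hP.deg
  have hN1 := P.one_le_N
  have hl := P.eight_le_lam
  have hlW := P.lam_le_W
  have hlW' : P.lf + P.lam ≤ P.W := by unfold W; omega
  have hWt : P.W ≤ P.top := by have := Nat.mul_le_mul P.one_le_B (le_refl P.W); unfold top; omega
  have hbW := bet_of_le_top hWt
  have hd : f.natDegree ≤ P.D := by rw [hP.D]; split_ifs <;> omega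
  have hsz : bits (P.N : ℤ) = P.N.size := by simp [bits]
  have hszN : P.N.size ≤ P.N := Nat.size_le.2 Nat.lt_two_pow_self
  have hbN : P.b ≤ P.N.size := by rw [hP.b]; omega
  have hbl : P.b ≤ P.lam := by have := P.lam_ge; omega
  have hsh : (2 - P.sh : ℤ) = if f.coeff 0 = 0 then 0 else 1 := by rw [hP.sh]; split_ifs <;> norm_num
  have hp := bc_pos P.ctx P.lam
  have hu := bc_le_unit (P := P)
  have hcW : 800 * bc P.ctx P.W ≤ P.unit := by
    have h1 := bc_le_cellCost P.ctx P.W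
    have h2 := bc_pos P.ctx P.W
    have h3 : (1 : ℝ) ≤ (2 * P.D + 3) ^ 3 := one_le_pow₀ (by linarith [(Nat.cast_nonneg P.D : (0 : ℝ) ≤ P.D)])
    unfold unit
    nlinarith
  have hshl : P.ctx.u P.lam ≤ bc P.ctx P.lam := by
    have := P.ctx.u_mono (show P.lam ≤ 64 * (P.lam + 1) by omega)
    have := P.ctx.u_pos (64 * (P.lam + 1))
    unfold bc; linarith
  have hfit : ∀ (i : ℕ), bits (f.coeff i) ≤ P.W := fun i => (hP.lf i).trans (by omega)
  refine .cons (.asg_ok (P.g : ℤ) ?_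
    (fun _ => P.short_D (by have := P.hgD; rcases P.hsh with h | h <;> rw [h] at this <;> omega)) ?_)
  · simp only [Ex.evals, inputSt]
    norm_num
    omega
  refine .cons (.asg (P.sh : ℤ) (by omega) hbW.2
    (fun _ => by simpa [inputSt, Ex.Leaf] using hfit 0) ?_
    (hs := fun _ => P.short_N (by rcases P.hsh with h | h <;> omega)) ?_)
  · rw [hP.sh]
    by_cases h0 : f.coeff 0 = 0
    · simp [inputSt, h0]
    · have : 0 < f.coeff 0 * f.coeff 0 := mul_self_pos.2 h0
      simp [inputSt, h0, this]
  refine .cons (.asg_ok (P.D : ℤ) ?_ (fun _ => bits_D) ?_)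
  · simp only [Ex.evals, St.set_v, if_true]
    rw [hsh, hP.D]
    by_cases h0 : f.coeff 0 = 0 <;> simp [h0, inputSt]
    omega
  set s1 := (((inputSt f P.N).set 8 P.g).set 3 P.sh).set 2 P.D with hs1
  have hs10 : s1.v 0 = P.N := by simp [hs1, inputSt]
  refine .cons (does_tabDot (L := P.W) (B := 0) (N1 := 1) (N2 := P.D + 1) (N3 := 1)
    (f := fun _ k _ => P.h k) ⟨by simp only [ctx_lam]; omega, hbW.1, ⟨bits_one, P.short_D (by omega), bits_one⟩, fun s' h => ?_,
      fun r hr k hk j hj s' h h36 h37 h38 => ⟨?_, fun hf => ?_⟩,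
      fun r hr k hk n hn => bits_sum_one hn ((P.hh k).trans (by omega)), by decide, by decide⟩
    (fun r hr k hk _ => ⟨by norm_num, ?_, ?_⟩) fun s2 ha2 hv2 => ?_)
  · have : s'.v 2 = P.D := by rw [h.v 2]; simp [hs1]
    simp [this]
  · have e3 : s'.v 3 = P.sh := by rw [h.v 3]; simp [hs1]
    have e0 : ∀ i, s'.a 0 i = f.coeff i := fun i => by rw [h.arr 0 i (by simp)]; simp [hs1, inputSt]
    have e1 : ((k : ℤ) / 2 + 1).toNat = k / 2 + 1 := by omega
    simp only [Ex.evals, e3, e0, h37, Int.toNat_natCast, Int.toNat_one, pow_one, e1, hsh, hP.h k]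
    by_cases h0 : f.coeff 0 = 0
    · rw [if_pos h0, if_pos h0, if_neg (by norm_num)]
      by_cases hk2 : Even k
      · rw [if_pos hk2, if_neg (by have := hk2.two_dvd; omega)]
      · rw [if_neg hk2, if_pos (by rw [even_iff_two_dvd] at hk2; omega)]
    · rw [if_neg h0, if_neg h0, if_pos (by norm_num)]
  · have hW : ∀ {e : Ex}, e.ok = true → e.Leaf P.W s' := fun h => (hf.leaf h).mono (by simp only [ctx_lam]; omega)
    have e0 : ∀ i, bits (s'.a 0 i) ≤ P.W := fun i => by
      rw [h.arr 0 i (by simp)]; exact hfit i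
    exact ⟨hW (by decide), fun _ => ⟨hW (by decide), e0 _⟩,
      fun _ => ⟨hW (by decide), fun _ => hW (by decide), fun _ => ⟨hW (by decide), e0 _⟩⟩⟩
  · obtain rfl : r = 0 := by omega
    change _ < P.len 2
    simp only [len]; norm_num; omega
  · change _ ≤ P.cap 2 _
    simp only [cap, sum_range_one]; norm_num
    exact P.hh k
  have ha2' : ∀ j, s2.a 2 j = P.h j := by
    intro j
    rcases Nat.lt_or_ge j (P.D + 1) with hj | hj
    · rw [ha2]
      simp only [fill]
      rw [if_pos ⟨trivial, by omega, by omega⟩]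
      simp [Nat.mod_eq_of_lt hj]
    · rw [ha2, fill_of_le (by omega), hz j (by omega)]; simp [hs1, inputSt]
  have hv2' : Same s1 s2 := hv2
  refine .cons (.asg_ok (P.N.size : ℤ)
    (by simp [@hv2.v, hs10, bits]) (fun _ => P.short_N) ?_)
  refine .cons (.asg_ok (((P.N.size + 1) / 2 : ℕ) : ℤ)
    (by simp) (fun _ => P.short_N) ?_)
  refine .cons (.asg_ok (P.b : ℤ)
    (by simp [hP.b, bits]; split_ifs <;> omega) (fun _ => P.short_N) ?_)
  refine .cons (.asg_ok 1 (by simp) (fun _ => by simpa using bits_one (P := P)) ?_)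
  have hb1 : bits 1 ≤ P.lam := by simpa using bits_one (P := P)
  have hb2 : 2 * P.lam ≤ P.bet := by have := P.bet_ge; omega
  refine .cons (.shl 1 P.b (by simp) (by simp) (n := P.lam)
    hb1 hbl hb2 ?_)
  refine .cons (.shl 1 ((P.N.size + 1) / 2) (by simp) (by simp) (n := P.lam)
    hb1 (by have := P.lam_ge; omega) hb2 ?_)
  refine .cons (.asg (P.B : ℤ) hl bet_lam
    (fun _ => ⟨by norm_num, ?_⟩) (by simp [B]) (hs := fun _ => bits_B) ?_)
  · simpa [B] using bits_B (P := P)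
  have hQ : bits (P.Q : ℤ) ≤ P.lam := P.short_N (by have := P.Q_le; omega)
  refine .cons (.asg (P.Q : ℤ) hl bet_lam
    (fun _ => ⟨by norm_num, ?_⟩) (by simp [Q]) (hs := fun _ => hQ) ?_)
  · simpa [Q] using hQ
  refine .cons (.asg_ok (P.D * P.D : ℤ)
    (by simp [@hv2.v, hs1]) (fun _ => ?_) ?_)
  · have := P.short_nat (n := P.D * P.D) 0 2 (by norm_num) (by norm_num) (by nlinarith)
    simpa using this
  have hnb := Nat.div_le_self P.N P.B
  refine .cons (.asg_ok (P.nb : ℤ)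
    (by simp [@hv2.v, hs10, nb, B]) (fun _ => P.short_N (by unfold nb; omega)) ?_)
  refine .cons ((does_core (nb := P.nb) ⟨?_, ?_, ?_, ?_, ?_, ?_, ?_, ?_, ?_⟩ hz ?_ ?_ ?_ ?_
    fun s' h1 h2 => .nil ?_ (hR s' h1 h2)))
  iterate 7 simp [@hv2.v, hs1, inputSt]
  · simpa using ha2'
  · intro i; simp [ha2, hs1, inputSt, fill_ne]
  · simp
  · rw [nb, Nat.add_sub_cancel]; exact Nat.div_mul_le_self _ _
  · unfold nb; omega
  · rw [nb]; exact (Nat.lt_div_mul_add P.one_le_B).le.trans (by rw [Nat.add_mul, Nat.one_mul])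
  · have := bc_mono P.ctx hl
    have h3 : (0 : ℝ) ≤ P.D := P.D.cast_nonneg
    have h4 : 4 * ((P.D : ℝ) + 2) ≤ (2 * P.D + 3) ^ 3 := by nlinarith [pow_nonneg h3 2, pow_nonneg h3 3]
    have h5 := mul_le_mul_of_nonneg_right h4 (cellCost_pos P.ctx P.W).le
    rw [← unit] at h5
    unfold totalCost
    simp only [ctx_lam]
    push_cast
    linarith

end Par

/-! ### Admissible primes and Hasse–Witt matrices in terms of the parameters -/

/-- `f (x ^ 2)` is squarefree if and only if `x f` is. -/
lemma squarefree_expand_two {K : Type*} [Field K] [PerfectField K] (h2 : (2 : K) ≠ 0) {f : K[X]} :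
    f.coeff 0 ≠ 0 ∧ Squarefree (expand K 2 f) ↔ Squarefree (X * f) := by
  have hl := isLocalHom_expand K two_pos
  have h1 : Squarefree (expand K 2 f) → Squarefree f := fun h a ha => by
    have h5 : expand K 2 (a * a) ∣ expand K 2 f := _root_.map_dvd (expand K 2) ha
    rw [map_mul] at h5
    exact isUnit_of_map_unit (expand K 2) a (h _ h5)
  rw [squarefree_mul_iff, irreducible_X.isRelPrime_iff_not_dvd, X_dvd_iff]
  refine and_congr_right fun h0 => ⟨fun h => ⟨irreducible_X.squarefree, h1 h⟩, fun h => ?_⟩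
  · have h3 := PerfectField.separable_iff_squarefree.2 h.2
    refine PerfectField.separable_iff_squarefree.1 ?_
    rw [separable_def, derivative_expand]
    refine (IsCoprime.map h3 (expand K 2).toRingHom).mul_right (IsCoprime.mul_right ?_ ?_)
    · rw [← C_eq_natCast]
      exact isCoprime_one_right.of_isCoprime_of_dvd_right
        (isUnit_C.2 (IsUnit.mk0 _ (by simpa using h2))).dvd
    · rw [pow_one, isCoprime_comm, irreducible_X.coprime_iff_not_dvd, X_dvd_iff]
      change ¬ (expand K 2 f).coeff 0 = 0
      rwa [coeff_expand two_pos, if_pos (dvd_zero _)]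

namespace Par
variable {P : Par} {f : ℤ[X]} {p : ℕ}

lemma IsFor.eq_zero (hP : P.IsFor f) (j : ℕ) (hj : P.D < j) : P.h j = 0 := by
  rw [hP.h]
  have := hP.D
  split_ifs at this ⊢ with h1 h2
  · exact coeff_eq_zero_of_natDegree_lt (by have := h2.two_dvd; omega)
  · rfl
  · exact coeff_eq_zero_of_natDegree_lt (by omega)

lemma IsFor.redPoly_eq (hP : P.IsFor f) : P.redPoly p =
    if f.coeff 0 = 0 then expand (ZMod p) 2 (reduceMod p f.divX) else reduceMod p f := by
  ext j
  rw [coeff_redPoly hP.eq_zero, hP.h]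
  split_ifs with h1 h2
  · obtain ⟨i, rfl⟩ := h2.two_dvd
    rw [Polynomial.coeff_expand_mul' two_pos]
    simp [reduceMod]
  · rw [coeff_expand two_pos, if_neg (by rwa [← even_iff_two_dvd])]
    simp
  · simp [reduceMod]

lemma reduceMod_eq (h0 : f.coeff 0 = 0) : reduceMod p f = X * reduceMod p f.divX := by
  conv_lhs => rw [← X_mul_divX_add f, h0]
  simp [reduceMod]

lemma IsFor.admissible_iff (hP : P.IsFor f) :
    p ≤ P.N ∧ IsAdmissible P.g f p ↔ p ∈ P.primes ∧ P.Good p := by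
  have hd : ((P.h P.D : ℤ) : ZMod p) ≠ 0 ↔ ¬ (p : ℤ) ∣ f.leadingCoeff := by
    rw [Ne, ZMod.intCast_zmod_eq_zero_iff_dvd, hP.h, hP.D, leadingCoeff]
    have := hP.deg
    have := P.hg
    split_ifs with h1 h2
    · rw [show 2 * (f.natDegree - 1) / 2 + 1 = f.natDegree by omega]
    · exact absurd (even_two_mul _) h2
    · rfl
  have key : ∀ [Fact p.Prime], p ≠ 2 → (((P.h 0 : ℤ) : ZMod p) ≠ 0 ∧ Squarefree (P.redPoly p) ↔
      Squarefree (reduceMod p f) ∧ (f.coeff 0 ≠ 0 → ¬ (p : ℤ) ∣ f.coeff 0)) := by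
    intro _ h2
    rw [hP.redPoly_eq, hP.h]
    by_cases h0 : f.coeff 0 = 0
    · have : (2 : ZMod p) ≠ 0 := by
        intro h
        exact h2 ((Nat.prime_dvd_prime_iff_eq Fact.out Nat.prime_two).1
          ((ZMod.natCast_eq_zero_iff 2 p).1 (mod_cast h)))
      rw [reduceMod_eq h0, ← squarefree_expand_two this]
      simp [h0, reduceMod]
    · rw [if_neg h0, if_neg h0, Ne, ZMod.intCast_zmod_eq_zero_iff_dvd]
      tauto
  rw [mem_primes, Good, and_left_comm (a := ((P.h 0 : ℤ) : ZMod p) ≠ 0), hd]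
  constructor
  · rintro ⟨hN, hp, ho, hg, hl, hc⟩
    have := Fact.mk hp
    have h2 : p ≠ 2 := by rintro rfl; exact absurd ho (by decide)
    exact ⟨⟨hN, hp, h2⟩, hl, (key h2).2 ⟨hg.1, hc⟩⟩
  · rintro ⟨⟨hN, hp, h2⟩, hl, h⟩
    have := Fact.mk hp
    have h3 := (key h2).1 h
    refine ⟨hN, hp, hp.odd_of_ne_two h2, ⟨h3.1, ?_⟩, hl, h3.2⟩
    rw [reduceMod, natDegree_map_of_leadingCoeff_ne_zero]
    · exact hP.deg
    · rwa [eq_intCast, Ne, ZMod.intCast_zmod_eq_zero_iff_dvd]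

lemma IsFor.hasseWitt_eq (hP : P.IsFor f) [Fact p.Prime] (h2 : p ≠ 2) (i j : Fin P.g) :
    hasseWitt P.g f p i j = P.entry p i j := by
  obtain ⟨n, hn⟩ := (Fact.out : p.Prime).odd_of_ne_two h2
  have hn' : (p - 1) / 2 = n := by omega
  have e1 : ∀ k : ℤ, ((zcoeff (f ^ n) k : ℤ) : ZMod p) =
      if 0 ≤ k then (reduceMod p f ^ n).coeff k.toNat else 0 := fun k => by
    unfold zcoeff
    split_ifs
    · rw [reduceMod, ← Polynomial.map_pow, coeff_map, eq_intCast]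
    · simp
  rw [hasseWitt, Matrix.of_apply, hn', e1, entry, hn', hP.redPoly_eq, hP.sh]
  by_cases h0 : f.coeff 0 = 0
  · simp only [if_pos h0]
    rw [reduceMod_eq h0, mul_pow, ← map_pow]
    simp only [coeff_X_pow_mul']
    have e2 : (p : ℤ) * (i + 1) = p * i + 2 * n + 1 := by rw [mul_add, hn]; push_cast; ring
    have e3 : p * (2 * (i : ℕ) + 1) = 2 * (p * i) + 2 * n + 1 := by rw [mul_add]; nth_rw 2 [hn]; ring
    rw [e2, e3]
    generalize hm : p * (i : ℕ) = m
    have hm' : (p : ℤ) * (i : ℕ) = m := by rw [← hm]; push_cast; rfl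
    rw [hm']
    split_ifs with a b c <;> first | omega | rfl | skip
    rw [show 2 * m + 2 * n + 1 - (2 * (j : ℕ) + 1) = 2 * (m + n - j) by omega,
      Polynomial.coeff_expand_mul' two_pos]
    congr 1
    omega
  · simp only [if_neg h0, one_mul]
    generalize hm : p * ((i : ℕ) + 1) = m
    have hm' : (p : ℤ) * ((i : ℕ) + 1) = m := by rw [← hm]; push_cast; rfl
    rw [hm']
    split_ifs with a b b <;> first | omega | rfl | skip
    congr 1
    omega

end Par

/-! ### The running time -/

lemma sq_le_four_mul_two_pow (n : ℕ) : n ^ 2 ≤ 4 * 2 ^ n := by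
  have h1 : n / 2 < 2 ^ (n / 2) := Nat.lt_two_pow_self
  calc n ^ 2 ≤ (2 * 2 ^ (n / 2)) ^ 2 := Nat.pow_le_pow_left (by omega) 2
    _ = 4 * 2 ^ (n / 2 * 2) := by rw [mul_pow, ← pow_mul]; norm_num
    _ ≤ _ := Nat.mul_le_mul_left _ (Nat.pow_le_pow_right (by norm_num) (by omega))

lemma bc_le_mul {c : Ctx} {n L Z : ℕ} {m : ℕ} (hL : 1 ≤ L) (hZ : L ≤ Z) (h : n * L ≤ m * Z) :
    (n : ℝ) * bc c L ≤ 4 * m * bc c Z := by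
  have h1 : n * (64 * (L + 1) + 1) ≤ 4 * m * (64 * (Z + 1) + 1) := by nlinarith
  have h2 : (n : ℝ) * (64 * (L + 1) + 1 : ℕ) ≤ 4 * m * (64 * (Z + 1) + 1 : ℕ) := mod_cast h1
  refine (mul_le_mul_of_nonneg_left (bc_le_div c hZ) n.cast_nonneg).trans ?_
  rw [← mul_assoc, mul_div_assoc']
  refine mul_le_mul_of_nonneg_right ?_ (bc_pos c Z).le
  rwa [div_le_iff₀ (by positivity)]

lemma cellCost_le_mul {c : Ctx} {n L Z : ℕ} {m : ℕ} (hL : 1 ≤ L) (hZ : 160 * L ≤ Z)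
    (h : n * (160 * L) ≤ m * Z) : (n : ℝ) * cellCost c L ≤ 3200 * m * bc c Z := by
  have := bc_le_mul (c := c) (by omega) hZ h
  unfold cellCost modCost
  linarith

namespace Par
variable {P : Par} {f : ℤ[X]}

lemma size_pos : 1 ≤ P.N.size := Nat.size_pos.2 P.one_le_N

lemma size_le_N : P.N.size ≤ P.N := Nat.size_le.2 Nat.lt_two_pow_self

lemma size_mul_Q : P.N.size * P.Q ≤ 4 * P.N := by
  have h0 := size_pos (P := P)
  set q := (P.N.size + 1) / 2 with hq
  have h1 : 2 ^ (P.N.size - 1) ≤ P.N := Nat.lt_size.1 (by omega)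
  have h2 : 2 ^ (2 * q - 2) ≤ P.N := (Nat.pow_le_pow_right (by norm_num) (by omega)).trans h1
  have h3 : q < 2 ^ q := Nat.lt_two_pow_self
  have h4 : q ≤ 2 ^ (q - 1) := by
    have : q - 1 < 2 ^ (q - 1) := Nat.lt_two_pow_self
    omega
  calc P.N.size * P.Q ≤ (2 * 2 ^ (q - 1)) * 2 ^ q := Nat.mul_le_mul (by omega) le_rfl
    _ = 4 * 2 ^ (2 * q - 2) := by
      obtain ⟨r, hr⟩ : ∃ r, q = r + 1 := ⟨q - 1, by omega⟩
      rw [hr, show r + 1 - 1 = r by omega, show 2 * (r + 1) - 2 = r + r by omega]; ring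
    _ ≤ _ := Nat.mul_le_mul_left _ h2

lemma nb_mul_B : P.nb * P.B ≤ 2 * P.N := by
  have := Nat.div_mul_le_self P.N P.B
  have := P.B_le
  rw [nb, Nat.add_mul]; omega

lemma IsFor.nb_le (hP : P.IsFor f) : P.nb ≤ 4 * P.N.size ^ 2 := by
  have h1 : P.N < 2 ^ P.N.size := Nat.lt_size_self _
  have h2 : 2 ^ P.N.size ≤ 2 ^ (2 * P.N.size.size) * P.B := by
    rw [B, ← pow_add, hP.b]; exact Nat.pow_le_pow_right (by norm_num) (by omega)
  have h3 : P.N / P.B < 2 ^ (2 * P.N.size.size) := Nat.div_lt_of_lt_mul (by rw [mul_comm]; omega)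
  have h4 : 0 < P.N.size.size := Nat.size_pos.2 size_pos
  have h5 : 2 ^ (P.N.size.size - 1) ≤ P.N.size := Nat.lt_size.1 (by omega)
  have h6 : 2 ^ (2 * P.N.size.size) = 4 * (2 ^ (P.N.size.size - 1)) ^ 2 := by
    rw [← pow_mul, show (4 : ℕ) = 2 ^ 2 by norm_num, ← pow_add]; congr 1; omega
  have := Nat.pow_le_pow_left h5 2
  unfold nb
  omega

/-- The running time is dominated by that of the arithmetic with numbers of `N * W` bits. -/
lemma IsFor.totalCost_le (hP : P.IsFor f) : P.totalCost ≤
    10 ^ 9 * ((2 * P.D + 3) ^ 3 * P.N.size * bc P.ctx (640 * (P.N * P.W))) := by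
  set S := P.N.size with hS
  set Z := 640 * (P.N * P.W) with hZ
  set X := bc P.ctx Z
  have hX : 0 < X := bc_pos _ _
  have hN := P.one_le_N
  have hB := P.one_le_B
  have hBN := P.B_le
  have hl := P.lam_ge
  have hlW := P.lam_le_W
  have hS1 : 1 ≤ S := size_pos
  have hSN : S ≤ P.N := size_le_N
  have hSQ : S * P.Q ≤ 4 * P.N := size_mul_Q
  have hnB := nb_mul_B (P := P)
  have hn := hP.nb_le
  rw [← hS] at hn
  have hbS : P.b + 1 ≤ S := by rw [hP.b, ← hS]; have := Nat.size_pos.2 hS1; omega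
  have hNW : P.N ≤ P.N * P.W := Nat.le_mul_of_pos_right _ (by omega)
  have hWN : P.W ≤ P.N * P.W := Nat.le_mul_of_pos_left _ (by omega)
  have hBW : P.B * P.W ≤ P.N * P.W := Nat.mul_le_mul_right _ hBN
  have htop : P.top = 2 * P.N + P.B * P.W + P.lam := rfl
  have k1 : P.nb * P.Q * P.lam ≤ 16 * S * (P.N * P.W) := by
    calc P.nb * P.Q * P.lam ≤ 4 * S ^ 2 * P.Q * P.W :=
          Nat.mul_le_mul (Nat.mul_le_mul_right _ hn) (by omega)
      _ = 4 * S * (S * P.Q) * P.W := by ring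
      _ ≤ 4 * S * (4 * P.N) * P.W := Nat.mul_le_mul_right _ (Nat.mul_le_mul_left _ hSQ)
      _ = _ := by ring
  have k2 : P.nb * P.B * P.W ≤ 2 * (P.N * P.W) := by
    rw [← mul_assoc]; exact Nat.mul_le_mul_right _ hnB
  have k3 : P.nb * P.B * P.lam ≤ P.nb * P.B * P.W := Nat.mul_le_mul_left _ (by omega)
  have k4 : P.nb ≤ P.nb * P.B := Nat.le_mul_of_pos_right _ (by omega)
  have k5 : P.nb * P.lam ≤ P.nb * P.B * P.lam := Nat.mul_le_mul_right _ k4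
  have k6 : P.nb * P.N ≤ S * (P.N * P.W) := by
    have h1 : 4 * S ^ 2 ≤ S * P.W := by nlinarith
    calc P.nb * P.N ≤ S * P.W * P.N := Nat.mul_le_mul_right _ (hn.trans h1)
      _ = _ := by ring
  have k7 : P.N * P.W ≤ S * (P.N * P.W) := Nat.le_mul_of_pos_left _ hS1
  have k8 : P.B * P.lam ≤ P.B * P.W := Nat.mul_le_mul_left _ (by omega)
  have k9 : 1 ≤ P.B * P.lam := Nat.mul_pos hB (by omega)
  have k10 : 1 ≤ P.B * (160 * P.W) := Nat.mul_pos hB (by omega)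
  have t1 := cellCost_le_mul (c := P.ctx) (n := P.nb * P.Q) (L := P.lam) (Z := Z) (m := 16 * S)
    (by omega) (by omega) (by rw [hZ]; linarith)
  have t2 := cellCost_le_mul (c := P.ctx) (n := P.nb * P.B) (L := P.lam) (Z := Z) (m := 2)
    (by omega) (by omega) (by rw [hZ]; linarith)
  have t3 := bc_le_mul (c := P.ctx) (n := P.nb) (L := P.B * P.lam) (Z := Z) (m := 2)
    k9 (by rw [hZ]; linarith) (by rw [hZ]; linarith)
  have t4 := cellCost_le_mul (c := P.ctx) (n := P.nb * P.B) (L := P.W) (Z := Z) (m := 2)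
    (by omega) (by omega) (by rw [hZ]; linarith)
  have t5 := bc_le_mul (c := P.ctx) (n := P.nb) (L := P.B * (160 * P.W)) (Z := Z) (m := 2)
    k10 (by rw [hZ]; linarith) (by rw [hZ]; linarith)
  have t6 := cellCost_le_mul (c := P.ctx) (n := P.nb) (L := P.top) (Z := Z) (m := 6 * S)
    (by omega) (by omega) (by rw [htop, hZ]; linarith)
  have t7 := cellCost_le_mul (c := P.ctx) (n := P.nb) (L := P.lam) (Z := Z) (m := 2)
    (by omega) (by omega) (by rw [hZ]; linarith)
  have t8 := cellCost_le_mul (c := P.ctx) (n := 1) (L := P.W) (Z := Z) (m := 1)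
    (by omega) (by omega) (by omega)
  have hnb1 : (1 : ℝ) ≤ P.nb := mod_cast Nat.succ_pos _
  push_cast at t1 t2 t3 t4 t5 t6 t7 t8
  have c1 := cellCost_pos P.ctx P.lam
  have c2 := cellCost_pos P.ctx P.W
  have c3 := bc_pos P.ctx (P.B * (160 * P.W))
  have c4 := bc_pos P.ctx (P.B * P.lam)
  have r1 : (1 : ℝ) ≤ S := mod_cast hS1
  have r2 : (P.b : ℝ) + 1 ≤ S := mod_cast hbS
  have hD : (0 : ℝ) ≤ P.D := P.D.cast_nonneg
  set T : ℝ := (2 * P.D + 3) ^ 3 with hT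
  have r3 : ((P.D : ℝ) + 1) ^ 3 ≤ T := pow_le_pow_left₀ (by positivity) (by linarith) 3
  have r4 : 1 ≤ T := one_le_pow₀ (by linarith)
  have g1 : ((P.b : ℝ) + 1) * (P.nb * bc P.ctx (P.B * P.lam)) ≤ S * (4 * 2 * X) := by gcongr
  have g2 : ((P.b : ℝ) + 1) * (P.nb * bc P.ctx (P.B * (160 * P.W))) ≤ S * (4 * 2 * X) := by gcongr
  have g3 : (S : ℝ) * (P.nb * P.B * cellCost P.ctx P.lam) ≤ S * (3200 * 2 * X) := by gcongr
  have g4 : (S : ℝ) * (P.nb * P.B * cellCost P.ctx P.W) ≤ S * (3200 * 2 * X) := by gcongr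
  have g5 : X ≤ S * X := le_mul_of_one_le_left hX.le r1
  have g6 : T * (P.nb * P.B * cellCost P.ctx P.W) ≤ T * (3200 * 2 * X) := by gcongr
  have g7 : T * X ≤ T * (S * X) := by gcongr
  have g8 : S * X ≤ T * (S * X) := le_mul_of_one_le_left (by positivity) r4
  have g9 : ((P.D : ℝ) + 1) ^ 3 * (9 * (P.nb * P.B * cellCost P.ctx P.W) +
      4800 * (((P.b : ℝ) + 1) * (P.nb * bc P.ctx (P.B * (160 * P.W)))) +
      4 * (P.nb * cellCost P.ctx P.top)) ≤
      T * (9 * (3200 * 2 * X) + 4800 * (S * (4 * 2 * X)) + 4 * (3200 * (6 * S) * X)) := by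
    have := cellCost_pos P.ctx P.top
    refine mul_le_mul r3 (by linarith) (by positivity) (by linarith)
  have g10 : T * (1 * cellCost P.ctx P.W) ≤ T * (3200 * 1 * X) := by gcongr
  have hblock : P.nb * P.blockCost ≤ 10 ^ 7 * (T * (S * X)) := by
    have e : P.nb * P.blockCost = 4 * (P.nb * P.Q * cellCost P.ctx P.lam) +
        4 * (S * (P.nb * P.B * cellCost P.ctx P.lam)) + 24 * (P.nb * P.B * cellCost P.ctx P.lam) +
        2 * (((P.b : ℝ) + 1) * (P.nb * bc P.ctx (P.B * P.lam))) +
        ((P.D : ℝ) + 1) ^ 3 * (9 * (P.nb * P.B * cellCost P.ctx P.W) +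
          4800 * (((P.b : ℝ) + 1) * (P.nb * bc P.ctx (P.B * (160 * P.W)))) +
          4 * (P.nb * cellCost P.ctx P.top)) + 80 * (T * (P.nb * P.B * cellCost P.ctx P.W)) +
        4 * (S * (P.nb * P.B * cellCost P.ctx P.W)) + 4 * (P.nb * P.B * cellCost P.ctx P.W) +
        P.nb * cellCost P.ctx P.lam := by
      unfold blockCost modTreeCost sieveCost matTreeCost prefTreeCost leafCost unit
      rw [← hT, ← hS]
      ring
    rw [e]
    linarith
  have hb0 := P.blockCost_nonneg.1
  have c5 := cellCost_pos P.ctx P.top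
  have g11 : ((P.nb : ℝ) + 1) * (2 * P.blockCost + 4 * cellCost P.ctx P.top) ≤
      (P.nb + P.nb) * (2 * P.blockCost + 4 * cellCost P.ctx P.top) := by gcongr
  unfold totalCost coreCost unit
  rw [← hT]
  linarith

end Par

/-! ### The space -/

lemma sum_range_div (F : ℕ → ℕ) {m : ℕ} (hm : 0 < m) (n : ℕ) :
    ∑ i ∈ range (n * m), F (i / m) = m * ∑ v ∈ range n, F v := by
  induction n with
  | zero => simp
  | succ n ih =>
    rw [Nat.succ_mul, sum_range_add, ih, sum_range_succ, mul_add]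
    congr 1
    rw [sum_congr rfl fun i hi => ?_, sum_const, card_range, smul_eq_mul]
    rw [Nat.mul_comm, Nat.mul_add_div hm, Nat.div_eq_of_lt (mem_range.1 hi), add_zero]

lemma sum_div_two_pow (a n : ℕ) : ∑ i ∈ range n, a / 2 ^ i ≤ 2 * a := by
  have : ∀ n, ∑ i ∈ range n, a / 2 ^ i + 2 * (a / 2 ^ n) ≤ 2 * a := fun n => by
    induction n with
    | zero => rw [sum_range_zero, pow_zero, Nat.div_one]; omega
    | succ n ih =>
      rw [sum_range_succ, pow_succ, ← Nat.div_div_eq_div_mul]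
      have := Nat.div_mul_le_self (a / 2 ^ n) 2
      omega
  exact le_trans (Nat.le_add_right _ _) (this n)

lemma log_le_size (n : ℕ) : Real.log n ≤ n.size := by
  rcases Nat.eq_zero_or_pos n with rfl | h0
  · simp
  have h1 : (n : ℝ) ≤ 2 ^ n.size := mod_cast (Nat.lt_size_self n).le
  have h := Real.log_le_log (by positivity) h1
  rw [Real.log_pow] at h
  have h3 := Real.log_two_lt_d9
  nlinarith [(n.size.cast_nonneg : (0 : ℝ) ≤ n.size)]

lemma size_le_log {n : ℕ} (h : 1 ≤ n) : (n.size : ℝ) ≤ 1 + 3 / 2 * Real.log n := by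
  have h0 : 1 ≤ n.size := Nat.size_pos.2 h
  have h1 : 2 ^ (n.size - 1) ≤ n := Nat.lt_size.1 (by omega)
  have h2 : (2 : ℝ) ^ (n.size - 1) ≤ n := mod_cast h1
  have h3 := Real.log_le_log (by positivity) h2
  rw [Real.log_pow, Nat.cast_sub h0, Nat.cast_one] at h3
  have h4 := Real.log_two_gt_d9
  have h5 : (1 : ℝ) ≤ n.size := mod_cast h0
  nlinarith

lemma size_le_three_mul_log {n : ℕ} (h : 1 < n) : (n.size : ℝ) ≤ 3 * Real.log n := by
  have h1 := size_le_log h.le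
  have h2 : Real.log 2 ≤ Real.log n := Real.log_le_log (by norm_num) (mod_cast h)
  have h4 := Real.log_two_gt_d9
  linarith

lemma size_mul_primeCounting_le {n : ℕ} (h : 1 < n) : n.size * Nat.primeCounting n ≤ 40 * n := by
  have h1 := Chebyshev.pi_le_log4_mul_div (x := n) (mod_cast h)
  rw [Nat.floor_natCast, Real.log_sqrt n.cast_nonneg] at h1
  have h2 := size_le_three_mul_log h
  have h3 : 0 < Real.log n := Real.log_pos (mod_cast h)
  have h4 : Real.log 4 ≤ 2 := by
    have h5 := Real.log_two_lt_d9
    rw [show (4 : ℝ) = 2 ^ 2 by norm_num, Real.log_pow]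
    push_cast; linarith
  have h5 : Real.log n ≤ 2 * √n := by
    have := Real.log_le_self (Real.sqrt_nonneg (n : ℝ))
    rw [Real.log_sqrt n.cast_nonneg] at this
    linarith
  have h6 := Real.mul_self_sqrt (n.cast_nonneg : (0 : ℝ) ≤ n)
  have h7 := Real.sqrt_nonneg (n : ℝ)
  have : (n.size : ℝ) * Nat.primeCounting n ≤ 40 * n := by
    calc (n.size : ℝ) * Nat.primeCounting n
        ≤ 3 * Real.log n * (Real.log 4 * n / (Real.log n / 2) + √n) := by gcongr
      _ = 6 * Real.log 4 * n + 3 * (Real.log n * √n) := by field_simp; ring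
      _ ≤ 6 * 2 * n + 3 * (2 * √n * √n) := by gcongr
      _ = 18 * n := by rw [mul_assoc 2, h6]; ring
      _ ≤ _ := by linarith [(n.cast_nonneg : (0 : ℝ) ≤ n)]
  exact_mod_cast this

namespace Par
variable {P : Par} {f : ℤ[X]}

lemma IsFor.size_mul_B (hP : P.IsFor f) : P.N.size * P.N.size * P.B ≤ 8 * P.N := by
  have h1 := P.two_pow_size_le
  have h2 := sq_le_four_mul_two_pow P.N.size
  rcases Nat.lt_or_ge P.N.size (2 * P.N.size.size) with h | h
  · have : P.b = 0 := by rw [hP.b]; omega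
    rw [B, this]
    nlinarith
  · have h3 : P.N.size < 2 ^ P.N.size.size := Nat.lt_size_self _
    calc P.N.size * P.N.size * P.B ≤ 2 ^ P.N.size.size * 2 ^ P.N.size.size * P.B :=
          Nat.mul_le_mul_right _ (Nat.mul_le_mul h3.le h3.le)
      _ = 2 ^ P.N.size := by rw [B, hP.b, ← pow_add, ← pow_add]; congr 1; omega
      _ ≤ _ := by omega

lemma IsFor.size_mul_bet (hP : P.IsFor f) : P.N.size * P.bet ≤ 12 * 10 ^ 6 * (P.N * P.W) := by
  have hl := P.lam_le_W
  have h0 := P.lam_ge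
  have e0 := size_le_N (P := P)
  have h1 : 1 ≤ P.N.size := size_pos
  have e1 : P.N.size * P.lam ≤ P.N * P.W := Nat.mul_le_mul e0 (by omega)
  have e2 : P.N.size * P.N ≤ P.N * P.W := by rw [mul_comm]; exact Nat.mul_le_mul_left _ (by omega)
  have e3 : P.N.size ≤ P.N * P.W := e0.trans (Nat.le_mul_of_pos_right _ (by omega))
  have e4 : P.N.size * (P.B * P.W) ≤ 8 * (P.N * P.W) := by
    rw [← mul_assoc, ← mul_assoc]
    refine Nat.mul_le_mul_right _ (le_trans ?_ hP.size_mul_B)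
    exact Nat.mul_le_mul_right _ (Nat.le_mul_of_pos_left _ h1)
  have h5 : P.bet = 10 ^ 6 * (2 * P.N + P.B * P.W + P.lam + 1) := by unfold bet top; norm_num
  rw [h5]
  linarith

lemma sum_leaves_le (P : Par) : ∑ v ∈ range (2 * P.B), leaves P.b v ≤ (P.b + 3) * P.B := by
  have hB := P.one_le_B
  have h2 : 2 * P.B = 2 * 2 ^ P.b - 1 + 1 := by unfold B at hB ⊢; omega
  rw [h2, sum_range_succ', sum_leaves P.b]
  have : leaves P.b 0 = 2 * P.B := by simp [leaves, B, pow_succ, mul_comm]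
  rw [this, B]
  linarith

lemma sum_nodeCap_le (P : Par) : ∑ v ∈ range (2 * P.B + 1), P.nodeCap v ≤
    (P.b + 3) * P.B * P.lam + 2 * (2 * P.N + 1) := by
  have h1 : P.nodeCap (2 * P.B) = 2 * P.N + 1 := by simp [nodeCap]
  have h2 : ∑ v ∈ range (2 * P.B), P.nodeCap v ≤
      ∑ v ∈ range (2 * P.B), (leaves P.b v * P.lam + if v = 0 then 2 * P.N + 1 else 0) := by
    refine sum_le_sum fun v hv => ?_
    have := mem_range.1 hv
    unfold nodeCap
    split_ifs <;> omega
  rw [sum_add_distrib, sum_ite_eq' , if_pos (by have := P.one_le_B; simp; omega),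
    ← sum_mul] at h2
  have := Nat.mul_le_mul_right P.lam P.sum_leaves_le
  rw [sum_range_succ, h1]
  omega

lemma size_le_lam {i : ℕ} (h : i ≤ 2 ^ 20 * ((P.N + 1) * (P.D + 2) ^ 2)) : i.size ≤ P.lam := by
  have := P.short_nat 1 2 (n := i) (by norm_num) (by norm_num) (by rwa [pow_one])
  simpa [bits] using this

lemma array_le {x : ℕ} (hx : x < 16) {c : ℕ} (hl : P.len x ≤ 2 ^ 20 * ((P.N + 1) * (P.D + 2) ^ 2))
    (hc : ∑ i ∈ range (P.len x), P.cap x i ≤ c) :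
    ∑ i ∈ range (P.len x), (x.size + i.size + 1 + P.cap x i) ≤ P.len x * (2 * P.lam) + c := by
  rw [sum_add_distrib]
  refine Nat.add_le_add ((sum_le_card_nsmul _ _ (2 * P.lam) fun i hi => ?_).trans (by simp)) hc
  have h1 := size_le_lam (P := P) ((mem_range.1 hi).le.trans hl)
  have h2 : x.size ≤ 4 := Nat.size_le.2 (by omega)
  have := P.lam_ge
  omega

lemma card_primes (P : Par) : P.primes.card ≤ Nat.primeCounting P.N := by
  rw [← Nat.primesLE_card_eq_primeCounting]
  refine card_le_card fun p hp => ?_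
  have := mem_primes.1 hp
  simp only [Nat.primesLE, Nat.mem_primesBelow]
  exact ⟨by omega, this.2.1⟩

lemma IsFor.array_space_le (hP : P.IsFor f) {x : ℕ} (hx : x < 16) (h2 : 1 < P.N) :
    P.N.size * ∑ i ∈ range (P.len x), (x.size + i.size + 1 + P.cap x i) ≤
      10 ^ 9 * ((P.D + 2) ^ 2 * (P.N * P.W)) := by
  set S := P.N.size with hS
  set A := P.N * P.W with hA
  set d := (P.D + 2) ^ 2 with hd
  have hN := P.one_le_N
  have hB := P.one_le_B
  have hBN := P.B_le
  have hl := P.lam_ge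
  have hlW := P.lam_le_W
  have hfW : P.lf ≤ P.W := by unfold W; omega
  have hS1 : 1 ≤ S := size_pos
  have hSN : S ≤ P.N := size_le_N
  have hbS : P.b + 3 ≤ 3 * S := by
    have : 1 ≤ S.size := Nat.size_pos.2 hS1
    rw [hP.b, ← hS]; omega
  have hgD : P.g ≤ P.D + 1 := by have := P.hgD; rcases P.hsh with h | h <;> rw [h] at this <;> omega
  have hπN : P.primes.card ≤ P.N + 1 := (card_filter_le _ _).trans (by simp)
  have e1 : S * P.lam ≤ A := Nat.mul_le_mul hSN (by omega)
  have e2 : S * P.lf ≤ A := Nat.mul_le_mul hSN hfW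
  have e3 : S * P.N ≤ A := by rw [mul_comm]; exact Nat.mul_le_mul_left _ (by omega)
  have e4 : S * P.primes.card * P.lam ≤ 40 * A := by
    have := (Nat.mul_le_mul_left S P.card_primes).trans (size_mul_primeCounting_le h2)
    rw [hA, ← mul_assoc]
    exact Nat.mul_le_mul this (by omega)
  have e5 : S * ((P.b + 3) * P.B) ≤ 24 * P.N := by
    have := hP.size_mul_B
    rw [← hS] at this
    calc S * ((P.b + 3) * P.B) ≤ S * (3 * S * P.B) := Nat.mul_le_mul_left _ (Nat.mul_le_mul_right _ hbS)
      _ = 3 * (S * S * P.B) := by ring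
      _ ≤ _ := by omega
  have e6 : S * ((P.b + 3) * P.B) * P.W ≤ 24 * A := by
    exact (Nat.mul_le_mul_right _ e5).trans (by rw [mul_assoc])
  have e7 : S * ((P.b + 3) * P.B) * P.lam ≤ 24 * A := (Nat.mul_le_mul_left _ (by omega)).trans e6
  have e8 : S * P.B * P.lam ≤ 24 * A := by
    refine le_trans (Nat.mul_le_mul_right _ (Nat.mul_le_mul_left _ ?_)) e7
    exact Nat.le_mul_of_pos_left _ (by omega)
  have hd' : d = P.D * P.D + 4 * P.D + 4 := by rw [hd]; ring
  have hDd : P.D + 1 ≤ d := by omega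
  have hDD : P.D * P.D ≤ d := by omega
  have hgg : P.g * P.g ≤ d := (Nat.mul_le_mul hgD hgD).trans (by rw [hd']; linarith)
  have d1 : A ≤ d * A := Nat.le_mul_of_pos_left _ (by positivity)
  have d2 : (P.D + 1) * A ≤ d * A := Nat.mul_le_mul_right _ hDd
  have d3 : P.D * P.D * A ≤ d * A := Nat.mul_le_mul_right _ hDD
  have d4 : P.g * P.g * A ≤ d * A := Nat.mul_le_mul_right _ hgg
  have m1 := fun k => Nat.mul_le_mul_left k e1
  have m4 := fun k => Nat.mul_le_mul_left k e4
  have key : ∀ n c, P.len x ≤ n → n ≤ 2 ^ 20 * ((P.N + 1) * d) →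
      ∑ i ∈ range (P.len x), P.cap x i ≤ c → S * (n * (2 * P.lam) + c) ≤ 10 ^ 9 * (d * A) →
      S * ∑ i ∈ range (P.len x), (x.size + i.size + 1 + P.cap x i) ≤ 10 ^ 9 * (d * A) :=
    fun n c hn hn' hc h => le_trans (Nat.mul_le_mul_left _ ((array_le hx (hn.trans hn') hc).trans
      (Nat.add_le_add_right (Nat.mul_le_mul_right _ hn) c))) h
  have hsmall : ∀ n, (x = 1 ∨ 8 ≤ x) → P.len x ≤ n → n ≤ 2 ^ 20 * ((P.N + 1) * d) →
      S * (n * (3 * P.lam)) ≤ 10 ^ 9 * (d * A) →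
      S * ∑ i ∈ range (P.len x), (x.size + i.size + 1 + P.cap x i) ≤ 10 ^ 9 * (d * A) :=
    fun n hx' hn hn' h => key n (n * P.lam) hn hn' (by
      simpa [P.cap_small x _ hx'] using Nat.mul_le_mul_right _ hn) (le_of_eq_of_le (by ring) h)
  have hdN : d ≤ (P.N + 1) * d := Nat.le_mul_of_pos_left _ (by omega)
  have hNd : P.N + 1 ≤ (P.N + 1) * d := Nat.le_mul_of_pos_right _ (by positivity)
  rcases Nat.lt_or_ge x 9 with h9 | h9
  swap
  · refine hsmall (4 * d) (.inr (by omega)) ((len_nine h9).le.trans (by rw [hd, sq])) (by omega) ?_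
    have := m1 d
    linarith
  have hBd : 2 * P.B * (P.D * P.D) ≤ 2 * ((P.N + 1) * d) := by
    rw [mul_assoc]; exact Nat.mul_le_mul_left _ (Nat.mul_le_mul (by omega) hDD)
  have hDD0 : 0 < P.D * P.D := Nat.mul_pos (by have := P.hD; omega) (by have := P.hD; omega)
  have m8 := fun k => Nat.mul_le_mul_left k e8
  have m7 := fun k => Nat.mul_le_mul_left k e7
  have m3 := Nat.mul_le_mul_left (P.D * P.D) e3
  have hSA : S ≤ A := (Nat.le_mul_of_pos_right S (by omega)).trans e1
  interval_cases x
  · refine key (P.D + 1 + P.primes.card) ((P.D + 1 + P.primes.card) * P.lam + (P.D + 1) * P.lf)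
      (by simp [len]) (by omega) ?_ ?_
    · have h1 : ∀ i, P.cap 0 i = P.lam + if i < P.D + 1 then P.lf else 0 := fun i => by
        simp only [cap]; split_ifs <;> omega
      simp only [h1, sum_add_distrib, ← sum_filter, sum_const, smul_eq_mul,
        card_range]
      refine Nat.add_le_add (Nat.mul_le_mul_right _ (by simp [len])) (Nat.mul_le_mul_right _ ?_)
      refine (card_le_card (t := range (P.D + 1)) fun i hi => ?_).trans (by simp)
      exact mem_range.2 (mem_filter.1 hi).2
    · have := m1 (P.D + 1)
      have := Nat.mul_le_mul_left (P.D + 1) e2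
      linarith
  · refine hsmall (P.primes.card * P.g * P.g) (.inl rfl) (by simp [len]) ?_ ?_
    · rw [mul_assoc]
      have := Nat.mul_le_mul hπN hgg
      omega
    · have := m4 (P.g * P.g)
      linarith
  · refine key (P.D + 1) ((P.D + 1) * P.lf) (by simp [len]) (by omega) (by simp [cap, len]) ?_
    have := m1 (P.D + 1)
    have := Nat.mul_le_mul_left (P.D + 1) e2
    linarith
  · have h1 : P.bet.size ^ 2 ≤ 8 * P.bet := by
      have h0 : 1 ≤ P.bet.size := Nat.size_pos.2 (by have := P.bet_ge; omega)
      have h1 : 2 ^ (P.bet.size - 1) ≤ P.bet := Nat.lt_size.1 (by omega)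
      refine (sq_le_four_mul_two_pow _).trans ?_
      rw [show P.bet.size = P.bet.size - 1 + 1 by omega, pow_succ]
      omega
    have h3 : P.bet.size ≤ P.bet := Nat.size_le.2 Nat.lt_two_pow_self
    have h4 : ∑ i ∈ range (P.len 3), ((3 : ℕ).size + i.size + 1 + P.cap 3 i) ≤ 16 * P.bet := by
      rw [len_three]
      calc _ ≤ ∑ i ∈ range P.bet.size, (P.bet.size + 6 + P.bet / 2 ^ i) := by
            refine sum_le_sum fun i hi => ?_
            have h5 : i.size ≤ i := Nat.size_le.2 Nat.lt_two_pow_self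
            have h6 : (3 : ℕ).size ≤ 2 := Nat.size_le.2 (by norm_num)
            have := mem_range.1 hi
            rw [cap_three]; omega
        _ ≤ P.bet.size * (P.bet.size + 6) + 2 * P.bet := by
            rw [sum_add_distrib]
            exact Nat.add_le_add (by simp) (sum_div_two_pow _ _)
        _ ≤ _ := by linarith
    refine (Nat.mul_le_mul_left S h4).trans ?_
    have := hP.size_mul_bet
    linarith
  · refine key (2 * P.B + 1) ((P.b + 3) * P.B * P.lam + 2 * (2 * P.N + 1)) (by simp [len]) (by omega) ?_ ?_
    · rw [show P.len 4 = 2 * P.B + 1 by simp [len]]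
      exact (sum_congr rfl fun i _ => cap_four i).trans_le P.sum_nodeCap_le
    · linarith
  · refine key (2 * P.B * (P.D * P.D)) (P.D * P.D * ((P.b + 3) * P.B * P.W)) (by simp [len]) (by omega) ?_ ?_
    · simp only [len, cap]
      norm_num
      rw [sum_range_div (fun v => leaves P.b v * P.W) hDD0, ← sum_mul]
      exact Nat.mul_le_mul_left _ (Nat.mul_le_mul_right _ P.sum_leaves_le)
    · have := m8 (P.D * P.D)
      have := Nat.mul_le_mul_left (P.D * P.D) e6
      linarith
  · refine key ((2 * P.B + 1) * (P.D * P.D)) (P.D * P.D * ((P.b + 3) * P.B * P.lam + 2 * (2 * P.N + 1)))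
      (by simp [len]) (by rw [Nat.add_mul]; omega) ?_ ?_
    · simp only [len, cap]
      norm_num
      rw [sum_range_div P.nodeCap hDD0]
      exact Nat.mul_le_mul_left _ P.sum_nodeCap_le
    · have := m8 (P.D * P.D)
      have := m7 (P.D * P.D)
      have := m1 (P.D * P.D)
      have := Nat.mul_le_mul_left (P.D * P.D) hSA
      linarith
  · simp [len]
  · refine hsmall P.B (.inr le_rfl) (len_eight).le (by omega) ?_
    linarith

lemma IsFor.space_le (hP : P.IsFor f) (h2 : 1 < P.N) :
    P.N.size * P.ctx.S ≤ 10 ^ 11 * ((P.D + 2) ^ 2 * (P.N * P.W)) := by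
  have h1 : ∑ x ∈ range 16, P.N.size * ∑ i ∈ range (P.ctx.len x),
      (x.size + i.size + 1 + P.ctx.cap x i) ≤ 16 * (10 ^ 9 * ((P.D + 2) ^ 2 * (P.N * P.W))) :=
    (sum_le_card_nsmul _ _ _ fun x hx => hP.array_space_le (mem_range.1 hx) h2).trans
      (by simp)
  have h3 := hP.size_mul_bet
  have h4 : P.N.size ≤ P.N * P.W :=
    size_le_N.trans (Nat.le_mul_of_pos_right _ (by have := P.lam_le_W; have := P.lam_ge; omega))
  have h5 : P.N * P.W ≤ (P.D + 2) ^ 2 * (P.N * P.W) := Nat.le_mul_of_pos_left _ (by positivity)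
  rw [Ctx.S, mul_add, mul_sum, ctx_bet]
  linarith

end Par

/-! ### Parameters for a polynomial, and conclusion -/

lemma bits_coeff_le (f : ℤ[X]) (j : ℕ) : bits (f.coeff j) ≤ (coeffNorm f).size := by
  by_cases h : f.coeff j = 0
  · simp [h]
  · exact Nat.size_le_size (le_sup (f := fun k => (f.coeff k).natAbs) (mem_support_iff.2 h))

/-- The parameters for `f`. -/
def Par.ofPoly {M : ℕ → ℝ} (hM : IsMulTime M) {g N : ℕ} {f : ℤ[X]} (hg : 1 ≤ g) (hN : 1 < N)
    (hd : f.natDegree = 2 * g + 1 ∨ f.natDegree = 2 * g + 2) : Par where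
  M := M
  hM := hM
  N := N
  D := if f.coeff 0 = 0 then 2 * (f.natDegree - 1) else f.natDegree
  g := g
  sh := if f.coeff 0 = 0 then 2 else 1
  b := N.size - 2 * N.size.size
  lf := (coeffNorm f).size
  lam := 4 * N.size + 16 * g + 68
  h j := if f.coeff 0 = 0 then if Even j then f.coeff (j / 2 + 1) else 0 else f.coeff j
  lam_ge := by
    have h : ∀ n : ℕ, n.size ≤ n := fun n => Nat.size_le.2 Nat.lt_two_pow_self
    split_ifs
    · have := h (2 * (f.natDegree - 1)); omega
    · have := h f.natDegree; omega
  hb := by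
    have h1 : 0 < N.size := Nat.size_pos.2 (by omega)
    have h2 : 0 < N.size.size := Nat.size_pos.2 h1
    have h3 : 2 ^ (N.size - 1) ≤ N := Nat.lt_size.1 (by omega)
    exact (Nat.pow_le_pow_right (by norm_num) (by omega)).trans h3
  hD := by split_ifs <;> omega
  hg := hg
  hsh := by split_ifs <;> simp
  hgD := by split_ifs <;> omega
  hh j := by
    split_ifs
    · exact bits_coeff_le f _
    · simp
    · exact bits_coeff_le f _

lemma Par.isFor_ofPoly {M : ℕ → ℝ} (hM : IsMulTime M) {g N : ℕ} {f : ℤ[X]} (hg : 1 ≤ g)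
    (hN : 1 < N) (hd : f.natDegree = 2 * g + 1 ∨ f.natDegree = 2 * g + 2) :
    (Par.ofPoly hM hg hN hd).IsFor f :=
  ⟨hd, rfl, rfl, rfl, fun _ => rfl, bits_coeff_le f⟩

namespace Par
variable {P : Par} {f : ℤ[X]} {s : St}

lemma IsFor.goodCount_eq (hP : P.IsFor f) {k : ℕ} :
    P.goodCount k = {p | p < k ∧ p ≤ P.N ∧ IsAdmissible P.g f p}.ncard := by
  classical
  rw [goodCount, Nat.count_eq_card_filter_range, ← Set.ncard_coe_finset]
  congr 1
  ext p
  simp [hP.admissible_iff]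

lemma IsFor.holdsHasseWitt (hP : P.IsFor f) {σ : Store} (hσ : Describes P.ctx σ s) {k : ℕ}
    (hk : P.N < k) (h0 : s.v 0 = P.goodCount k) (hw : P.Written k s) :
    HoldsHasseWitt P.g f P.N σ := by
  have hc : ∀ m ≤ P.N, P.goodCount m = {q | q < m ∧ IsAdmissible P.g f q}.ncard := fun m hm => by
    rw [hP.goodCount_eq]
    congr 1; ext q; simp only [Set.mem_ofPred_eq]
    exact ⟨fun h => ⟨h.1, h.2.2⟩, fun h => ⟨h.1, by omega, h.2⟩⟩
  refine ⟨?_, fun p hp ha i hi => ?_⟩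
  · rw [hσ.var 0 (by norm_num), h0, hP.goodCount_eq]
    congr 2; ext q; simp only [Set.mem_ofPred_eq]
    exact ⟨fun h => h.2, fun h => ⟨by omega, h⟩⟩
  · obtain ⟨hpp, hg⟩ := hP.admissible_iff.1 ⟨hp, ha⟩
    have := Fact.mk ha.prime
    rw [← hc p hp] at hi
    subst hi
    refine ⟨by rw [hσ.arr, hw.prime p (by omega) hpp hg], fun i j => ?_⟩
    rw [hσ.arr, hP.hasseWitt_eq (mem_primes.1 hpp).2.2, ← hw.entry p (by omega) hpp hg i i.2 j j.2]
    congr 1; ring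

end Par

/-- The length `W` in terms of logarithms. -/
lemma W_ofPoly_le {M : ℕ → ℝ} (hM : IsMulTime M) {g N : ℕ} {f : ℤ[X]} (hg : 1 ≤ g)
    (hN : 1 < N) (hd : f.natDegree = 2 * g + 1 ∨ f.natDegree = 2 * g + 2) {C : ℝ}
    (h : (g : ℝ) ≤ C * Real.log N) (hf : 1 ≤ coeffNorm f) :
    ((Par.ofPoly hM hg hN hd).W : ℝ) ≤
      (231 + 32 * |C|) * (Real.log (coeffNorm f) + Real.log N) := by
  have h1 := size_le_log hf
  have h2 := size_le_three_mul_log hN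
  have h3 : Real.log 2 ≤ Real.log N := Real.log_le_log (by norm_num) (mod_cast hN)
  have h4 := Real.log_two_gt_d9
  have h5 : 0 ≤ Real.log (coeffNorm f) := Real.log_natCast_nonneg _
  have h6 : (g : ℝ) ≤ |C| * Real.log N := h.trans (mul_le_mul_of_nonneg_right (le_abs_self C) (by linarith))
  have h7 : 0 ≤ |C| * Real.log (coeffNorm f) := by positivity
  have e : (Par.ofPoly hM hg hN hd).W = (coeffNorm f).size + 2 * (4 * N.size + 16 * g + 68) + 1 := rfl
  rw [e]
  push_cast
  linarith

namespace Par
variable {P : Par} {f : ℤ[X]}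

lemma IsFor.D_le (hP : P.IsFor f) : (P.D : ℝ) ≤ 4 * P.g + 2 := by
  have h1 := hP.D
  have h2 := hP.deg
  have : P.D ≤ 4 * P.g + 2 := by split_ifs at h1 <;> omega
  exact_mod_cast this

lemma IsFor.time_le (hP : P.IsFor f) (hN : 1 < P.N) {k X : ℕ} {K : ℝ}
    (hM : P.M (k * X) ≤ K * (k * P.M X)) (h : 50000 * (P.N * P.W) ≤ k * X) :
    P.totalCost ≤ 10 ^ 9 * (3375 * 3 * (200 * (3 + P.M 0) * (K * k))) *
      ((P.g : ℝ) ^ 5 * P.M X * Real.log P.N) := by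
  have hM0 := P.hM.nonneg 0
  have h1 : 1 ≤ P.N * P.W :=
    Nat.mul_pos P.one_le_N (by have := P.lam_le_W; have := P.eight_le_lam; omega)
  have h3 : bc P.ctx (640 * (P.N * P.W)) ≤ 200 * ((3 + P.M 0) * (K * (k * P.M X))) := by
    have h2 : P.M (64 * (640 * (P.N * P.W) + 1) + 1) ≤ K * (k * P.M X) :=
      (P.hM.mono (by omega) (by omega)).trans hM
    exact mul_le_mul_of_nonneg_left (mul_le_mul_of_nonneg_left h2 (add_nonneg (by norm_num) hM0)) (by norm_num)
  have hg1 : (1 : ℝ) ≤ P.g := mod_cast P.hg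
  have hD := hP.D_le
  have hD0 : (0 : ℝ) ≤ P.D := P.D.cast_nonneg
  have h4 : (2 * (P.D : ℝ) + 3) ^ 3 ≤ 3375 * (P.g : ℝ) ^ 5 := by
    calc (2 * (P.D : ℝ) + 3) ^ 3 ≤ (15 * (P.g : ℝ)) ^ 3 :=
          pow_le_pow_left₀ (by linarith) (by linarith) 3
      _ = 3375 * (P.g : ℝ) ^ 3 := by ring
      _ ≤ _ := mul_le_mul_of_nonneg_left (pow_le_pow_right₀ hg1 (by norm_num)) (by norm_num)
  have h5 : (P.N.size : ℝ) ≤ 3 * Real.log P.N := size_le_three_mul_log hN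
  have h6 := bc_pos P.ctx (640 * (P.N * P.W))
  refine hP.totalCost_le.trans ?_
  calc _ ≤ 10 ^ 9 * (3375 * (P.g : ℝ) ^ 5 * (3 * Real.log P.N) * (200 * ((3 + P.M 0) * (K * (k * P.M X))))) :=
        mul_le_mul_of_nonneg_left (mul_le_mul (mul_le_mul h4 h5 (by positivity) (by positivity)) h3
          h6.le (mul_nonneg (by positivity) ((Nat.cast_nonneg _).trans h5))) (by norm_num)
    _ = _ := by ring

lemma IsFor.space_le_log (hP : P.IsFor f) (hN : 1 < P.N) {K L : ℝ}
    (hW : (P.W : ℝ) ≤ K * (L + Real.log P.N)) :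
    (P.ctx.S : ℝ) ≤ 10 ^ 11 * (64 * K) * ((P.g : ℝ) ^ 2 * P.N * (1 + L / Real.log P.N)) := by
  have hl0 : 0 < Real.log P.N := Real.log_pos (mod_cast hN)
  have h1 : (P.N.size : ℝ) * P.ctx.S ≤ 10 ^ 11 * (((P.D : ℝ) + 2) ^ 2 * (P.N * P.W)) := by
    exact_mod_cast hP.space_le hN
  have hD := hP.D_le
  have hg1 : (1 : ℝ) ≤ P.g := mod_cast P.hg
  have h2 : ((P.D : ℝ) + 2) ^ 2 ≤ 64 * (P.g : ℝ) ^ 2 := by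
    calc ((P.D : ℝ) + 2) ^ 2 ≤ (8 * (P.g : ℝ)) ^ 2 := pow_le_pow_left₀ (by positivity) (by linarith) 2
      _ = _ := by ring
  refine le_of_mul_le_mul_left ?_ hl0
  calc Real.log P.N * P.ctx.S ≤ P.N.size * P.ctx.S :=
        mul_le_mul_of_nonneg_right (log_le_size P.N) (Nat.cast_nonneg _)
    _ ≤ 10 ^ 11 * (64 * (P.g : ℝ) ^ 2 * (P.N * (K * (L + Real.log P.N)))) :=
        h1.trans (mul_le_mul_of_nonneg_left (mul_le_mul h2 (mul_le_mul_of_nonneg_left hW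
          (Nat.cast_nonneg _)) (by positivity) (by positivity)) (by norm_num))
    _ = _ := by field_simp; ring

end Par

theorem theorem1 :
    ∃ P : Program, ∀ M : ℕ → ℝ, IsMulTime M → ∀ C : ℝ, ∃ K : ℝ,
      ∀ (g N : ℕ) (f : ℤ[X]), 1 ≤ g → IsHyperelliptic g (f.map (Int.castRingHom ℚ)) →
        (g : ℝ) ≤ C * Real.log N →
        ∃ (σ : Store) (t : ℝ) (s : ℕ), Exec M P (inputStore f N) σ t s ∧
          HoldsHasseWitt g f N σ ∧
          t ≤ K * ((g : ℝ) ^ 5 * M ⌈(N : ℝ) * Real.log (coeffNorm f * N)⌉₊ * Real.log N) ∧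
          (s : ℝ) ≤ K * ((g : ℝ) ^ 2 * N * (1 + Real.log (coeffNorm f) / Real.log N)) := by
  refine ⟨blk Par.initProg, fun M hM C => ?_⟩
  obtain ⟨K1, hK1⟩ : ∃ K1, K1 = 231 + 32 * |C| := ⟨_, rfl⟩
  have hK1pos : 0 < K1 := by rw [hK1]; positivity
  obtain ⟨k, hk⟩ : ∃ k, k = 50000 * ⌈K1⌉₊ := ⟨_, rfl⟩
  obtain ⟨K2, hK2⟩ := hM.mul_le k
  refine ⟨max (10 ^ 9 * (3375 * 3 * (200 * (3 + M 0) * (K2 * k)))) (10 ^ 11 * (64 * K1)),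
    fun g N f hg hf hgC => ?_⟩
  have hd : f.natDegree = 2 * g + 1 ∨ f.natDegree = 2 * g + 2 := by
    have := hf.2
    rwa [natDegree_map_eq_of_injective (Int.cast_injective)] at this
  have hg1 : (1 : ℝ) ≤ g := mod_cast hg
  -- for `N ≤ 1` the logarithm vanishes, against `1 ≤ g ≤ C log N`
  have hN : 1 < N := by
    by_contra h
    have : Real.log N = 0 := by interval_cases N <;> simp
    rw [this, mul_zero] at hgC
    linarith
  have hf1 : 1 ≤ coeffNorm f := by
    have h0 : f.leadingCoeff ≠ 0 := leadingCoeff_ne_zero.2 (by rintro rfl; simp at hd)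
    refine (Nat.one_le_iff_ne_zero.2 (Int.natAbs_ne_zero.2 h0)).trans ?_
    exact le_sup (f := fun k => (f.coeff k).natAbs) (mem_support_iff.2 h0)
  obtain ⟨P, hPM, hPN, hPg, hP, hW⟩ : ∃ P : Par, P.M = M ∧ P.N = N ∧ P.g = g ∧ P.IsFor f ∧
      (P.W : ℝ) ≤ K1 * (Real.log (coeffNorm f) + Real.log N) :=
    ⟨_, rfl, rfl, rfl, Par.isFor_ofPoly hM hg hN hd, by
      rw [hK1]; exact W_ofPoly_le hM hg hN hd hgC hf1⟩
  subst hPN hPg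
  have hl0 : 0 < Real.log P.N := Real.log_pos (mod_cast hN)
  have hL0 : 0 ≤ Real.log (coeffNorm f) := Real.log_natCast_nonneg _
  obtain ⟨τ, s', ⟨t, sp, hex, ht, hsp⟩, hτ, h0, hw⟩ :=
    Par.does_main hP hP.eq_zero (R := fun s' => s'.v 0 = (P.goodCount (P.nb * P.B + 1) : ℤ) ∧
      P.Written (P.nb * P.B + 1) s') (fun s' h1 h2 => ⟨h1, h2⟩) _ (Par.describes_input hP)
  have hnb : P.N < P.nb * P.B + 1 := by
    have := Nat.lt_div_mul_add (a := P.N) P.one_le_B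
    rw [Par.nb, Nat.add_mul, Nat.one_mul]; omega
  rw [show P.ctx.M = M from hPM] at hex
  refine ⟨τ, t, sp, hex, hP.holdsHasseWitt hτ hnb h0 hw, ?_, ?_⟩
  · have hlog : Real.log (coeffNorm f * P.N) = Real.log (coeffNorm f) + Real.log P.N :=
      Real.log_mul (by positivity) (by positivity)
    rw [hlog]
    have hp : 0 < P.N * (Real.log (coeffNorm f) + Real.log P.N) := by positivity
    obtain ⟨X, hX⟩ : ∃ X, X = ⌈P.N * (Real.log (coeffNorm f) + Real.log P.N)⌉₊ := ⟨_, rfl⟩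
    have hX0 : 1 ≤ X := hX ▸ Nat.ceil_pos.2 hp
    rw [← hX]
    have hNW : P.N * P.W ≤ ⌈K1⌉₊ * X := by
      have : (P.N : ℝ) * P.W ≤ ⌈K1⌉₊ * X := by
        calc (P.N : ℝ) * P.W ≤ P.N * (K1 * (Real.log (coeffNorm f) + Real.log P.N)) :=
              mul_le_mul_of_nonneg_left hW (Nat.cast_nonneg _)
          _ = K1 * (P.N * (Real.log (coeffNorm f) + Real.log P.N)) := by ring
          _ ≤ _ := mul_le_mul (Nat.le_ceil _) (hX ▸ Nat.le_ceil _) hp.le (Nat.cast_nonneg _)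
      exact_mod_cast this
    have h1 := hP.time_le hN (k := k) (X := X) (K := K2)
      (by
        rw [hPM]
        refine hK2 k X (by have := Nat.ceil_pos.2 hK1pos; omega) hX0 ?_
        exact le_mul_of_one_le_right k.cast_nonneg (by linarith [Real.log_natCast_nonneg X]))
      (by rw [hk, mul_assoc]; omega)
    rw [hPM] at h1
    refine (ht.trans h1).trans (mul_le_mul_of_nonneg_right (le_max_left _ _) ?_)
    have := hM.nonneg X
    positivity
  · have h3 : (sp : ℝ) ≤ P.ctx.S := mod_cast hsp
    exact (h3.trans (hP.space_le_log hN hW)).trans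
      (mul_le_mul_of_nonneg_right (le_max_right _ _) (by positivity))
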